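/- **Setting.** Fix $0<q<1$ and $z_-<0<z_+$. Put $(x;q)_\infty=\prod_{k\ge0}(1-xq^k)$, $\theta(x)=(x;q)_\infty(q/x;q)_\infty$; several arguments denote products and $f(yx^{\pm1})=f(yx)f(y/x)$. Let $\mathbb R_q=\{z_+q^n\}_{n\in\mathbb Z}\cup\{z_-q^n\}_{n\in\mathbb Z}$ and $$\int_{\mathbb R_q}f\,d_qx=(1-q)\sum_{n\in\mathbb Z}f(z_+q^n)z_+q^n-(1-q)\sum_{n\in\mathbb Z}f(z_-q^n)z_-q^n .$$ Let $P_{q,z_-,z_+}$ be the set of $(\alpha,\beta)\in\mathbb C^2$ with $\alpha,\beta\notin z_\pm^{-1}q^{\mathbb Z}$ such that either $\alpha=\overline\beta$, or $\alpha,\beta$ are real and for some $k\in\mathbb Z$ one has $z_+q^{k}<\beta^{-1}<\alpha^{-1}<z_+q^{k-1}$ or $z_-q^{k-1}<\alpha^{-1}<\beta^{-1}<z_-q^{k}$. Let $(a,b),(c,d)\in P_{q,z_-,z_+}$ with $a\ne b$, $c\ne d$ and $c/a,\,c/b,\,d/a,\,d/b,\,cd/ab\notin q^{\mathbb Z}$.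 Put $s=\sqrt{cdq/ab}>0$, $\mu(\gamma)=\gamma+\gamma^{-1}$, and let $\dagger$ denote the interchange of $a$ and $b$. Let $$w(x)=\frac{(ax,bx;q)_\infty}{(cx,dx;q)_\infty},\qquad \langle f,g\rangle_{\mathcal L^2}=\int_{\mathbb R_q}f\,\overline g\,w\,d_qx,$$ let $\mathcal L^2$ be the Hilbert space of functions $\mathbb R_q\to\mathbb C$ with finite norm, and let $$(Lf)(x)=A(x)f(x/q)+B(x)f(qx)+(s+s^{-1}-A(x)-B(x))f(x),$$ $$A(x)=s^{-1}(1-\tfrac q{ax})(1-\tfrac q{bx}),\qquad B(x)=s(1-\tfrac1{cx})(1-\tfrac1{dx}).$$ **Eigenfunctions.** $\varphi_\gamma$ is the unique solution of $Lf=\mu(\gamma)f$ on $\mathbb R_q$ that equals ${}_3\phi_2\!\left(q/ax,\,s\gamma,\,s/\gamma;\;cq/a,\,dq/a;\;q,bx\right)$ for $|x|<1/|b|$. Let $V_\mu$ be the space of solutions of $Lf=\mu f$ on $\mathbb R_q$ such that $f$ and its $q$-derivative $D_qf(x)=\frac{f(x)-f(qx)}{(1-q)x}$ have limits as $x\to0$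 which are the same from both sides. For $0<|\gamma|<1$ let $\Phi^\pm_\gamma$ be the unique element of $V_{\mu(\gamma)}$ that, at $x=z_\pm q^{-k}$ with $k$ large, equals $$(s\gamma)^k\frac{(q/bx,\,q^2\gamma/asx;q)_\infty}{(q/cx,\,q/dx;q)_\infty}\;{}_3\phi_2\!\left(q\gamma/s,\ cq\gamma/sa,\ dq\gamma/sa;\;q^2\gamma/asx,\ q\gamma^2;\;q,q/bx\right).$$ Let $D(f,g)(x)=\big(f(x)g(qx)-f(qx)g(x)\big)(1-q)B(x)\,x\,w(x)$ be the Casorati determinant and $v(\gamma)=D(\Phi^+_\gamma,\Phi^-_\gamma)$, which is constant on $\mathbb R_q$. Let $\Gamma$ be the set of zeros of $v$ in $(-1,1)\setminus\{0\}$ (the poles of the Green kernel of $L$). For $\gamma\in\Gamma$ one has $\Phi^+_\gamma=b(\gamma)\Phi^-_\gamma$ for a constant $b(\gamma)$, and we put $$N(\gamma)=b(\gamma)^{-1}\operatorname{Res}_{\lambda=\gamma}\frac{1/\lambda-\lambda}{\lambda v(\lambda)} .$$ **The Hilbert space $\mathcal H$.** Define $$v_1(\gamma)=\frac{(cq/a,dq/a;q)_\infty^2\,\theta(bz_+,bz_-)}{(1-q)abz_-^2z_+^2\,\theta(z_-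 /z_+,z_+/z_-,a/b,b/a)}\cdot\frac{(\gamma^{\pm2};q)_\infty}{(s\gamma^{\pm1},cq\gamma^{\pm1}/as,dq\gamma^{\pm1}/as;q)_\infty\,\theta(s\gamma^{\pm1},absz_-z_+\gamma^{\pm1})}$$ $$\qquad\times\Big(z_-\theta(az_+,cz_+,dz_+,bz_-,asz_-\gamma^{\pm1})-z_+\theta(az_-,cz_-,dz_-,bz_+,asz_+\gamma^{\pm1})\Big),$$ $$v_2(\gamma)=\frac{(cq/a,dq/a,cq/b,dq/b;q)_\infty\,\theta(az_+,az_-,bz_+,bz_-,cdz_-z_+)}{abz_-^2z_+(1-q)\,\theta(z_+/z_-,a/b,b/a)}\cdot\frac{(\gamma^{\pm2};q)_\infty}{(s\gamma^{\pm1};q)_\infty\,\theta(s\gamma^{\pm1},absz_-z_+\gamma^{\pm1})},$$ $$\mathbf v(\gamma)=\begin{pmatrix}v_2(\gamma)&v_1^\dagger(\gamma)\\ v_1(\gamma)&v_2(\gamma)\end{pmatrix},$$ and for $y\in\mathbb C^2$ let $y^T=(\overline{y_1}\ \overline{y_2})$ if $a=\overline b$ and $y^T=(\overline{y_2}\ \overline{y_1})$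 if $a\ne\overline b$. Let $\mathcal H_c$ be the Hilbert space of (classes of) measurable $g:\mathbb T\to\mathbb C^2$ on the unit circle with $g(\gamma^{-1})=g(\gamma)$ a.e. and finite norm for $$\langle g_1,g_2\rangle_{\mathcal H_c}=\frac1{4\pi i}\int_{\mathbb T}g_2(\gamma)^T\mathbf v(\gamma)g_1(\gamma)\frac{d\gamma}\gamma ,$$ let $\mathcal H_p$ be the Hilbert space of functions on $\Gamma$ with inner product $\sum_{\gamma\in\Gamma}g_1(\gamma)\overline{g_2(\gamma)}N(\gamma)$, and let $\mathcal H=\mathcal H_c\oplus\mathcal H_p$. **The transforms.** For finitely supported $f$ on $\mathbb R_q$ let $$(\mathcal Ff)(\gamma)=\Big(\int_{\mathbb R_q}f\varphi_\gamma w\,d_qx,\ \int_{\mathbb R_q}f\varphi^\dagger_\gamma w\,d_qx\Big)\quad(\gamma\in\mathbb T),\qquad (\mathcal Ff)(\gamma)=\langle f,\Phi^+_\gamma\rangle_{\mathcal L^2}\quad(\gamma\in\Gamma),$$ and let $\mathcal F:\mathcal L^2\to\mathcal H$ also denote the continuous extension. For $g\in\mathcal H_c$ and $x\in\mathbb R_q$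 put $$(\mathcal G_cg)(x)=\frac1{4\pi i}\int_{\mathbb T}\begin{pmatrix}\varphi_\gamma(x)\\ \varphi_\gamma^\dagger(x)\end{pmatrix}^{T}\mathbf v(\gamma)g(\gamma)\frac{d\gamma}\gamma .$$ **Proposition.** For every $g\in\mathcal H_c$ the integral defining $(\mathcal G_cg)(x)$ converges absolutely for all $x\in\mathbb R_q$, and $\mathcal G_cg\in\mathcal L^2$. Moreover $$\langle\mathcal G_cg_1,\mathcal G_cg_2\rangle_{\mathcal L^2}=\langle g_1,g_2\rangle_{\mathcal H_c}\qquad(g_1,g_2\in\mathcal H_c),$$ where the integral defining the right-hand side converges absolutely, and $\mathcal F(\mathcal G_cg)=g\oplus\mathbf 0$ in $\mathcal H$ for every $g\in\mathcal H_c$, where $\mathbf 0$ is the zero function in $\mathcal H_p$: for every sequence of finitely supported $f_n$ with $f_n\to\mathcal G_cg$ in $\mathcal L^2$, all $\mathcal Ff_n$ lie in $\mathcal H$ and $\mathcal Ff_n\to g\oplus\mathbf 0$ in $\mathcal H$. -/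

import Mathlib

open Filter Topology MeasureTheory
open scoped ComplexConjugate Matrix

noncomputable section

namespace BigQJacobi

/-! ### Basic hypergeometric notation -/

/-- The infinite `q`-shifted factorial `(x; q)_∞`. -/
def qPochInf (q : ℝ) (x : ℂ) : ℂ := ∏' k : ℕ, (1 - x * (q : ℂ) ^ k)

/-- The finite `q`-shifted factorial `(x; q)_n`, `n ≥ 0`. -/
def qPoch (q : ℝ) (x : ℂ) (n : ℕ) : ℂ := ∏ k ∈ Finset.range n, (1 - x * (q : ℂ) ^ k)

/-- The normalized Jacobi theta function `θ(x) = (x, q/x; q)_∞`. -/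
def theta (q : ℝ) (x : ℂ) : ℂ := qPochInf q x * qPochInf q (q / x)

/-- The basic hypergeometric series `₃φ₂(x₁, x₂, x₃; y₁, y₂; q, z)`. -/
def phi32 (q : ℝ) (x₁ x₂ x₃ y₁ y₂ z : ℂ) : ℂ :=
  ∑' k : ℕ, (qPoch q x₁ k * qPoch q x₂ k * qPoch q x₃ k) /
    (qPoch q q k * qPoch q y₁ k * qPoch q y₂ k) * z ^ k

/-! ### Parameters and the `q`-analogue of the real line -/

/-- The data `q, z₊, z₋, a, b, c, d`; the conditions on them are in `Params.IsGeneric`. -/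
structure Params where
  q : ℝ
  zp : ℝ
  zm : ℝ
  a : ℂ
  b : ℂ
  c : ℂ
  d : ℂ

/-- `ℝ_q = {z₊ qⁿ} ∪ {z₋ qⁿ}`, parametrized by the pairs (sign, exponent): `(true, n)` stands for
the point `z₊ qⁿ` and `(false, n)` for the point `z₋ qⁿ`. -/
abbrev RqIndex : Type := Bool × ℤ

namespace Params

/-- The set of pairs `(α, β)` called `P_{q, z₋, z₊}`. -/
def PairDomain (p : Params) (α β : ℂ) : Prop :=
  (∀ n : ℤ, α ≠ ((p.zp⁻¹ * p.q ^ n : ℝ) : ℂ) ∧ α ≠ ((p.zm⁻¹ * p.q ^ n : ℝ) : ℂ) ∧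
    β ≠ ((p.zp⁻¹ * p.q ^ n : ℝ) : ℂ) ∧ β ≠ ((p.zm⁻¹ * p.q ^ n : ℝ) : ℂ)) ∧
  (α = conj β ∨
    (∃ r t : ℝ, α = (r : ℂ) ∧ β = (t : ℂ) ∧ ∃ k : ℤ,
      p.zp * p.q ^ k < t⁻¹ ∧ t⁻¹ < r⁻¹ ∧ r⁻¹ < p.zp * p.q ^ (k - 1)) ∨
    (∃ r t : ℝ, α = (r : ℂ) ∧ β = (t : ℂ) ∧ ∃ k : ℤ,
      p.zm * p.q ^ (k - 1) < r⁻¹ ∧ r⁻¹ < t⁻¹ ∧ t⁻¹ < p.zm * p.q ^ k))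

/-- `0 < q < 1`, `z₋ < 0 < z₊` and `(a, b, c, d) ∈ P_gen`. -/
structure IsGeneric (p : Params) : Prop where
  q_pos : 0 < p.q
  q_lt_one : p.q < 1
  zp_pos : 0 < p.zp
  zm_neg : p.zm < 0
  ab : p.PairDomain p.a p.b
  cd : p.PairDomain p.c p.d
  a_ne_b : p.a ≠ p.b
  c_ne_d : p.c ≠ p.d
  ca : ∀ n : ℤ, p.c / p.a ≠ (p.q : ℂ) ^ n
  cb : ∀ n : ℤ, p.c / p.b ≠ (p.q : ℂ) ^ n
  da : ∀ n : ℤ, p.d / p.a ≠ (p.q : ℂ) ^ n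
  db : ∀ n : ℤ, p.d / p.b ≠ (p.q : ℂ) ^ n
  cdab : ∀ n : ℤ, p.c * p.d / (p.a * p.b) ≠ (p.q : ℂ) ^ n

/-- The operation `†` on parameters: interchange `a` and `b`. -/
def dagger (p : Params) : Params := { p with a := p.b, b := p.a }

/-- `s = √(cdq/ab)` (principal branch). -/
def s (p : Params) : ℂ := (p.c * p.d * p.q / (p.a * p.b)) ^ (1 / 2 : ℂ)

/-- `z₊` or `z₋`. -/
def z (p : Params) (ε : Bool) : ℝ := if ε then p.zp else p.zm

/-- The point of `ℝ_q` with a given index. -/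
def pt (p : Params) (i : RqIndex) : ℝ := p.z i.1 * p.q ^ i.2

/-- The index of the point `q x`, where `x` is the point with index `i`. -/
def _root_.BigQJacobi.up (i : RqIndex) : RqIndex := (i.1, i.2 + 1)

/-- The index of the point `x / q`, where `x` is the point with index `i`. -/
def _root_.BigQJacobi.down (i : RqIndex) : RqIndex := (i.1, i.2 - 1)

/-! ### The difference operator `L`, the weight and the Casorati determinant -/

/-- The coefficient `A(x)`. -/
def coeffA (p : Params) (x : ℂ) : ℂ :=
  p.s⁻¹ * (1 - p.q / (p.a * x)) * (1 - p.q / (p.b * x))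

/-- The coefficient `B(x)`. -/
def coeffB (p : Params) (x : ℂ) : ℂ :=
  p.s * (1 - 1 / (p.c * x)) * (1 - 1 / (p.d * x))

/-- The coefficient `C(x)`. -/
def coeffC (p : Params) (x : ℂ) : ℂ := p.s⁻¹ + p.s - p.coeffA x - p.coeffB x

/-- `(L f)(x) = A(x) f(x/q) + B(x) f(qx) + C(x) f(x)`. -/
def L (p : Params) (f : RqIndex → ℂ) (i : RqIndex) : ℂ :=
  p.coeffA (p.pt i) * f (down i) + p.coeffB (p.pt i) * f (up i) + p.coeffC (p.pt i) * f i

/-- The weight `w(x) = (ax, bx; q)_∞ / (cx, dx; q)_∞`. -/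
def w (p : Params) (x : ℂ) : ℂ :=
  (qPochInf p.q (p.a * x) * qPochInf p.q (p.b * x)) /
    (qPochInf p.q (p.c * x) * qPochInf p.q (p.d * x))

/-- The Jackson integral `∫_{ℝ_q} f(x) d_q x`. -/
def qInt (p : Params) (f : RqIndex → ℂ) : ℂ :=
  (1 - p.q) * (∑' n : ℤ, f (true, n) * p.pt (true, n)) -
    (1 - p.q) * (∑' n : ℤ, f (false, n) * p.pt (false, n))

/-- Membership in `ℒ² = L²(ℝ_q, w(x) d_q x)`. -/
def MemL2 (p : Params) (f : RqIndex → ℂ) : Prop :=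
  Summable fun i : RqIndex => ‖f i‖ ^ 2 * ‖p.w (p.pt i)‖ * |p.pt i|

/-- The inner product of `ℒ²`. -/
def innerL2 (p : Params) (f g : RqIndex → ℂ) : ℂ :=
  p.qInt fun i => f i * conj (g i) * p.w (p.pt i)

/-- The squared norm of `ℒ²`. -/
def normSqL2 (p : Params) (f : RqIndex → ℂ) : ℝ := (p.innerL2 f f).re

/-- The `q`-derivative `(D_q f)(x) = (f(x) - f(qx)) / ((1 - q) x)`. -/
def qDeriv (p : Params) (f : RqIndex → ℂ) (i : RqIndex) : ℂ :=
  (f i - f (up i)) / ((p.pt i : ℂ) * (1 - p.q))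

/-- The function `u(x) = (1 - q)² B(x) x² w(x)`. -/
def u (p : Params) (x : ℂ) : ℂ := (1 - p.q) ^ 2 * p.coeffB x * x ^ 2 * p.w x

/-- The Casorati determinant `D(f, g)(x) = (f(x) g(qx) - f(qx) g(x)) u(x) / ((1 - q) x)`. -/
def casorati (p : Params) (f g : RqIndex → ℂ) (i : RqIndex) : ℂ :=
  (f i * g (up i) - f (up i) * g i) * (p.u (p.pt i) / ((1 - p.q) * p.pt i))

/-! ### Eigenfunctions -/

/-- `μ(γ) = γ + γ⁻¹`. -/
def _root_.BigQJacobi.mu (γ : ℂ) : ℂ := γ + γ⁻¹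

/-- The space `V_μ` of solutions of `L f = μ f` on `ℝ_q` that are continuously differentiable at
the origin: `f(0⁻) = f(0⁺)` and `f'(0⁻) = f'(0⁺)`. -/
def InV (p : Params) (m : ℂ) (f : RqIndex → ℂ) : Prop :=
  (∀ i, p.L f i = m * f i) ∧
  (∃ l : ℂ, ∀ ε : Bool, Tendsto (fun n : ℤ => f (ε, n)) atTop (𝓝 l)) ∧
  (∃ l : ℂ, ∀ ε : Bool, Tendsto (fun n : ℤ => p.qDeriv f (ε, n)) atTop (𝓝 l))

/-- The series that defines `φ_γ(x)` for `|x| < 1/|b|`. -/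
def phiSeries (p : Params) (γ x : ℂ) : ℂ :=
  phi32 p.q (p.q / (p.a * x)) (p.s * γ) (p.s / γ) (p.c * p.q / p.a) (p.d * p.q / p.a) (p.b * x)

/-- The big `q`-Jacobi function `φ_γ` on `ℝ_q`: the unique solution of `L f = μ(γ) f` that is given
by the series for `|x| < 1/|b|`. The function `φ_γ†` is `p.dagger.phi γ`. -/
def phi (p : Params) (γ : ℂ) : RqIndex → ℂ :=
  Classical.epsilon fun f : RqIndex → ℂ =>
    (∀ i, p.L f i = mu γ * f i) ∧ ∀ i, |p.pt i| < 1 / ‖p.b‖ → f i = p.phiSeries γ (p.pt i)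

/-- The explicit expression for the asymptotic solution `Φ_γ(x)` at `x = z q^{-k}`, `|x|` large
(here `n = -k`). -/
def PhiSeries (p : Params) (γ : ℂ) (ε : Bool) (n : ℤ) : ℂ :=
  (p.s * γ) ^ (-n) *
    ((qPochInf p.q (p.q / (p.b * p.pt (ε, n))) *
        qPochInf p.q (p.q ^ 2 * γ / (p.a * p.s * p.pt (ε, n)))) /
      (qPochInf p.q (p.q / (p.c * p.pt (ε, n))) * qPochInf p.q (p.q / (p.d * p.pt (ε, n))))) *
    phi32 p.q (p.q * γ / p.s) (p.c * p.q * γ / (p.s * p.a)) (p.d * p.q * γ / (p.s * p.a))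
      (p.q ^ 2 * γ / (p.a * p.s * p.pt (ε, n))) (p.q * γ ^ 2) (p.q / (p.b * p.pt (ε, n)))

/-- The asymptotic solution `Φ_γ⁺` (for `ε = true`) or `Φ_γ⁻` (for `ε = false`) on all of `ℝ_q`:
the unique element of `V_{μ(γ)}` that is given by the explicit expression far out on the half line
of sign `ε`. -/
def Phi (p : Params) (ε : Bool) (γ : ℂ) : RqIndex → ℂ :=
  Classical.epsilon fun f : RqIndex → ℂ =>
    p.InV (mu γ) f ∧ ∀ᶠ n : ℤ in atBot, f (ε, n) = p.PhiSeries γ ε n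

/-! ### The discrete part of the spectrum -/

/-- `v(γ) = D(Φ_γ⁺, Φ_γ⁻)`, a constant function on `ℝ_q`; evaluated here at `z₊`. -/
def v (p : Params) (γ : ℂ) : ℂ := p.casorati (p.Phi true γ) (p.Phi false γ) (true, 0)

/-- The set `Γ` of poles in `(-1, 1)` of the Green kernel `Φ_γ⁻(x) Φ_γ⁺(y) / v(γ)`. -/
def Gam (p : Params) : Set ℝ := {t | -1 < t ∧ t < 1 ∧ t ≠ 0 ∧ p.v t = 0}

/-- The factor `b(γ)` in `Φ_γ⁺ = b(γ) Φ_γ⁻`, `γ ∈ Γ`. -/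
def bFactor (p : Params) (γ : ℂ) : ℂ :=
  Classical.epsilon fun t : ℂ => ∀ i, p.Phi true γ i = t * p.Phi false γ i

/-- The weight `N(γ) = b(γ)⁻¹ Res_{ζ = γ} ((1/ζ - ζ) / (ζ v(ζ)))`; the poles are simple. -/
def N (p : Params) (γ : ℂ) : ℂ :=
  (p.bFactor γ)⁻¹ *
    limUnder (𝓝[≠] γ) fun ζ : ℂ => (ζ - γ) * ((1 / ζ - ζ) / (ζ * p.v ζ))

/-! ### The matrix-valued weight on the unit circle -/

/-- `f(yγ) f(y/γ)`, the convention for an argument `yγ^{±1}`. -/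
def _root_.BigQJacobi.pm (f : ℂ → ℂ) (y γ : ℂ) : ℂ := f (y * γ) * f (y / γ)

/-- The function `v₁(γ)`. -/
def v1 (p : Params) (γ : ℂ) : ℂ :=
  let P := qPochInf p.q
  let θ := theta p.q
  let zp : ℂ := p.zp
  let zm : ℂ := p.zm
  ((P (p.c * p.q / p.a) * P (p.d * p.q / p.a)) ^ 2 * (θ (p.b * zp) * θ (p.b * zm))) /
    ((1 - p.q) * p.a * p.b * zm ^ 2 * zp ^ 2 *
      (θ (zm / zp) * θ (zp / zm) * θ (p.a / p.b) * θ (p.b / p.a))) *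
  ((P (γ ^ 2) * P (1 / γ ^ 2)) /
    (pm P p.s γ * pm P (p.c * p.q / (p.a * p.s)) γ * pm P (p.d * p.q / (p.a * p.s)) γ *
      (pm θ p.s γ * pm θ (p.a * p.b * p.s * zm * zp) γ))) *
  (zm * (θ (p.a * zp) * θ (p.c * zp) * θ (p.d * zp) * θ (p.b * zm) * pm θ (p.a * p.s * zm) γ) -
    zp * (θ (p.a * zm) * θ (p.c * zm) * θ (p.d * zm) * θ (p.b * zp) * pm θ (p.a * p.s * zp) γ))

/-- The function `v₂(γ)`. -/
def v2 (p : Params) (γ : ℂ) : ℂ :=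
  let P := qPochInf p.q
  let θ := theta p.q
  let zp : ℂ := p.zp
  let zm : ℂ := p.zm
  (P (p.c * p.q / p.a) * P (p.d * p.q / p.a) * P (p.c * p.q / p.b) * P (p.d * p.q / p.b) *
      (θ (p.a * zp) * θ (p.a * zm) * θ (p.b * zp) * θ (p.b * zm) * θ (p.c * p.d * zm * zp))) /
    (p.a * p.b * zm ^ 2 * zp * (1 - p.q) * (θ (zp / zm) * θ (p.a / p.b) * θ (p.b / p.a))) *
  ((P (γ ^ 2) * P (1 / γ ^ 2)) /
    (pm P p.s γ * (pm θ p.s γ * pm θ (p.a * p.b * p.s * zm * zp) γ)))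

/-- The matrix `𝐯(γ)`. -/
def vMat (p : Params) (γ : ℂ) : Matrix (Fin 2) (Fin 2) ℂ :=
  !![p.v2 γ, p.dagger.v1 γ; p.v1 γ, p.v2 γ]

open Classical in
/-- The row vector `yᵀ`: it is `(ȳ₁ ȳ₂)` if `a = b̄`, and `(ȳ₂ ȳ₁)` if `a ≠ b̄`. -/
def rowT (p : Params) (y : Fin 2 → ℂ) : Fin 2 → ℂ :=
  if p.a = conj p.b then ![conj (y 0), conj (y 1)] else ![conj (y 1), conj (y 0)]

/-! ### The Hilbert spaces `ℋ_c`, `ℋ_p` and `ℋ = ℋ_c ⊕ ℋ_p` -/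

/-- The function `θ ↦ g₂(γ)ᵀ 𝐯(γ) g₁(γ)`, `γ = e^{iθ}`. -/
def formHc (p : Params) (g₁ g₂ : Circle → Fin 2 → ℂ) (t : ℝ) : ℂ :=
  p.rowT (g₂ (Circle.exp t)) ⬝ᵥ (p.vMat (Circle.exp t : ℂ) *ᵥ g₁ (Circle.exp t))

/-- The integral that defines `⟨g₁, g₂⟩` in `ℋ_c` converges absolutely. -/
def PairIntegrable (p : Params) (g₁ g₂ : Circle → Fin 2 → ℂ) : Prop :=
  IntervalIntegrable (p.formHc g₁ g₂) volume (-Real.pi) Real.pi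

/-- The inner product `⟨g₁, g₂⟩ = (1/4πi) ∮ g₂(γ)ᵀ 𝐯(γ) g₁(γ) dγ/γ` of `ℋ_c`, where
`dγ/γ = i dθ` for `γ = e^{iθ}`. -/
def innerHc (p : Params) (g₁ g₂ : Circle → Fin 2 → ℂ) : ℂ :=
  1 / (4 * Real.pi) * ∫ t in (-Real.pi)..Real.pi, p.formHc g₁ g₂ t

/-- Membership in `ℋ_c`: measurable `ℂ²`-valued functions on the unit circle with finite norm and
`g(γ⁻¹) = g(γ)` almost everywhere. -/
def MemHc (p : Params) (g : Circle → Fin 2 → ℂ) : Prop :=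
  AEStronglyMeasurable (fun t : ℝ => g (Circle.exp t))
    (volume.restrict (Set.Ioc (-Real.pi) Real.pi)) ∧
  p.PairIntegrable g g ∧
  ∀ᵐ t ∂(volume.restrict (Set.Ioc (-Real.pi) Real.pi)),
    g ((Circle.exp t)⁻¹) = g (Circle.exp t)

/-- Membership in `ℋ_p`. -/
def MemHp (p : Params) (h : p.Gam → ℂ) : Prop :=
  Summable fun γ : p.Gam => h γ * conj (h γ) * p.N (γ : ℝ)

/-- The inner product of `ℋ_p`. -/
def innerHp (p : Params) (h₁ h₂ : p.Gam → ℂ) : ℂ :=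
  ∑' γ : p.Gam, h₁ γ * conj (h₂ γ) * p.N (γ : ℝ)

/-- Functions on `𝕋 ∪ Γ`, `ℂ²`-valued on `𝕋` and complex-valued on `Γ`. -/
abbrev HFun (p : Params) : Type := (Circle → Fin 2 → ℂ) × (p.Gam → ℂ)

/-- Membership in `ℋ = ℋ_c ⊕ ℋ_p`. -/
def MemH (p : Params) (h : p.HFun) : Prop := p.MemHc h.1 ∧ p.MemHp h.2

/-- The inner product of `ℋ`. -/
def innerH (p : Params) (h₁ h₂ : p.HFun) : ℂ := p.innerHc h₁.1 h₂.1 + p.innerHp h₁.2 h₂.2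

/-- The squared norm of `ℋ`. -/
def normSqH (p : Params) (h : p.HFun) : ℝ := (p.innerH h h).re

/-! ### The transforms `ℱ` and `𝒢` -/

/-- The kernel `Ψ(x, ·)`, as a function on `𝕋 ∪ Γ`. -/
def Psi (p : Params) (i : RqIndex) : p.HFun :=
  (fun γ => ![p.phi γ i, p.dagger.phi γ i], fun γ => p.Phi true (γ : ℝ) i)

/-- `(ℱ_c f)(γ) = ∫_{ℝ_q} f(x) φ_γ(x) w(x) d_q x`. -/
def transformC (p : Params) (f : RqIndex → ℂ) (γ : ℂ) : ℂ :=
  p.qInt fun i => f i * p.phi γ i * p.w (p.pt i)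

/-- `(ℱ_c† f)(γ) = ∫_{ℝ_q} f(x) φ_γ†(x) w(x) d_q x`. -/
def transformCDagger (p : Params) (f : RqIndex → ℂ) (γ : ℂ) : ℂ :=
  p.qInt fun i => f i * p.dagger.phi γ i * p.w (p.pt i)

/-- `(ℱ_p f)(γ) = ⟨f, Φ_γ⁺⟩`. -/
def transformP (p : Params) (f : RqIndex → ℂ) (γ : ℂ) : ℂ := p.innerL2 f (p.Phi true γ)

/-- The vector-valued big `q`-Jacobi function transform `ℱ f` of a finitely supported `f`. -/
def transformFin (p : Params) (f : RqIndex → ℂ) : p.HFun :=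
  (fun γ => ![p.transformC f γ, p.transformCDagger f γ], fun γ => p.transformP f (γ : ℝ))

/-- `ℱ f = h` in `ℋ`, where `ℱ : ℒ² → ℋ` is the continuous extension of the transform from the
finitely supported functions, which are dense in `ℒ²`: for every sequence of finitely supported
functions that tends to `f` in `ℒ²`, the transforms belong to `ℋ` and tend to `h` in `ℋ`. -/
def TransformEq (p : Params) (f : RqIndex → ℂ) (h : p.HFun) : Prop :=
  p.MemL2 f ∧ p.MemH h ∧
  ∀ F : ℕ → RqIndex → ℂ, (∀ n, (Function.support (F n)).Finite) →
    Tendsto (fun n => p.normSqL2 (F n - f)) atTop (𝓝 0) →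
    (∀ n, p.MemH (p.transformFin (F n))) ∧
      Tendsto (fun n => p.normSqH (p.transformFin (F n) - h)) atTop (𝓝 0)

/-- The integral transform `(𝒢 h)(x) = ⟨h, Ψ(x, ·)⟩` on `ℋ`. -/
def G (p : Params) (h : p.HFun) (i : RqIndex) : ℂ := p.innerH h (p.Psi i)

/-- The restriction `𝒢_c` of `𝒢` to `ℋ_c`. -/
def Gc (p : Params) (g : Circle → Fin 2 → ℂ) : RqIndex → ℂ := p.G (g, 0)

end Params

end BigQJacobi

end

noncomputable section
namespace BigQJacobi
open scoped Real
open Complex (norm_of_nonneg norm_real continuous_conj normSq_eq_norm_sq continuous_re ofReal_re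
  conj_ofReal conj_conj ofReal_one ofReal_sub continuous_ofReal ofReal_pow)
open Finset (prod_congr range mul_sum mem_range sum_congr sum_range_succ HasAntidiagonal sum_mul
  Icc mem_Icc card_range prod_const single_le_sum sum_nonneg mem_univ)
open Metric (ball isOpen_ball)
open Real (norm_eq_abs sq_sqrt continuous_sqrt sqrt_sq sqrt_pos sqrt_zero pi_pos)
open Circle (coe_inv exp norm_coe)
open Set (Ioc)
open intervalIntegral (integral_congr integral_comp_neg integral_of_le)
local notation "ℂ²" => Fin 2 → ℂ

/-! ### The `q`-shifted factorials -/

section QPoch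

variable {q : ℝ}

@[simp] lemma qPoch_zero (x : ℂ) : qPoch q x 0 = 1 := by simp [qPoch]

lemma qPoch_succ (x : ℂ) (n : ℕ) :
    qPoch q x (n + 1) = qPoch q x n * (1 - x * q ^ n) := Finset.prod_range_succ _ _

lemma qPoch_add (x : ℂ) (m n : ℕ) :
    qPoch q x (m + n) = qPoch q x m * qPoch q (x * q ^ m) n := by
  simp only [qPoch, Finset.prod_range_add]
  congr 1
  refine prod_congr rfl fun k _ => ?_
  rw [pow_add]; ring

lemma qPoch_succ' (x : ℂ) (n : ℕ) :
    qPoch q x (n + 1) = (1 - x) * qPoch q (x * q) n := by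
  rw [add_comm, qPoch_add]; simp [qPoch]

lemma qPoch_ne_zero {x : ℂ} (h : ∀ k : ℕ, x * q ^ k ≠ 1) (n : ℕ) : qPoch q x n ≠ 0 :=
  Finset.prod_ne_zero_iff.2 fun k _ hk => h k (by linear_combination -hk)

@[simp] lemma qPochInf_zero : qPochInf q 0 = 1 := by simp [qPochInf]

lemma differentiable_qPoch (n : ℕ) : Differentiable ℂ fun x => qPoch q x n := by
  unfold qPoch; fun_prop

lemma conj_qPoch (x : ℂ) (n : ℕ) : conj (qPoch q x n) = qPoch q (conj x) n := by
  simp [qPoch, map_prod]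

variable (h0 : 0 < q) (h1 : q < 1)
include h0 h1

lemma summable_norm_mul_qpow (x : ℂ) :
    Summable fun k : ℕ => ‖-(x * q ^ k)‖ := by
  have : Summable fun k : ℕ => ‖x‖ * q ^ k := (summable_geometric_of_lt_one h0.le h1).mul_left _
  refine this.congr fun k => ?_
  rw [norm_neg, norm_mul, norm_pow, norm_of_nonneg h0.le]

lemma multipliable_qPochInf (x : ℂ) :
    Multipliable fun k : ℕ => (1 - x * q ^ k) := by
  simpa [sub_eq_add_neg] using multipliable_one_add_of_summable (summable_norm_mul_qpow h0 h1 x)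

lemma tendsto_qPoch (x : ℂ) :
    Tendsto (qPoch q x) atTop (𝓝 (qPochInf q x)) :=
  (multipliable_qPochInf h0 h1 x).hasProd.tendsto_prod_nat

lemma qPochInf_eq_mul (x : ℂ) (n : ℕ) :
    qPochInf q x = qPoch q x n * qPochInf q (x * q ^ n) := by
  have h := (tendsto_qPoch h0 h1 x).comp (tendsto_add_atTop_nat n)
  have h' := (tendsto_qPoch h0 h1 (x * q ^ n)).const_mul (qPoch q x n)
  refine tendsto_nhds_unique h (h'.congr fun m => ?_)
  simp only [Function.comp]
  rw [← qPoch_add, add_comm]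

lemma qPochInf_step (x : ℂ) :
    qPochInf q x = (1 - x) * qPochInf q (x * q) := by
  simpa [qPoch] using qPochInf_eq_mul h0 h1 x 1

lemma qPochInf_ne_zero {x : ℂ} (h : ∀ k : ℕ, x * q ^ k ≠ 1) :
    qPochInf q x ≠ 0 := by
  have := tprod_one_add_ne_zero_of_summable (f := fun k : ℕ => -(x * q ^ k))
    (fun k hk => h k (by linear_combination -hk)) (summable_norm_mul_qpow h0 h1 x)
  simpa [qPochInf, sub_eq_add_neg] using this

lemma mul_qpow_ne_one {x : ℂ} (hx : ‖x‖ < 1) (k : ℕ) :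
    x * q ^ k ≠ 1 := by
  intro h
  have := congrArg norm h
  rw [norm_mul, norm_pow, norm_of_nonneg h0.le, norm_one] at this
  have h2 : q ^ k ≤ 1 := pow_le_one₀ h0.le h1.le
  nlinarith [norm_nonneg x, pow_pos h0 k]

lemma norm_qPoch_le (x : ℂ) (n : ℕ) :
    ‖qPoch q x n‖ ≤ Real.exp (‖x‖ / (1 - q)) := by
  have h2 : ‖qPoch q x n‖ ≤ ∏ k ∈ range n, Real.exp (‖x‖ * q ^ k) := by
    rw [qPoch, norm_prod]
    refine Finset.prod_le_prod (fun _ _ => norm_nonneg _) fun k _ => ?_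
    calc ‖1 - x * q ^ k‖ ≤ ‖(1 : ℂ)‖ + ‖x * q ^ k‖ := norm_sub_le _ _
      _ = ‖x‖ * q ^ k + 1 := by rw [norm_one, norm_mul, norm_pow, norm_of_nonneg h0.le, add_comm]
      _ ≤ _ := Real.add_one_le_exp _
  refine h2.trans ?_
  rw [← Real.exp_sum, ← mul_sum, div_eq_mul_inv, Real.exp_le_exp]
  refine mul_le_mul_of_nonneg_left ?_ (norm_nonneg _)
  rw [← tsum_geometric_of_lt_one h0.le h1]
  exact (summable_geometric_of_lt_one h0.le h1).sum_le_tsum _ fun _ _ => pow_nonneg h0.le _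

lemma norm_qPochInf_le (x : ℂ) :
    ‖qPochInf q x‖ ≤ Real.exp (‖x‖ / (1 - q)) :=
  le_of_tendsto (tendsto_qPoch h0 h1 x).norm (.of_forall (norm_qPoch_le h0 h1 x))

lemma exists_norm_qPoch_ge {x : ℂ}
    (h : ∀ k : ℕ, x * q ^ k ≠ 1) : ∃ c > 0, ∀ n, c ≤ ‖qPoch q x n‖ := by
  have hl := (tendsto_qPoch h0 h1 x).norm
  have hp : 0 < ‖qPochInf q x‖ := norm_pos_iff.2 (qPochInf_ne_zero h0 h1 h)
  obtain ⟨N, hN⟩ := eventually_atTop.1 (hl.eventually_const_le (half_lt_self hp))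
  have hfin : ∃ c > 0, ∀ n < N, c ≤ ‖qPoch q x n‖ := by
    clear hN
    induction N with
    | zero => exact ⟨1, one_pos, by simp⟩
    | succ N ih =>
      obtain ⟨c, hc, hcN⟩ := ih
      refine ⟨min c ‖qPoch q x N‖, lt_min hc (norm_pos_iff.2 (qPoch_ne_zero h N)), fun n hn => ?_⟩
      rcases Nat.lt_succ_iff_lt_or_eq.1 hn with h' | rfl
      · exact (min_le_left _ _).trans (hcN n h')
      · exact min_le_right _ _
  obtain ⟨c, hc, hcN⟩ := hfin
  refine ⟨min c (‖qPochInf q x‖ / 2), lt_min hc (half_pos hp), fun n => ?_⟩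
  rcases lt_or_ge n N with h' | h'
  · exact (min_le_left _ _).trans (hcN n h')
  · exact (min_le_right _ _).trans (hN n h')

lemma exists_norm_qPoch_ge_of_norm_le {ρ : ℝ} (hρ0 : 0 ≤ ρ)
    (hρ : ρ < 1) : ∃ c > 0, ∀ x : ℂ, ‖x‖ ≤ ρ → ∀ n, c ≤ ‖qPoch q x n‖ := by
  obtain ⟨c, hc, h⟩ := exists_norm_qPoch_ge h0 h1 (x := (ρ : ℂ))
    (mul_qpow_ne_one h0 h1 (by rwa [norm_of_nonneg hρ0]))
  refine ⟨c, hc, fun x hx n => (h n).trans ?_⟩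
  rw [qPoch, qPoch, norm_prod, norm_prod]
  refine Finset.prod_le_prod (fun _ _ => norm_nonneg _) fun k _ => ?_
  have hk : q ^ k ≤ 1 := pow_le_one₀ h0.le h1.le
  have hk0 : 0 < q ^ k := pow_pos h0 k
  have e : (1 - (ρ : ℂ) * q ^ k) = ((1 - ρ * q ^ k : ℝ) : ℂ) := by push_cast; ring
  rw [e, norm_of_nonneg (by nlinarith)]
  have h3 := norm_sub_norm_le (1 : ℂ) (x * q ^ k)
  rw [norm_one, norm_mul, norm_pow, norm_of_nonneg h0.le] at h3
  nlinarith

lemma differentiable_qPochInf : Differentiable ℂ (qPochInf q) := by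
  intro x
  set R := ‖x‖ + 1
  have hu : Summable fun k : ℕ => R * q ^ k := (summable_geometric_of_lt_one h0.le h1).mul_left _
  have hp := Summable.hasProdLocallyUniformlyOn_nat_one_add (K := ball (0 : ℂ) R)
    (f := fun (k : ℕ) (x : ℂ) => -(x * (q : ℂ) ^ k)) isOpen_ball hu
    (.of_forall fun k y hy => by
      rw [norm_neg, norm_mul, norm_pow, norm_of_nonneg h0.le]
      exact mul_le_mul_of_nonneg_right (mem_ball_zero_iff.1 hy).le (pow_nonneg h0.le _))
    (fun k => by fun_prop)
  have hd := hp.differentiableOn (.of_forall fun s => by fun_prop) isOpen_ball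
  have := hd.differentiableAt (x := x) (isOpen_ball.mem_nhds (mem_ball_zero_iff.2 (by simp [R])))
  have e : qPochInf q = fun x => ∏' k : ℕ, (1 + -(x * (q : ℂ) ^ k)) := by
    funext y; simp [qPochInf, sub_eq_add_neg]
  rw [e]; exact this

lemma continuous_qPochInf : Continuous (qPochInf q) := (differentiable_qPochInf h0 h1).continuous

lemma conj_qPochInf (x : ℂ) :
    conj (qPochInf q x) = qPochInf q (conj x) := by
  have h := (continuous_conj.tendsto _).comp (tendsto_qPoch h0 h1 x)
  refine tendsto_nhds_unique h ((tendsto_qPoch h0 h1 (conj x)).congr fun n => ?_)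
  simp [conj_qPoch]

lemma norm_qPochInf_neg_mono {x : ℂ} {y : ℝ} (h : ‖x‖ ≤ y) :
    ‖qPochInf q x‖ ≤ ‖qPochInf q (-y)‖ := by
  refine le_of_tendsto_of_tendsto' (tendsto_qPoch h0 h1 x).norm (tendsto_qPoch h0 h1 _).norm
    fun n => norm_qPoch_neg_mono h0 h n
where
  norm_qPoch_neg_mono (h0 : 0 < q) {x : ℂ} {y : ℝ} (h : ‖x‖ ≤ y) (n : ℕ) :
      ‖qPoch q x n‖ ≤ ‖qPoch q (-y) n‖ := by
    have hy : 0 ≤ y := (norm_nonneg x).trans h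
    rw [qPoch, qPoch, norm_prod, norm_prod]
    refine Finset.prod_le_prod (fun _ _ => norm_nonneg _) fun k _ => ?_
    have e : (1 - (-(y : ℂ)) * q ^ k) = ((1 + y * q ^ k : ℝ) : ℂ) := by push_cast; ring
    rw [e, norm_of_nonneg (by positivity)]
    have h3 := norm_sub_le (1 : ℂ) (x * q ^ k)
    rw [norm_one, norm_mul, norm_pow, norm_of_nonneg h0.le] at h3
    nlinarith [pow_pos h0 k]

/-- Reflection of a shifted factorial with argument `y q^{-k}`. -/
lemma qPochInf_mul_zpow_neg {y : ℂ} (hy : y ≠ 0) (k : ℕ) :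
    qPochInf q (y * q ^ (-(k : ℤ))) =
      qPoch q (q / y) k * (-y) ^ k * ((q : ℂ) ^ (k * (k + 1) / 2))⁻¹ * qPochInf q y := by
  have hq : (q : ℂ) ≠ 0 := mod_cast h0.ne'
  induction k with
  | zero => simp
  | succ k ih =>
    have e : (k + 1) * (k + 1 + 1) / 2 = k * (k + 1) / 2 + (k + 1) := by
      have : (k + 1) * (k + 1 + 1) = k * (k + 1) + 2 * (k + 1) := by ring
      omega
    rw [qPochInf_step h0 h1]
    have e2 : y * q ^ (-((k + 1 : ℕ) : ℤ)) * q = y * q ^ (-(k : ℤ)) := by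
      rw [mul_assoc, ← zpow_add_one₀ hq]; congr 2; push_cast; ring
    rw [e2, ih, qPoch_succ, e, pow_add, pow_succ (-y)]
    have e3 : (q : ℂ) ^ (-((k + 1 : ℕ) : ℤ)) = ((q : ℂ) ^ (k + 1))⁻¹ := by
      rw [zpow_neg, zpow_natCast]
    rw [e3]; field_simp; ring

end QPoch

/-! ### The theta function -/

section Theta

variable {q : ℝ}

variable (h0 : 0 < q) (h1 : q < 1)
include h0 h1

lemma theta_mul_q {x : ℂ} (hx : x ≠ 0) :
    theta q (q * x) = -x⁻¹ * theta q x := by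
  have hq : (q : ℂ) ≠ 0 := mod_cast h0.ne'
  unfold theta
  have e1 : (q : ℂ) / (q * x) = x⁻¹ := by field_simp
  rw [e1, qPochInf_step h0 h1 x, qPochInf_step h0 h1 x⁻¹, mul_comm x (q : ℂ),
    show x⁻¹ * q = q / x by ring]
  field_simp
  ring

lemma theta_inv {x : ℂ} (hx : x ≠ 0) :
    theta q x⁻¹ = -x⁻¹ * theta q x := by
  have hq : (q : ℂ) ≠ 0 := mod_cast h0.ne'
  rw [← theta_mul_q h0 h1 hx]
  unfold theta
  rw [mul_comm]
  congr 2 <;> field_simp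

lemma theta_ne_zero {x : ℂ} (hx : x ≠ 0)
    (h : ∀ n : ℤ, x ≠ (q : ℂ) ^ n) : theta q x ≠ 0 := by
  have hq : (q : ℂ) ≠ 0 := mod_cast h0.ne'
  refine mul_ne_zero (qPochInf_ne_zero h0 h1 fun k hk => h (-k) ?_)
    (qPochInf_ne_zero h0 h1 fun k hk => h (k + 1) ?_)
  · rw [zpow_neg, zpow_natCast]; exact eq_inv_of_mul_eq_one_left hk
  · rw [zpow_add_one₀ hq, zpow_natCast]; field_simp at hk; rw [← hk]; ring

lemma conj_theta (x : ℂ) : conj (theta q x) = theta q (conj x) := by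
  simp [theta, conj_qPochInf h0 h1]

end Theta

/-! ### Summation and transformation formulas -/

section Summation

variable {q : ℝ}

/-- The series `₂φ₁(a, b; c; q, z)`. -/
def phi21Term (q : ℝ) (a b c z : ℂ) (n : ℕ) : ℂ :=
  qPoch q a n * qPoch q b n / (qPoch q q n * qPoch q c n) * z ^ n

variable (h0 : 0 < q) (h1 : q < 1)
include h0 h1

lemma qPoch_q_ne_zero (n : ℕ) : qPoch q q n ≠ 0 :=
  qPoch_ne_zero (mul_qpow_ne_one h0 h1 (by rwa [norm_of_nonneg h0.le])) n

lemma exists_norm_qPoch_q_ge : ∃ c > 0, ∀ n, c ≤ ‖qPoch q q n‖ :=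
  exists_norm_qPoch_ge h0 h1 (mul_qpow_ne_one h0 h1 (by rwa [norm_of_nonneg h0.le]))

lemma exists_phi21Term_le (a b : ℂ) {c : ℂ}
    (hc : ∀ k : ℕ, c * q ^ k ≠ 1) :
    ∃ M > 0, ∀ (m : ℕ) (z : ℂ) (n : ℕ), ‖phi21Term q a b (c * q ^ m) z n‖ ≤ M * ‖z‖ ^ n := by
  obtain ⟨c₁, hc₁, h₁⟩ := exists_norm_qPoch_q_ge h0 h1
  obtain ⟨c₂, hc₂, h₂⟩ := exists_norm_qPoch_ge h0 h1 hc
  set ea := Real.exp (‖a‖ / (1 - q))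
  set eb := Real.exp (‖b‖ / (1 - q))
  set ec := Real.exp (‖c‖ / (1 - q))
  have hea : 0 < ea := Real.exp_pos _
  have heb : 0 < eb := Real.exp_pos _
  have hec : 0 < ec := Real.exp_pos _
  refine ⟨ea * eb / (c₁ * (c₂ / ec)), by positivity, fun m z n => ?_⟩
  have h3 : c₂ / ec ≤ ‖qPoch q (c * q ^ m) n‖ := by
    have h := h₂ (m + n)
    rw [qPoch_add, norm_mul] at h
    have h' := norm_qPoch_le h0 h1 c m
    rw [div_le_iff₀ hec]
    have := norm_nonneg (qPoch q (c * q ^ m) n)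
    nlinarith
  rw [phi21Term, norm_mul, norm_pow, norm_div, norm_mul, norm_mul]
  refine mul_le_mul_of_nonneg_right ?_ (by positivity)
  exact div_le_div₀ (by positivity)
    (mul_le_mul (norm_qPoch_le h0 h1 a n) (norm_qPoch_le h0 h1 b n) (norm_nonneg _) hea.le)
    (by positivity) (mul_le_mul (h₁ n) h3 (by positivity) (norm_nonneg _))

lemma summable_phi21Term (a b : ℂ) {c z : ℂ}
    (hc : ∀ k : ℕ, c * q ^ k ≠ 1) (hz : ‖z‖ < 1) : Summable (phi21Term q a b c z) := by
  obtain ⟨M, -, hM⟩ := exists_phi21Term_le h0 h1 a b hc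
  refine Summable.of_norm_bounded
    ((summable_geometric_of_lt_one (norm_nonneg z) hz).mul_left M) fun n => ?_
  simpa using hM 0 z n

lemma phi21_contiguous (a b : ℂ) {z : ℂ} (hz : ‖z‖ < 1)
    (hc : ∀ k : ℕ, a * b * z * (q : ℂ) ^ k ≠ 1) :
    (1 - a * b * z) * (1 - z) * ∑' n, phi21Term q a b (a * b * z) z n =
      (1 - a * z) * (1 - b * z) * ∑' n, phi21Term q a b (a * b * (z * q)) (z * q) n := by
  have hc' : ∀ k : ℕ, a * b * (z * q) * (q : ℂ) ^ k ≠ 1 := fun k h => hc (k + 1) (by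
    rw [← h, pow_succ]; ring)
  have hzq : ‖z * q‖ < 1 := by rw [norm_mul, norm_of_nonneg h0.le]; nlinarith [norm_nonneg z]
  set t := phi21Term q a b (a * b * z) z with ht
  have hs := summable_phi21Term h0 h1 a b hc hz
  have hs' := summable_phi21Term h0 h1 a b hc' hzq
  have key : ∀ n, (1 - a * b * z) * (1 - z) * t n -
      (1 - a * z) * (1 - b * z) * phi21Term q a b (a * b * (z * q)) (z * q) n =
      (1 - a * b * z) * ((1 - (q : ℂ) ^ n) * t n - (1 - (q : ℂ) ^ (n + 1)) * t (n + 1)) := by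
    intro n
    have e1 : qPoch q (a * b * z) (n + 1) = (1 - a * b * z) * qPoch q (a * b * (z * q)) n := by
      rw [qPoch_succ', mul_assoc (a * b)]
    have e2 := qPoch_succ (q := q) (a * b * z) n
    have n1 := qPoch_ne_zero hc n
    have n2 := qPoch_ne_zero hc' n
    have n3 := qPoch_q_ne_zero h0 h1 n
    have n4 : (1 - a * b * z * (q : ℂ) ^ n) ≠ 0 := sub_ne_zero.2 (hc n).symm
    have n5 : (1 - (q : ℂ) * (q : ℂ) ^ n) ≠ 0 :=
      sub_ne_zero.2 (mul_qpow_ne_one h0 h1 (by rwa [norm_of_nonneg h0.le]) n).symm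
    have n6 : (1 - a * b * z) ≠ 0 := sub_ne_zero.2 (by simpa using (hc 0).symm)
    have e3 : qPoch q (a * b * (z * q)) n =
        qPoch q (a * b * z) n * (1 - a * b * z * (q : ℂ) ^ n) / (1 - a * b * z) := by
      rw [eq_div_iff n6, ← e2, e1]; ring
    simp only [ht, phi21Term, e3, qPoch_succ, mul_pow, pow_succ]
    rw [show (1 - (q : ℂ) ^ n * q) = (1 - (q : ℂ) * (q : ℂ) ^ n) by ring]
    generalize qPoch q a n = A, qPoch q b n = B, qPoch q q n = Q, qPoch q (a * b * z) n = D at *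
    generalize (q : ℂ) ^ n = N at *
    generalize hU : 1 - (q : ℂ) * N = U at *
    generalize hV : 1 - a * b * z * N = V at *
    generalize hW : 1 - a * b * z = W at *
    field_simp
    rw [← hV]; ring
  have hlim : Tendsto (fun n : ℕ => (1 - (q : ℂ) ^ n) * t n) atTop (𝓝 0) := by
    have hq : Tendsto (fun n : ℕ => (q : ℂ) ^ n) atTop (𝓝 0) :=
      tendsto_pow_atTop_nhds_zero_of_norm_lt_one (by rwa [norm_of_nonneg h0.le])
    simpa using (hq.const_sub 1).mul hs.tendsto_atTop_zero
  have htel : HasSum (fun n : ℕ => (1 - (q : ℂ) ^ n) * t n - (1 - (q : ℂ) ^ (n + 1)) * t (n + 1))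
      0 := by
    have hsum : Summable fun n : ℕ => (1 - (q : ℂ) ^ n) * t n := by
      refine Summable.of_norm_bounded (hs.norm.mul_left 2) fun n => ?_
      rw [norm_mul]
      refine mul_le_mul_of_nonneg_right ((norm_sub_le _ _).trans ?_) (norm_nonneg _)
      rw [norm_one, norm_pow, norm_of_nonneg h0.le]; linarith [pow_le_one₀ h0.le h1.le (n := n)]
    have h2 := hsum.sub ((summable_nat_add_iff 1).2 hsum)
    have h3 := h2.hasSum.tendsto_sum_nat
    have h4 : Tendsto (fun n : ℕ => ∑ i ∈ range n, ((1 - (q : ℂ) ^ i) * t i -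
        (1 - (q : ℂ) ^ (i + 1)) * t (i + 1))) atTop (𝓝 0) := by
      have : ∀ n : ℕ, ∑ i ∈ range n, ((1 - (q : ℂ) ^ i) * t i -
        (1 - (q : ℂ) ^ (i + 1)) * t (i + 1)) = -((1 - (q : ℂ) ^ n) * t n) := fun n => by
        rw [Finset.sum_range_sub' fun i => (1 - (q : ℂ) ^ i) * t i]; simp
      simp_rw [this]; simpa using hlim.neg
    rw [← tendsto_nhds_unique h3 h4]; exact h2.hasSum
  have hfin := (hs.hasSum.mul_left ((1 - a * b * z) * (1 - z))).sub
    (hs'.hasSum.mul_left ((1 - a * z) * (1 - b * z)))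
  have hfin' := htel.mul_left (1 - a * b * z)
  simp_rw [← key] at hfin'
  have := hfin.unique hfin'
  rw [mul_zero] at this
  exact sub_eq_zero.1 this

/-- The `q`-Gauss sum. -/
theorem qGauss (a b : ℂ) {z : ℂ} (hz : ‖z‖ < 1)
    (hc : ∀ k : ℕ, a * b * z * q ^ k ≠ 1) :
    qPochInf q (a * b * z) * qPochInf q z * ∑' n, phi21Term q a b (a * b * z) z n =
      qPochInf q (a * z) * qPochInf q (b * z) := by
  have hq1 : ∀ m : ℕ, ‖(q : ℂ) ^ m‖ ≤ 1 := fun m => by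
    rw [norm_pow, norm_of_nonneg h0.le]; exact pow_le_one₀ h0.le h1.le
  have hzm : ∀ m : ℕ, ‖z * q ^ m‖ ≤ ‖z‖ := fun m => by
    rw [norm_mul]; exact mul_le_of_le_one_right (norm_nonneg _) (hq1 m)
  have iter : ∀ m : ℕ, qPoch q (a * b * z) m * qPoch q z m *
      ∑' n, phi21Term q a b (a * b * z) z n = qPoch q (a * z) m * qPoch q (b * z) m *
      ∑' n, phi21Term q a b (a * b * (z * q ^ m)) (z * q ^ m) n := by
    intro m
    induction m with
    | zero => simp
    | succ m ih =>
      have hh := phi21_contiguous h0 h1 a b (z := z * q ^ m) ((hzm m).trans_lt hz)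
        (fun k h => hc (m + k) (by rw [← h, pow_add]; ring))
      simp only [qPoch_succ]
      rw [show z * q ^ (m + 1) = z * q ^ m * q by ring]
      linear_combination (1 - a * b * z * q ^ m) * (1 - z * q ^ m) * ih +
        qPoch q (a * z) m * qPoch q (b * z) m * hh
  have hlim : Tendsto (fun m : ℕ => ∑' n, phi21Term q a b (a * b * (z * q ^ m))
      (z * q ^ m) n) atTop (𝓝 (∑' n : ℕ, if n = 0 then 1 else 0)) := by
    obtain ⟨M, hM0, hM⟩ := exists_phi21Term_le h0 h1 a b hc
    refine tendsto_tsum_of_dominated_convergence (bound := fun n => M * ‖z‖ ^ n)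
      ((summable_geometric_of_lt_one (norm_nonneg z) hz).mul_left M) (fun n => ?_)
      (.of_forall fun m n => ?_)
    · rcases Nat.eq_zero_or_pos n with rfl | hn
      · simp [phi21Term]
      · rw [if_neg hn.ne']
        refine squeeze_zero_norm (a := fun m : ℕ => M * (q ^ m)) (fun m => ?_) ?_
        · have := hM m (z * q ^ m) n
          rw [mul_assoc] at this
          rw [← mul_assoc, mul_assoc]
          refine (this.trans (mul_le_mul_of_nonneg_left ?_ hM0.le))
          calc ‖z * q ^ m‖ ^ n ≤ ‖z * q ^ m‖ ^ 1 :=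
                pow_le_pow_of_le_one (norm_nonneg _) ((hzm m).trans hz.le) hn
            _ ≤ q ^ m := by
              rw [pow_one, norm_mul, norm_pow, norm_of_nonneg h0.le]
              exact mul_le_of_le_one_left (by positivity) hz.le
        · simpa using (tendsto_pow_atTop_nhds_zero_of_lt_one h0.le h1).const_mul M
    · have := hM m (z * q ^ m) n
      rw [mul_assoc] at this
      refine this.trans (mul_le_mul_of_nonneg_left ?_ hM0.le)
      exact pow_le_pow_left₀ (norm_nonneg _) (hzm m) n
  rw [tsum_ite_eq] at hlim
  have hL := ((tendsto_qPoch h0 h1 (a * b * z)).mul (tendsto_qPoch h0 h1 z)).mul_const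
    (∑' n, phi21Term q a b (a * b * z) z n)
  have hR := ((tendsto_qPoch h0 h1 (a * z)).mul (tendsto_qPoch h0 h1 (b * z))).mul hlim
  rw [mul_one] at hR
  exact tendsto_nhds_unique hL (hR.congr fun m => (iter m).symm)

/-- The `q`-Saalschütz sum. -/
theorem qSaalschutz {b c e : ℂ}
    (hd : ∀ k : ℕ, e * b * c * (q : ℂ) ^ k ≠ 1) (n : ℕ) :
    ∑ k ∈ range (n + 1), qPoch q b k * qPoch q c k * e ^ k /
        (qPoch q q k * qPoch q (e * b * c) k) * (qPoch q e (n - k) / qPoch q q (n - k)) =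
      qPoch q (e * c) n * qPoch q (e * b) n / (qPoch q q n * qPoch q (e * b * c) n) := by
  have hq : (q : ℂ) ≠ 0 := mod_cast h0.ne'
  have hqn : ∀ n : ℕ, (1 - (q : ℂ) * (q : ℂ) ^ n) ≠ 0 := fun n =>
      sub_ne_zero.2 (mul_qpow_ne_one h0 h1 (by rwa [norm_of_nonneg h0.le]) n).symm
  have hdn : ∀ n : ℕ, (1 - e * b * c * (q : ℂ) ^ n) ≠ 0 := fun n => sub_ne_zero.2 (hd n).symm
  set s : ℕ → ℕ → ℂ := fun n k => qPoch q b k * qPoch q c k * e ^ k /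
        (qPoch q q k * qPoch q (e * b * c) k) * (qPoch q e (n - k) / qPoch q q (n - k)) with hs
  induction n with
  | zero => simp
  | succ n ih =>
    set g : ℕ → ℂ := fun k => (1 - (q : ℂ) ^ k) * (1 - e * b * c * (q : ℂ) ^ k / q) *
      (-(q : ℂ) * (q : ℂ) ^ n / (q : ℂ) ^ k) * (qPoch q b k * qPoch q c k * e ^ k /
        (qPoch q q k * qPoch q (e * b * c) k)) *
        (qPoch q e (n + 1 - k) / qPoch q q (n + 1 - k)) with hg
    have key : ∀ k ∈ range (n + 1),
        (1 - (q : ℂ) * (q : ℂ) ^ n) * (1 - e * b * c * (q : ℂ) ^ n) * s (n + 1) k -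
        (1 - e * c * (q : ℂ) ^ n) * (1 - e * b * (q : ℂ) ^ n) * s n k = g (k + 1) - g k := by
      intro k hk
      obtain ⟨m, rfl⟩ := Nat.exists_eq_add_of_le (Nat.lt_succ_iff.1 (mem_range.1 hk))
      have e1 : k + m + 1 - k = m + 1 := by omega
      have e2 : k + m - k = m := by omega
      have e3 : k + m + 1 - (k + 1) = m := by omega
      simp only [hs, hg, e1, e2, e3, qPoch_succ, pow_add, pow_one, pow_succ e]
      have n1 := qPoch_q_ne_zero h0 h1 k
      have n2 := qPoch_q_ne_zero h0 h1 m
      have n3 := qPoch_ne_zero hd k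
      have n4 := hqn k
      have n5 := hqn m
      have n6 := hdn k
      have n7 : (q : ℂ) ^ k ≠ 0 := pow_ne_zero _ hq
      rw [show (1 - (q : ℂ) ^ k * q) = 1 - (q : ℂ) * (q : ℂ) ^ k by ring]
      generalize qPoch q b k = B, qPoch q c k = C, qPoch q q k = Q, qPoch q q m = Q',
        qPoch q (e * b * c) k = D, qPoch q e m = E at *
      generalize (q : ℂ) ^ k = K at *
      generalize (q : ℂ) ^ m = M at *
      generalize e ^ k = ek at *
      generalize hU : 1 - (q : ℂ) * K = U at *
      generalize hV : 1 - (q : ℂ) * M = V at *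
      generalize hW : 1 - e * b * c * K = W at *
      field_simp
      rw [← hW, ← hV]; ring
    have hsum := sum_congr rfl key
    rw [Finset.sum_range_sub, Finset.sum_sub_distrib, ← mul_sum, ← mul_sum, ih] at hsum
    have g0 : g 0 = 0 := by simp [hg]
    have gn : g (n + 1) = -((1 - (q : ℂ) * (q : ℂ) ^ n) * (1 - e * b * c * (q : ℂ) ^ n) *
        s (n + 1) (n + 1)) := by
      simp only [hs, hg, pow_succ]
      rw [show (1 - (q : ℂ) ^ n * q) = 1 - (q : ℂ) * (q : ℂ) ^ n by ring]
      have := pow_ne_zero n hq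
      field_simp
    rw [g0, gn, sub_zero] at hsum
    change ∑ k ∈ range (n + 1 + 1), s (n + 1) k = _
    rw [qPoch_succ (e * c), qPoch_succ (e * b), qPoch_succ (q : ℂ) n, qPoch_succ (e * b * c)]
    have n1 := qPoch_q_ne_zero h0 h1 n
    have n3 := qPoch_ne_zero hd n
    have n4 := hqn n
    have n6 := hdn n
    rw [eq_div_iff (by simp_all)]
    have hS : (1 - (q : ℂ) * (q : ℂ) ^ n) * (1 - e * b * c * (q : ℂ) ^ n) *
        (∑ k ∈ range (n + 1), s (n + 1) k + s (n + 1) (n + 1)) =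
        (1 - e * c * (q : ℂ) ^ n) * (1 - e * b * (q : ℂ) ^ n) *
        (qPoch q (e * c) n * qPoch q (e * b) n / (qPoch q q n * qPoch q (e * b * c) n)) := by
      linear_combination hsum
    generalize qPoch q (e * b * c) n = D, qPoch q q n = Q, qPoch q (e * c) n = E₁,
      qPoch q (e * b) n = E₂ at *
    have hS' : (∑ k ∈ range (n + 1), s (n + 1) k + s (n + 1) (n + 1)) *
        (Q * (1 - (q : ℂ) * (q : ℂ) ^ n) * (D * (1 - e * b * c * (q : ℂ) ^ n))) =
        (1 - e * c * (q : ℂ) ^ n) * (1 - e * b * (q : ℂ) ^ n) * (E₁ * E₂ / (Q * D)) * (Q * D) := by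
      rw [← hS]; ring
    rw [mul_assoc _ (E₁ * E₂ / (Q * D)), div_mul_cancel₀ _ (mul_ne_zero n1 n3),
      ← sum_range_succ] at hS'
    refine hS'.trans ?_
    ring

/-- A transformation of nonterminating `₃φ₂` series. -/
theorem phi32_transform {a b c e r : ℂ} (hr : ‖r‖ < 1)
    (her : ‖e * r‖ < 1) (hd : ∀ k : ℕ, e * b * c * q ^ k ≠ 1)
    (hE : ∀ k : ℕ, r * a * q ^ k ≠ 1) (hF : ∀ k : ℕ, e * r * a * q ^ k ≠ 1) :
    qPochInf q (r * a) * qPochInf q (e * r) * phi32 q a b c (e * b * c) (r * a) (e * r) =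
      qPochInf q r * qPochInf q (e * r * a) *
        phi32 q a (e * c) (e * b) (e * b * c) (e * r * a) r := by
  obtain ⟨c₁, hc₁, h₁⟩ := exists_norm_qPoch_q_ge h0 h1
  obtain ⟨c₂, hc₂, h₂⟩ := exists_norm_qPoch_ge h0 h1 hd
  obtain ⟨c₃, hc₃, h₃⟩ := exists_norm_qPoch_ge h0 h1 hF
  set F : ℕ × ℕ → ℂ := fun x =>
    qPoch q b x.1 * qPoch q c x.1 * e ^ x.1 / (qPoch q q x.1 * qPoch q (e * b * c) x.1) *
      (qPoch q e x.2 / qPoch q q x.2) *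
      (qPoch q a (x.1 + x.2) / qPoch q (e * r * a) (x.1 + x.2) * r ^ (x.1 + x.2)) with hFdef
  have hsum : Summable F := by
    set E : ℂ → ℝ := fun x => Real.exp (‖x‖ / (1 - q)) with hEdef
    have hE0 : ∀ x, 0 < E x := fun x => Real.exp_pos _
    have hle : ∀ x n, ‖qPoch q x n‖ ≤ E x := fun x n => norm_qPoch_le h0 h1 x n
    have hg := (summable_geometric_of_lt_one (norm_nonneg _) her).mul_of_nonneg
      (summable_geometric_of_lt_one (norm_nonneg _) hr) (fun _ => by positivity)
      (fun _ => by positivity)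
    refine Summable.of_norm_bounded
      (hg.mul_left (E b * E c / (c₁ * c₂) * (E e / c₁) * (E a / c₃))) fun x => ?_
    have e1 : F x = (qPoch q b x.1 * qPoch q c x.1 / (qPoch q q x.1 * qPoch q (e * b * c) x.1)) *
      (qPoch q e x.2 / qPoch q q x.2) *
      (qPoch q a (x.1 + x.2) / qPoch q (e * r * a) (x.1 + x.2)) * ((e * r) ^ x.1 * r ^ x.2) := by
      simp only [hFdef, pow_add, mul_pow]; ring
    rw [e1, norm_mul, norm_mul ((e * r) ^ x.1), norm_pow, norm_pow]
    refine mul_le_mul_of_nonneg_right ?_ (by positivity)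
    simp only [norm_mul, norm_div]
    have := hE0 a
    have := hE0 b
    have := hE0 c
    have := hE0 e
    gcongr <;> first | exact hle _ _ | exact h₁ _ | exact h₂ _ | exact h₃ _
  have hR : ∑' x, F x = phi32 q a (e * c) (e * b) (e * b * c) (e * r * a) r := by
    rw [← Equiv.tsum_eq HasAntidiagonal.sigmaAntidiagonalEquivProd F]
    have hs2 : Summable fun x => F (HasAntidiagonal.sigmaAntidiagonalEquivProd x) :=
      (Equiv.summable_iff HasAntidiagonal.sigmaAntidiagonalEquivProd (f := F)).2 hsum
    rw [hs2.tsum_sigma' fun n => (hasSum_fintype _).summable, phi32]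
    refine tsum_congr fun n => ?_
    rw [tsum_fintype]
    simp only [HasAntidiagonal.sigmaAntidiagonalEquivProd_apply]
    rw [Finset.sum_coe_sort (HasAntidiagonal.antidiagonal n) (fun x => F x), hFdef]
    rw [Finset.Nat.sum_antidiagonal_eq_sum_range_succ (fun i j =>
      qPoch q b i * qPoch q c i * e ^ i / (qPoch q q i * qPoch q (e * b * c) i) *
      (qPoch q e j / qPoch q q j) *
      (qPoch q a (i + j) / qPoch q (e * r * a) (i + j) * r ^ (i + j))) n]
    have : ∀ k ∈ range (n + 1), k + (n - k) = n := fun k hk => by have := mem_range.1 hk; omega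
    rw [sum_congr rfl fun k hk => by rw [this k hk], ← sum_mul,
      qSaalschutz h0 h1 hd n, mul_assoc (qPoch q a n), mul_comm (qPoch q a n)]
    rw [← mul_assoc, div_mul_div_comm]
  have hL : qPochInf q r * qPochInf q (e * r * a) * ∑' x, F x =
      qPochInf q (r * a) * qPochInf q (e * r) * phi32 q a b c (e * b * c) (r * a) (e * r) := by
    rw [hsum.tsum_prod, phi32, ← tsum_mul_left, ← tsum_mul_left]
    refine tsum_congr fun k => ?_
    have hg := qGauss h0 h1 (a * q ^ k) e hr (fun m h => hF (k + m) (by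
      rw [← h, pow_add]; ring))
    have e1 : ∀ m, F (k, m) = qPoch q b k * qPoch q c k * (e * r) ^ k * qPoch q a k /
        (qPoch q q k * qPoch q (e * b * c) k * qPoch q (e * r * a) k) *
        phi21Term q (a * q ^ k) e (a * q ^ k * e * r) r m := by
      intro m
      simp only [hFdef, phi21Term, qPoch_add, pow_add, mul_pow]
      rw [show a * q ^ k * e * r = e * r * a * q ^ k by ring]
      simp only [div_eq_mul_inv, mul_inv]; ring
    rw [tsum_congr e1, tsum_mul_left]
    rw [show a * q ^ k * e * r = e * r * a * q ^ k by ring,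
      show a * q ^ k * r = r * a * q ^ k by ring] at hg
    rw [show a * q ^ k * e * r = e * r * a * q ^ k by ring]
    rw [qPochInf_eq_mul h0 h1 (e * r * a) k, qPochInf_eq_mul h0 h1 (r * a) k]
    have n1 := qPoch_q_ne_zero h0 h1 k
    have n2 := qPoch_ne_zero hd k
    have n3 := qPoch_ne_zero hF k
    have n4 := qPoch_ne_zero hE k
    field_simp
    linear_combination (qPoch q b k * qPoch q c k * qPoch q a k * e ^ k * r ^ k) * hg
  rw [← hL, hR]

end Summation

/-! ### The triple product and the addition formula for theta functions -/

section ThetaAddition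

variable {q : ℝ}

/-- The triangular exponent `n (n - 1) / 2`. -/
def tri (n : ℤ) : ℤ := n * (n - 1) / 2

lemma two_mul_tri (n : ℤ) : 2 * tri n = n * (n - 1) :=
  Int.mul_ediv_cancel' (Int.even_mul_pred_self n).two_dvd

lemma tri_natCast (n : ℕ) : tri n = ((n * (n - 1) / 2 : ℕ) : ℤ) := by
  have h := two_mul_tri n
  have h2 : 2 * (n * (n - 1) / 2) = n * (n - 1) :=
    Nat.mul_div_cancel' (Nat.even_mul_pred_self n).two_dvd
  have h3 : ((n * (n - 1) : ℕ) : ℤ) = n * (n - 1) := by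
    rcases n with - | n
    · simp
    · push_cast; simp
  have h4 : (2 : ℤ) * ((n * (n - 1) / 2 : ℕ) : ℤ) = ((n * (n - 1) : ℕ) : ℤ) := mod_cast h2
  linarith

/-- The terms of the Laurent series of the theta function. -/
def thetaTerm (q : ℝ) (x : ℂ) (n : ℤ) : ℂ := (-x) ^ n * q ^ tri n

/-- The Laurent series of the theta function. -/
def thetaSeries (q : ℝ) (x : ℂ) : ℂ := ∑' n : ℤ, thetaTerm q x n

lemma norm_thetaTerm (h0 : 0 < q) (x : ℂ) (n : ℤ) :
    ‖thetaTerm q x n‖ = ‖x‖ ^ n * q ^ tri n := by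
  rw [thetaTerm, norm_mul, norm_zpow, norm_zpow, norm_neg, norm_of_nonneg h0.le]

/-- The pairs of integers, sorted by the parity of their sum. -/
def parityEquiv : (ℤ × ℤ) ⊕ (ℤ × ℤ) ≃ ℤ × ℤ where
  toFun := Sum.elim (fun x => (x.1 + x.2, x.1 - x.2)) fun x => (x.1 + x.2 + 1, x.1 - x.2)
  invFun x := if (x.1 + x.2) % 2 = 0 then Sum.inl ((x.1 + x.2) / 2, (x.1 - x.2) / 2)
    else Sum.inr ((x.1 + x.2) / 2, (x.1 - x.2) / 2)
  left_inv := by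
    rintro (⟨j, i⟩ | ⟨j, i⟩)
    · have h : (j + i + (j - i)) % 2 = 0 := by omega
      exact (if_pos h).trans (show (Sum.inl ((j + i + (j - i)) / 2, (j + i - (j - i)) / 2) :
        (ℤ × ℤ) ⊕ (ℤ × ℤ)) = _ by congr 2 <;> omega)
    · have h : ¬ (j + i + 1 + (j - i)) % 2 = 0 := by omega
      exact (if_neg h).trans (show (Sum.inr ((j + i + 1 + (j - i)) / 2,
        (j + i + 1 - (j - i)) / 2) : (ℤ × ℤ) ⊕ (ℤ × ℤ)) = _ by congr 2 <;> omega)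
  right_inv := by
    rintro ⟨m, n⟩
    dsimp only
    split_ifs with h
    · simp only [Sum.elim_inl]; congr 1 <;> omega
    · simp only [Sum.elim_inr]; congr 1 <;> omega

/-- `∑ q^{n²} x^n`. -/
def evenTheta (q : ℝ) (x : ℂ) : ℂ := ∑' n : ℤ, x ^ n * q ^ (n ^ 2)

/-- `∑ q^{n² + n} x^n`. -/
def oddTheta (q : ℝ) (x : ℂ) : ℂ := ∑' n : ℤ, x ^ n * q ^ (n ^ 2 + n)

lemma thetaTerm_mul_even (h0 : 0 < q) {x y : ℂ} (hx : x ≠ 0) (hy : y ≠ 0) (j i : ℤ) :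
    thetaTerm q x (j + i) * thetaTerm q y (j - i) =
      ((x * y) ^ j * q ^ (j ^ 2 + -1 * j)) * ((x / y) ^ i * q ^ (i ^ 2)) := by
  have hq : (q : ℂ) ≠ 0 := mod_cast h0.ne'
  have t : tri (j + i) + tri (j - i) = (j ^ 2 + -1 * j) + i ^ 2 := by
    have := two_mul_tri (j + i); have := two_mul_tri (j - i); linarith
  have e : (-x) ^ (j + i) * (-y) ^ (j - i) = (x * y) ^ j * (x / y) ^ i := by
    rw [zpow_add₀ (neg_ne_zero.2 hx), zpow_sub₀ (neg_ne_zero.2 hy), ← neg_mul_neg x y, mul_zpow,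
      ← neg_div_neg_eq x y, div_zpow]
    ring
  have e' : (q : ℂ) ^ tri (j + i) * q ^ tri (j - i) =
      (q : ℂ) ^ (j ^ 2 + -1 * j) * q ^ (i ^ 2) := by
    rw [← zpow_add₀ hq, ← zpow_add₀ hq, t]
  rw [thetaTerm, thetaTerm, mul_mul_mul_comm, e, e', mul_mul_mul_comm]

lemma thetaTerm_mul_odd (h0 : 0 < q) {x y : ℂ} (hx : x ≠ 0) (hy : y ≠ 0) (j i : ℤ) :
    thetaTerm q x (j + i + 1) * thetaTerm q y (j - i) =
      -(x * (((x * y) ^ j * q ^ (j ^ 2)) * ((x / y) ^ i * q ^ (i ^ 2 + i)))) := by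
  have hq : (q : ℂ) ≠ 0 := mod_cast h0.ne'
  have t : tri (j + i + 1) + tri (j - i) = j ^ 2 + (i ^ 2 + i) := by
    have := two_mul_tri (j + i + 1); have := two_mul_tri (j - i); linarith
  have e : (-x) ^ (j + i + 1) * (-y) ^ (j - i) = -x * ((x * y) ^ j * (x / y) ^ i) := by
    rw [zpow_add_one₀ (neg_ne_zero.2 hx), zpow_add₀ (neg_ne_zero.2 hx),
      zpow_sub₀ (neg_ne_zero.2 hy), ← neg_mul_neg x y, mul_zpow, ← neg_div_neg_eq x y, div_zpow]
    ring
  have e' : (q : ℂ) ^ tri (j + i + 1) * q ^ tri (j - i) =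
      (q : ℂ) ^ (j ^ 2) * q ^ (i ^ 2 + i) := by
    rw [← zpow_add₀ hq, ← zpow_add₀ hq, t]
  rw [thetaTerm, thetaTerm, mul_mul_mul_comm, e, e', mul_assoc, mul_mul_mul_comm ((x * y) ^ j),
    neg_mul]

variable (h0 : 0 < q) (h1 : q < 1)
include h0 h1

lemma summable_pow_mul_qpow_sq (r : ℝ) :
    Summable fun n : ℕ => r ^ n * q ^ (n * (n - 1) / 2) := by
  refine summable_of_ratio_test_tendsto_lt_one (l := 0) one_pos ?_ ?_ |>.of_norm_bounded
    (g := fun n : ℕ => (|r| + 1) ^ n * q ^ (n * (n - 1) / 2)) fun n => ?_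
  · exact .of_forall fun n => by positivity
  · have : ∀ n : ℕ, ‖(|r| + 1) ^ (n + 1) * q ^ ((n + 1) * (n + 1 - 1) / 2)‖ /
        ‖(|r| + 1) ^ n * q ^ (n * (n - 1) / 2)‖ = (|r| + 1) * q ^ n := by
      intro n
      have e : (n + 1) * (n + 1 - 1) / 2 = n * (n - 1) / 2 + n := by
        cases n with
        | zero => simp
        | succ m =>
          have : (m + 1 + 1) * (m + 1 + 1 - 1) = (m + 1) * (m + 1 - 1) + 2 * (m + 1) := by
            simp only [Nat.add_sub_cancel]; ring
          omega
      have p1 : 0 < |r| + 1 := by positivity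
      rw [Real.norm_of_nonneg (by positivity), Real.norm_of_nonneg (by positivity), e, pow_add,
        pow_succ]
      field_simp; ring
    simp_rw [this]
    simpa using (tendsto_pow_atTop_nhds_zero_of_lt_one h0.le h1).const_mul (|r| + 1)
  · rw [norm_mul, norm_pow, norm_pow, Real.norm_of_nonneg h0.le]
    gcongr
    exact le_add_of_nonneg_right zero_le_one

lemma summable_norm_thetaTerm {x : ℂ} (_ : x ≠ 0) :
    Summable fun n => ‖thetaTerm q x n‖ := by
  simp_rw [norm_thetaTerm h0]
  refine Summable.of_nat_of_neg ?_ ?_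
  · refine (summable_pow_mul_qpow_sq h0 h1 ‖x‖).congr fun n => ?_
    rw [tri_natCast, zpow_natCast, zpow_natCast]
  · refine (summable_pow_mul_qpow_sq h0 h1 (‖x‖⁻¹ * q)).congr fun n => ?_
    have : tri (-(n : ℤ)) = n + tri n := by
      have := two_mul_tri n; have := two_mul_tri (-(n : ℤ)); linarith
    rw [this, zpow_add₀ h0.ne', tri_natCast, zpow_natCast, zpow_natCast, mul_pow, zpow_neg,
      zpow_natCast, inv_pow, mul_assoc]

lemma qBinomial (y : ℂ) (M : ℕ) :
    qPoch q y M = ∑ j ∈ range (M + 1), (-y) ^ j * (q : ℂ) ^ tri j *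
      (qPoch q q M / (qPoch q q j * qPoch q q (M - j))) := by
  have hq : (q : ℂ) ≠ 0 := mod_cast h0.ne'
  have hqn : ∀ n : ℕ, (1 - (q : ℂ) * (q : ℂ) ^ n) ≠ 0 := fun n =>
      sub_ne_zero.2 (mul_qpow_ne_one h0 h1 (by rwa [norm_of_nonneg h0.le]) n).symm
  induction M generalizing y with
  | zero => simp [tri]
  | succ M ih =>
    set G : ℕ → ℂ := fun j => (-(y * q)) ^ j * (q : ℂ) ^ tri j *
      (qPoch q q M / (qPoch q q j * qPoch q q (M - j))) with hG
    have hG' : qPoch q (y * q) M = ∑ j ∈ range (M + 1), G j := ih (y * q)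
    have s1 : (1 - y) * qPoch q (y * q) M = (∑ j ∈ range M, G (j + 1) + G 0) -
        y * (∑ j ∈ range M, G j + G M) := by
      rw [← Finset.sum_range_succ', ← sum_range_succ, hG']; ring
    rw [qPoch_succ', s1, sum_range_succ _ (M + 1), Finset.sum_range_succ' _ M]
    have hn := fun n => qPoch_q_ne_zero h0 h1 n
    have e1 : ∀ k ∈ range M, (-y) ^ (k + 1) * (q : ℂ) ^ tri ((k + 1 : ℕ) : ℤ) *
        (qPoch q q (M + 1) / (qPoch q q (k + 1) * qPoch q q (M + 1 - (k + 1)))) =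
        G (k + 1) - y * G k := by
      intro k hk
      simp only [hG]
      obtain ⟨m, rfl⟩ := Nat.exists_eq_add_of_le (Nat.succ_le_of_lt (mem_range.1 hk))
      have a1 : k.succ + m + 1 - (k + 1) = m + 1 := by omega
      have a2 : k.succ + m - (k + 1) = m := by omega
      have a3 : k.succ + m - k = m + 1 := by omega
      have a4 : tri ((k + 1 : ℕ) : ℤ) = k + tri k := by
        have h := two_mul_tri k
        have h' := two_mul_tri ((k : ℤ) + 1)
        push_cast; linarith
      rw [a1, a2, a3, a4, zpow_add₀ hq, zpow_natCast, qPoch_succ _ m, qPoch_succ _ k,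
        qPoch_succ _ (k.succ + m), neg_mul_eq_neg_mul y, mul_pow, mul_pow, pow_succ (-y),
        pow_succ (q : ℂ), pow_add, pow_succ (q : ℂ) k]
      have := hn m
      have := hn k
      have n4 := hqn m
      have n5 := hqn k
      generalize qPoch q q k = Qk, qPoch q q m = Qm, qPoch q q (k.succ + m) = QM at *
      generalize (q : ℂ) ^ k = K at *
      generalize (q : ℂ) ^ m = M at *
      generalize hU : 1 - (q : ℂ) * K = U at *
      generalize hV : 1 - (q : ℂ) * M = V at *
      field_simp
      rw [← hU, ← hV]; ring
    rw [sum_congr rfl e1, Finset.sum_sub_distrib, ← mul_sum]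
    have a5 : tri ((M + 1 : ℕ) : ℤ) = M + tri M := by
      have h := two_mul_tri M
      have h' := two_mul_tri ((M : ℤ) + 1)
      push_cast; linarith
    have := hn M
    have := hn (M + 1)
    simp only [hG, Nat.sub_self, Nat.sub_zero, qPoch_zero, mul_one, pow_zero, Nat.cast_zero, one_mul,
      a5, zpow_add₀ hq, zpow_natCast, div_self this, div_self (hn M), pow_succ (-y)]
    rw [neg_mul_eq_neg_mul y, mul_pow]; ring

/-- The Jacobi triple product. -/
theorem thetaSeries_eq {x : ℂ} (hx : x ≠ 0) :
    thetaSeries q x = qPochInf q q * theta q x := by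
  have hq : (q : ℂ) ≠ 0 := mod_cast h0.ne'
  obtain ⟨c, hc, hcn⟩ := exists_norm_qPoch_q_ge h0 h1
  set B : ℕ → ℤ → ℂ := fun N n => if -(N : ℤ) ≤ n ∧ n ≤ N then
    qPoch q q (2 * N) / (qPoch q q (N + n).toNat * qPoch q q (N - n).toNat) else 0 with hB
  have hfin : ∀ N : ℕ, ∑' n : ℤ, thetaTerm q x n * B N n = qPoch q x N * qPoch q (q / x) N := by
    intro N
    have h := qBinomial h0 h1 (x * q ^ (-(N : ℤ))) (2 * N)
    have hl : qPoch q (x * q ^ (-(N : ℤ))) (2 * N) * q ^ tri (N + 1) * (-x) ^ (-(N : ℤ)) =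
        qPoch q x N * qPoch q (q / x) N := by
      have e1 : qPoch q (x * q ^ (-(N : ℤ))) N =
          qPoch q (q / x) N * (-x) ^ N * ((q : ℂ) ^ tri (N + 1))⁻¹ := by
        clear h
        induction N with
        | zero => simp [tri]
        | succ N ih =>
          rw [qPoch_succ', qPoch_succ, show x * q ^ (-((N + 1 : ℕ) : ℤ)) * q =
            x * q ^ (-(N : ℤ)) by rw [mul_assoc, ← zpow_add_one₀ hq]; congr 2; push_cast; ring, ih]
          have a4 : tri ((N + 1 : ℕ) + 1 : ℤ) = (N + 1 : ℕ) + tri (N + 1) := by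
            have h := two_mul_tri (N + 1)
            have h' := two_mul_tri (((N + 1 : ℕ) : ℤ) + 1)
            push_cast at h' ⊢; linarith
          rw [a4, zpow_add₀ hq, zpow_neg, zpow_natCast, pow_succ (-x)]; field_simp; ring
      rw [two_mul, qPoch_add, e1, mul_assoc x, ← zpow_natCast (q : ℂ) N, ← zpow_add₀ hq,
        neg_add_cancel, zpow_zero, mul_one, zpow_neg, zpow_natCast]
      have := neg_ne_zero.2 hx
      field_simp
    rw [← hl, h, sum_mul, sum_mul]
    have hsupp : ∀ n ∉ (Icc (-(N : ℤ)) N), thetaTerm q x n * B N n = 0 := by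
      intro n hn
      rw [mem_Icc] at hn
      simp [hB, hn]
    rw [tsum_eq_sum hsupp]
    symm
    refine Finset.sum_bij (fun j _ => (j : ℤ) - N) (fun j hj => ?_) (fun j _ j' _ h => ?_)
      (fun n hn => ?_) (fun j hj => ?_)
    · have := mem_range.1 hj; rw [mem_Icc]; omega
    · simpa using h
    · rw [mem_Icc] at hn
      exact ⟨(n + N).toNat, by rw [mem_range]; omega, by omega⟩
    · have hj' := mem_range.1 hj
      have c1 : -(N : ℤ) ≤ (j : ℤ) - N ∧ (j : ℤ) - N ≤ N := by omega
      have t1 : ((N : ℤ) + ((j : ℤ) - N)).toNat = j := by omega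
      have t2 : ((N : ℤ) - ((j : ℤ) - N)).toNat = 2 * N - j := by omega
      simp only [hB, if_pos c1, t1, t2, thetaTerm]
      have t3 : (-(x * q ^ (-(N : ℤ)))) ^ j * q ^ tri j * q ^ tri (N + 1) *
          (-x) ^ (-(N : ℤ)) = (-x) ^ ((j : ℤ) - N) * q ^ tri (j - N) := by
        rw [neg_mul_eq_neg_mul, mul_pow, ← zpow_natCast (-x), ← zpow_natCast ((q : ℂ) ^ (-(N : ℤ))),
          ← zpow_mul, sub_eq_add_neg (j : ℤ), zpow_add₀ (neg_ne_zero.2 hx)]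
        have : tri (j + -N) = -(N : ℤ) * j + tri j + tri (N + 1) := by
          have := two_mul_tri j
          have := two_mul_tri (N + 1)
          have := two_mul_tri (j + -N)
          linarith
        rw [this, zpow_add₀ hq, zpow_add₀ hq]; ring
      rw [← t3]; ring
  have hlim : Tendsto (fun N => ∑' n : ℤ, thetaTerm q x n * B N n) atTop
      (𝓝 (∑' n : ℤ, thetaTerm q x n * (qPochInf q q)⁻¹)) := by
    set e := Real.exp (‖(q : ℂ)‖ / (1 - q))
    have he : 0 < e := Real.exp_pos _
    refine tendsto_tsum_of_dominated_convergence
      (bound := fun n => ‖thetaTerm q x n‖ * (e / (c * c)))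
      ((summable_norm_thetaTerm h0 h1 hx).mul_right _) (fun n => ?_)
      (.of_forall fun N n => ?_)
    · refine Tendsto.const_mul _ ?_
      have l0 := tendsto_qPoch h0 h1 (q : ℂ)
      have hne : qPochInf q q ≠ 0 := qPochInf_ne_zero h0 h1 (mul_qpow_ne_one h0 h1
        (by rwa [norm_of_nonneg h0.le]))
      have l1 : Tendsto (fun N : ℕ => 2 * N) atTop atTop :=
        tendsto_atTop_mono (fun N => (by omega : N ≤ 2 * N)) tendsto_id
      have l2 : Tendsto (fun N : ℕ => ((N : ℤ) + n).toNat) atTop atTop :=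
        tendsto_atTop.2 fun b => by
          filter_upwards [eventually_ge_atTop (b + n.natAbs)] with N hN; omega
      have l3 : Tendsto (fun N : ℕ => ((N : ℤ) - n).toNat) atTop atTop :=
        tendsto_atTop.2 fun b => by
          filter_upwards [eventually_ge_atTop (b + n.natAbs)] with N hN; omega
      have l4 := (l0.comp l1).div ((l0.comp l2).mul (l0.comp l3)) (mul_ne_zero hne hne)
      rw [show (qPochInf q q)⁻¹ = qPochInf q q / (qPochInf q q * qPochInf q q) by field_simp]
      refine l4.congr' ?_
      filter_upwards [eventually_ge_atTop n.natAbs] with N hN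
      have c1 : -(N : ℤ) ≤ n ∧ n ≤ N := by omega
      simp only [hB, if_pos c1]; rfl
    · rw [norm_mul]
      refine mul_le_mul_of_nonneg_left ?_ (norm_nonneg _)
      simp only [hB]
      split_ifs
      · rw [norm_div, norm_mul]
        gcongr
        · exact norm_qPoch_le h0 h1 _ _
        · exact hcn _
        · exact hcn _
      · rw [norm_zero]; positivity
  simp_rw [hfin] at hlim
  have := tendsto_nhds_unique hlim ((tendsto_qPoch h0 h1 x).mul (tendsto_qPoch h0 h1 (q / x)))
  rw [tsum_mul_right] at this
  have hne : qPochInf q q ≠ 0 := qPochInf_ne_zero h0 h1 (mul_qpow_ne_one h0 h1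
    (by rwa [norm_of_nonneg h0.le]))
  rw [theta, ← this, thetaSeries]
  field_simp

lemma summable_norm_zpow_mul {x : ℂ} (hx : x ≠ 0) (m : ℤ) :
    Summable fun n : ℤ => ‖x ^ n * q ^ (n ^ 2 + m * n)‖ := by
  have hq : (q : ℂ) ≠ 0 := mod_cast h0.ne'
  have h := summable_norm_thetaTerm (q := q ^ 2) (by positivity) (by nlinarith)
    (neg_ne_zero.2 (mul_ne_zero hx (zpow_ne_zero (1 + m) hq)))
  refine h.congr fun n => ?_
  have e : n ^ 2 + m * n = (1 + m) * n + 2 * tri n := by linarith [two_mul_tri n]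
  rw [thetaTerm, neg_neg, e, zpow_add₀ hq _ (2 * tri n), zpow_mul, zpow_mul, mul_zpow]
  push_cast
  rw [← mul_assoc, zpow_ofNat]

lemma thetaSeries_mul {x y : ℂ} (hx : x ≠ 0) (hy : y ≠ 0) :
    thetaSeries q x * thetaSeries q y =
      x * y * oddTheta q (x * y) * evenTheta q (x / y) -
        x * evenTheta q (x * y) * oddTheta q (x / y) := by
  rw [sub_eq_add_neg]
  have hq : (q : ℂ) ≠ 0 := mod_cast h0.ne'
  have sx := summable_norm_thetaTerm h0 h1 hx
  have sy := summable_norm_thetaTerm h0 h1 hy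
  have hs := summable_mul_of_summable_norm sx sy
  rw [thetaSeries, thetaSeries, sx.of_norm.tsum_mul_tsum sy.of_norm hs]
  set f : ℤ × ℤ → ℂ := fun z => thetaTerm q x z.1 * thetaTerm q y z.2 with hf
  have hs' : Summable (f ∘ parityEquiv) := parityEquiv.summable_iff.2 hs
  have e : ∑' z, f z = ∑' z, (f ∘ parityEquiv) z := (parityEquiv.tsum_eq f).symm
  have sl : Summable fun z : ℤ × ℤ => (f ∘ parityEquiv) (Sum.inl z) :=
    hs'.comp_injective Sum.inl_injective
  have sr : Summable fun z : ℤ × ℤ => (f ∘ parityEquiv) (Sum.inr z) :=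
    hs'.comp_injective Sum.inr_injective
  change ∑' z, f z = _
  rw [e, (HasSum.sum sl.hasSum sr.hasSum : HasSum (f ∘ parityEquiv) _).tsum_eq]
  have hxy := mul_ne_zero hx hy
  have hxdy := div_ne_zero hx hy
  have p1 := summable_norm_zpow_mul h0 h1 hxy (-1)
  have p2 := summable_norm_zpow_mul h0 h1 hxdy 0
  have p3 := summable_norm_zpow_mul h0 h1 hxy 0
  have p4 := summable_norm_zpow_mul h0 h1 hxdy 1
  have hodd : ∑' n : ℤ, (x * y) ^ n * q ^ (n ^ 2 + -1 * n) =
      x * y * oddTheta q (x * y) := by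
    rw [oddTheta, ← tsum_mul_left, ← (Equiv.addRight (1 : ℤ)).tsum_eq]
    refine tsum_congr fun n => ?_
    simp only [Equiv.coe_addRight]
    rw [zpow_add_one₀ hxy, show (n + 1) ^ 2 + -1 * (n + 1) = n ^ 2 + n by ring]
    ring
  have e2 : ∀ n : ℤ, n ^ 2 + 0 * n = n ^ 2 := fun n => by ring
  have e3 : ∀ n : ℤ, n ^ 2 + 1 * n = n ^ 2 + n := fun n => by ring
  simp only [e2] at p2 p3
  simp only [e3] at p4
  have r1 : ∑' z : ℤ × ℤ, (f ∘ parityEquiv) (Sum.inl z) =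
      x * y * oddTheta q (x * y) * evenTheta q (x / y) := by
    have h := tsum_mul_tsum_of_summable_norm
      (f := fun n : ℤ => (x * y) ^ n * q ^ (n ^ 2 + -1 * n))
      (g := fun n : ℤ => (x / y) ^ n * q ^ (n ^ 2)) p1 p2
    rw [← hodd, evenTheta, h]
    exact tsum_congr fun z => thetaTerm_mul_even h0 hx hy z.1 z.2
  have r2 : ∑' z : ℤ × ℤ, (f ∘ parityEquiv) (Sum.inr z) =
      -(x * evenTheta q (x * y) * oddTheta q (x / y)) := by
    have h := tsum_mul_tsum_of_summable_norm
      (f := fun n : ℤ => (x * y) ^ n * q ^ (n ^ 2))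
      (g := fun n : ℤ => (x / y) ^ n * q ^ (n ^ 2 + n)) p3 p4
    rw [evenTheta, oddTheta, mul_assoc x, h, ← tsum_mul_left, ← tsum_neg]
    exact tsum_congr fun z => thetaTerm_mul_odd h0 hx hy z.1 z.2
  rw [r1, r2]

/-- The addition formula for theta functions. -/
theorem theta_addition {a b z w p : ℂ} (ha : a ≠ 0) (hb : b ≠ 0)
    (hz : z ≠ 0) (hw : w ≠ 0) (hp : p ≠ 0) :
    theta q (a * z) * theta q (p * z / a) * (theta q (b * w) * theta q (p * w / b)) -
      theta q (a * w) * theta q (p * w / a) * (theta q (b * z) * theta q (p * z / b)) =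
      p * w / a * (theta q (p * z * w) * theta q (z / w) *
        (theta q (a * b / p) * theta q (a / b))) := by
  have hne : qPochInf q q ≠ 0 := qPochInf_ne_zero h0 h1 (mul_qpow_ne_one h0 h1
    (by rwa [norm_of_nonneg h0.le]))
  have key : ∀ {x y : ℂ}, x ≠ 0 → y ≠ 0 → qPochInf q q ^ 2 * (theta q x * theta q y) =
      x * y * oddTheta q (x * y) * evenTheta q (x / y) -
        x * evenTheta q (x * y) * oddTheta q (x / y) := fun {x y} hx hy => by
    rw [← thetaSeries_mul h0 h1 hx hy, thetaSeries_eq h0 h1 hx, thetaSeries_eq h0 h1 hy]; ring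
  have k1 := key (mul_ne_zero ha hz) (div_ne_zero (mul_ne_zero hp hz) ha)
  have k2 := key (mul_ne_zero hb hw) (div_ne_zero (mul_ne_zero hp hw) hb)
  have k3 := key (mul_ne_zero ha hw) (div_ne_zero (mul_ne_zero hp hw) ha)
  have k4 := key (mul_ne_zero hb hz) (div_ne_zero (mul_ne_zero hp hz) hb)
  have k5 := key (mul_ne_zero (mul_ne_zero hp hz) hw) (div_ne_zero hz hw)
  have k6 := key (div_ne_zero (mul_ne_zero ha hb) hp) (div_ne_zero ha hb)
  rw [show a * z * (p * z / a) = p * z ^ 2 by field_simp,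
    show a * z / (p * z / a) = a ^ 2 / p by field_simp] at k1
  rw [show b * w * (p * w / b) = p * w ^ 2 by field_simp,
    show b * w / (p * w / b) = b ^ 2 / p by field_simp] at k2
  rw [show a * w * (p * w / a) = p * w ^ 2 by field_simp,
    show a * w / (p * w / a) = a ^ 2 / p by field_simp] at k3
  rw [show b * z * (p * z / b) = p * z ^ 2 by field_simp,
    show b * z / (p * z / b) = b ^ 2 / p by field_simp] at k4
  rw [show p * z * w * (z / w) = p * z ^ 2 by field_simp,
    show p * z * w / (z / w) = p * w ^ 2 by field_simp] at k5
  rw [show a * b / p * (a / b) = a ^ 2 / p by field_simp,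
    show a * b / p / (a / b) = b ^ 2 / p by field_simp] at k6
  refine mul_left_cancel₀ (pow_ne_zero 4 hne) ?_
  calc _ = (qPochInf q q ^ 2 * (theta q (a * z) * theta q (p * z / a))) *
        (qPochInf q q ^ 2 * (theta q (b * w) * theta q (p * w / b))) -
        (qPochInf q q ^ 2 * (theta q (a * w) * theta q (p * w / a))) *
        (qPochInf q q ^ 2 * (theta q (b * z) * theta q (p * z / b))) := by ring
    _ = p * w / a * ((qPochInf q q ^ 2 * (theta q (p * z * w) * theta q (z / w))) *
        (qPochInf q q ^ 2 * (theta q (a * b / p) * theta q (a / b)))) := by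
      rw [k1, k2, k3, k4, k5, k6]; field_simp; ring
    _ = _ := by ring

end ThetaAddition

/-! ### Regular parameters -/

namespace Params

/-- The conditions on the parameters that are symmetric in `a` and `b`. -/
structure IsReg (p : Params) : Prop where
  q_pos : 0 < p.q
  q_lt_one : p.q < 1
  zp_pos : 0 < p.zp
  zm_neg : p.zm < 0
  a_ne : p.a ≠ 0
  b_ne : p.b ≠ 0
  c_ne : p.c ≠ 0
  d_ne : p.d ≠ 0
  a_pt : ∀ i, p.a * p.pt i ≠ 1
  b_pt : ∀ i, p.b * p.pt i ≠ 1
  c_pt : ∀ i, p.c * p.pt i ≠ 1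
  d_pt : ∀ i, p.d * p.pt i ≠ 1
  ca : ∀ n : ℤ, p.c / p.a ≠ (p.q : ℂ) ^ n
  cb : ∀ n : ℤ, p.c / p.b ≠ (p.q : ℂ) ^ n
  da : ∀ n : ℤ, p.d / p.a ≠ (p.q : ℂ) ^ n
  db : ∀ n : ℤ, p.d / p.b ≠ (p.q : ℂ) ^ n
  ab : ∀ n : ℤ, p.a / p.b ≠ (p.q : ℂ) ^ n
  cdab : ∀ n : ℤ, p.c * p.d / (p.a * p.b) ≠ (p.q : ℂ) ^ n
  ab_pos : ∃ r : ℝ, 0 < r ∧ p.a * p.b = r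
  s_pos : ∃ r : ℝ, 0 < r ∧ p.s = r
  s_sq : p.s ^ 2 * (p.a * p.b) = p.c * p.d * p.q

variable {p : Params} {γ : ℂ} {ε : Bool} {t N : ℝ} {u v : ℝ → ℂ²} {f g : RqIndex → ℂ}

lemma PairDomain.ne_zero {α β : ℂ} (h : p.PairDomain α β) (hz : 0 < p.zp) (hz' : p.zm < 0)
    (hq : 0 < p.q) (hne : α ≠ β) : α ≠ 0 ∧ β ≠ 0 ∧ ∃ r : ℝ, 0 < r ∧ α * β = r := by
  rcases h.2 with h | ⟨r, t, rfl, rfl, k, h1, h2, h3⟩ | ⟨r, t, rfl, rfl, k, h1, h2, h3⟩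
  · have hβ : β ≠ 0 := by rintro rfl; simp [h] at hne
    refine ⟨by simp [h, hβ], hβ, ‖β‖ ^ 2, by positivity, ?_⟩
    rw [h, mul_comm, Complex.mul_conj, normSq_eq_norm_sq]
  · have ht : 0 < t := inv_pos.1 (lt_trans (by positivity) h1)
    have hr : 0 < r := inv_pos.1 ((inv_pos.2 ht).trans h2)
    exact ⟨mod_cast hr.ne', mod_cast ht.ne', r * t, by positivity, by push_cast; ring⟩
  · have ht : t < 0 := inv_lt_zero.1 (h3.trans (mul_neg_of_neg_of_pos hz' (by positivity)))
    have hr : r < 0 := inv_lt_zero.1 (h2.trans (inv_lt_zero.2 ht))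
    exact ⟨mod_cast hr.ne, mod_cast ht.ne, r * t, mul_pos_of_neg_of_neg hr ht, by push_cast; ring⟩

lemma PairDomain.div_ne {α β : ℂ} (h : p.PairDomain α β) (hz : 0 < p.zp) (hz' : p.zm < 0)
    (hq : 0 < p.q) (hq1 : p.q < 1) (hne : α ≠ β) (n : ℤ) : α / β ≠ (p.q : ℂ) ^ n := by
  obtain ⟨hα, hβ, -⟩ := h.ne_zero hz hz' hq hne
  have key : ∀ u v : ℝ, 0 < v → v < u → p.q * u < v → v / u ≠ p.q ^ n := by
    intro u v hv huv hq' he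
    have hu := hv.trans huv
    have h1 : v / u < 1 := (div_lt_one hu).2 huv
    have h2 : p.q < v / u := (lt_div_iff₀ hu).2 hq'
    rw [he] at h1 h2
    have h3 := (zpow_lt_one_iff_right_of_lt_one₀ hq hq1).1 h1
    have h4 := (zpow_lt_zpow_iff_right_of_lt_one₀ hq hq1).1 ((zpow_one _).trans_lt h2)
    omega
  intro he
  rcases h.2 with h | ⟨r, t, rfl, rfl, k, h1, h2, h3⟩ | ⟨r, t, rfl, rfl, k, h1, h2, h3⟩
  · have h1 := congrArg norm he
    rw [h, norm_div, RCLike.norm_conj, div_self (norm_ne_zero_iff.2 hβ), norm_zpow,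
      norm_of_nonneg hq.le] at h1
    rw [(zpow_eq_one_iff_right₀ hq.le hq1.ne).1 h1.symm, zpow_zero, div_eq_one_iff_eq hβ] at he
    exact hne he
  · have ht : 0 < t := inv_pos.1 (lt_trans (by positivity) h1)
    have hr : 0 < r := inv_pos.1 ((inv_pos.2 ht).trans h2)
    refine key r⁻¹ t⁻¹ (inv_pos.2 ht) h2 ?_ ?_
    · rw [zpow_sub_one₀ hq.ne'] at h3
      calc p.q * r⁻¹ < p.q * (p.zp * (p.q ^ k * p.q⁻¹)) := by gcongr
        _ = p.zp * p.q ^ k := by field_simp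
        _ < _ := h1
    · have : r / t = p.q ^ n := mod_cast he
      rw [← this]; field_simp
  · have ht : t < 0 := inv_lt_zero.1 (h3.trans (mul_neg_of_neg_of_pos hz' (by positivity)))
    have hr : r < 0 := inv_lt_zero.1 (h2.trans (inv_lt_zero.2 ht))
    refine key (-r⁻¹) (-t⁻¹) (by have := inv_lt_zero.2 ht; linarith) (by linarith) ?_ ?_
    · rw [zpow_sub_one₀ hq.ne'] at h1
      have : p.q * (p.zm * (p.q ^ k * p.q⁻¹)) < p.q * r⁻¹ := by gcongr
      have e : p.q * (p.zm * (p.q ^ k * p.q⁻¹)) = p.zm * p.q ^ k := by field_simp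
      linarith
    · have : r / t = p.q ^ n := mod_cast he
      rw [← this, neg_div_neg_eq]; field_simp

lemma s_dagger : p.dagger.s = p.s := by simp [s, dagger, mul_comm]

lemma pt_dagger : p.dagger.pt = p.pt := rfl

lemma IsReg.dagger (h : p.IsReg) : p.dagger.IsReg := by
  have hs := s_dagger (p := p)
  refine ⟨h.q_pos, h.q_lt_one, h.zp_pos, h.zm_neg, h.b_ne, h.a_ne, h.c_ne, h.d_ne, h.b_pt, h.a_pt,
    h.c_pt, h.d_pt, h.cb, h.ca, h.db, h.da, fun n e => h.ab (-n) ?_, ?_, ?_, hs ▸ h.s_pos, ?_⟩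
  · rw [zpow_neg, ← inv_div]; exact congrArg _ e
  · exact mul_comm p.a p.b ▸ h.cdab
  · exact mul_comm p.a p.b ▸ h.ab_pos
  · exact hs ▸ mul_comm p.a p.b ▸ h.s_sq

lemma IsGeneric.isRegular (h : p.IsGeneric) : p.IsReg := by
  obtain ⟨ha, hb, r, hr, hab⟩ := h.ab.ne_zero h.zp_pos h.zm_neg h.q_pos h.a_ne_b
  obtain ⟨hc, hd, t, ht, hcd⟩ := h.cd.ne_zero h.zp_pos h.zm_neg h.q_pos h.c_ne_d
  have key : ∀ α : ℂ, (∀ n : ℤ, α ≠ ((p.zp⁻¹ * p.q ^ n : ℝ) : ℂ) ∧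
      α ≠ ((p.zm⁻¹ * p.q ^ n : ℝ) : ℂ)) → ∀ i, α * p.pt i ≠ 1 := by
    rintro α hα ⟨ε, n⟩ he
    have hz : p.z ε ≠ 0 := by cases ε <;> simp [z, h.zp_pos.ne', h.zm_neg.ne]
    have hqn := zpow_ne_zero n h.q_pos.ne'
    have : α = (((p.z ε)⁻¹ * p.q ^ (-n) : ℝ) : ℂ) := by
      rw [eq_div_of_mul_eq (by simp [pt, hz, h.q_pos.ne', zpow_ne_zero]) he]
      simp [pt]; ring
    cases ε
    · exact (hα (-n)).2 (by simpa [z] using this)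
    · exact (hα (-n)).1 (by simpa [z] using this)
  have hz : p.c * p.d * p.q / (p.a * p.b) = ((t * p.q / r : ℝ) : ℂ) := by
    rw [hab, hcd]; push_cast; ring
  have hpos : 0 < t * p.q / r := by have := h.q_pos; positivity
  exact ⟨h.q_pos, h.q_lt_one, h.zp_pos, h.zm_neg, ha, hb, hc, hd,
    key _ fun n => ⟨(h.ab.1 n).1, (h.ab.1 n).2.1⟩, key _ fun n => (h.ab.1 n).2.2,
    key _ fun n => ⟨(h.cd.1 n).1, (h.cd.1 n).2.1⟩, key _ fun n => (h.cd.1 n).2.2,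
    h.ca, h.cb, h.da, h.db, h.ab.div_ne h.zp_pos h.zm_neg h.q_pos h.q_lt_one h.a_ne_b, h.cdab,
    ⟨r, hr, hab⟩, ⟨(t * p.q / r) ^ (1 / 2 : ℝ), Real.rpow_pos_of_pos hpos _, by
      rw [s, hz, Complex.ofReal_cpow hpos.le]; push_cast; rfl⟩,
    by rw [s, ← Complex.cpow_nat_mul]; norm_num; field_simp⟩

namespace IsReg
variable (h : p.IsReg)
include h

lemma s_ne : p.s ≠ 0 := by
  obtain ⟨r, hr, e⟩ := h.s_pos; rw [e]; exact_mod_cast hr.ne'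

lemma q_ne : (p.q : ℂ) ≠ 0 := mod_cast h.q_pos.ne'

lemma ne_zero : p.a ≠ 0 ∧ p.b ≠ 0 ∧ p.c ≠ 0 ∧ p.d ≠ 0 ∧ p.s ≠ 0 ∧ (p.q : ℂ) ≠ 0 :=
  ⟨h.a_ne, h.b_ne, h.c_ne, h.d_ne, h.s_ne, h.q_ne⟩

lemma z_ne (ε : Bool) : p.z ε ≠ 0 := by
  cases ε <;> simp [z, h.zp_pos.ne', h.zm_neg.ne]

lemma z_ne' (ε : Bool) : (p.z ε : ℂ) ≠ 0 := mod_cast h.z_ne ε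

lemma one_sub_ne : (1 - p.q : ℂ) ≠ 0 := mod_cast (sub_pos.2 h.q_lt_one).ne'

lemma poch_ne {x : ℂ} (hx : ∀ k : ℕ, x * p.q ^ k ≠ 1) : qPochInf p.q x ≠ 0 :=
  qPochInf_ne_zero h.q_pos h.q_lt_one hx

lemma differentiable_poch : Differentiable ℂ (qPochInf p.q) :=
  differentiable_qPochInf h.q_pos h.q_lt_one

lemma pt_ne (i : RqIndex) : (p.pt i : ℂ) ≠ 0 := by
  have := h.z_ne i.1
  have := zpow_ne_zero i.2 h.q_pos.ne'
  exact_mod_cast mul_ne_zero ‹_› ‹_›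

lemma pt_up (i : RqIndex) : p.pt (up i) = p.q * p.pt i := by
  simp only [pt, up, zpow_add_one₀ h.q_pos.ne']; ring

lemma pt_down (i : RqIndex) : p.pt (down i) = p.pt i / p.q := by
  simp only [pt, down, zpow_sub_one₀ h.q_pos.ne']; ring

end IsReg

@[simp] lemma _root_.BigQJacobi.up_down (i : RqIndex) : up (down i) = i := by simp [up, down]

@[simp] lemma _root_.BigQJacobi.down_up (i : RqIndex) : down (up i) = i := by simp [up, down]

lemma IsReg.coeffA_ne (h : p.IsReg) (i : RqIndex) : p.coeffA (p.pt i) ≠ 0 := by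
  have h1 := h.a_pt (down i)
  have h2 := h.b_pt (down i)
  have := h.pt_ne i
  obtain ⟨_, _, _, _, _, _⟩ := h.ne_zero
  rw [h.pt_down] at h1 h2
  push_cast at h1 h2
  refine mul_ne_zero (mul_ne_zero (inv_ne_zero h.s_ne) ?_) ?_
  · intro e; apply h1; field_simp at e ⊢; linear_combination e
  · intro e; apply h2; field_simp at e ⊢; linear_combination e

lemma IsReg.coeffB_ne (h : p.IsReg) (i : RqIndex) : p.coeffB (p.pt i) ≠ 0 := by
  have h1 := h.c_pt i
  have h2 := h.d_pt i
  have := h.pt_ne i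
  obtain ⟨_, _, _, _, _, _⟩ := h.ne_zero
  refine mul_ne_zero (mul_ne_zero h.s_ne ?_) ?_
  · intro e; apply h1; field_simp at e; linear_combination e
  · intro e; apply h2; field_simp at e; linear_combination e

lemma coeffA_dagger (x : ℂ) : p.dagger.coeffA x = p.coeffA x := by
  simp only [coeffA, s_dagger]; simp only [dagger]; ring

lemma coeffB_dagger (x : ℂ) : p.dagger.coeffB x = p.coeffB x := by
  simp only [coeffB, s_dagger]; rfl

lemma L_dagger (f : RqIndex → ℂ) : p.dagger.L f = p.L f := by
  funext i
  simp only [L, coeffC, coeffA_dagger, coeffB_dagger, s_dagger, pt_dagger]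

/-! ### Three-term recurrences -/

lemma exists_recurrence_extension (α β c : ℤ → ℂ) (hα : ∀ n, α n ≠ 0) (y₀ : ℤ → ℂ) (N : ℤ)
    (h : ∀ n ≥ N, α n * y₀ (n - 1) + β n * y₀ (n + 1) + c n * y₀ n = 0) :
    ∃ y : ℤ → ℂ, (∀ n, α n * y (n - 1) + β n * y (n + 1) + c n * y n = 0) ∧
      ∀ n ≥ N - 1, y n = y₀ n := by
  let g : ℕ → ℂ × ℂ := fun k => Nat.rec (y₀ (N - 1), y₀ N) (fun k u =>
    (-(β (N - 1 - k) * u.2 + c (N - 1 - k) * u.1) / α (N - 1 - k), u.1)) k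
  let y : ℤ → ℂ := fun n => if N - 1 ≤ n then y₀ n else (g (N - 1 - n).toNat).1
  have hy : ∀ n ≥ N - 1, y n = y₀ n := fun n hn => if_pos hn
  have hg : ∀ k : ℕ, y (N - 1 - k) = (g k).1 ∧ y (N - k) = (g k).2 := by
    intro k
    induction k with
    | zero => exact ⟨by simp [y, g], by rw [hy _ (by simp)]; simp [g]⟩
    | succ k ih =>
      refine ⟨?_, ?_⟩
      · have h1 : ¬ N - 1 ≤ N - 1 - ((k + 1 : ℕ) : ℤ) := by push_cast; omega
        have h2 : (N - 1 - (N - 1 - ((k + 1 : ℕ) : ℤ))).toNat = k + 1 := by omega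
        simp only [y, if_neg h1, h2]
      · rw [show N - ((k + 1 : ℕ) : ℤ) = N - 1 - k by push_cast; ring, ih.1]
  refine ⟨y, fun n => ?_, hy⟩
  rcases le_or_gt N n with hn | hn
  · rw [hy n (by omega), hy (n - 1) (by omega), hy (n + 1) (by omega)]; exact h n hn
  · obtain ⟨k, rfl⟩ : ∃ k : ℕ, n = N - 1 - k := ⟨(N - 1 - n).toNat, by omega⟩
    have h1 := hg k
    have h2 := (hg (k + 1)).1
    rw [show N - 1 - (k : ℤ) - 1 = N - 1 - ((k + 1 : ℕ) : ℤ) by push_cast; ring, h2,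
      show N - 1 - (k : ℤ) + 1 = N - k by ring, h1.1, h1.2]
    have := hα (N - 1 - k)
    simp only [g]; field_simp; ring

lemma recurrence_eq_zero (α β c : ℤ → ℂ) (hα : ∀ n, α n ≠ 0) (y : ℤ → ℂ) (N : ℤ)
    (h : ∀ n, α n * y (n - 1) + β n * y (n + 1) + c n * y n = 0) (h0 : ∀ n ≥ N, y n = 0) :
    ∀ n, y n = 0 := by
  have : ∀ k : ℕ, ∀ n ≥ N - k, y n = 0 := by
    intro k
    induction k with
    | zero => simpa using h0
    | succ k ih =>
      intro n hn
      have h1 := h (n + 1)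
      rw [ih (n + 1) (by push_cast at hn; omega), ih (n + 1 + 1) (by push_cast at hn; omega)] at h1
      simpa [hα] using h1
  exact fun n => this (N - n).toNat n (by omega)

/-- Reflection of `exists_recurrence_extension`. -/
lemma exists_recurrence_extension' (α β c : ℤ → ℂ) (hβ : ∀ n, β n ≠ 0) (y₀ : ℤ → ℂ) (N : ℤ)
    (h : ∀ n ≤ N, α n * y₀ (n - 1) + β n * y₀ (n + 1) + c n * y₀ n = 0) :
    ∃ y : ℤ → ℂ, (∀ n, α n * y (n - 1) + β n * y (n + 1) + c n * y n = 0) ∧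
      ∀ n ≤ N + 1, y n = y₀ n := by
  obtain ⟨y, h1, h2⟩ := exists_recurrence_extension (fun n => β (-n)) (fun n => α (-n))
    (fun n => c (-n)) (fun n => hβ _) (fun n => y₀ (-n)) (-N) (fun n hn => by
      have := h (-n) (by omega)
      rw [show -(n - 1) = -n + 1 by ring, show -(n + 1) = -n - 1 by ring]
      linear_combination this)
  refine ⟨fun n => y (-n), fun n => ?_, fun n hn => ?_⟩
  · have := h1 (-n)
    simp only [neg_neg] at this
    beta_reduce
    rw [show -(n - 1) = -n + 1 by ring, show -(n + 1) = -n - 1 by ring]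
    linear_combination this
  · have := h2 (-n) (by omega)
    simpa using this

lemma tsum_eq_zero_of_telescope {f T : ℕ → ℂ} (hf : Summable f) (h : ∀ n, f n = T n - T (n + 1))
    (h0 : T 0 = 0) (hT : Tendsto T atTop (𝓝 0)) : ∑' n, f n = 0 := by
  refine tendsto_nhds_unique hf.hasSum.tendsto_sum_nat ?_
  have : ∀ n, ∑ i ∈ range n, f i = -T n := fun n => by
    rw [sum_congr rfl fun i _ => h i, Finset.sum_range_sub' T, h0, zero_sub]
  simp_rw [this]
  simpa using hT.neg

lemma IsReg.exists_solution (h : p.IsReg) (m : ℂ) (f₀ : RqIndex → ℂ) (N : Bool → ℤ)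
    (hf : ∀ i : RqIndex, N i.1 ≤ i.2 → p.L f₀ i = m * f₀ i) :
    ∃ f : RqIndex → ℂ, (∀ i, p.L f i = m * f i) ∧ ∀ i : RqIndex, N i.1 - 1 ≤ i.2 → f i = f₀ i := by
  have := fun ε => exists_recurrence_extension (fun n => p.coeffA (p.pt (ε, n)))
    (fun n => p.coeffB (p.pt (ε, n))) (fun n => p.coeffC (p.pt (ε, n)) - m)
    (fun n => h.coeffA_ne (ε, n)) (fun n => f₀ (ε, n)) (N ε) (fun n hn => by
      have := hf (ε, n) hn
      simp only [L, up, down] at this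
      linear_combination this)
  choose y h1 h2 using this
  refine ⟨fun i => y i.1 i.2, fun i => ?_, fun i hi => h2 i.1 i.2 hi⟩
  have := h1 i.1 i.2
  simp only [L, up, down]
  linear_combination this

lemma IsReg.solution_unique (h : p.IsReg) {m : ℂ}
    (hf : ∀ n, p.L f (ε, n) = m * f (ε, n)) (hg : ∀ n, p.L g (ε, n) = m * g (ε, n)) {N : ℤ}
    (hfg : ∀ n ≥ N, f (ε, n) = g (ε, n)) (n : ℤ) : f (ε, n) = g (ε, n) := by
  have := recurrence_eq_zero (fun n => p.coeffA (p.pt (ε, n)))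
    (fun n => p.coeffB (p.pt (ε, n))) (fun n => p.coeffC (p.pt (ε, n)) - m)
    (fun n => h.coeffA_ne (ε, n)) (fun n => f (ε, n) - g (ε, n)) N (fun n => by
      have h1 := hf n
      have h2 := hg n
      simp only [L, up, down] at h1 h2
      linear_combination h1 - h2) (fun n hn => sub_eq_zero.2 (hfg n hn)) n
  exact sub_eq_zero.1 this

/-! ### The big `q`-Jacobi functions -/

/-- The coefficients of the series for `φ_γ`. -/
def phiCoeff (p : Params) (γ : ℂ) (n : ℕ) : ℂ :=
  qPoch p.q (p.s * γ) n * qPoch p.q (p.s / γ) n /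
    (qPoch p.q p.q n * qPoch p.q (p.c * p.q / p.a) n * qPoch p.q (p.d * p.q / p.a) n)

/-- The polynomials `(q/ax; q)_n (bx)^n`. -/
def phiPoly (p : Params) (n : ℕ) (x : ℂ) : ℂ :=
  ∏ j ∈ range n, (p.b * x - p.b / p.a * p.q ^ (j + 1))

/-- The series for `φ_γ`, as a function that is analytic near `0`. -/
def phiFun (p : Params) (γ x : ℂ) : ℂ := ∑' n, p.phiCoeff γ n * p.phiPoly n x

lemma phiPoly_eq (h : p.IsReg) {x : ℂ} (hx : x ≠ 0) (n : ℕ) :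
    qPoch p.q (p.q / (p.a * x)) n * (p.b * x) ^ n = p.phiPoly n x := by
  have := h.a_ne
  rw [phiPoly, qPoch, ← card_range n, ← prod_const, card_range, ← Finset.prod_mul_distrib]
  refine prod_congr rfl fun j _ => ?_
  field_simp
  ring

lemma phiSeries_eq (h : p.IsReg) (γ : ℂ) {x : ℂ} (hx : x ≠ 0) :
    p.phiSeries γ x = p.phiFun γ x := by
  rw [phiSeries, phi32, phiFun]
  refine tsum_congr fun n => ?_
  rw [← phiPoly_eq h hx, phiCoeff]
  ring

lemma phiPoly_succ (n : ℕ) (x : ℂ) :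
    p.phiPoly (n + 1) x = p.phiPoly n x * (p.b * x - p.b / p.a * p.q ^ (n + 1)) :=
  Finset.prod_range_succ _ _

lemma phiPoly_mul_q (h : p.IsReg) (n : ℕ) (x : ℂ) :
    p.phiPoly (n + 1) (p.q * x) = (p.q : ℂ) ^ (n + 1) * (p.b * x - p.b / p.a) * p.phiPoly n x := by
  have := h.q_ne
  induction n with
  | zero => simp [phiPoly]; ring
  | succ n ih => rw [phiPoly_succ, ih, phiPoly_succ]; ring

lemma phiPoly_div_q (h : p.IsReg) (n : ℕ) (x : ℂ) :
    (p.b * x - p.b / p.a * p.q) * p.phiPoly n (x / p.q) =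
      ((p.q : ℂ) ^ n)⁻¹ * p.phiPoly (n + 1) x := by
  have := h.q_ne
  induction n with
  | zero => simp [phiPoly]
  | succ n ih =>
    have := h.a_ne
    rw [phiPoly_succ, ← mul_assoc, ih, phiPoly_succ (n + 1)]; field_simp; ring

lemma norm_phiPoly_le (h : p.IsReg) {ρ : ℝ} (hρ : 0 < ρ) (x : ℂ) (hx : ‖p.b * x‖ ≤ ρ) (n : ℕ) :
    ‖p.phiPoly n x‖ ≤ ρ ^ n * Real.exp (‖p.b / p.a * p.q‖ / ρ / (1 - p.q)) := by
  have h0 := h.q_pos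
  have e : ρ ^ n * ∏ j ∈ range n, (1 + ‖p.b / p.a * p.q‖ / ρ * p.q ^ j) =
      ∏ j ∈ range n, (ρ + ‖p.b / p.a * p.q‖ * p.q ^ j) := by
    rw [← card_range n, ← prod_const, card_range, ← Finset.prod_mul_distrib]
    refine prod_congr rfl fun j _ => ?_
    field_simp
  have h2 := norm_qPoch_le h.q_pos h.q_lt_one (-((‖p.b / p.a * p.q‖ / ρ : ℝ) : ℂ)) n
  have e2 : qPoch p.q (-((‖p.b / p.a * p.q‖ / ρ : ℝ) : ℂ)) n =
      ((∏ j ∈ range n, (1 + ‖p.b / p.a * p.q‖ / ρ * p.q ^ j) : ℝ) : ℂ) := by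
    rw [qPoch, Complex.ofReal_prod]
    refine prod_congr rfl fun j _ => ?_
    push_cast; ring
  rw [e2, norm_neg, norm_real, norm_of_nonneg (by positivity),
    Real.norm_of_nonneg (by positivity)] at h2
  calc ‖p.phiPoly n x‖ ≤ ∏ j ∈ range n, (ρ + ‖p.b / p.a * p.q‖ * p.q ^ j) := by
        rw [phiPoly, norm_prod]
        refine Finset.prod_le_prod (fun _ _ => norm_nonneg _) fun j _ => ?_
        refine (norm_sub_le _ _).trans (add_le_add hx (le_of_eq ?_))
        rw [pow_succ', ← mul_assoc, norm_mul, norm_pow, norm_of_nonneg h0.le]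
    _ = _ := e.symm
    _ ≤ _ := mul_le_mul_of_nonneg_left h2 (by positivity)

namespace IsReg
variable (h : p.IsReg)
include h

lemma div_a_ne {x : ℂ} (hx : ∀ n : ℤ, x / p.a ≠ (p.q : ℂ) ^ n) (k : ℕ) :
    x * p.q / p.a * p.q ^ k ≠ 1 := by
  have := h.q_ne
  have := h.a_ne
  refine fun e => hx (-(k + 1 : ℕ)) ?_
  rw [zpow_neg, zpow_natCast, pow_succ]
  field_simp at e ⊢
  linear_combination e

lemma ca_ne (k : ℕ) : p.c * p.q / p.a * p.q ^ k ≠ 1 := h.div_a_ne h.ca k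

lemma da_ne (k : ℕ) : p.d * p.q / p.a * p.q ^ k ≠ 1 := h.div_a_ne h.da k

lemma exists_phiCoeff_le (R : ℝ) :
    ∃ M > 0, ∀ γ : ℂ, ‖p.s * γ‖ ≤ R → ‖p.s / γ‖ ≤ R → ∀ n, ‖p.phiCoeff γ n‖ ≤ M := by
  obtain ⟨c₁, hc₁, h₁⟩ := exists_norm_qPoch_q_ge h.q_pos h.q_lt_one
  obtain ⟨c₂, hc₂, h₂⟩ := exists_norm_qPoch_ge h.q_pos h.q_lt_one h.ca_ne
  obtain ⟨c₃, hc₃, h₃⟩ := exists_norm_qPoch_ge h.q_pos h.q_lt_one h.da_ne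
  have hq : 0 < 1 - p.q := sub_pos.2 h.q_lt_one
  refine ⟨Real.exp (R / (1 - p.q)) * Real.exp (R / (1 - p.q)) / (c₁ * c₂ * c₃), by positivity,
    fun γ h4 h5 n => ?_⟩
  rw [phiCoeff, norm_div, norm_mul, norm_mul, norm_mul]
  gcongr
  · exact (norm_qPoch_le h.q_pos h.q_lt_one _ _).trans (by gcongr)
  · exact (norm_qPoch_le h.q_pos h.q_lt_one _ _).trans (by gcongr)
  · exact h₁ n
  · exact h₂ n
  · exact h₃ n

lemma phiTerm_le (R : ℝ) {ρ : ℝ} (hρ : 0 < ρ) :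
    ∃ M > 0, ∀ γ : ℂ, ‖p.s * γ‖ ≤ R → ‖p.s / γ‖ ≤ R → ∀ x : ℂ, ‖p.b * x‖ ≤ ρ →
      ∀ n, ‖p.phiCoeff γ n * p.phiPoly n x‖ ≤ M * ρ ^ n := by
  obtain ⟨M, hM, hM'⟩ := h.exists_phiCoeff_le R
  refine ⟨M * Real.exp (‖p.b / p.a * p.q‖ / ρ / (1 - p.q)), by positivity, fun γ h1 h2 x hx n => ?_⟩
  rw [norm_mul]
  calc _ ≤ M * (ρ ^ n * Real.exp (‖p.b / p.a * p.q‖ / ρ / (1 - p.q))) :=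
        mul_le_mul (hM' γ h1 h2 n) (norm_phiPoly_le h hρ x hx n) (norm_nonneg _) hM.le
    _ = _ := by ring

lemma summable_phiFun (γ : ℂ) {x : ℂ} (hx : ‖p.b * x‖ < 1) :
    Summable fun n => p.phiCoeff γ n * p.phiPoly n x := by
  obtain ⟨ρ, h1, h2⟩ := exists_between hx
  have hρ := (norm_nonneg _).trans_lt h1
  obtain ⟨M, -, hM⟩ := h.phiTerm_le (max ‖p.s * γ‖ ‖p.s / γ‖) hρ
  exact Summable.of_norm_bounded ((summable_geometric_of_lt_one hρ.le h2).mul_left M)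
    (hM γ (le_max_left _ _) (le_max_right _ _) x h1.le)

lemma d_eq : p.d = p.s ^ 2 * (p.a * p.b) / (p.c * p.q) := by
  have := h.c_ne
  have := h.q_ne
  rw [h.s_sq]; field_simp

/-- The action of `L` on the polynomials `(q/ax; q)_n (bx)^n`. -/
lemma L_phiPoly {x : ℂ} (hx : x ≠ 0) (n : ℕ) :
    p.coeffA x * p.phiPoly (n + 1) (x / p.q) + p.coeffB x * p.phiPoly (n + 1) (p.q * x) +
      p.coeffC x * p.phiPoly (n + 1) x =
    (p.s * p.q ^ (n + 1) + (p.s * p.q ^ (n + 1))⁻¹) * p.phiPoly (n + 1) x -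
      (p.s * p.q ^ n)⁻¹ * (1 - p.q * p.q ^ n) *
      (1 - p.c * p.q / p.a * p.q ^ n) * (1 - p.d * p.q / p.a * p.q ^ n) * p.phiPoly n x := by
  obtain ⟨ha, hb, hc, hd, hs, hq⟩ := h.ne_zero
  have hqn : (p.q : ℂ) ^ n ≠ 0 := pow_ne_zero _ hq
  have hA : p.coeffA x * p.phiPoly (n + 1) (x / p.q) =
      p.s⁻¹ * (1 - p.q / (p.b * x)) / (p.b * x) *
        (((p.q : ℂ) ^ (n + 1))⁻¹ * p.phiPoly (n + 2) x) := by
    rw [← phiPoly_div_q h, coeffA]; field_simp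
  rw [hA, phiPoly_mul_q h, phiPoly_succ (n + 1), phiPoly_succ n, coeffC, coeffA, coeffB]
  have e1 : 1 / (p.d * x) = p.c * p.q / (p.s ^ 2 * (p.a * p.b) * x) := by rw [h.s_sq]; field_simp
  have e2 : p.d * p.q / p.a = p.s ^ 2 * p.b / p.c := by
    rw [div_eq_div_iff ha hc]; linear_combination -h.s_sq
  rw [e1, e2]
  simp only [pow_succ]
  generalize p.phiPoly n x = P, (p.q : ℂ) ^ n = N at *
  field_simp
  ring

lemma phiCoeff_succ (hγ : γ ≠ 0) (n : ℕ) :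
    p.phiCoeff γ (n + 1) * ((p.s * (p.q : ℂ) ^ n)⁻¹ * (1 - (p.q : ℂ) * (p.q : ℂ) ^ n) *
      (1 - p.c * p.q / p.a * (p.q : ℂ) ^ n) * (1 - p.d * p.q / p.a * (p.q : ℂ) ^ n)) =
    -(mu γ - (p.s * (p.q : ℂ) ^ n + (p.s * (p.q : ℂ) ^ n)⁻¹)) * p.phiCoeff γ n := by
  have hs := h.s_ne
  have hqn : (p.q : ℂ) ^ n ≠ 0 := pow_ne_zero _ h.q_ne
  have n1 := qPoch_q_ne_zero h.q_pos h.q_lt_one n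
  have n2 := qPoch_ne_zero h.ca_ne n
  have n3 := qPoch_ne_zero h.da_ne n
  have n4 : 1 - p.c * p.q / p.a * (p.q : ℂ) ^ n ≠ 0 := sub_ne_zero.2 (h.ca_ne n).symm
  have n5 : 1 - p.d * p.q / p.a * (p.q : ℂ) ^ n ≠ 0 := sub_ne_zero.2 (h.da_ne n).symm
  have n6 : 1 - (p.q : ℂ) * (p.q : ℂ) ^ n ≠ 0 := sub_ne_zero.2 (mul_qpow_ne_one h.q_pos h.q_lt_one
    (by rw [norm_of_nonneg h.q_pos.le]; exact h.q_lt_one) n).symm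
  simp only [phiCoeff, qPoch_succ, mu]
  generalize qPoch p.q (p.c * p.q / p.a) n = C, qPoch p.q (p.d * p.q / p.a) n = D at *
  generalize 1 - p.c * p.q / p.a * (p.q : ℂ) ^ n = U, 1 - p.d * p.q / p.a * (p.q : ℂ) ^ n = V,
    qPoch p.q p.q n = Q, 1 - (p.q : ℂ) * (p.q : ℂ) ^ n = W at *
  generalize (p.q : ℂ) ^ n = N at *
  field_simp
  ring

/-- The series for `φ_γ` solves the eigenvalue equation near `0`. -/
lemma L_phiFun (hγ : γ ≠ 0) {x : ℂ} (hx : x ≠ 0)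
    (hx' : ‖p.b * x‖ < p.q) :
    p.coeffA x * p.phiFun γ (x / p.q) + p.coeffB x * p.phiFun γ (p.q * x) +
      p.coeffC x * p.phiFun γ x = mu γ * p.phiFun γ x := by
  have hq0 := h.q_pos
  have hq := h.q_ne
  have x1 : ‖p.b * (x / p.q)‖ < 1 := by
    rw [← mul_div_assoc, norm_div, norm_of_nonneg hq0.le, div_lt_one hq0]; exact hx'
  have x2 : ‖p.b * (p.q * x)‖ < 1 := by
    rw [mul_left_comm, norm_mul, norm_of_nonneg hq0.le]
    nlinarith [h.q_lt_one, norm_nonneg (p.b * x)]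
  have s1 := (h.summable_phiFun γ x1).mul_left (p.coeffA x)
  have s2 := (h.summable_phiFun γ x2).mul_left (p.coeffB x)
  have s3 := (h.summable_phiFun γ (hx'.trans h.q_lt_one)).mul_left (p.coeffC x - mu γ)
  set T : ℕ → ℂ := fun n => match n with
    | 0 => 0
    | n + 1 => (mu γ - (p.s * p.q ^ n + (p.s * p.q ^ n)⁻¹)) *
        (p.phiCoeff γ n * p.phiPoly n x) with hT
  have key : ∀ n, p.coeffA x * (p.phiCoeff γ n * p.phiPoly n (x / p.q)) +
      p.coeffB x * (p.phiCoeff γ n * p.phiPoly n (p.q * x)) +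
      (p.coeffC x - mu γ) * (p.phiCoeff γ n * p.phiPoly n x) = T n - T (n + 1) := by
    intro n
    cases n with
    | zero => simp [hT, phiPoly, coeffC]; ring
    | succ n =>
      have h1 := h.L_phiPoly hx n
      have h2 := h.phiCoeff_succ hγ n
      simp only [hT]
      linear_combination p.phiCoeff γ (n + 1) * h1 - p.phiPoly n x * h2
  have hlim : Tendsto T atTop (𝓝 0) := by
    rw [← tendsto_add_atTop_iff_nat 1]
    simp only [hT]
    obtain ⟨ρ, r1, r2⟩ := exists_between hx'
    have hρ := (norm_nonneg _).trans_lt r1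
    obtain ⟨M, hM0, hM⟩ := h.phiTerm_le (max ‖p.s * γ‖ ‖p.s / γ‖) hρ
    refine squeeze_zero_norm
      (a := fun n => (‖mu γ‖ + ‖p.s‖ + ‖p.s⁻¹‖) * M * (ρ / p.q) ^ n) (fun n => ?_) ?_
    · rw [norm_mul]
      have b1 := hM γ (le_max_left _ _) (le_max_right _ _) x r1.le n
      have hqn : 0 < p.q ^ n := pow_pos hq0 n
      have hqn1 : p.q ^ n ≤ 1 := pow_le_one₀ hq0.le h.q_lt_one.le
      have b2 : ‖mu γ - (p.s * p.q ^ n + (p.s * p.q ^ n)⁻¹)‖ ≤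
          (‖mu γ‖ + ‖p.s‖ + ‖p.s⁻¹‖) * (p.q ^ n)⁻¹ := by
        have c1 : ‖p.s * p.q ^ n‖ = ‖p.s‖ * p.q ^ n := by
          rw [norm_mul, norm_pow, norm_of_nonneg hq0.le]
        have c2 : ‖(p.s * p.q ^ n)⁻¹‖ = ‖p.s⁻¹‖ * (p.q ^ n)⁻¹ := by
          rw [norm_inv, c1, mul_inv, norm_inv]
        have c3 : 1 ≤ (p.q ^ n)⁻¹ := (one_le_inv₀ hqn).2 hqn1
        refine (norm_sub_le _ _).trans ((add_le_add le_rfl (norm_add_le _ _)).trans ?_)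
        rw [c1, c2]
        nlinarith [norm_nonneg (mu γ), norm_nonneg p.s]
      calc _ ≤ (‖mu γ‖ + ‖p.s‖ + ‖p.s⁻¹‖) * (p.q ^ n)⁻¹ * (M * ρ ^ n) :=
            mul_le_mul b2 b1 (norm_nonneg _) (by positivity)
        _ = _ := by rw [div_pow]; field_simp
    · simpa using (tendsto_pow_atTop_nhds_zero_of_lt_one (by positivity)
        ((div_lt_one hq0).2 r2)).const_mul ((‖mu γ‖ + ‖p.s‖ + ‖p.s⁻¹‖) * M)
  have := tsum_eq_zero_of_telescope ((s1.add s2).add s3) key rfl hlim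
  rw [(s1.add s2).tsum_add s3, s1.tsum_add s2, tsum_mul_left, tsum_mul_left, tsum_mul_left] at this
  simp only [phiFun]
  linear_combination this

/-- The threshold index below which points are small. -/
lemma exists_threshold (ε : Bool) {r : ℝ} (hr : 0 < r) :
    ∃ N : ℤ, ∀ n : ℤ, |p.pt (ε, n)| < r ↔ N ≤ n := by
  have hz := abs_pos.2 (h.z_ne ε)
  have hpt : ∀ n : ℤ, |p.pt (ε, n)| = |p.z ε| * p.q ^ n := fun n => by
    rw [pt, abs_mul, abs_of_pos (zpow_pos h.q_pos n)]
  have hanti : ∀ {m n : ℤ}, m ≤ n → |p.pt (ε, n)| ≤ |p.pt (ε, m)| := fun {m n} hmn => by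
    rw [hpt, hpt]
    exact mul_le_mul_of_nonneg_left (zpow_le_zpow_right_of_le_one₀ h.q_pos h.q_lt_one.le hmn) hz.le
  have ex1 : ∃ n : ℤ, |p.pt (ε, n)| < r := by
    obtain ⟨n, hn⟩ := exists_pow_lt_of_lt_one (div_pos hr hz) h.q_lt_one
    exact ⟨n, by rw [hpt, zpow_natCast, mul_comm]; exact (lt_div_iff₀ hz).1 hn⟩
  have ex2 : ∃ b : ℤ, ∀ n : ℤ, |p.pt (ε, n)| < r → b ≤ n := by
    obtain ⟨n, hn⟩ := exists_pow_lt_of_lt_one (div_pos hz hr) h.q_lt_one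
    refine ⟨-n, fun m hm => ?_⟩
    by_contra hlt
    have h1 := (hanti (not_le.1 hlt).le).trans_lt hm
    rw [hpt, zpow_neg, zpow_natCast] at h1
    rw [lt_div_iff₀ hr] at hn
    have := pow_pos h.q_pos n
    rw [mul_inv_lt_iff₀ this] at h1; linarith
  obtain ⟨b, hb⟩ := ex2
  obtain ⟨N, hN, hN'⟩ := Int.exists_least_of_bdd ⟨b, hb⟩ ex1
  exact ⟨N, fun n => ⟨hN' n, fun hn => (hanti hn).trans_lt hN⟩⟩

end IsReg

lemma norm_mul_pt_lt {b : ℂ} (hb : b ≠ 0) (i : RqIndex) (r : ℝ) :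
    ‖b * p.pt i‖ < r ↔ |p.pt i| < r / ‖b‖ := by
  rw [norm_mul, norm_real, norm_eq_abs, lt_div_iff₀ (norm_pos_iff.2 hb), mul_comm]

lemma IsReg.phi_spec (h : p.IsReg) (hγ : γ ≠ 0) :
    (∀ i, p.L (p.phi γ) i = mu γ * p.phi γ i) ∧
      ∀ i, |p.pt i| < 1 / ‖p.b‖ → p.phi γ i = p.phiSeries γ (p.pt i) := by
  have hb := norm_pos_iff.2 h.b_ne
  choose N hN using fun ε => h.exists_threshold ε (r := 1 / ‖p.b‖) (by positivity)
  have hsol : ∀ i : RqIndex, N i.1 + 1 ≤ i.2 →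
      p.L (fun i => p.phiFun γ (p.pt i)) i = mu γ * p.phiFun γ (p.pt i) := by
    intro i hi
    have h1 : |p.pt (down i)| < 1 / ‖p.b‖ := (hN i.1 (i.2 - 1)).2 (by omega)
    have h2 : ‖p.b * p.pt i‖ < p.q := by
      rw [← norm_mul_pt_lt h.b_ne, h.pt_down] at h1
      push_cast at h1
      rwa [← mul_div_assoc, norm_div, norm_real p.q, Real.norm_of_nonneg h.q_pos.le,
        div_lt_one h.q_pos] at h1
    have := h.L_phiFun hγ (h.pt_ne i) h2
    simp only [L]
    rw [h.pt_down, h.pt_up]; push_cast; exact this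
  obtain ⟨f, hf1, hf2⟩ := h.exists_solution (mu γ) _ (fun ε => N ε + 1) hsol
  exact Classical.epsilon_spec (p := fun f : RqIndex → ℂ =>
    (∀ i, p.L f i = mu γ * f i) ∧ ∀ i, |p.pt i| < 1 / ‖p.b‖ → f i = p.phiSeries γ (p.pt i))
    ⟨f, hf1, fun i hi => by
      rw [phiSeries_eq h γ (h.pt_ne i)]
      exact hf2 i (by have := (hN i.1 i.2).1 hi; omega)⟩

lemma IsReg.L_phi (h : p.IsReg) (hγ : γ ≠ 0) (i : RqIndex) :
    p.L (p.phi γ) i = mu γ * p.phi γ i := (h.phi_spec hγ).1 i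

lemma IsReg.phi_eq (h : p.IsReg) (hγ : γ ≠ 0) {i : RqIndex}
    (hi : ‖p.b * p.pt i‖ < 1) : p.phi γ i = p.phiFun γ (p.pt i) := by
  rw [(h.phi_spec hγ).2 i ((norm_mul_pt_lt h.b_ne i 1).1 hi), phiSeries_eq h γ (h.pt_ne i)]

lemma phi_inv (γ : ℂ) : p.phi γ⁻¹ = p.phi γ := by
  have e1 : mu γ⁻¹ = mu γ := by simp [mu, add_comm]
  have e2 : ∀ x, p.phiSeries γ⁻¹ x = p.phiSeries γ x := fun x => by
    simp only [phiSeries, phi32, div_inv_eq_mul, ← div_eq_mul_inv]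
    refine tsum_congr fun k => ?_
    ring
  simp only [phi, e1, e2]

/-! ### The behaviour of `φ_γ` at infinity for large `|γ|` -/

/-- The terms of the series for `(bx; q)_∞ φ_γ(x)`. -/
def entireTerm (p : Params) (γ : ℂ) (n : ℕ) (x : ℂ) : ℂ :=
  phi21Term p.q (p.s * γ) (p.c * p.q * γ / (p.a * p.s)) (p.c * p.q / p.a)
      (p.d * p.q / (p.a * p.s * γ)) n *
    (qPoch p.q (p.c * x) n * qPochInf p.q (p.b * p.s * γ * x * p.q ^ n))

/-- The entire function `(bx; q)_∞ φ_γ(x)`, up to a constant factor. -/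
def entireFun (p : Params) (γ x : ℂ) : ℂ := ∑' n, p.entireTerm γ n x

namespace IsReg
variable (h : p.IsReg)
include h

lemma entireTerm_le (γ : ℂ) :
    ∃ M > 0, ∀ n x, ‖p.entireTerm γ n x‖ ≤ M * ‖p.d * p.q / (p.a * p.s * γ)‖ ^ n *
      ‖qPoch p.q (p.c * x) n * qPochInf p.q (p.b * p.s * γ * x * p.q ^ n)‖ := by
  obtain ⟨M, hM0, hM⟩ := exists_phi21Term_le h.q_pos h.q_lt_one (p.s * γ)
    (p.c * p.q * γ / (p.a * p.s)) h.ca_ne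
  refine ⟨M, hM0, fun n x => ?_⟩
  rw [entireTerm, norm_mul]
  refine mul_le_mul_of_nonneg_right ?_ (norm_nonneg _)
  simpa using hM 0 (p.d * p.q / (p.a * p.s * γ)) n

lemma exists_entireTerm_le (γ : ℂ) (R : ℝ) :
    ∃ M > 0, ∀ n x, ‖x‖ ≤ R → ‖p.entireTerm γ n x‖ ≤ M * ‖p.d * p.q / (p.a * p.s * γ)‖ ^ n := by
  obtain ⟨M, hM0, hM⟩ := h.entireTerm_le γ
  have hq : 0 < 1 - p.q := sub_pos.2 h.q_lt_one
  refine ⟨M * (Real.exp (‖p.c‖ * R / (1 - p.q)) * Real.exp (‖p.b * p.s * γ‖ * R / (1 - p.q))),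
    by positivity, fun n x hx => (hM n x).trans ?_⟩
  have e1 : ‖p.c * x‖ ≤ ‖p.c‖ * R := by rw [norm_mul]; gcongr
  have e2 : ‖p.b * p.s * γ * x * p.q ^ n‖ ≤ ‖p.b * p.s * γ‖ * R := by
    rw [norm_mul, norm_mul _ x, norm_pow, norm_of_nonneg h.q_pos.le]
    calc _ ≤ ‖p.b * p.s * γ‖ * ‖x‖ * 1 := by
          gcongr; exact pow_le_one₀ h.q_pos.le h.q_lt_one.le
      _ ≤ _ := by rw [mul_one]; gcongr
  have : ‖qPoch p.q (p.c * x) n * qPochInf p.q (p.b * p.s * γ * x * p.q ^ n)‖ ≤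
      Real.exp (‖p.c‖ * R / (1 - p.q)) * Real.exp (‖p.b * p.s * γ‖ * R / (1 - p.q)) := by
    rw [norm_mul]; gcongr
    · exact (norm_qPoch_le h.q_pos h.q_lt_one _ _).trans (by gcongr)
    · exact (norm_qPochInf_le h.q_pos h.q_lt_one _).trans (by gcongr)
  calc _ ≤ M * ‖p.d * p.q / (p.a * p.s * γ)‖ ^ n * _ :=
        mul_le_mul_of_nonneg_left this (by positivity)
    _ = _ := by ring

lemma differentiable_entireFun
    (hr : ‖p.d * p.q / (p.a * p.s * γ)‖ < 1) : Differentiable ℂ (p.entireFun γ) := by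
  intro x
  obtain ⟨M, -, hM⟩ := h.exists_entireTerm_le γ (‖x‖ + 1)
  have hd : ∀ n, Differentiable ℂ (p.entireTerm γ n) := fun n => by
    unfold entireTerm
    have h1 := (differentiable_qPoch (q := p.q) n).comp
      (show Differentiable ℂ fun x : ℂ => p.c * x by fun_prop)
    have h2 := h.differentiable_poch.comp
      (show Differentiable ℂ fun x : ℂ => p.b * p.s * γ * x * p.q ^ n by fun_prop)
    exact (h1.mul h2).const_mul _
  refine (Complex.differentiableOn_tsum_of_summable_norm
    ((summable_geometric_of_lt_one (norm_nonneg _) hr).mul_left M)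
    (fun n => (hd n).differentiableOn) (isOpen_ball (x := (0 : ℂ)) (ε := ‖x‖ + 1))
    fun n y hy => hM n y (by simpa using (Metric.mem_ball.1 hy).le)).differentiableAt
    (isOpen_ball.mem_nhds (by simp))

lemma entireFun_eq (hγ : γ ≠ 0)
    (hr : ‖p.d * p.q / (p.a * p.s * γ)‖ < 1) {x : ℂ} (hx : x ≠ 0) (hbx : ‖p.b * x‖ < 1)
    (hx' : ‖p.b * p.s * γ * x‖ < 1) :
    qPochInf p.q (p.d * p.q / p.a) * qPochInf p.q (p.b * x) * p.phiFun γ x =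
      qPochInf p.q (p.d * p.q / (p.a * p.s * γ)) * p.entireFun γ x := by
  obtain ⟨ha, hb, hc, _, hs, hq⟩ := h.ne_zero
  have e1 : p.c * x * γ / p.s * (p.q / (p.a * x)) * (p.s / γ) = p.c * p.q / p.a := by field_simp
  have e2 : p.d * p.q / (p.a * p.s * γ) * (p.s * γ) = p.d * p.q / p.a := by field_simp
  have e3 : p.c * x * γ / p.s * (p.d * p.q / (p.a * p.s * γ)) = p.b * x := by
    rw [h.d_eq]; field_simp
  have e5 : p.b * x * (p.s * γ) = p.b * p.s * γ * x := by ring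
  have key := phi32_transform h.q_pos h.q_lt_one (a := p.s * γ) (b := p.q / (p.a * x))
    (c := p.s / γ) (e := p.c * x * γ / p.s) (r := p.d * p.q / (p.a * p.s * γ)) hr
    (by rw [e3]; exact hbx) (fun k => by rw [e1]; exact h.ca_ne k)
    (fun k => by rw [e2]; exact h.da_ne k)
    (fun k => by rw [e3, e5]; exact mul_qpow_ne_one h.q_pos h.q_lt_one hx' k)
  rw [e1, e2, e3, e5] at key
  have e6 : phi32 p.q (p.s * γ) (p.q / (p.a * x)) (p.s / γ) (p.c * p.q / p.a) (p.d * p.q / p.a)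
      (p.b * x) = p.phiFun γ x := by
    rw [← phiSeries_eq h γ hx, phiSeries, phi32, phi32]
    exact tsum_congr fun n => by ring
  rw [e6] at key
  rw [key, mul_assoc, entireFun, phi32, ← tsum_mul_left]
  congr 1
  refine tsum_congr fun n => ?_
  have e7 : p.c * x * γ / p.s * (p.s / γ) = p.c * x := by field_simp
  have e8 : p.c * x * γ / p.s * (p.q / (p.a * x)) = p.c * p.q * γ / (p.a * p.s) := by field_simp
  have n1 := qPoch_ne_zero (fun k => mul_qpow_ne_one h.q_pos h.q_lt_one hx' k) n
  have n2 := qPoch_ne_zero h.ca_ne n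
  have n3 := qPoch_q_ne_zero h.q_pos h.q_lt_one n
  rw [e7, e8, entireTerm, phi21Term, qPochInf_eq_mul h.q_pos h.q_lt_one (p.b * p.s * γ * x) n]
  field_simp

end IsReg

lemma eventually_norm_mul_lt (b : ℂ) {r : ℝ} (hr : 0 < r) : ∀ᶠ x : ℂ in 𝓝 0, ‖b * x‖ < r := by
  have : Continuous fun x : ℂ => ‖b * x‖ := by fun_prop
  exact (this.tendsto 0).eventually_lt_const (by simpa using hr)

lemma IsReg.L_entireFun (h : p.IsReg) (hγ : γ ≠ 0)
    (hr : ‖p.d * p.q / (p.a * p.s * γ)‖ < 1) (x : ℂ) :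
    p.s⁻¹ * (x - p.q / p.a) * (-(p.q / p.b)) * p.entireFun γ (x / p.q) +
      p.s * (x - 1 / p.c) * (x - 1 / p.d) * (1 - p.b * x) * p.entireFun γ (p.q * x) +
      ((p.s⁻¹ + p.s - mu γ) * x ^ 2 - p.s⁻¹ * (x - p.q / p.a) * (x - p.q / p.b) -
        p.s * (x - 1 / p.c) * (x - 1 / p.d)) * p.entireFun γ x = 0 := by
  obtain ⟨ha, hb, hc, hd, hs, hq⟩ := h.ne_zero
  have hU := h.differentiable_entireFun hr
  set E : ℂ → ℂ := fun x =>
    p.s⁻¹ * (x - p.q / p.a) * (-(p.q / p.b)) * p.entireFun γ (x / p.q) +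
      p.s * (x - 1 / p.c) * (x - 1 / p.d) * (1 - p.b * x) * p.entireFun γ (p.q * x) +
      ((p.s⁻¹ + p.s - mu γ) * x ^ 2 - p.s⁻¹ * (x - p.q / p.a) * (x - p.q / p.b) -
        p.s * (x - 1 / p.c) * (x - 1 / p.d)) * p.entireFun γ x with hE
  have hEd : Differentiable ℂ E := by
    have d1 : Differentiable ℂ fun x => p.entireFun γ (x / p.q) :=
      hU.comp (show Differentiable ℂ fun x : ℂ => x / p.q by fun_prop)
    have d2 : Differentiable ℂ fun x => p.entireFun γ (p.q * x) :=
      hU.comp (show Differentiable ℂ fun x : ℂ => p.q * x by fun_prop)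
    rw [hE]
    fun_prop
  have hP : qPochInf p.q (p.d * p.q / (p.a * p.s * γ)) ≠ 0 :=
    h.poch_ne fun k => mul_qpow_ne_one h.q_pos h.q_lt_one hr k
  have hev : ∀ᶠ x in 𝓝[≠] (0 : ℂ), E x = 0 := by
    have a1 := (eventually_norm_mul_lt p.b h.q_pos).filter_mono (nhdsWithin_le_nhds (s := {0}ᶜ))
    have a2 := (eventually_norm_mul_lt (p.b * p.s * γ) h.q_pos).filter_mono
      (nhdsWithin_le_nhds (s := {0}ᶜ))
    filter_upwards [a1, a2, self_mem_nhdsWithin] with x b1 b2 hx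
    have hx : x ≠ 0 := hx
    have hdiv : ∀ y : ℂ, ‖y * x‖ < p.q → ‖y * (x / p.q)‖ < 1 := fun y hy => by
      rw [← mul_div_assoc, norm_div, norm_of_nonneg h.q_pos.le, div_lt_one h.q_pos]; exact hy
    have hmul : ∀ y : ℂ, ‖y * x‖ < p.q → ‖y * (p.q * x)‖ < 1 := fun y hy => by
      rw [mul_left_comm, norm_mul, norm_of_nonneg h.q_pos.le]
      nlinarith [h.q_lt_one, norm_nonneg (y * x), h.q_pos]
    have c1 := h.entireFun_eq hγ hr hx (b1.trans h.q_lt_one) (b2.trans h.q_lt_one)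
    have c2 := h.entireFun_eq hγ hr (div_ne_zero hx hq) (hdiv _ b1) (hdiv _ b2)
    have c3 := h.entireFun_eq hγ hr (mul_ne_zero hq hx) (hmul _ b1) (hmul _ b2)
    have c4 := h.L_phiFun hγ hx b1
    have s1 := qPochInf_step h.q_pos h.q_lt_one (p.b * (x / p.q))
    have s2 := qPochInf_step h.q_pos h.q_lt_one (p.b * x)
    rw [show p.b * (x / p.q) * p.q = p.b * x by field_simp] at s1
    rw [show p.b * x * p.q = p.b * (p.q * x) by ring] at s2
    rw [s1] at c2
    refine (mul_eq_zero.1 ?_).resolve_left hP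
    have i1 : x ^ 2 * p.coeffA x = p.s⁻¹ * (x - p.q / p.a) * (x - p.q / p.b) := by
      rw [coeffA]; field_simp
    have i2 : x ^ 2 * p.coeffB x = p.s * (x - 1 / p.c) * (x - 1 / p.d) := by rw [coeffB]; field_simp
    have i3 : x ^ 2 * p.coeffC x = (p.s⁻¹ + p.s) * x ^ 2 -
        p.s⁻¹ * (x - p.q / p.a) * (x - p.q / p.b) - p.s * (x - 1 / p.c) * (x - 1 / p.d) := by
      rw [coeffC, ← i1, ← i2]; ring
    have i4 : (x - p.q / p.b) = (1 - p.b * (x / p.q)) * (-(p.q / p.b)) := by field_simp; ring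
    rw [hE]
    linear_combination (-(p.s⁻¹ * (x - p.q / p.a) * (-(p.q / p.b)))) * c2 -
      p.s * (x - 1 / p.c) * (x - 1 / p.d) * (1 - p.b * x) * c3 -
      ((p.s⁻¹ + p.s - mu γ) * x ^ 2 - p.s⁻¹ * (x - p.q / p.a) * (x - p.q / p.b) -
        p.s * (x - 1 / p.c) * (x - 1 / p.d)) * c1 +
      x ^ 2 * qPochInf p.q (p.d * p.q / p.a) * qPochInf p.q (p.b * x) * c4 -
      qPochInf p.q (p.d * p.q / p.a) * qPochInf p.q (p.b * x) *
        (p.phiFun γ (x / p.q) * i1 + p.phiFun γ (p.q * x) * i2 + p.phiFun γ x * i3) -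
      qPochInf p.q (p.d * p.q / p.a) * qPochInf p.q (p.b * x) * p.s⁻¹ * (x - p.q / p.a) *
        p.phiFun γ (x / p.q) * i4 -
      p.s * (x - 1 / p.c) * (x - 1 / p.d) * qPochInf p.q (p.d * p.q / p.a) *
        p.phiFun γ (p.q * x) * s2
  have := (AnalyticOnNhd.eqOn_zero_of_preconnected_of_frequently_eq_zero
    (hEd.differentiableOn.analyticOnNhd isOpen_univ) isPreconnected_univ (Set.mem_univ (0 : ℂ))
    hev.frequently) (Set.mem_univ x)
  exact this

lemma IsReg.b_pt_qpow (h : p.IsReg) (i : RqIndex) (k : ℕ) :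
    p.b * p.pt i * p.q ^ k ≠ 1 := by
  have := h.b_pt (i.1, i.2 + k)
  simp only [pt, zpow_add₀ h.q_pos.ne', zpow_natCast] at this ⊢
  push_cast at this ⊢
  intro e
  exact this (by linear_combination e)

lemma IsReg.phi_eq_entireFun (h : p.IsReg) (hγ : γ ≠ 0)
    (hr : ‖p.d * p.q / (p.a * p.s * γ)‖ < 1) (i : RqIndex) :
    qPochInf p.q (p.d * p.q / p.a) * qPochInf p.q (p.b * p.pt i) * p.phi γ i =
      qPochInf p.q (p.d * p.q / (p.a * p.s * γ)) * p.entireFun γ (p.pt i) := by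
  obtain ⟨ha, hb, hc, hd, hs, hq⟩ := h.ne_zero
  have hP : ∀ i, qPochInf p.q (p.b * p.pt i) ≠ 0 := fun i =>
    h.poch_ne (h.b_pt_qpow i)
  have hQ : qPochInf p.q (p.d * p.q / p.a) ≠ 0 := h.poch_ne h.da_ne
  have key : p.phi γ i = qPochInf p.q (p.d * p.q / (p.a * p.s * γ)) * p.entireFun γ (p.pt i) /
      (qPochInf p.q (p.d * p.q / p.a) * qPochInf p.q (p.b * p.pt i)) := by
    obtain ⟨N, hN⟩ := h.exists_threshold i.1 (r := min (1 / ‖p.b‖) (1 / ‖p.b * p.s * γ‖))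
      (by have := norm_pos_iff.2 h.b_ne
          have : 0 < ‖p.b * p.s * γ‖ := norm_pos_iff.2 (by simp [h.b_ne, h.s_ne, hγ])
          positivity)
    refine h.solution_unique (ε := i.1) (m := mu γ) (f := p.phi γ) (g := fun i =>
      qPochInf p.q (p.d * p.q / (p.a * p.s * γ)) * p.entireFun γ (p.pt i) /
      (qPochInf p.q (p.d * p.q / p.a) * qPochInf p.q (p.b * p.pt i)))
      (fun n => h.L_phi hγ _) (fun n => ?_) (N := N) (fun n hn => ?_) i.2
    · set j : RqIndex := (i.1, n)
      have s1 := qPochInf_step h.q_pos h.q_lt_one (p.b * p.pt (down j))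
      have s2 := qPochInf_step h.q_pos h.q_lt_one (p.b * p.pt j)
      have hx := h.pt_ne j
      have e := h.L_entireFun hγ hr (p.pt j)
      have n1 := hP (down j)
      have n2 := hP j
      have n3 := hP (up j)
      have n4 : p.b * p.pt j ≠ p.q := by
        have := h.b_pt (down j)
        rw [h.pt_down] at this
        push_cast at this
        intro e; apply this; rw [← mul_div_assoc, e, div_self hq]
      simp only [L]
      rw [h.pt_down] at s1 n1 ⊢
      rw [h.pt_up] at n3 ⊢
      push_cast at s1 n1 n3 ⊢
      rw [show p.b * (p.pt j / p.q) * p.q = p.b * p.pt j by field_simp] at s1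
      rw [show p.b * p.pt j * p.q = p.b * (p.q * p.pt j) by ring] at s2
      rw [s1, s2]
      have n5 : 1 - p.b * p.pt j ≠ 0 := sub_ne_zero.2 (h.b_pt j).symm
      have n6 : 1 - p.b * (p.pt j / p.q) ≠ 0 := by intro e; rw [e, zero_mul] at s1; exact n1 s1
      rw [coeffC, coeffA, coeffB]
      generalize p.entireFun γ (p.pt j / p.q) = U1, p.entireFun γ (p.q * p.pt j) = U2 at *
      generalize p.entireFun γ (p.pt j) = U3 at *
      generalize qPochInf p.q (p.b * (p.q * p.pt j)) = Q, qPochInf p.q (p.d * p.q / p.a) = Q1,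
        qPochInf p.q (p.d * p.q / (p.a * p.s * γ)) = Q2 at *
      generalize (p.pt j : ℂ) = x at *
      have i4 : (x - p.q / p.b) = (1 - p.b * (x / p.q)) * (-(p.q / p.b)) := by field_simp; ring
      have i5 : 1 - p.q / (p.b * x) = (1 - p.b * (x / p.q)) * (-(p.q / p.b)) / x := by
        rw [← i4]; field_simp
      have i6 : 1 - p.q / (p.a * x) = (x - p.q / p.a) / x := by field_simp
      have i7 : 1 - 1 / (p.c * x) = (x - 1 / p.c) / x := by field_simp
      have i8 : 1 - 1 / (p.d * x) = (x - 1 / p.d) / x := by field_simp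
      rw [i4] at e
      rw [i5, i6, i7, i8]
      generalize x - 1 / p.d = X1, x - 1 / p.c = X2, x - p.q / p.a = X3,
        1 - p.b * (x / p.q) = W1, 1 - p.b * x = W2, -(p.q / p.b) = W3 at *
      field_simp
      field_simp at e
      linear_combination Q2 * e
    · have h1 := (hN n).2 hn
      have b1 := (norm_mul_pt_lt h.b_ne (i.1, n) 1).2 (h1.trans_le (min_le_left _ _))
      have hne : p.b * p.s * γ ≠ 0 := by simp [h.b_ne, h.s_ne, hγ]
      have b2 := (norm_mul_pt_lt hne (i.1, n) 1).2 (h1.trans_le (min_le_right _ _))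
      rw [h.phi_eq hγ b1, ← h.entireFun_eq hγ hr (h.pt_ne _) b1 b2]
      field_simp [hP (i.1, n), hQ]
  rw [key]
  field_simp [hP i, hQ]

/-- The quotient of two reflected `q`-shifted factorials. -/
lemma tendsto_qPochInf_div {q : ℝ} (h0 : 0 < q) (h1 : q < 1) {y z : ℂ} (hy : y ≠ 0) (hz : z ≠ 0)
    (h : ∀ n : ℤ, z ≠ (q : ℂ) ^ n) :
    Tendsto (fun k : ℕ => qPochInf q (y * q ^ (-(k : ℤ))) /
      ((y / z) ^ k * qPochInf q (z * q ^ (-(k : ℤ))))) atTop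
      (𝓝 (theta q y / theta q z)) := by
  have hq : (q : ℂ) ≠ 0 := mod_cast h0.ne'
  have hp : ∀ k : ℕ, z * q ^ k ≠ 1 := fun k hk => h (-k) (by
    rw [zpow_neg, zpow_natCast]; exact eq_inv_of_mul_eq_one_left hk)
  have hp' : ∀ k : ℕ, q / z * q ^ k ≠ 1 := fun k hk => h (k + 1) (by
    rw [zpow_add_one₀ hq, zpow_natCast]; field_simp at hk; linear_combination -hk)
  have hPz := qPochInf_ne_zero h0 h1 hp
  have hPz' := qPochInf_ne_zero h0 h1 hp'
  have t := ((tendsto_qPoch h0 h1 (q / y)).mul_const (qPochInf q y)).div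
    ((tendsto_qPoch h0 h1 (q / z)).mul_const (qPochInf q z)) (mul_ne_zero hPz' hPz)
  rw [theta, theta, mul_comm (qPochInf q y), mul_comm (qPochInf q z)]
  refine t.congr fun k => ?_
  have h2 := qPoch_ne_zero hp' k
  rw [qPochInf_mul_zpow_neg h0 h1 hy, qPochInf_mul_zpow_neg h0 h1 hz, neg_pow y, neg_pow z, div_pow]
  have h3 : (q : ℂ) ^ (k * (k + 1) / 2) ≠ 0 := pow_ne_zero _ hq
  have h4 : (-1 : ℂ) ^ k ≠ 0 := pow_ne_zero _ (by norm_num)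
  have h5 : y ^ k ≠ 0 := pow_ne_zero _ hy
  have h6 : z ^ k ≠ 0 := pow_ne_zero _ hz
  simp only [Pi.div_apply]
  field_simp

/-- The quotient of two finite `q`-shifted factorials. -/
lemma tendsto_qPoch_div {q : ℝ} (h0 : 0 < q) (h1 : q < 1) (y : ℂ) {z : ℂ} (hz : z ≠ 0)
    (n : ℕ) :
    Tendsto (fun k : ℕ => qPoch q (y * q ^ (-(k : ℤ))) n /
      qPoch q (z * q ^ (-(k : ℤ))) n) atTop (𝓝 ((y / z) ^ n)) := by
  have hq : (q : ℂ) ≠ 0 := mod_cast h0.ne'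
  have hqt : Tendsto (fun k : ℕ => (q : ℂ) ^ k) atTop (𝓝 0) :=
    tendsto_pow_atTop_nhds_zero_of_norm_lt_one (by rwa [norm_of_nonneg h0.le])
  simp only [qPoch, ← Finset.prod_div_distrib]
  rw [← card_range n, ← prod_const, card_range]
  refine tendsto_finsetProd _ fun j _ => ?_
  have hqj : (q : ℂ) ^ j ≠ 0 := pow_ne_zero _ hq
  have := (hqt.sub_const (y * q ^ j)).div (hqt.sub_const (z * q ^ j)) (by simp [hz, hq])
  rw [show (0 - y * q ^ j) / (0 - z * q ^ j) = y / z by field_simp; ring] at this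
  refine this.congr fun k => ?_
  have hqk : (q : ℂ) ^ k ≠ 0 := pow_ne_zero _ hq
  rw [zpow_neg, zpow_natCast, ← mul_div_mul_left _ _ hqk, Pi.div_apply]
  congr 1 <;> field_simp

/-- The coefficient of `Φ_γ` in the expansion of `φ_γ` on the half line of sign `ε`. -/
def dCoef (p : Params) (ε : Bool) (γ : ℂ) : ℂ :=
  theta p.q (p.b * p.s * γ * p.z ε) / theta p.q (p.b * p.z ε) *
    (qPochInf p.q (p.s / γ) * qPochInf p.q (p.c * p.q / (p.a * p.s * γ)) *
      qPochInf p.q (p.d * p.q / (p.a * p.s * γ))) /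
    (qPochInf p.q (p.c * p.q / p.a) * qPochInf p.q (p.d * p.q / p.a) * qPochInf p.q (1 / γ ^ 2))

lemma IsReg.b_z_ne (h : p.IsReg) (ε : Bool) (n : ℤ) : p.b * p.z ε ≠ (p.q : ℂ) ^ n := by
  intro e
  apply h.b_pt (ε, -n)
  have := zpow_ne_zero n h.q_ne
  simp only [pt]
  push_cast
  rw [← mul_assoc, e, zpow_neg]
  field_simp

lemma IsReg.tendsto_phi (h : p.IsReg) (ε : Bool) (hγ : 1 < ‖γ‖)
    (hr : ‖p.d * p.q / (p.a * p.s * γ)‖ < 1) (hc : ‖p.c‖ ≤ ‖p.b * p.s * γ‖) :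
    Tendsto (fun k : ℕ => ((p.s * γ) ^ k)⁻¹ * p.phi γ (ε, -(k : ℤ))) atTop (𝓝 (p.dCoef ε γ)) := by
  have h0 := h.q_pos
  have h1 := h.q_lt_one
  obtain ⟨ha, hb, hcne, _, hs, hq⟩ := h.ne_zero
  have hγ0 : γ ≠ 0 := by rintro rfl; simp at hγ; linarith
  have hz := h.z_ne' ε
  have hbz : p.b * p.z ε ≠ 0 := mul_ne_zero hb hz
  have hY : p.b * p.s * γ * p.z ε ≠ 0 := by simp [hb, hs, hγ0, hz]
  have hsg : p.s * γ ≠ 0 := mul_ne_zero hs hγ0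
  have hP : ∀ k : ℕ, qPochInf p.q (p.b * p.z ε * p.q ^ (-(k : ℤ))) ≠ 0 := fun k =>
    h.poch_ne fun j => by
      have := h.b_pt_qpow (ε, -(k : ℤ)) j
      simp only [pt] at this; push_cast at this; rwa [← mul_assoc] at this
  have hpt : ∀ (y : ℂ) (k : ℕ), y * p.pt (ε, -(k : ℤ)) = y * p.z ε * p.q ^ (-(k : ℤ)) :=
    fun y k => by simp only [pt]; push_cast; ring
  set r := p.d * p.q / (p.a * p.s * γ) with hrdef
  set C : ℕ → ℂ := phi21Term p.q (p.s * γ) (p.c * p.q * γ / (p.a * p.s)) (p.c * p.q / p.a) r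
    with hCdef
  set W : ℕ → ℕ → ℂ := fun k n => qPoch p.q (p.c * p.pt (ε, -(k : ℤ))) n *
    qPochInf p.q (p.b * p.s * γ * p.pt (ε, -(k : ℤ)) * p.q ^ n) /
      ((p.s * γ) ^ k * qPochInf p.q (p.b * p.z ε * p.q ^ (-(k : ℤ)))) with hW
  -- the pointwise limit
  have hlim : ∀ n, Tendsto (fun k => W k n) atTop
      (𝓝 (theta p.q (p.b * p.s * γ * p.z ε) / theta p.q (p.b * p.z ε) *
        (p.c / (p.b * p.s * γ)) ^ n)) := by
    intro n
    have t1 := tendsto_qPochInf_div h0 h1 hY hbz (h.b_z_ne ε)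
    have t2 := tendsto_qPoch_div h0 h1 (p.c * p.z ε) hbz n
    rw [show p.b * p.s * γ * p.z ε / (p.b * p.z ε) = p.s * γ by field_simp] at t1
    rw [← tendsto_add_atTop_iff_nat n]
    have t3 := (t1.mul ((t2.comp (tendsto_add_atTop_nat n)).mul_const (((p.s * γ) ^ n)⁻¹)))
    rw [show (p.c * p.z ε / (p.b * p.z ε)) ^ n * ((p.s * γ) ^ n)⁻¹ =
      (p.c / (p.b * p.s * γ)) ^ n by rw [← inv_pow, ← mul_pow]; congr 1; field_simp] at t3
    refine t3.congr fun k => ?_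
    have e1 : ∀ y : ℂ, y * p.q ^ (-((k + n : ℕ) : ℤ)) * p.q ^ n =
        y * p.q ^ (-(k : ℤ)) := fun y => by
      rw [mul_assoc, ← zpow_natCast, ← zpow_add₀ hq]; congr 2; push_cast; ring
    have e2 := qPochInf_eq_mul h0 h1 (p.b * p.z ε * p.q ^ (-((k + n : ℕ) : ℤ))) n
    rw [e1] at e2
    have n1 := hP (k + n)
    have n2 := hP k
    have n3 : qPoch p.q (p.b * p.z ε * p.q ^ (-((k + n : ℕ) : ℤ))) n ≠ 0 := by
      intro e; rw [e, zero_mul] at e2; exact n1 e2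
    simp only [hW, Function.comp, hpt, e1]
    rw [e2, pow_add]; field_simp
  -- the uniform bound
  have hbd : ∃ B, ∀ k n, ‖W k n‖ ≤ B := by
    have hYn : (-(‖p.b * p.s * γ * p.z ε‖ : ℂ)) ≠ 0 := by simp [hb, hs, hγ0, h.z_ne ε]
    have t1 := (tendsto_qPochInf_div h0 h1 hYn hbz (h.b_z_ne ε)).norm
    obtain ⟨B, hB⟩ := t1.bddAbove_range
    refine ⟨B, fun k n => le_trans ?_ (hB ⟨k, rfl⟩)⟩
    simp only [hW]
    rw [norm_div, norm_div, norm_mul ((p.s * γ) ^ k), norm_mul (_ ^ k)]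
    have e1 : ‖(-(‖p.b * p.s * γ * p.z ε‖ : ℂ) / (p.b * p.z ε)) ^ k‖ = ‖(p.s * γ) ^ k‖ := by
      rw [norm_pow, norm_pow, norm_div, norm_neg, norm_real, norm_norm, ← norm_div]
      congr 2; field_simp
    rw [e1]
    refine div_le_div_of_nonneg_right ?_ (by positivity)
    set x : ℂ := ((p.pt (ε, -(k : ℤ)) : ℝ) : ℂ) with hx
    set y : ℝ := ‖p.b * p.s * γ * x‖ with hy
    have e2 : -(‖p.b * p.s * γ * p.z ε‖ : ℂ) * p.q ^ (-(k : ℤ)) = -(y : ℂ) := by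
      rw [hy, hx, hpt, norm_mul _ ((p.q : ℂ) ^ (-(k : ℤ))), norm_zpow, norm_real p.q,
        Real.norm_of_nonneg h0.le]
      push_cast; ring
    rw [e2, qPochInf_eq_mul h0 h1 (-(y : ℂ)) n, norm_mul, norm_mul]
    have e3 : ‖p.c * x‖ ≤ y := by rw [hy, norm_mul, norm_mul _ x]; gcongr
    refine mul_le_mul (norm_qPochInf_neg_mono.norm_qPoch_neg_mono h0 h1 h0 e3 n) ?_ (norm_nonneg _)
      (norm_nonneg _)
    have := norm_qPochInf_neg_mono h0 h1 (x := p.b * p.s * γ * x * p.q ^ n)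
      (y := y * p.q ^ n) (by
        rw [norm_mul, norm_pow, norm_of_nonneg h0.le])
    push_cast at this
    rwa [← neg_mul] at this
  obtain ⟨B, hB⟩ := hbd
  have hCsum : Summable fun n => ‖C n‖ := (summable_phi21Term h0 h1 _ _ h.ca_ne hr).norm
  have hB0 : 0 ≤ B := (norm_nonneg _).trans (hB 0 0)
  have T := tendsto_tsum_of_dominated_convergence (bound := fun n => ‖C n‖ * B)
    (hCsum.mul_right B) (fun n => (hlim n).const_mul (C n))
    (.of_forall fun k n => by
      rw [norm_mul]; exact mul_le_mul_of_nonneg_left (hB k n) (norm_nonneg _))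
  have hQ : qPochInf p.q (p.d * p.q / p.a) ≠ 0 := h.poch_ne h.da_ne
  have hQc : qPochInf p.q (p.c * p.q / p.a) ≠ 0 := h.poch_ne h.ca_ne
  have T2 := T.const_mul (qPochInf p.q r / qPochInf p.q (p.d * p.q / p.a))
  have hg1 : ‖1 / γ ^ 2‖ < 1 := by
    rw [norm_div, norm_one, norm_pow, div_lt_one (by positivity)]
    exact one_lt_pow₀ hγ (by norm_num)
  have hG : qPochInf p.q (1 / γ ^ 2) ≠ 0 := h.poch_ne fun k => mul_qpow_ne_one h0 h1 hg1 k
  have hval : qPochInf p.q r / qPochInf p.q (p.d * p.q / p.a) *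
      ∑' n, C n * (theta p.q (p.b * p.s * γ * p.z ε) / theta p.q (p.b * p.z ε) *
        (p.c / (p.b * p.s * γ)) ^ n) = p.dCoef ε γ := by
    have g1 : p.s * γ * (p.c * p.q * γ / (p.a * p.s)) * (1 / γ ^ 2) = p.c * p.q / p.a := by
      field_simp
    have G := qGauss h0 h1 (p.s * γ) (p.c * p.q * γ / (p.a * p.s)) (z := 1 / γ ^ 2) hg1
      (fun k => by rw [g1]; exact h.ca_ne k)
    rw [g1, show p.s * γ * (1 / γ ^ 2) = p.s / γ by field_simp,
      show p.c * p.q * γ / (p.a * p.s) * (1 / γ ^ 2) = p.c * p.q / (p.a * p.s * γ) by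
        field_simp] at G
    have e3 : ∀ n, C n * (theta p.q (p.b * p.s * γ * p.z ε) / theta p.q (p.b * p.z ε) *
        (p.c / (p.b * p.s * γ)) ^ n) =
        theta p.q (p.b * p.s * γ * p.z ε) / theta p.q (p.b * p.z ε) *
        phi21Term p.q (p.s * γ) (p.c * p.q * γ / (p.a * p.s)) (p.c * p.q / p.a) (1 / γ ^ 2) n := by
      intro n
      have : 1 / γ ^ 2 = r * (p.c / (p.b * p.s * γ)) := by rw [hrdef, h.d_eq]; field_simp
      rw [hCdef, phi21Term, phi21Term, this, mul_pow]; ring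
    simp_rw [e3]
    rw [tsum_mul_left, dCoef, ← hrdef]
    have hth : theta p.q (p.b * p.z ε) ≠ 0 := theta_ne_zero h0 h1 hbz (h.b_z_ne ε)
    generalize (∑' n, phi21Term p.q (p.s * γ) (p.c * p.q * γ / (p.a * p.s)) (p.c * p.q / p.a)
      (1 / γ ^ 2) n) = S at *
    generalize qPochInf p.q (p.c * p.q / p.a) = Q1, qPochInf p.q (p.d * p.q / p.a) = Q2,
      qPochInf p.q (1 / γ ^ 2) = Q3, theta p.q (p.b * p.z ε) = Q4, qPochInf p.q (p.s / γ) = Q5,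
      qPochInf p.q (p.c * p.q / (p.a * p.s * γ)) = Q6 at *
    field_simp
    linear_combination theta p.q (p.b * p.s * γ * p.z ε) * qPochInf p.q r * G
  rw [hval] at T2
  refine T2.congr fun k => ?_
  have e := h.phi_eq_entireFun hγ0 hr (ε, -(k : ℤ))
  rw [hpt] at e
  have n1 := hP k
  have e4 : ∑' n, C n * W k n = p.entireFun γ (p.pt (ε, -(k : ℤ))) /
      ((p.s * γ) ^ k * qPochInf p.q (p.b * p.z ε * p.q ^ (-(k : ℤ)))) := by
    rw [entireFun, ← tsum_div_const]
    exact tsum_congr fun n => by simp only [hW, hCdef, entireTerm]; ring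
  rw [e4]
  have n2 : (p.s * γ) ^ k ≠ 0 := pow_ne_zero _ hsg
  field_simp
  linear_combination -e

/-- Bounded holomorphic functions are Lipschitz at the centre of a disk. -/
lemma norm_sub_le_of_differentiableOn {F : ℂ → ℂ} {r M : ℝ}
    (hF : DifferentiableOn ℂ F (ball 0 r)) (hb : ∀ y ∈ ball (0 : ℂ) r, ‖F y‖ ≤ M)
    {y : ℂ} (hy : y ∈ ball (0 : ℂ) r) :
    ‖F y - F 0‖ ≤ (2 * M + 1) / r * ‖y‖ := by
  have hr : 0 < r := (norm_nonneg y).trans_lt (by simpa using hy)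
  have := Complex.dist_le_div_mul_dist_of_mapsTo_ball (R₂ := 2 * M + 1) hF (fun w hw => ?_) hy
  · simpa [dist_eq_norm] using this
  · have h1 := hb w hw
    have h2 := hb 0 (Metric.mem_ball_self hr)
    rw [Metric.mem_closedBall, dist_eq_norm]; linarith [norm_sub_le (F w) (F 0)]

/-! ### The asymptotic solutions -/

/-- The coefficients of the series for `Φ_γ`. -/
def bigCoeff (p : Params) (γ : ℂ) (n : ℕ) : ℂ :=
  qPoch p.q (p.q * γ / p.s) n * qPoch p.q (p.c * p.q * γ / (p.s * p.a)) n *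
    qPoch p.q (p.d * p.q * γ / (p.s * p.a)) n / (qPoch p.q p.q n * qPoch p.q (p.q * γ ^ 2) n)

/-- The terms of the series for `Φ_γ`, as functions of `y = 1/x`. -/
def bigTerm (p : Params) (γ : ℂ) (n : ℕ) (y : ℂ) : ℂ :=
  p.bigCoeff γ n * (qPochInf p.q (p.q ^ 2 * γ / (p.a * p.s) * y * p.q ^ n) * (p.q * y / p.b) ^ n)

/-- The series for `Φ_γ`, as a function of `y = 1/x`. -/
def bigFun (p : Params) (γ y : ℂ) : ℂ := ∑' n, p.bigTerm γ n y

/-- The gauge factor in `Φ_γ`, as a function of `y = 1/x`. -/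
def gauge (p : Params) (y : ℂ) : ℂ :=
  qPochInf p.q (p.q * y / p.b) / (qPochInf p.q (p.q * y / p.c) * qPochInf p.q (p.q * y / p.d))

/-- The explicit expression for `Φ_γ` far out. -/
def asym (p : Params) (γ : ℂ) (i : RqIndex) : ℂ :=
  (p.s * γ) ^ (-i.2) * (p.gauge (1 / p.pt i) * p.bigFun γ (1 / p.pt i))

lemma qγ_norm {R : ℝ} (hq : 0 < p.q) (hγ : ‖γ‖ ≤ R) : ‖p.q * γ ^ 2‖ ≤ p.q * R ^ 2 := by
  rw [norm_mul, norm_pow, norm_of_nonneg hq.le]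
  gcongr

namespace IsReg
variable (h : p.IsReg)
include h

lemma exists_bigTerm_le {R ρ : ℝ} (hR : p.q * R ^ 2 < 1)
    (hR0 : 0 ≤ R) (hρ : 0 ≤ ρ) :
    ∃ M > 0, ∀ γ : ℂ, ‖γ‖ ≤ R → ∀ y : ℂ, ‖p.q * y / p.b‖ ≤ ρ → ∀ n,
      ‖p.bigTerm γ n y‖ ≤ M * ρ ^ n := by
  have hq0 := h.q_pos
  have hq : 0 < 1 - p.q := sub_pos.2 h.q_lt_one
  have hb := norm_pos_iff.2 h.b_ne
  obtain ⟨c₁, hc₁, h₁⟩ := exists_norm_qPoch_q_ge h.q_pos h.q_lt_one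
  obtain ⟨c₂, hc₂, h₂⟩ := exists_norm_qPoch_ge_of_norm_le h.q_pos h.q_lt_one
    (show 0 ≤ p.q * R ^ 2 by positivity) hR
  set E : ℂ → ℝ := fun x => Real.exp (‖x‖ * R / (1 - p.q)) with hE
  set E' : ℝ := Real.exp (‖(p.q : ℂ) ^ 2 / (p.a * p.s)‖ * R * (ρ * ‖p.b‖ / p.q) / (1 - p.q))
  refine ⟨E (p.q / p.s) * E (p.c * p.q / (p.s * p.a)) * E (p.d * p.q / (p.s * p.a)) /
    (c₁ * c₂) * E', by positivity, fun γ hγ y hy n => ?_⟩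
  have hP : ∀ x : ℂ, ‖qPoch p.q (x * γ) n‖ ≤ E x := fun x => by
    refine (norm_qPoch_le h.q_pos h.q_lt_one _ _).trans ?_
    simp only [hE]
    rw [norm_mul]; gcongr
  have hy' : ‖y‖ ≤ ρ * ‖p.b‖ / p.q := by
    rw [norm_div, norm_mul, norm_of_nonneg hq0.le, div_le_iff₀ hb] at hy
    rw [le_div_iff₀ hq0]; linarith
  have hE' : ‖qPochInf p.q (p.q ^ 2 * γ / (p.a * p.s) * y * p.q ^ n)‖ ≤ E' := by
    refine (norm_qPochInf_le h.q_pos h.q_lt_one _).trans (Real.exp_le_exp.2 ?_)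
    refine div_le_div_of_nonneg_right ?_ hq.le
    rw [norm_mul, norm_mul, mul_div_right_comm, norm_mul, norm_pow _ n, norm_of_nonneg hq0.le]
    calc _ ≤ ‖(p.q : ℂ) ^ 2 / (p.a * p.s)‖ * R * (ρ * ‖p.b‖ / p.q) * 1 := by
          gcongr
          exact pow_le_one₀ hq0.le h.q_lt_one.le
      _ = _ := mul_one _
  rw [bigTerm, bigCoeff, norm_mul, norm_mul (qPochInf _ _), norm_div, norm_mul, norm_mul, norm_mul,
    norm_pow (p.q * y / p.b), mul_div_right_comm (p.q : ℂ) γ, mul_div_right_comm (p.c * p.q) γ,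
    mul_div_right_comm (p.d * p.q) γ]
  rw [← mul_assoc]
  gcongr
  · exact hP _
  · exact hP _
  · exact hP _
  · exact h₁ n
  · exact h₂ _ (qγ_norm hq0 hγ) n

lemma summable_bigTerm {γ y : ℂ} (hγ : p.q * ‖γ‖ ^ 2 < 1)
    (hy : ‖p.q * y / p.b‖ < 1) : Summable fun n => p.bigTerm γ n y := by
  obtain ⟨M, -, hM⟩ := h.exists_bigTerm_le hγ (norm_nonneg _) (norm_nonneg (p.q * y / p.b))
  exact Summable.of_norm_bounded ((summable_geometric_of_lt_one (norm_nonneg _) hy).mul_left M)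
    (hM γ le_rfl y le_rfl)

lemma qγ_ne (hγ : p.q * ‖γ‖ ^ 2 < 1) (k : ℕ) :
    p.q * γ ^ 2 * p.q ^ k ≠ 1 :=
  mul_qpow_ne_one h.q_pos h.q_lt_one ((qγ_norm h.q_pos le_rfl).trans_lt hγ) k

lemma L_bigFun {γ y : ℂ} (hγ0 : γ ≠ 0) (hγ : p.q * ‖γ‖ ^ 2 < 1)
    (hy : ‖y / p.b‖ < 1) :
    γ * (1 - p.q * y / p.a) * (1 - p.q * y / p.c) * (1 - p.q * y / p.d) * p.bigFun γ (p.q * y) +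
      γ⁻¹ * (1 - y / p.b) * p.bigFun γ (y / p.q) +
      (p.s⁻¹ + p.s - p.s⁻¹ * (1 - p.q * y / p.a) * (1 - p.q * y / p.b) -
        p.s * (1 - y / p.c) * (1 - y / p.d) - mu γ) * p.bigFun γ y = 0 := by
  obtain ⟨ha, hb, hc, hd, hs, hq⟩ := h.ne_zero
  have hq0 := h.q_pos
  have b1 : ‖p.q * y / p.b‖ < 1 := by
    rw [mul_div_assoc, norm_mul, norm_of_nonneg hq0.le]
    nlinarith [h.q_lt_one, norm_nonneg (y / p.b)]
  have b2 : ‖p.q * (p.q * y) / p.b‖ < 1 := by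
    rw [mul_div_assoc, norm_mul, norm_of_nonneg hq0.le]
    nlinarith [h.q_lt_one, norm_nonneg (p.q * y / p.b)]
  have b3 : ‖p.q * (y / p.q) / p.b‖ < 1 := by rw [mul_div_cancel₀ y hq]; exact hy
  set T : ℕ → ℂ := fun n => p.bigTerm γ n y *
    (γ⁻¹ * ((p.q : ℂ) ^ n)⁻¹ * (1 - (p.q : ℂ) ^ n) * (1 - γ ^ 2 * (p.q : ℂ) ^ n)) with hT
  have s1 := (h.summable_bigTerm hγ b2).mul_left
    (γ * (1 - p.q * y / p.a) * (1 - p.q * y / p.c) * (1 - p.q * y / p.d))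
  have s2 := (h.summable_bigTerm hγ b3).mul_left (γ⁻¹ * (1 - y / p.b))
  have s3 := (h.summable_bigTerm hγ b1).mul_left
    (p.s⁻¹ + p.s - p.s⁻¹ * (1 - p.q * y / p.a) * (1 - p.q * y / p.b) -
        p.s * (1 - y / p.c) * (1 - y / p.d) - mu γ)
  have key : ∀ n, γ * (1 - p.q * y / p.a) * (1 - p.q * y / p.c) * (1 - p.q * y / p.d) *
      p.bigTerm γ n (p.q * y) + γ⁻¹ * (1 - y / p.b) * p.bigTerm γ n (y / p.q) +
      (p.s⁻¹ + p.s - p.s⁻¹ * (1 - p.q * y / p.a) * (1 - p.q * y / p.b) -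
        p.s * (1 - y / p.c) * (1 - y / p.d) - mu γ) * p.bigTerm γ n y = T n - T (n + 1) := by
    intro n
    have hN : (p.q : ℂ) ^ n ≠ 0 := pow_ne_zero _ hq
    have n1 := qPoch_q_ne_zero h.q_pos h.q_lt_one n
    have n2 := qPoch_ne_zero (h.qγ_ne hγ) n
    have n3 : 1 - p.q * γ ^ 2 * (p.q : ℂ) ^ n ≠ 0 := sub_ne_zero.2 (h.qγ_ne hγ n).symm
    have n4 : 1 - (p.q : ℂ) * (p.q : ℂ) ^ n ≠ 0 := sub_ne_zero.2 (mul_qpow_ne_one h.q_pos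
      h.q_lt_one (by rw [norm_of_nonneg h.q_pos.le]; exact h.q_lt_one)
      n).symm
    have g1 := qPochInf_step h.q_pos h.q_lt_one (p.q ^ 2 * γ / (p.a * p.s) * y * (p.q : ℂ) ^ n)
    have g2 := qPochInf_step h.q_pos h.q_lt_one
      (p.q ^ 2 * γ / (p.a * p.s) * (y / p.q) * (p.q : ℂ) ^ n)
    rw [show p.q ^ 2 * γ / (p.a * p.s) * (y / p.q) * (p.q : ℂ) ^ n * p.q =
      p.q ^ 2 * γ / (p.a * p.s) * y * (p.q : ℂ) ^ n by field_simp, g1] at g2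
    have g3 : p.q ^ 2 * γ / (p.a * p.s) * (p.q * y) * (p.q : ℂ) ^ n =
      p.q ^ 2 * γ / (p.a * p.s) * y * (p.q : ℂ) ^ n * p.q := by ring
    have g4 : p.q ^ 2 * γ / (p.a * p.s) * y * (p.q : ℂ) ^ (n + 1) =
      p.q ^ 2 * γ / (p.a * p.s) * y * (p.q : ℂ) ^ n * p.q := by ring
    have w1 : p.q * (p.q * y) / p.b = p.q * y / p.b * p.q := by ring
    have w2 : p.q * (y / p.q) / p.b = p.q * y / p.b / p.q := by ring
    simp only [hT, bigTerm, g3, g4, g2, g1, w1, w2, mul_pow _ (p.q : ℂ) n, div_pow _ (p.q : ℂ) n,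
      pow_succ (p.q * y / p.b), bigCoeff, qPoch_succ, mu]
    rw [show 1 - γ ^ 2 * (p.q : ℂ) ^ (n + 1) = 1 - p.q * γ ^ 2 * (p.q : ℂ) ^ n by ring,
      show 1 - (p.q : ℂ) ^ (n + 1) = 1 - p.q * (p.q : ℂ) ^ n by ring, pow_succ (p.q : ℂ) n, h.d_eq]
    generalize qPoch p.q p.q n = Q1, qPoch p.q (p.q * γ ^ 2) n = Q2,
      hU : 1 - p.q * γ ^ 2 * (p.q : ℂ) ^ n = U, hV : 1 - p.q * (p.q : ℂ) ^ n = V at *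
    generalize qPochInf p.q (p.q ^ 2 * γ / (p.a * p.s) * y * (p.q : ℂ) ^ n * p.q) = G
    generalize qPoch p.q (p.q * γ / p.s) n = Q3
    generalize qPoch p.q (p.c * p.q * γ / (p.s * p.a)) n = Q4
    generalize qPoch p.q (p.s ^ 2 * (p.a * p.b) / (p.c * p.q) * p.q * γ / (p.s * p.a)) n = Q5
    generalize (p.q * y / p.b) ^ n = Y
    generalize (p.q : ℂ) ^ n = N at *
    clear hU hV g1 g2 g3 g4 w1 w2 s1 s2 s3
    field_simp; ring
  have hlim : Tendsto T atTop (𝓝 0) := by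
    obtain ⟨ρ, r1, r2⟩ := exists_between (show ‖p.q * y / p.b‖ < p.q by
      rw [mul_div_assoc, norm_mul, norm_of_nonneg hq0.le]
      nlinarith)
    have hρ := (norm_nonneg _).trans_lt r1
    obtain ⟨M, hM0, hM⟩ := h.exists_bigTerm_le hγ (norm_nonneg _) hρ.le
    refine squeeze_zero_norm (a := fun n => M * ‖γ⁻¹‖ * 2 * (1 + ‖γ‖ ^ 2) * (ρ / p.q) ^ n)
      (fun n => ?_) ?_
    · have hqn : 0 < p.q ^ n := pow_pos hq0 n
      have hqn1 : p.q ^ n ≤ 1 := pow_le_one₀ hq0.le h.q_lt_one.le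
      have e0 : ‖(p.q : ℂ) ^ n‖ = p.q ^ n := by rw [norm_pow, norm_of_nonneg hq0.le]
      have e1 : ‖1 - (p.q : ℂ) ^ n‖ ≤ 2 := by
        refine (norm_sub_le _ _).trans ?_
        rw [norm_one, e0]; linarith
      have e2 : ‖1 - γ ^ 2 * (p.q : ℂ) ^ n‖ ≤ 1 + ‖γ‖ ^ 2 := by
        refine (norm_sub_le _ _).trans ?_
        rw [norm_one, norm_mul, e0, norm_pow]
        nlinarith [sq_nonneg ‖γ‖]
      rw [norm_mul, norm_mul, norm_mul, norm_mul, norm_inv _, norm_inv _, e0]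
      calc _ ≤ M * ρ ^ n * (‖γ‖⁻¹ * (p.q ^ n)⁻¹ * 2 * (1 + ‖γ‖ ^ 2)) := by
            gcongr
            exact hM γ le_rfl y r1.le n
        _ = _ := by rw [div_pow]; field_simp
    · simpa using (tendsto_pow_atTop_nhds_zero_of_lt_one (by positivity)
        ((div_lt_one hq0).2 r2)).const_mul (M * ‖γ⁻¹‖ * 2 * (1 + ‖γ‖ ^ 2))
  have := tsum_eq_zero_of_telescope ((s1.add s2).add s3) key (by simp [hT]) hlim
  rw [(s1.add s2).tsum_add s3, s1.tsum_add s2, tsum_mul_left, tsum_mul_left, tsum_mul_left] at this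
  exact this

lemma qPochInf_inv_ne {t : ℂ} (ht : ∀ i, t * p.pt i ≠ 1) (ht0 : t ≠ 0)
    (i : RqIndex) : qPochInf p.q (p.q * (1 / p.pt i) / t) ≠ 0 := by
  have hq := h.q_ne
  have hx := h.pt_ne i
  refine h.poch_ne fun k hk => ht (i.1, i.2 - (k + 1 : ℕ)) ?_
  have e : (p.pt (i.1, i.2 - (k + 1 : ℕ)) : ℂ) = p.pt i / p.q ^ (k + 1) := by
    simp only [pt, zpow_sub₀ h.q_pos.ne', zpow_natCast]
    push_cast; ring
  rw [e]
  field_simp at hk ⊢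
  linear_combination -hk

/-- The explicit expression solves the eigenvalue equation far out. -/
lemma L_asym (hγ0 : γ ≠ 0) (hγ : p.q * ‖γ‖ ^ 2 < 1)
    {i : RqIndex} (hi : ‖1 / p.pt i / p.b‖ < 1) : p.L (p.asym γ) i = mu γ * p.asym γ i := by
  obtain ⟨ha, hb, hc, hd, hs, hq⟩ := h.ne_zero
  have hx := h.pt_ne i
  have key := h.L_bigFun hγ0 hγ hi
  have hsγ : p.s * γ ≠ 0 := mul_ne_zero hs hγ0
  have st : ∀ t : ℂ, qPochInf p.q (p.q * (1 / p.pt i) / t) =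
      (1 - p.q * (1 / p.pt i) / t) * qPochInf p.q (p.q * (1 / p.pt (down i)) / t) := fun t => by
    rw [qPochInf_step h.q_pos h.q_lt_one]
    congr 2
    rw [h.pt_down]; push_cast; field_simp
  have st' : ∀ t : ℂ, qPochInf p.q (p.q * (1 / p.pt (up i)) / t) =
      (1 - (1 / p.pt i) / t) * qPochInf p.q (p.q * (1 / p.pt i) / t) := fun t => by
    rw [qPochInf_step h.q_pos h.q_lt_one, h.pt_up]; push_cast
    rw [show p.q * (1 / (p.q * p.pt i)) / t = (1 / p.pt i : ℂ) / t by field_simp]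
    congr 2; ring
  have c1 := h.qPochInf_inv_ne h.c_pt hc i
  have c2 := h.qPochInf_inv_ne h.c_pt hc (down i)
  have c3 := h.qPochInf_inv_ne h.c_pt hc (up i)
  have d1 := h.qPochInf_inv_ne h.d_pt hd i
  have d2 := h.qPochInf_inv_ne h.d_pt hd (down i)
  have d3 := h.qPochInf_inv_ne h.d_pt hd (up i)
  have b1 := h.qPochInf_inv_ne h.b_pt hb i
  have u1 : (1 - p.q * (1 / p.pt i) / p.b : ℂ) ≠ 0 := fun e => b1 (by rw [st, e, zero_mul])
  have u2 : (1 - p.q * (1 / p.pt i) / p.c : ℂ) ≠ 0 := fun e => c1 (by rw [st, e, zero_mul])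
  have u3 : (1 - p.q * (1 / p.pt i) / p.d : ℂ) ≠ 0 := fun e => d1 (by rw [st, e, zero_mul])
  have u4 : (1 - (1 / p.pt i) / p.c : ℂ) ≠ 0 := fun e => c3 (by rw [st', e, zero_mul])
  have u5 : (1 - (1 / p.pt i) / p.d : ℂ) ≠ 0 := fun e => d3 (by rw [st', e, zero_mul])
  have e1 : (1 / p.pt (down i) : ℂ) = p.q * (1 / p.pt i) := by rw [h.pt_down]; push_cast; field_simp
  have e2 : (1 / p.pt (up i) : ℂ) = 1 / p.pt i / p.q := by rw [h.pt_up]; push_cast; field_simp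
  have A : p.coeffA (p.pt i) = p.s⁻¹ * (1 - p.q * (1 / p.pt i) / p.a) *
      (1 - p.q * (1 / p.pt i) / p.b) := by rw [coeffA]; field_simp
  have B : p.coeffB (p.pt i) = p.s * (1 - (1 / p.pt i) / p.c) * (1 - (1 / p.pt i) / p.d) := by
    rw [coeffB]; field_simp
  simp only [L, asym, gauge, coeffC, A, B]
  rw [st' p.b, st' p.c, st' p.d, st p.b, st p.c, st p.d, e1, e2]
  have z1 : (p.s * γ) ^ (-(down i).2) = (p.s * γ) ^ (-i.2) * (p.s * γ) := by
    rw [← zpow_add_one₀ hsγ]; congr 1; simp [down]; ring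
  have z2 : (p.s * γ) ^ (-(up i).2) = (p.s * γ) ^ (-i.2) / (p.s * γ) := by
    rw [div_eq_mul_inv, ← zpow_sub_one₀ hsγ]; congr 1; simp [up]; ring
  rw [z1, z2]
  rw [e1] at c2 d2
  generalize qPochInf p.q (p.q * (p.q * (1 / p.pt i)) / p.c) = C2,
    qPochInf p.q (p.q * (p.q * (1 / p.pt i)) / p.d) = D2,
    qPochInf p.q (p.q * (p.q * (1 / p.pt i)) / p.b) = B2, p.bigFun γ (p.q * (1 / p.pt i)) = F1,
    p.bigFun γ (1 / p.pt i / p.q) = F2, p.bigFun γ (1 / p.pt i) = F3 at *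
  clear st st' e1 e2 A B z1 z2 c1 c3 d1 d3 b1 hi
  generalize (1 - p.q * (1 / p.pt i) / p.b : ℂ) = U1, (1 - p.q * (1 / p.pt i) / p.c : ℂ) = U2,
    (1 - p.q * (1 / p.pt i) / p.d : ℂ) = U3, (1 - (1 / p.pt i) / p.c : ℂ) = U4,
    (1 - (1 / p.pt i) / p.d : ℂ) = U5, (1 - (1 / p.pt i) / p.b : ℂ) = U6,
    (1 - p.q * (1 / p.pt i) / p.a : ℂ) = U7, (p.s * γ) ^ (-i.2) = Z, mu γ = m at *
  field_simp at key ⊢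
  linear_combination Z * B2 * key

lemma PhiSeries_eq {n : ℤ}
    (hn : ‖p.q ^ 2 * γ / (p.a * p.s * p.pt (ε, n))‖ < 1) :
    p.PhiSeries γ ε n = p.asym γ (ε, n) := by
  obtain ⟨ha, hb, _, _, hs, _⟩ := h.ne_zero
  have hx := h.pt_ne (ε, n)
  have e1 : ∀ t : ℂ, p.q * (1 / p.pt (ε, n)) / t = p.q / (t * p.pt (ε, n)) := fun t => by
    rw [mul_one_div, div_div, mul_comm t]
  have e2 : p.q ^ 2 * γ / (p.a * p.s) * (1 / p.pt (ε, n)) =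
    p.q ^ 2 * γ / (p.a * p.s * p.pt (ε, n)) := by rw [mul_one_div, div_div]
  have e3 : qPochInf p.q (p.q ^ 2 * γ / (p.a * p.s * p.pt (ε, n))) *
      phi32 p.q (p.q * γ / p.s) (p.c * p.q * γ / (p.s * p.a)) (p.d * p.q * γ / (p.s * p.a))
      (p.q ^ 2 * γ / (p.a * p.s * p.pt (ε, n))) (p.q * γ ^ 2) (p.q / (p.b * p.pt (ε, n))) =
      p.bigFun γ (1 / p.pt (ε, n)) := by
    rw [bigFun, phi32, ← tsum_mul_left]
    refine tsum_congr fun k => ?_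
    rw [bigTerm, bigCoeff, e1, e2,
      qPochInf_eq_mul h.q_pos h.q_lt_one (p.q ^ 2 * γ / (p.a * p.s * p.pt (ε, n))) k]
    have n1 := qPoch_ne_zero (fun k => mul_qpow_ne_one h.q_pos h.q_lt_one hn k) k
    generalize qPoch p.q (p.q ^ 2 * γ / (p.a * p.s * p.pt (ε, n))) k = X at *
    generalize qPoch p.q (p.q * γ ^ 2) k = X1
    generalize (p.q / (p.b * p.pt (ε, n)) : ℂ) ^ k = X2
    generalize qPochInf p.q _ = X3
    rw [mul_right_comm _ X, ← div_div]; field_simp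
  rw [PhiSeries, asym, gauge, e1, e1, e1, ← e3]
  ring

lemma differentiableOn_bigFun_left {y : ℂ}
    (hy : ‖p.q * y / p.b‖ < 1) :
    DifferentiableOn ℂ (fun γ => p.bigFun γ y) {γ | p.q * ‖γ‖ ^ 2 < 1} := by
  intro γ hγ
  have hγ : p.q * ‖γ‖ ^ 2 < 1 := hγ
  obtain ⟨R, h1, h2⟩ : ∃ R, ‖γ‖ < R ∧ p.q * R ^ 2 < 1 := by
    have hc : ContinuousWithinAt (fun R : ℝ => p.q * R ^ 2) (Set.Ioi ‖γ‖) ‖γ‖ := by fun_prop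
    obtain ⟨R, h3, h4⟩ := ((hc.eventually_lt_const hγ).and self_mem_nhdsWithin).exists
    exact ⟨R, h4, h3⟩
  have hR := (norm_nonneg γ).trans_lt h1
  obtain ⟨M, -, hM⟩ := h.exists_bigTerm_le h2 hR.le (norm_nonneg (p.q * y / p.b))
  have hball : ∀ w ∈ ball (0 : ℂ) R, p.q * ‖w‖ ^ 2 < 1 := fun w hw => by
    have : ‖w‖ < R := by simpa using hw
    have := h.q_pos
    calc _ ≤ p.q * R ^ 2 := by gcongr
      _ < 1 := h2
  have hd : ∀ n, DifferentiableOn ℂ (fun γ => p.bigTerm γ n y) (ball 0 R) := fun n => by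
    have hq : ∀ t : ℂ, Differentiable ℂ fun γ : ℂ => qPoch p.q (p.q * γ / t) n := fun t =>
      (differentiable_qPoch (q := p.q) n).comp
        (show Differentiable ℂ fun γ : ℂ => p.q * γ / t by fun_prop)
    have hq' : ∀ t u : ℂ, Differentiable ℂ fun γ : ℂ => qPoch p.q (u * p.q * γ / t) n :=
      fun t u => (differentiable_qPoch (q := p.q) n).comp
        (show Differentiable ℂ fun γ : ℂ => u * p.q * γ / t by fun_prop)
    have hq2 : Differentiable ℂ fun γ : ℂ => qPoch p.q (p.q * γ ^ 2) n :=
      (differentiable_qPoch (q := p.q) n).comp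
        (show Differentiable ℂ fun γ : ℂ => p.q * γ ^ 2 by fun_prop)
    have hP : Differentiable ℂ fun γ : ℂ =>
        qPochInf p.q (p.q ^ 2 * γ / (p.a * p.s) * y * p.q ^ n) :=
      h.differentiable_poch.comp
        (show Differentiable ℂ fun γ : ℂ =>
          p.q ^ 2 * γ / (p.a * p.s) * y * p.q ^ n by fun_prop)
    unfold bigTerm bigCoeff
    refine DifferentiableOn.mul (DifferentiableOn.div ?_ ?_ fun w hw => ?_) ?_
    · exact (((hq _).mul (hq' _ _)).mul (hq' _ _)).differentiableOn
    · exact (hq2.const_mul _).differentiableOn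
    · exact mul_ne_zero (qPoch_q_ne_zero h.q_pos h.q_lt_one n)
        (qPoch_ne_zero (h.qγ_ne (hball w hw)) n)
    · exact (hP.mul_const _).differentiableOn
  refine (Complex.differentiableOn_tsum_of_summable_norm
    ((summable_geometric_of_lt_one (norm_nonneg _) hy).mul_left M) hd isOpen_ball
    fun n w hw => hM w (by simpa using (Metric.mem_ball.1 hw).le) y le_rfl n).differentiableAt
    (isOpen_ball.mem_nhds (by simpa using h1)) |>.differentiableWithinAt

lemma differentiableOn_bigFun (hγ : p.q * ‖γ‖ ^ 2 < 1) {r : ℝ}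
    (hr : p.q * r / ‖p.b‖ < 1) (hr0 : 0 ≤ r) :
    DifferentiableOn ℂ (p.bigFun γ) (ball 0 r) := by
  have hρ : 0 ≤ p.q * r / ‖p.b‖ := by have := h.q_pos; positivity
  obtain ⟨M, -, hM⟩ := h.exists_bigTerm_le hγ (norm_nonneg _) hρ
  refine Complex.differentiableOn_tsum_of_summable_norm
    ((summable_geometric_of_lt_one hρ hr).mul_left M) (fun n => ?_) isOpen_ball
    fun n y hy => hM γ le_rfl y ?_ n
  · have hP : Differentiable ℂ fun y : ℂ =>
        qPochInf p.q (p.q ^ 2 * γ / (p.a * p.s) * y * p.q ^ n) :=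
      h.differentiable_poch.comp
        (show Differentiable ℂ fun y : ℂ =>
          p.q ^ 2 * γ / (p.a * p.s) * y * p.q ^ n by fun_prop)
    have h2 : Differentiable ℂ fun y : ℂ => (p.q * y / p.b) ^ n := by fun_prop
    exact ((hP.mul h2).const_mul _).differentiableOn
  · rw [norm_div, norm_mul, norm_of_nonneg h.q_pos.le]
    have := h.q_pos
    have : ‖y‖ < r := by simpa using hy
    gcongr

/-- Uniform asymptotics of `Φ_γ` at infinity. -/
lemma exists_asym_bound {R : ℝ} (hR : p.q * R ^ 2 < 1) (hR0 : 0 ≤ R) :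
    ∃ C > 0, ∃ r > 0, ∀ γ : ℂ, ‖γ‖ ≤ R → ∀ y : ℂ, ‖y‖ < r →
      ‖p.gauge y * p.bigFun γ y - 1‖ ≤ C * ‖y‖ := by
  have hq := h.q_pos
  have hq1 : 0 < 1 - p.q := sub_pos.2 h.q_lt_one
  have hb := norm_pos_iff.2 h.b_ne
  have hc := norm_pos_iff.2 h.c_ne
  have hd := norm_pos_iff.2 h.d_ne
  set r := min ‖p.b‖ (min ‖p.c‖ ‖p.d‖) with hr
  have hr0 : 0 < r := by positivity
  have hsmall : ∀ t : ℂ, 0 < ‖t‖ → r ≤ ‖t‖ → ∀ y ∈ ball (0 : ℂ) r, ‖p.q * y / t‖ ≤ p.q := by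
    intro t ht hrt y hy
    have hy : ‖y‖ < r := by simpa using hy
    rw [norm_div, norm_mul, norm_of_nonneg hq.le, div_le_iff₀ ht]; gcongr
    exact hy.le.trans hrt
  have rb : r ≤ ‖p.b‖ := min_le_left _ _
  have rc : r ≤ ‖p.c‖ := (min_le_right _ _).trans (min_le_left _ _)
  have rd : r ≤ ‖p.d‖ := (min_le_right _ _).trans (min_le_right _ _)
  obtain ⟨M, hM0, hM⟩ := h.exists_bigTerm_le hR hR0 hq.le
  obtain ⟨c₂, hc₂, h₂⟩ := exists_norm_qPoch_ge_of_norm_le h.q_pos h.q_lt_one hq.le h.q_lt_one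
  have hlow : ∀ x : ℂ, ‖x‖ ≤ p.q → c₂ ≤ ‖qPochInf p.q x‖ := fun x hx =>
    ge_of_tendsto' (tendsto_qPoch h.q_pos h.q_lt_one x).norm (h₂ x hx)
  set E := Real.exp (p.q / (1 - p.q))
  set B := E / (c₂ * c₂) * (M * (1 - p.q)⁻¹)
  have hB : 0 < B := by positivity
  refine ⟨(2 * B + 1) / r, by positivity, r, hr0, fun γ hγ y hy => ?_⟩
  have hγ' : p.q * ‖γ‖ ^ 2 < 1 := lt_of_le_of_lt (by gcongr) hR
  have hF0 : p.gauge 0 * p.bigFun γ 0 = 1 := by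
    rw [bigFun, tsum_eq_single 0 (fun n hn => by simp [bigTerm, hn])]
    simp [gauge, bigTerm, bigCoeff, qPochInf_zero]
  have := norm_sub_le_of_differentiableOn (F := fun y => p.gauge y * p.bigFun γ y) (r := r) (M := B)
    ?_ ?_ (y := y) (by simpa using hy)
  · simpa only [hF0] using this
  · have hd : ∀ t : ℂ, Differentiable ℂ fun y : ℂ => qPochInf p.q (p.q * y / t) := fun t =>
      h.differentiable_poch.comp (show Differentiable ℂ fun y : ℂ => p.q * y / t by fun_prop)
    refine DifferentiableOn.mul (DifferentiableOn.div (hd _).differentiableOn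
      ((hd _).mul (hd _)).differentiableOn fun w hw => ?_) (h.differentiableOn_bigFun hγ' ?_ hr0.le)
    · exact mul_ne_zero (norm_pos_iff.1 (hc₂.trans_le (hlow _ (hsmall _ hc rc w hw))))
        (norm_pos_iff.1 (hc₂.trans_le (hlow _ (hsmall _ ‹0 < ‖p.d‖› rd w hw))))
    · rw [div_lt_one hb]
      nlinarith [h.q_lt_one]
  · intro w hw
    have hs : ‖p.bigFun γ w‖ ≤ M * (1 - p.q)⁻¹ := by
      rw [← tsum_geometric_of_lt_one hq.le h.q_lt_one, ← tsum_mul_left]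
      exact tsum_of_norm_bounded
        ((summable_geometric_of_lt_one hq.le h.q_lt_one).mul_left M).hasSum
        (hM γ hγ w (hsmall _ hb rb w hw))
    have hP : ‖qPochInf p.q (p.q * w / p.b)‖ ≤ E :=
      (norm_qPochInf_le h.q_pos h.q_lt_one _).trans (Real.exp_le_exp.2
        (div_le_div_of_nonneg_right (hsmall _ hb rb w hw) hq1.le))
    simp only [gauge]
    rw [norm_mul, norm_div, norm_mul]
    refine mul_le_mul (div_le_div₀ (Real.exp_pos _).le hP (by positivity)
      (mul_le_mul ?_ ?_ hc₂.le (norm_nonneg _))) hs (norm_nonneg _) (by positivity)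
    · exact hlow _ (hsmall _ hc rc w hw)
    · exact hlow _ (hsmall _ hd rd w hw)

end IsReg

/-! ### The connection formula -/

namespace IsReg
variable (h : p.IsReg)
include h

lemma mul_z_ne {t : ℂ} (ht : ∀ i, t * p.pt i ≠ 1) (ε : Bool) (n : ℤ) :
    t * p.z ε ≠ (p.q : ℂ) ^ n := by
  intro e
  apply ht (ε, -n)
  have := zpow_ne_zero n h.q_ne
  simp only [pt]
  push_cast
  rw [← mul_assoc, e, zpow_neg]
  field_simp

lemma theta_z_ne {t : ℂ} (ht : ∀ i, t * p.pt i ≠ 1) (ht0 : t ≠ 0)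
    (ε : Bool) : theta p.q (t * p.z ε) ≠ 0 :=
  theta_ne_zero h.q_pos h.q_lt_one (mul_ne_zero ht0 (mod_cast h.z_ne ε)) (h.mul_z_ne ht ε)

lemma theta_ne (ε : Bool) : theta p.q (p.a * p.z ε) ≠ 0 ∧ theta p.q (p.b * p.z ε) ≠ 0 ∧
    theta p.q (p.c * p.z ε) ≠ 0 ∧ theta p.q (p.d * p.z ε) ≠ 0 :=
  ⟨h.theta_z_ne h.a_pt h.a_ne ε, h.theta_z_ne h.b_pt h.b_ne ε, h.theta_z_ne h.c_pt h.c_ne ε,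
    h.theta_z_ne h.d_pt h.d_ne ε⟩

lemma qPochInf_pt_ne {t : ℂ} (ht : ∀ i, t * p.pt i ≠ 1)
    (i : RqIndex) : qPochInf p.q (t * p.pt i) ≠ 0 :=
  h.poch_ne fun k hk => ht (i.1, i.2 + k) (by
    simp only [pt, zpow_add₀ h.q_pos.ne', zpow_natCast] at hk ⊢
    push_cast at hk ⊢
    linear_combination hk)

lemma coeffB_weight_down (i : RqIndex) :
    p.coeffB (p.pt (down i)) * (p.pt (down i) * p.w (p.pt (down i))) =
      p.coeffA (p.pt i) * (p.pt i * p.w (p.pt i)) := by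
  obtain ⟨ha, hb, hc, hd, hs, hq⟩ := h.ne_zero
  have hx := h.pt_ne i
  have st : ∀ t : ℂ, qPochInf p.q (t * (p.pt i / p.q)) =
      (1 - t * (p.pt i / p.q)) * qPochInf p.q (t * p.pt i) := fun t => by
    rw [qPochInf_step h.q_pos h.q_lt_one]
    congr 2; field_simp
  have c1 := h.qPochInf_pt_ne h.c_pt (down i)
  have d1 := h.qPochInf_pt_ne h.d_pt (down i)
  rw [w, w, h.pt_down] at *
  push_cast at *
  rw [st] at c1 d1
  rw [st p.a, st p.b, st p.c, st p.d]
  obtain ⟨c2, c3⟩ := mul_ne_zero_iff.1 c1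
  obtain ⟨d2, d3⟩ := mul_ne_zero_iff.1 d1
  have e1 : p.coeffB (p.pt i / p.q) = p.s * ((1 - p.c * (p.pt i / p.q)) *
      (1 - p.d * (p.pt i / p.q))) * (p.q ^ 2 / (p.c * p.d * p.pt i ^ 2)) := by
    rw [coeffB]; field_simp; ring
  have e2 : p.coeffA (p.pt i) = p.s⁻¹ * ((1 - p.a * (p.pt i / p.q)) *
      (1 - p.b * (p.pt i / p.q))) * (p.q ^ 2 / (p.a * p.b * p.pt i ^ 2)) := by
    rw [coeffA]; field_simp; ring
  rw [e1, e2, h.d_eq]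
  rw [h.d_eq] at d2 d3
  generalize qPochInf p.q (p.s ^ 2 * (p.a * p.b) / (p.c * p.q) * p.pt i) = X1,
    qPochInf p.q (p.c * p.pt i) = X2,
    (1 - p.s ^ 2 * (p.a * p.b) / (p.c * p.q) * (p.pt i / p.q) : ℂ) = X3,
    (1 - p.c * (p.pt i / p.q) : ℂ) = X4, (1 - p.a * (p.pt i / p.q) : ℂ) = X5,
    (1 - p.b * (p.pt i / p.q) : ℂ) = X6, qPochInf p.q (p.a * p.pt i) = X7,
    qPochInf p.q (p.b * p.pt i) = X8 at *
  clear st e1 e2 c1 d1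
  field_simp

lemma casorati_eq (f g : RqIndex → ℂ) (i : RqIndex) :
    p.casorati f g i = (f i * g (up i) - f (up i) * g i) *
      ((1 - p.q) * p.coeffB (p.pt i) * (p.pt i * p.w (p.pt i))) := by
  have hq := h.one_sub_ne
  have := h.pt_ne i
  rw [casorati, u]
  field_simp

lemma casorati_down {m : ℂ} {i : RqIndex}
    (hf : p.L f i = m * f i) (hg : p.L g i = m * g i) :
    p.casorati f g (down i) = p.casorati f g i := by
  rw [h.casorati_eq, h.casorati_eq, up_down, mul_assoc (1 - p.q : ℂ), h.coeffB_weight_down i]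
  simp only [L] at hf hg
  linear_combination (-g i * hf + f i * hg) * (-(1 - p.q : ℂ) * (p.pt i * p.w (p.pt i)))

lemma casorati_const {m : ℂ} {K : ℤ}
    (hf : ∀ n ≤ K, p.L f (ε, n) = m * f (ε, n)) (hg : ∀ n ≤ K, p.L g (ε, n) = m * g (ε, n))
    (k : ℕ) : p.casorati f g (ε, K - k) = p.casorati f g (ε, K) := by
  induction k with
  | zero => simp
  | succ k ih =>
    rw [← ih, ← h.casorati_down (hf (K - k) (by omega)) (hg (K - k) (by omega)), down]
    congr 2; push_cast; ring

lemma exists_far (r : ℝ) :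
    ∃ K : ℤ, ∀ ε, ∀ n ≤ K, r < |p.pt (ε, n)| := by
  choose N hN using fun ε => h.exists_threshold ε (r := |r| + 1) (by positivity)
  refine ⟨min (N true) (N false) - 1, fun ε n hn => ?_⟩
  have h1 : ¬ N ε ≤ n := by cases ε <;> omega
  rw [← hN, not_lt] at h1
  linarith [le_abs_self r]

end IsReg

lemma IsReg.norm_inv_div (p : Params) (b : ℂ) (i : RqIndex) :
    ‖1 / p.pt i / b‖ = 1 / (|p.pt i| * ‖b‖) := by
  rw [norm_div, norm_div, norm_one, norm_real, norm_eq_abs, div_div]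

lemma IsReg.exists_far_asym (h : p.IsReg) :
    ∃ K : ℤ, ∀ ε, ∀ n ≤ K, ‖1 / p.pt (ε, n) / p.b‖ < 1 := by
  have hb := norm_pos_iff.2 h.b_ne
  obtain ⟨K, hK⟩ := h.exists_far (1 / ‖p.b‖)
  refine ⟨K, fun ε n hn => ?_⟩
  have h1 := hK ε n hn
  have h2 : 0 < |p.pt (ε, n)| := lt_trans (by positivity) h1
  rw [IsReg.norm_inv_div, div_lt_one (by positivity)]
  rwa [div_lt_iff₀ hb] at h1

lemma IsReg.differentiableOn_phiFun (h : p.IsReg) {x : ℂ} (hx : ‖p.b * x‖ < 1) :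
    DifferentiableOn ℂ (fun γ => p.phiFun γ x) {0}ᶜ := by
  intro γ₀ hγ₀
  have hγ₀ : γ₀ ≠ 0 := hγ₀
  obtain ⟨ρ, h1, h2⟩ := exists_between hx
  have hρ := (norm_nonneg _).trans_lt h1
  set R := max ‖p.s * γ₀‖ ‖p.s / γ₀‖ + 1 with hR
  obtain ⟨M, -, hM⟩ := h.phiTerm_le R hρ
  set U : Set ℂ := {γ | γ ≠ 0 ∧ ‖p.s * γ‖ < R ∧ ‖p.s * γ₀‖ < R ∧ ‖p.s‖ < R * ‖γ‖} with hU
  have hUo : IsOpen U := by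
    have i1 : IsOpen {γ : ℂ | γ ≠ 0} := isOpen_ne
    have i2 : IsOpen {γ : ℂ | ‖p.s * γ‖ < R} := isOpen_lt (by fun_prop) (by fun_prop)
    have i3 : IsOpen {γ : ℂ | ‖p.s‖ < R * ‖γ‖} := isOpen_lt (by fun_prop) (by fun_prop)
    exact i1.inter (i2.inter (isOpen_const.inter i3))
  have hγU : γ₀ ∈ U := by
    have l1 : ‖p.s * γ₀‖ < R := (le_max_left _ _).trans_lt (lt_add_one _)
    have l2 : ‖p.s / γ₀‖ < R := (le_max_right _ _).trans_lt (lt_add_one _)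
    refine ⟨hγ₀, l1, l1, ?_⟩
    rwa [norm_div, div_lt_iff₀ (norm_pos_iff.2 hγ₀)] at l2
  have hd : ∀ n, DifferentiableOn ℂ (fun γ => p.phiCoeff γ n * p.phiPoly n x) U := fun n => by
    have q1 : Differentiable ℂ fun γ : ℂ => qPoch p.q (p.s * γ) n :=
      (differentiable_qPoch (q := p.q) n).comp
        (show Differentiable ℂ fun γ : ℂ => p.s * γ by fun_prop)
    have q2 : DifferentiableOn ℂ (fun γ : ℂ => qPoch p.q (p.s / γ) n) U :=
      (differentiable_qPoch (q := p.q) n).comp_differentiableOn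
        (DifferentiableOn.div (by fun_prop) (by fun_prop) fun γ hγ => hγ.1)
    unfold phiCoeff
    exact ((q1.differentiableOn.mul q2).div_const _).mul_const _
  refine ((Complex.differentiableOn_tsum_of_summable_norm
    ((summable_geometric_of_lt_one hρ.le h2).mul_left M) hd hUo
    fun n γ hγ => hM γ hγ.2.1.le ?_ x h1.le n).differentiableAt
    (hUo.mem_nhds hγU)).differentiableWithinAt
  rw [norm_div, div_le_iff₀ (norm_pos_iff.2 hγ.1)]
  exact hγ.2.2.2.le

lemma IsReg.differentiableOn_phi (h : p.IsReg) (i : RqIndex) :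
    DifferentiableOn ℂ (fun γ => p.phi γ i) {0}ᶜ := by
  obtain ⟨ε, n⟩ := i
  have hb := norm_pos_iff.2 h.b_ne
  obtain ⟨N, hN⟩ := h.exists_threshold ε (r := 1 / ‖p.b‖) (by positivity)
  have key : ∀ k : ℕ, ∀ n ≥ N - k, DifferentiableOn ℂ (fun γ => p.phi γ (ε, n)) {0}ᶜ := by
    intro k
    induction k with
    | zero =>
      intro n hn
      have h1 := (norm_mul_pt_lt h.b_ne (ε, n) 1).2 ((hN n).2 (by simpa using hn))
      exact (h.differentiableOn_phiFun h1).congr fun γ hγ => h.phi_eq hγ h1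
    | succ k ih =>
      intro n hn
      have hA := h.coeffA_ne (ε, n + 1)
      have d1 := ih (n + 1) (by push_cast at hn; omega)
      have d2 := ih (n + 1 + 1) (by push_cast at hn; omega)
      have d3 : DifferentiableOn ℂ mu {0}ᶜ := by
        unfold mu
        exact differentiableOn_id.add (differentiableOn_inv.mono fun x hx => hx)
      refine (((((d3.sub_const (p.coeffC (p.pt (ε, n + 1)))).mul d1).sub
        (d2.const_mul (p.coeffB (p.pt (ε, n + 1)))))).div_const
          (p.coeffA (p.pt (ε, n + 1)))).congr fun γ hγ => ?_
      have e := h.L_phi hγ (ε, n + 1)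
      simp only [L, down, up, add_sub_cancel_right] at e
      rw [eq_div_iff hA]
      simp only [Pi.sub_apply, Pi.mul_apply]
      linear_combination e
  exact key (N - n).toNat n (by omega)

/-- The constant in the asymptotics of the weight. -/
def kap (p : Params) (ε : Bool) : ℂ :=
  (1 - p.q) * (p.z ε * (theta p.q (p.a * p.z ε) * theta p.q (p.b * p.z ε) /
    (theta p.q (p.c * p.z ε) * theta p.q (p.d * p.z ε))))

namespace IsReg
variable (h : p.IsReg)
include h

lemma kap_ne (ε : Bool) : p.kap ε ≠ 0 := by
  have hq := h.one_sub_ne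
  have hz := h.z_ne' ε
  obtain ⟨h1, h2, h3, h4⟩ := h.theta_ne ε
  unfold kap
  positivity

lemma tendsto_weight (ε : Bool) :
    Tendsto (fun k : ℕ => p.s ^ (2 * k) *
      ((1 - p.q) * (p.pt (ε, -(k : ℤ)) * p.w (p.pt (ε, -(k : ℤ)))))) atTop (𝓝 (p.kap ε)) := by
  obtain ⟨ha, hb, hc, hd, hs, hq⟩ := h.ne_zero
  have hz := h.z_ne' ε
  have t1 := tendsto_qPochInf_div h.q_pos h.q_lt_one (mul_ne_zero ha hz) (mul_ne_zero hc hz)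
    (h.mul_z_ne h.c_pt ε)
  have t2 := tendsto_qPochInf_div h.q_pos h.q_lt_one (mul_ne_zero hb hz) (mul_ne_zero hd hz)
    (h.mul_z_ne h.d_pt ε)
  have t3 := ((t1.mul t2).const_mul (p.z ε : ℂ)).const_mul (1 - p.q : ℂ)
  rw [kap, ← div_mul_div_comm]
  refine t3.congr fun k => ?_
  have hpt : ∀ t : ℂ, t * p.pt (ε, -(k : ℤ)) = t * p.z ε * p.q ^ (-(k : ℤ)) :=
    fun t => by simp only [pt]; push_cast; ring
  have e1 : p.s ^ (2 * k) * p.pt (ε, -(k : ℤ)) =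
      p.z ε * (((p.a * p.z ε / (p.c * p.z ε)) ^ k)⁻¹ * ((p.b * p.z ε / (p.d * p.z ε)) ^ k)⁻¹) := by
    have hqk : (p.q : ℂ) ^ k ≠ 0 := pow_ne_zero _ hq
    have e2 : p.s ^ 2 = (p.a * p.z ε / (p.c * p.z ε))⁻¹ * (p.b * p.z ε / (p.d * p.z ε))⁻¹ * p.q := by
      field_simp
      linear_combination h.s_sq
    simp only [pt]; push_cast
    rw [pow_mul, e2, mul_pow, mul_pow, zpow_neg, zpow_natCast, inv_pow, inv_pow]; field_simp
  rw [w, hpt, hpt, hpt, hpt]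
  generalize qPochInf p.q (p.a * p.z ε * p.q ^ (-(k : ℤ))) = X1
  generalize qPochInf p.q (p.b * p.z ε * p.q ^ (-(k : ℤ))) = X2
  generalize qPochInf p.q (p.c * p.z ε * p.q ^ (-(k : ℤ))) = X3
  generalize qPochInf p.q (p.d * p.z ε * p.q ^ (-(k : ℤ))) = X4
  generalize (p.a * p.z ε / (p.c * p.z ε) : ℂ) ^ k = Y1,
    (p.b * p.z ε / (p.d * p.z ε) : ℂ) ^ k = Y2 at *
  rw [div_eq_mul_inv, div_eq_mul_inv, div_eq_mul_inv, mul_inv, mul_inv, mul_inv]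
  linear_combination (-(1 - p.q : ℂ) * X1 * X2 * X3⁻¹ * X4⁻¹) * e1

lemma tendsto_inv_pt (ε : Bool) :
    Tendsto (fun k : ℕ => 1 / (p.pt (ε, -(k : ℤ)) : ℂ)) atTop (𝓝 0) := by
  have h1 : Tendsto (fun k : ℕ => 1 / (p.z ε : ℂ) * (p.q : ℂ) ^ k) atTop (𝓝 (1 / (p.z ε : ℂ) * 0)) :=
    (tendsto_pow_atTop_nhds_zero_of_norm_lt_one
      (by rw [norm_of_nonneg h.q_pos.le]; exact h.q_lt_one)).const_mul _
  rw [mul_zero] at h1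
  refine h1.congr fun k => ?_
  simp only [pt, zpow_neg, zpow_natCast]
  push_cast
  field_simp

lemma tendsto_coeffB (ε : Bool) :
    Tendsto (fun k : ℕ => p.coeffB (p.pt (ε, -(k : ℤ)))) atTop (𝓝 p.s) := by
  have t := h.tendsto_inv_pt ε
  have t2 := ((((t.const_mul (1 / p.c)).const_sub 1).const_mul p.s).mul
    ((t.const_mul (1 / p.d)).const_sub 1))
  simp only [mul_zero, sub_zero, mul_one] at t2
  refine t2.congr fun k => ?_
  rw [coeffB, one_div_mul_one_div, one_div_mul_one_div]

/-- The Casorati determinant of two functions with prescribed asymptotics. -/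
lemma tendsto_casorati {α F G : ℂ} (hα : α ≠ 0)
    (hf : Tendsto (fun k : ℕ => ((p.s * α) ^ k)⁻¹ * f (ε, -(k : ℤ))) atTop (𝓝 F))
    (hg : Tendsto (fun k : ℕ => ((p.s * α⁻¹) ^ k)⁻¹ * g (ε, -(k : ℤ))) atTop (𝓝 G)) :
    Tendsto (fun k : ℕ => p.casorati f g (ε, -(k : ℤ))) atTop
      (𝓝 (p.kap ε * (F * G * (α - α⁻¹)))) := by
  have hs := h.s_ne
  rw [← tendsto_add_atTop_iff_nat 1]
  have hf1 := hf.comp (tendsto_add_atTop_nat 1)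
  have hg1 := hg.comp (tendsto_add_atTop_nat 1)
  have hB := (h.tendsto_coeffB ε).comp (tendsto_add_atTop_nat 1)
  have hW := (h.tendsto_weight ε).comp (tendsto_add_atTop_nat 1)
  have T := ((((hf1.mul hg).const_mul α).sub ((hf.mul hg1).const_mul α⁻¹)).mul
    (hB.const_mul p.s⁻¹)).mul hW
  rw [show (α * (F * G) - α⁻¹ * (F * G)) * (p.s⁻¹ * p.s) * p.kap ε =
    p.kap ε * (F * G * (α - α⁻¹)) by rw [inv_mul_cancel₀ hs]; ring] at T
  refine T.congr fun k => ?_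
  have e : up (ε, -((k + 1 : ℕ) : ℤ)) = (ε, -(k : ℤ)) := by simp [up]
  rw [h.casorati_eq, e]
  simp only [Function.comp]
  have n1 : p.s ^ k ≠ 0 := pow_ne_zero _ hs
  have n2 : α ^ k ≠ 0 := pow_ne_zero _ hα
  rw [mul_pow, mul_pow, mul_pow, mul_pow, pow_succ α, pow_succ α⁻¹, inv_pow, pow_succ p.s,
    pow_mul', pow_succ p.s]
  generalize (p.pt (ε, -((k + 1 : ℕ) : ℤ)) * p.w (p.pt (ε, -((k + 1 : ℕ) : ℤ))) : ℂ) = W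
  generalize p.coeffB (p.pt (ε, -((k + 1 : ℕ) : ℤ))) = B
  field_simp

lemma tendsto_asym (ε : Bool) (hγ0 : γ ≠ 0)
    (hγ : p.q * ‖γ‖ ^ 2 < 1) :
    Tendsto (fun k : ℕ => ((p.s * γ) ^ k)⁻¹ * p.asym γ (ε, -(k : ℤ))) atTop (𝓝 1) := by
  obtain ⟨C, -, r, hr, hC⟩ := h.exists_asym_bound hγ (norm_nonneg _)
  have t := (h.tendsto_inv_pt ε).norm
  rw [norm_zero] at t
  rw [tendsto_iff_norm_sub_tendsto_zero]
  have t2 := t.const_mul C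
  rw [mul_zero] at t2
  refine squeeze_zero' (.of_forall fun _ => norm_nonneg _) ?_ t2
  filter_upwards [t.eventually_lt_const hr] with k hk
  have e : ((p.s * γ) ^ k)⁻¹ * p.asym γ (ε, -(k : ℤ)) =
      p.gauge (1 / p.pt (ε, -(k : ℤ))) * p.bigFun γ (1 / p.pt (ε, -(k : ℤ))) := by
    have n1 : (p.s * γ) ^ k ≠ 0 := pow_ne_zero _ (mul_ne_zero h.s_ne hγ0)
    simp only [asym, neg_neg, zpow_natCast]; field_simp
  rw [e]
  exact hC γ le_rfl _ hk

end IsReg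

lemma isPreconnected_punctured_disk (q : ℝ) (hq : 0 < q) :
    IsPreconnected {γ : ℂ | γ ≠ 0 ∧ q * ‖γ‖ ^ 2 < 1} := by
  have e : {γ : ℂ | γ ≠ 0 ∧ q * ‖γ‖ ^ 2 < 1} = Complex.exp '' {w | w.re < -Real.log q / 2} := by
    ext γ
    simp only [Set.mem_ofPred_eq, Set.mem_image]
    have key : ∀ w : ℂ, q * ‖Complex.exp w‖ ^ 2 < 1 ↔ w.re < -Real.log q / 2 := fun w => by
      rw [Complex.norm_exp, ← Real.exp_nat_mul]
      nth_rewrite 1 [← Real.exp_log hq]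
      rw [← Real.exp_add, Real.exp_lt_one_iff]; push_cast
      constructor <;> intro h <;> linarith
    constructor
    · rintro ⟨h1, h2⟩
      exact ⟨Complex.log γ, (key _).1 (by rwa [Complex.exp_log h1]), Complex.exp_log h1⟩
    · rintro ⟨w, h1, rfl⟩
      exact ⟨Complex.exp_ne_zero _, (key _).2 h1⟩
  rw [e]
  refine IsPreconnected.image ?_ _ Complex.continuous_exp.continuousOn
  exact (convex_halfSpace_re_lt _).isPreconnected

/-- The Casorati determinant of `φ_γ` and `Φ_γ`, in closed form. -/
def connFun (p : Params) (ε : Bool) (γ : ℂ) : ℂ :=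
  p.kap ε * (theta p.q (p.b * p.s * γ⁻¹ * p.z ε) / theta p.q (p.b * p.z ε)) *
    (qPochInf p.q (p.s * γ) * qPochInf p.q (p.c * p.q / (p.a * p.s) * γ) *
      qPochInf p.q (p.d * p.q / (p.a * p.s) * γ)) /
    (qPochInf p.q (p.c * p.q / p.a) * qPochInf p.q (p.d * p.q / p.a) *
      (γ * qPochInf p.q (p.q * γ ^ 2)))

lemma IsReg.connFun_eq (h : p.IsReg) (ε : Bool) (hγ0 : γ ≠ 0) (hγ1 : γ ^ 2 ≠ 1) :
    p.connFun ε γ = p.kap ε * (p.dCoef ε γ⁻¹ * 1 * (γ⁻¹ - γ⁻¹⁻¹)) := by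
  have n1 : 1 - γ ^ 2 ≠ 0 := sub_ne_zero.2 hγ1.symm
  rw [connFun, dCoef]
  have e1 : ∀ t u : ℂ, t / (u * γ⁻¹) = t / u * γ := fun t u => by rw [← div_div, div_inv_eq_mul]
  rw [e1, e1, div_inv_eq_mul, inv_pow, one_div, inv_inv, inv_inv,
    qPochInf_step h.q_pos h.q_lt_one (γ ^ 2), mul_comm (γ ^ 2) (p.q : ℂ)]
  generalize qPochInf p.q (p.q * γ ^ 2) = X
  generalize qPochInf p.q (p.c * p.q / (p.a * p.s) * γ) = X1
  generalize qPochInf p.q (p.d * p.q / (p.a * p.s) * γ) = X2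
  generalize qPochInf p.q (p.c * p.q / p.a) = X3
  generalize qPochInf p.q (p.d * p.q / p.a) = X4
  generalize theta p.q (p.b * p.s * γ⁻¹ * p.z ε) / theta p.q (p.b * p.z ε) = X5
  have e2 : γ⁻¹ - γ = (1 - γ ^ 2) / γ := by field_simp
  rw [e2]
  generalize 1 - γ ^ 2 = Y at *
  field_simp

lemma IsReg.casorati_phi_asym (h : p.IsReg) {K : ℤ}
    (hK : ∀ n ≤ K, ‖1 / p.pt (ε, n) / p.b‖ < 1) (hγ0 : γ ≠ 0)
    (hγ : p.q * ‖γ‖ ^ 2 < 1) (hK1 : ∀ n ≤ K + 1, ‖p.q * (1 / p.pt (ε, n)) / p.b‖ < 1) :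
    p.casorati (p.phi γ) (p.asym γ) (ε, K) = p.connFun ε γ := by
  have hq0 := h.q_pos
  set S : Set ℂ := {γ : ℂ | γ ≠ 0 ∧ p.q * ‖γ‖ ^ 2 < 1} with hS
  have hSo : IsOpen S := isOpen_ne.inter (isOpen_lt
    (f := fun γ : ℂ => p.q * ‖γ‖ ^ 2) (g := fun _ => 1) (by fun_prop) continuous_const)
  have hd1 : DifferentiableOn ℂ (fun γ => p.casorati (p.phi γ) (p.asym γ) (ε, K)) S := by
    have p1 : ∀ i, DifferentiableOn ℂ (fun γ => p.phi γ i) S := fun i =>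
      (h.differentiableOn_phi i).mono fun γ hγ => hγ.1
    have p2 : ∀ n ≤ K + 1, DifferentiableOn ℂ (fun γ => p.asym γ (ε, n)) S := fun n hn => by
      unfold asym
      refine DifferentiableOn.mul (DifferentiableOn.zpow (by fun_prop)
        (Or.inl fun γ hγ => mul_ne_zero h.s_ne hγ.1)) (DifferentiableOn.const_mul ?_ _)
      exact (h.differentiableOn_bigFun_left (hK1 n hn)).mono fun γ hγ => hγ.2
    unfold casorati
    exact (((p1 _).mul (p2 (K + 1) le_rfl)).sub ((p1 _).mul (p2 K (by omega)))).mul_const _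
  have hd2 : DifferentiableOn ℂ (p.connFun ε) S := by
    have q1 : ∀ t : ℂ, Differentiable ℂ fun γ : ℂ => qPochInf p.q (t * γ) := fun t =>
      h.differentiable_poch.comp (show Differentiable ℂ fun γ : ℂ => t * γ by fun_prop)
    have q2 : Differentiable ℂ fun γ : ℂ => qPochInf p.q (p.q * γ ^ 2) :=
      h.differentiable_poch.comp (show Differentiable ℂ fun γ : ℂ => p.q * γ ^ 2 by fun_prop)
    have hinv : DifferentiableOn ℂ (fun γ : ℂ => γ⁻¹) S :=
      differentiableOn_inv.mono fun γ hγ => hγ.1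
    have q3 : DifferentiableOn ℂ (fun γ : ℂ => theta p.q (p.b * p.s * γ⁻¹ * p.z ε)) S := by
      unfold theta
      refine (h.differentiable_poch.comp_differentiableOn
        ((hinv.const_mul _).mul_const _)).mul
        (h.differentiable_poch.comp_differentiableOn
        (DifferentiableOn.div (differentiableOn_const _) ((hinv.const_mul _).mul_const _)
          fun γ hγ => ?_))
      have hz := h.z_ne' ε
      simp [h.b_ne, h.s_ne, hγ.1, h.z_ne ε]
    unfold connFun
    refine DifferentiableOn.div ((DifferentiableOn.const_mul (q3.div_const _) _).mul
      ((((q1 _).mul (q1 _)).mul (q1 _)).differentiableOn))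
      ((differentiable_id.mul q2).differentiableOn.const_mul _) fun γ hγ => ?_
    exact mul_ne_zero (mul_ne_zero (h.poch_ne h.ca_ne)
      (h.poch_ne h.da_ne)) (mul_ne_zero hγ.1
      (h.poch_ne (h.qγ_ne hγ.2)))
  -- agreement near `0`
  have hA : 0 < ‖p.d * p.q / (p.a * p.s)‖ := norm_pos_iff.2 (by
    simp [h.d_ne, h.q_pos.ne', h.a_ne, h.s_ne])
  have hbs : 0 < ‖p.b * p.s‖ := norm_pos_iff.2 (by simp [h.b_ne, h.s_ne])
  have hcp := norm_pos_iff.2 h.c_ne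
  have hsmall : ∃ r > 0, ∀ γ : ℂ, γ ≠ 0 → ‖γ‖ < r →
      p.casorati (p.phi γ) (p.asym γ) (ε, K) = p.connFun ε γ := by
    refine ⟨min 1 (min (1 / ‖p.d * p.q / (p.a * p.s)‖) (‖p.b * p.s‖ / ‖p.c‖)), by positivity,
      fun γ h0 hr => ?_⟩
    have r1 : ‖γ‖ < 1 := hr.trans_le (min_le_left _ _)
    have r2 : ‖γ‖ < 1 / ‖p.d * p.q / (p.a * p.s)‖ :=
      hr.trans_le ((min_le_right _ _).trans (min_le_left _ _))
    have r3 : ‖γ‖ < ‖p.b * p.s‖ / ‖p.c‖ := hr.trans_le ((min_le_right _ _).trans (min_le_right _ _))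
    have hγp := norm_pos_iff.2 h0
    have hγq : p.q * ‖γ‖ ^ 2 < 1 := by nlinarith [h.q_lt_one]
    have t1 := h.tendsto_phi ε (γ := γ⁻¹) (by rw [norm_inv]; exact (one_lt_inv₀ hγp).2 r1)
      (by rw [← div_div, div_inv_eq_mul, norm_mul]; rwa [lt_div_iff₀ hA, mul_comm] at r2)
      (by rw [norm_mul, norm_inv, ← div_eq_mul_inv, le_div_iff₀ hγp]
          rw [lt_div_iff₀ hcp] at r3; linarith)
    rw [phi_inv] at t1
    have t2 := h.tendsto_asym ε h0 hγq
    have t3 := h.tendsto_casorati (inv_ne_zero h0) t1 (by rwa [inv_inv])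
    rw [← h.connFun_eq ε h0 (fun e => by
      have := congrArg norm e
      rw [norm_pow, norm_one] at this
      nlinarith)] at t3
    refine tendsto_nhds_unique (tendsto_const_nhds.congr' ?_) t3
    filter_upwards [eventually_ge_atTop (-K).toNat] with k hk
    have := h.casorati_const (K := K) (ε := ε) (fun n _ => h.L_phi h0 (ε, n))
      (fun n hn => h.L_asym h0 hγq (hK n hn)) (K + k).toNat
    rw [← this]
    congr 2
    omega
  obtain ⟨r, hr, hrr⟩ := hsmall
  set γ₀ : ℂ := ((min r 1 / 2 : ℝ) : ℂ) with hγ₀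
  have hm : 0 < min r 1 := by positivity
  have hn0 : ‖γ₀‖ = min r 1 / 2 := by rw [hγ₀, norm_of_nonneg (by positivity)]
  have hn1 : ‖γ₀‖ < r := by rw [hn0]; linarith [min_le_left r 1]
  have hn2 : ‖γ₀‖ < 1 := by rw [hn0]; linarith [min_le_right r 1]
  have hγ₀0 : γ₀ ≠ 0 := norm_pos_iff.1 (by rw [hn0]; positivity)
  have hev : ∀ᶠ γ in 𝓝 γ₀, p.casorati (p.phi γ) (p.asym γ) (ε, K) = p.connFun ε γ := by
    have o1 : ∀ᶠ γ : ℂ in 𝓝 γ₀, ‖γ‖ < r := (continuous_norm.tendsto γ₀).eventually_lt_const hn1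
    filter_upwards [isOpen_ne.mem_nhds hγ₀0, o1] with γ h1 h2 using hrr γ h1 h2
  exact (hd1.analyticOnNhd hSo).eqOn_of_preconnected_of_eventuallyEq (hd2.analyticOnNhd hSo)
    (isPreconnected_punctured_disk p.q hq0)
    (show γ₀ ∈ S from ⟨hγ₀0, by nlinarith [h.q_lt_one, norm_nonneg γ₀]⟩) hev ⟨hγ0, hγ⟩

/-- The connection formula for `φ_γ`. -/
lemma IsReg.exists_phi_eq (h : p.IsReg) :
    ∃ K : ℤ, ∀ ε, ∀ n ≤ K, ∀ γ : ℂ, γ ≠ 0 → γ ^ 2 ≠ 1 → p.q * ‖γ‖ ^ 2 < 1 →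
      p.q * ‖γ⁻¹‖ ^ 2 < 1 →
      p.phi γ (ε, n) = p.dCoef ε γ * p.asym γ (ε, n) + p.dCoef ε γ⁻¹ * p.asym γ⁻¹ (ε, n) := by
  obtain ⟨K, hK⟩ := h.exists_far_asym
  refine ⟨K - 1, fun ε n hn γ h0 h1 h2 h3 => ?_⟩
  have h0' := inv_ne_zero h0
  have h1' : γ⁻¹ ^ 2 ≠ 1 := by rw [inv_pow]; exact fun e => h1 (inv_eq_one.1 e)
  have hmu : mu γ⁻¹ = mu γ := by simp [mu, add_comm]
  have hKε : ∀ m ≤ n, ‖1 / p.pt (ε, m) / p.b‖ < 1 := fun m hm => hK ε m (by omega)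
  have hK1 : ∀ m ≤ n + 1, ‖p.q * (1 / p.pt (ε, m)) / p.b‖ < 1 := fun m hm => by
    have := hK ε m (by omega)
    rw [mul_div_assoc, norm_mul, norm_of_nonneg h.q_pos.le]
    nlinarith [h.q_lt_one, norm_nonneg (1 / p.pt (ε, m) / p.b)]
  have c1 := h.casorati_phi_asym hKε h0 h2 hK1
  have c2 := h.casorati_phi_asym hKε h0' h3 hK1
  rw [phi_inv, h.connFun_eq ε h0' h1'] at c2
  rw [h.connFun_eq ε h0 h1] at c1
  have c3 : p.casorati (p.asym γ) (p.asym γ⁻¹) (ε, n) = p.kap ε * (1 * 1 * (γ - γ⁻¹)) := by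
    have t := h.tendsto_casorati h0 (h.tendsto_asym ε h0 h2) (h.tendsto_asym ε h0' h3)
    refine tendsto_nhds_unique (tendsto_const_nhds.congr' ?_) t
    filter_upwards [eventually_ge_atTop (-n).toNat] with k hk
    have := h.casorati_const (K := n) (ε := ε) (fun m hm => h.L_asym h0 h2 (hKε m hm))
      (fun m hm => by rw [← hmu]; exact h.L_asym h0' h3 (hKε m hm)) (n + k).toNat
    rw [← this]
    congr 2
    omega
  have hk := h.kap_ne ε
  have hγ : γ - γ⁻¹ ≠ 0 := fun e => h1 (by field_simp at e; linear_combination e)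
  have pl : p.phi γ (ε, n) * p.casorati (p.asym γ) (p.asym γ⁻¹) (ε, n) =
      p.asym γ (ε, n) * p.casorati (p.phi γ) (p.asym γ⁻¹) (ε, n) -
      p.asym γ⁻¹ (ε, n) * p.casorati (p.phi γ) (p.asym γ) (ε, n) := by
    simp only [casorati]; ring
  rw [c1, c2, c3] at pl
  simp only [inv_inv] at pl
  refine mul_right_cancel₀ (mul_ne_zero hk hγ) ?_
  linear_combination pl

/-! ### The weight matrix as the inverse of a Gram matrix -/

/-- The Gram-type pairing of connection coefficients. -/
def gram (p : Params) (f g : Bool → ℂ → ℂ) (γ : ℂ) : ℂ :=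
  p.kap true * (f true γ * g true γ⁻¹) - p.kap false * (f false γ * g false γ⁻¹)

/-- The part of the connection coefficient that does not depend on the half line. -/
def dFactor (p : Params) (γ : ℂ) : ℂ :=
  qPochInf p.q (p.s * γ⁻¹) * qPochInf p.q (p.c * p.q / (p.a * p.s) * γ⁻¹) *
      qPochInf p.q (p.d * p.q / (p.a * p.s) * γ⁻¹) /
    (qPochInf p.q (p.c * p.q / p.a) * qPochInf p.q (p.d * p.q / p.a) * qPochInf p.q (γ⁻¹ ^ 2))

lemma dCoef_eq (ε : Bool) (γ : ℂ) :
    p.dCoef ε γ = theta p.q (p.b * p.s * γ * p.z ε) / theta p.q (p.b * p.z ε) * p.dFactor γ := by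
  rw [dCoef, dFactor, mul_div_assoc, inv_pow, one_div, ← div_eq_mul_inv, ← div_eq_mul_inv,
    ← div_eq_mul_inv, div_div, div_div]

lemma dCoef_dagger_eq (ε : Bool) (γ : ℂ) :
    p.dagger.dCoef ε γ =
      theta p.q (p.a * p.s * γ * p.z ε) / theta p.q (p.a * p.z ε) * p.dagger.dFactor γ := by
  rw [dCoef_eq, s_dagger]; rfl

lemma dFactor_dagger_eq (γ : ℂ) :
    p.dagger.dFactor γ = qPochInf p.q (p.s * γ⁻¹) * qPochInf p.q (p.c * p.q / (p.b * p.s) * γ⁻¹) *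
      qPochInf p.q (p.d * p.q / (p.b * p.s) * γ⁻¹) /
    (qPochInf p.q (p.c * p.q / p.b) * qPochInf p.q (p.d * p.q / p.b) * qPochInf p.q (γ⁻¹ ^ 2)) := by
  rw [dFactor, s_dagger]; rfl

lemma IsReg.det_dCoef (h : p.IsReg) (hγ : γ ≠ 0) :
    p.dCoef true γ * p.dagger.dCoef false γ - p.dCoef false γ * p.dagger.dCoef true γ =
      p.dFactor γ * p.dagger.dFactor γ * (p.a * p.z false *
        (theta p.q (p.a * p.b * p.s * γ * p.z true * p.z false) *
        theta p.q (p.z true / p.z false) * (theta p.q (p.b / p.a) * theta p.q (p.s * γ)))) /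
      (theta p.q (p.a * p.z true) * theta p.q (p.a * p.z false) * theta p.q (p.b * p.z true) *
        theta p.q (p.b * p.z false)) := by
  obtain ⟨ha, hb, _, _, hs, _⟩ := h.ne_zero
  have hz1 := h.z_ne' true
  have hz2 := h.z_ne' false
  have key := theta_addition h.q_pos h.q_lt_one (a := p.b * p.s * γ) (b := p.b)
    (z := p.z true) (w := p.z false) (p := p.a * p.b * p.s * γ) (by simp [hb, hs, hγ]) hb hz1 hz2
    (by simp [ha, hb, hs, hγ])
  rw [show p.a * p.b * p.s * γ * p.z true / (p.b * p.s * γ) = p.a * p.z true by field_simp,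
    show p.a * p.b * p.s * γ * p.z false / (p.b * p.s * γ) = p.a * p.z false by field_simp,
    show p.a * p.b * p.s * γ * p.z true / p.b = p.a * p.s * γ * p.z true by field_simp,
    show p.a * p.b * p.s * γ * p.z false / p.b = p.a * p.s * γ * p.z false by field_simp,
    show p.b * p.s * γ * p.b / (p.a * p.b * p.s * γ) = p.b / p.a by field_simp,
    show p.b * p.s * γ / p.b = p.s * γ by field_simp] at key
  rw [dCoef_dagger_eq, dCoef_dagger_eq, dCoef_eq, dCoef_eq]
  obtain ⟨n1, n3, _⟩ := h.theta_ne true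
  obtain ⟨n2, n4, _⟩ := h.theta_ne false
  generalize theta p.q (p.a * p.z true) = A1, theta p.q (p.a * p.z false) = A2,
    theta p.q (p.b * p.z true) = B1, theta p.q (p.b * p.z false) = B2 at *
  rw [← key]
  generalize theta p.q (p.b * p.s * γ * p.z true) = T1
  generalize theta p.q (p.b * p.s * γ * p.z false) = T2
  generalize theta p.q (p.a * p.s * γ * p.z true) = T3
  generalize theta p.q (p.a * p.s * γ * p.z false) = T4
  field_simp

lemma gram_inv (f g : Bool → ℂ → ℂ) (γ : ℂ) : p.gram f g γ⁻¹ = p.gram g f γ := by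
  simp only [gram, inv_inv]; ring

lemma kap_dagger (ε : Bool) : p.dagger.kap ε = p.kap ε := by
  simp only [kap]
  show (1 - p.q : ℂ) * (p.z ε * (theta p.q (p.b * p.z ε) * theta p.q (p.a * p.z ε) / _)) = _
  rw [mul_comm (theta p.q (p.b * p.z ε))]
  rfl

lemma gram_dagger (f g : Bool → ℂ → ℂ) (γ : ℂ) : p.dagger.gram f g γ = p.gram f g γ := by
  simp only [gram, kap_dagger]

/-- The determinant of the Gram matrix. -/
def gramDet (p : Params) (γ : ℂ) : ℂ :=
  p.gram p.dCoef p.dCoef γ * p.gram p.dagger.dCoef p.dagger.dCoef γ -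
    p.gram p.dCoef p.dagger.dCoef γ * p.gram p.dagger.dCoef p.dCoef γ

lemma gramDet_dagger (γ : ℂ) : p.dagger.gramDet γ = p.gramDet γ := by
  have e : p.dagger.dagger = p := rfl
  simp only [gramDet, gram_dagger, e]; ring

lemma gramDet_inv (γ : ℂ) : p.gramDet γ⁻¹ = p.gramDet γ := by
  simp only [gramDet, gram_inv]; ring

lemma gramDet_eq (γ : ℂ) :
    p.gramDet γ = -(p.kap true * p.kap false) *
      (p.dCoef true γ * p.dagger.dCoef false γ - p.dCoef false γ * p.dagger.dCoef true γ) *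
      (p.dCoef true γ⁻¹ * p.dagger.dCoef false γ⁻¹ -
        p.dCoef false γ⁻¹ * p.dagger.dCoef true γ⁻¹) := by
  simp only [gramDet, gram]; ring

/-- The points of the unit circle where the weight matrix is given by the generic formula. -/
structure Good (p : Params) (γ : ℂ) : Prop where
  ne : γ ≠ 0
  sq : γ ^ 2 ≠ 1
  t1 : theta p.q (p.s * γ) ≠ 0
  t2 : theta p.q (p.s * γ⁻¹) ≠ 0
  t3 : theta p.q (p.a * p.b * p.s * γ * p.z true * p.z false) ≠ 0
  t4 : theta p.q (p.a * p.b * p.s * γ⁻¹ * p.z true * p.z false) ≠ 0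
  f1 : p.dFactor γ ≠ 0
  f2 : p.dFactor γ⁻¹ ≠ 0
  f3 : p.dagger.dFactor γ ≠ 0
  f4 : p.dagger.dFactor γ⁻¹ ≠ 0

lemma Good.inv (hγ : p.Good γ) : p.Good γ⁻¹ where
  ne := inv_ne_zero hγ.ne
  sq := by rw [inv_pow]; exact fun e => hγ.sq (inv_eq_one.1 e)
  t1 := hγ.t2
  t2 := by rw [inv_inv]; exact hγ.t1
  t3 := hγ.t4
  t4 := by rw [inv_inv]; exact hγ.t3
  f1 := hγ.f2
  f2 := by rw [inv_inv]; exact hγ.f1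
  f3 := hγ.f4
  f4 := by rw [inv_inv]; exact hγ.f3

lemma Good.dagger (hγ : p.Good γ) : p.dagger.Good γ where
  ne := hγ.ne
  sq := hγ.sq
  t1 := by rw [s_dagger]; exact hγ.t1
  t2 := by rw [s_dagger]; exact hγ.t2
  t3 := by have := hγ.t3; rw [mul_comm p.a] at this; rw [s_dagger]; exact this
  t4 := by have := hγ.t4; rw [mul_comm p.a] at this; rw [s_dagger]; exact this
  f1 := hγ.f3
  f2 := hγ.f4
  f3 := hγ.f1
  f4 := hγ.f2

lemma IsReg.theta_z_div_ne (h : p.IsReg) : theta p.q (p.z true / p.z false) ≠ 0 := by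
  have hz1 := h.z_ne' true
  have hz2 := h.z_ne' false
  refine theta_ne_zero h.q_pos h.q_lt_one (div_ne_zero hz1 hz2) fun n hn => ?_
  have : p.z true / p.z false = p.q ^ n := mod_cast hn
  have h2 : p.z true / p.z false < 0 := div_neg_of_pos_of_neg h.zp_pos h.zm_neg
  rw [this] at h2
  exact absurd h2 (not_lt.2 (zpow_pos h.q_pos n).le)

lemma IsReg.theta_ba_ne (h : p.IsReg) : theta p.q (p.b / p.a) ≠ 0 :=
  theta_ne_zero h.q_pos h.q_lt_one (div_ne_zero h.b_ne h.a_ne) h.dagger.ab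

lemma IsReg.gramDet_ne (h : p.IsReg) (hγ : p.Good γ) : p.gramDet γ ≠ 0 := by
  have ha := h.a_ne
  have hz2 := h.z_ne' false
  obtain ⟨n1, n3, _⟩ := h.theta_ne true
  obtain ⟨n2, n4, _⟩ := h.theta_ne false
  have n5 := h.theta_z_div_ne
  have n6 := h.theta_ba_ne
  have k1 := h.kap_ne true
  have k2 := h.kap_ne false
  rw [gramDet_eq, h.det_dCoef hγ.ne, h.det_dCoef (inv_ne_zero hγ.ne)]
  have := hγ.t1
  have := hγ.t2
  have := hγ.t3
  have := hγ.t4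
  have := hγ.f1
  have := hγ.f2
  have := hγ.f3
  have := hγ.f4
  refine mul_ne_zero (mul_ne_zero (neg_ne_zero.2 (mul_ne_zero k1 k2)) ?_) ?_ <;> positivity

lemma z_true : p.z true = p.zp := by simp [z]

lemma z_false : p.z false = p.zm := by simp [z]

lemma IsReg.theta_div_swap (h : p.IsReg) {x y : ℂ} (hx : x ≠ 0) (hy : y ≠ 0) :
    theta p.q (y / x) = -(y / x) * theta p.q (x / y) := by
  have := theta_inv h.q_pos h.q_lt_one (div_ne_zero hx hy)
  rwa [inv_div] at this

lemma v1_eq (γ : ℂ) : p.v1 γ = (p.dFactor γ * p.dFactor γ⁻¹)⁻¹ *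
    (theta p.q (p.b * p.z true) * theta p.q (p.b * p.z false)) /
    ((1 - p.q) * p.a * p.b * p.z false ^ 2 * p.z true ^ 2 *
      (theta p.q (p.z false / p.z true) * theta p.q (p.z true / p.z false) *
        theta p.q (p.a / p.b) * theta p.q (p.b / p.a))) /
    (theta p.q (p.s * γ) * theta p.q (p.s * γ⁻¹) *
      (theta p.q (p.a * p.b * p.s * γ * p.z true * p.z false) *
        theta p.q (p.a * p.b * p.s * γ⁻¹ * p.z true * p.z false))) *
    (p.z false * (theta p.q (p.a * p.z true) * theta p.q (p.c * p.z true) *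
      theta p.q (p.d * p.z true) * theta p.q (p.b * p.z false) *
      (theta p.q (p.a * p.s * γ * p.z false) * theta p.q (p.a * p.s * γ⁻¹ * p.z false))) -
    p.z true * (theta p.q (p.a * p.z false) * theta p.q (p.c * p.z false) *
      theta p.q (p.d * p.z false) * theta p.q (p.b * p.z true) *
      (theta p.q (p.a * p.s * γ * p.z true) * theta p.q (p.a * p.s * γ⁻¹ * p.z true)))) := by
  simp only [v1, pm, dFactor, inv_inv, one_div, ← inv_pow, z_true, z_false, div_eq_mul_inv _ γ]
  rw [show p.a * p.b * p.s * p.zm * p.zp * γ = p.a * p.b * p.s * γ * p.zp * p.zm by ring,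
    show p.a * p.b * p.s * p.zm * p.zp * γ⁻¹ = p.a * p.b * p.s * γ⁻¹ * p.zp * p.zm by ring,
    show p.a * p.s * p.zp * γ = p.a * p.s * γ * p.zp by ring,
    show p.a * p.s * p.zp * γ⁻¹ = p.a * p.s * γ⁻¹ * p.zp by ring,
    show p.a * p.s * p.zm * γ = p.a * p.s * γ * p.zm by ring,
    show p.a * p.s * p.zm * γ⁻¹ = p.a * p.s * γ⁻¹ * p.zm by ring]
  congr 1
  simp only [div_eq_mul_inv, mul_inv, inv_inv, mul_pow]
  ring

lemma IsReg.v1_mul_gramDet (h : p.IsReg) (hγ : p.Good γ) :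
    p.v1 γ * p.gramDet γ = p.gram p.dagger.dCoef p.dagger.dCoef γ := by
  obtain ⟨ha, hb, _, _, hs, _⟩ := h.ne_zero
  have hz1 := h.z_ne' true
  have hz2 := h.z_ne' false
  have hq1 := h.one_sub_ne
  obtain ⟨n1, n3, n7, n9⟩ := h.theta_ne true
  obtain ⟨n2, n4, n8, n10⟩ := h.theta_ne false
  have n5 := h.theta_z_div_ne
  have n6 := h.theta_ba_ne
  have g1 := hγ.t1
  have g2 := hγ.t2
  have g3 := hγ.t3
  have g4 := hγ.t4
  have f1 := hγ.f1
  have f2 := hγ.f2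
  rw [gramDet_eq, h.det_dCoef hγ.ne, h.det_dCoef (inv_ne_zero hγ.ne), gram, dCoef_dagger_eq,
    dCoef_dagger_eq, dCoef_dagger_eq, dCoef_dagger_eq, v1_eq, h.theta_div_swap hz1 hz2,
    h.theta_div_swap hb ha, kap, kap]
  generalize theta p.q (p.z true / p.z false) = Z, theta p.q (p.b / p.a) = W,
    theta p.q (p.a * p.z true) = A1, theta p.q (p.a * p.z false) = A2,
    theta p.q (p.b * p.z true) = B1, theta p.q (p.b * p.z false) = B2,
    theta p.q (p.c * p.z true) = C1, theta p.q (p.c * p.z false) = C2,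
    theta p.q (p.d * p.z true) = D1, theta p.q (p.d * p.z false) = D2,
    theta p.q (p.s * γ) = S1, theta p.q (p.s * γ⁻¹) = S2,
    theta p.q (p.a * p.b * p.s * γ * p.z true * p.z false) = Y1,
    theta p.q (p.a * p.b * p.s * γ⁻¹ * p.z true * p.z false) = Y2,
    theta p.q (p.a * p.s * γ * p.z true) = T1, theta p.q (p.a * p.s * γ * p.z false) = T2,
    theta p.q (p.a * p.s * γ⁻¹ * p.z true) = T3, theta p.q (p.a * p.s * γ⁻¹ * p.z false) = T4,
    p.dFactor γ = F1, p.dFactor γ⁻¹ = F2, p.dagger.dFactor γ = F3, p.dagger.dFactor γ⁻¹ = F4 at *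
  generalize (p.z true : ℂ) = z1, (p.z false : ℂ) = z2, (1 - p.q : ℂ) = q1, p.a = a, p.b = b at *
  clear hγ h
  field_simp
  ring

lemma IsReg.gram_cross (h : p.IsReg) (hγ : γ ≠ 0) :
    p.gram p.dCoef p.dagger.dCoef γ =
      (1 - p.q) * p.dFactor γ * p.dagger.dFactor γ⁻¹ /
        (theta p.q (p.c * p.z true) * theta p.q (p.c * p.z false) * theta p.q (p.d * p.z true) *
          theta p.q (p.d * p.z false)) *
      (-(p.z false) * (theta p.q (p.c * p.d * p.z true * p.z false) *
        theta p.q (p.z true / p.z false)) *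
        (theta p.q (p.b * p.s * γ / p.d) * theta p.q (p.b * p.s * γ / p.c))) := by
  obtain ⟨ha, hb, hc, hd, hs, hq⟩ := h.ne_zero
  have hz1 := h.z_ne' true
  have hz2 := h.z_ne' false
  obtain ⟨n1, n3, n7, n9⟩ := h.theta_ne true
  obtain ⟨n2, n4, n8, n10⟩ := h.theta_ne false
  have key := theta_addition h.q_pos h.q_lt_one (a := p.b * p.s * γ) (b := p.c)
    (z := p.z true) (w := p.z false) (p := p.c * p.d * p.q) (by simp [hb, hs, hγ]) hc hz1 hz2
    (by simp [hc, hd, h.q_pos.ne'])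
  have e1 : ∀ z : ℂ, p.c * p.d * p.q * z / (p.b * p.s * γ) = p.a * p.s * γ⁻¹ * z := fun z => by
    rw [← h.s_sq]; field_simp
  have e2 : ∀ z : ℂ, p.c * p.d * p.q * z / p.c = p.q * (p.d * z) := fun z => by field_simp
  have e3 : p.b * p.s * γ / p.d = p.q * (p.b * p.s * γ * p.c / (p.c * p.d * p.q)) := by field_simp
  have e4 : p.c * p.d * p.q * p.z true * p.z false =
    p.q * (p.c * p.d * p.z true * p.z false) := by ring
  have hx : p.b * p.s * γ * p.c / (p.c * p.d * p.q) ≠ 0 := by simp [hb, hs, hγ, hc, hd, h.q_pos.ne']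
  rw [e1, e1, e2, e2, e4, theta_mul_q h.q_pos h.q_lt_one (mul_ne_zero hd hz1),
    theta_mul_q h.q_pos h.q_lt_one (mul_ne_zero hd hz2), theta_mul_q h.q_pos h.q_lt_one
      (by simp [hc, hd, h.z_ne])] at key
  rw [gram, dCoef_dagger_eq, dCoef_dagger_eq, dCoef_eq, dCoef_eq, e3,
    theta_mul_q h.q_pos h.q_lt_one hx, kap, kap]
  generalize theta p.q (p.b * p.s * γ * p.c / (p.c * p.d * p.q)) = X,
    theta p.q (p.b * p.s * γ / p.c) = X', theta p.q (p.z true / p.z false) = Z,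
    theta p.q (p.a * p.z true) = A1, theta p.q (p.a * p.z false) = A2,
    theta p.q (p.b * p.z true) = B1, theta p.q (p.b * p.z false) = B2,
    theta p.q (p.c * p.z true) = C1, theta p.q (p.c * p.z false) = C2,
    theta p.q (p.d * p.z true) = D1, theta p.q (p.d * p.z false) = D2,
    theta p.q (p.b * p.s * γ * p.z true) = T1, theta p.q (p.b * p.s * γ * p.z false) = T2,
    theta p.q (p.a * p.s * γ⁻¹ * p.z true) = T3, theta p.q (p.a * p.s * γ⁻¹ * p.z false) = T4,
    theta p.q (p.c * p.d * p.z true * p.z false) = Y, p.dFactor γ = F1,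
    p.dagger.dFactor γ⁻¹ = F4 at *
  have sq := h.s_sq
  generalize (p.z true : ℂ) = z1, (p.z false : ℂ) = z2, (1 - p.q : ℂ) = q1, p.a = a, p.b = b,
    p.s = s, p.c = c, p.d = d at *
  generalize (p.q : ℂ) = q at *
  have key2 : z1 * T1 * T3 * C2 * D2 - z2 * T2 * T4 * C1 * D1 =
      a * s * γ⁻¹ * z2 / c * (Y * Z * (X * X')) := by
    have : z1 * T1 * T3 * C2 * D2 - z2 * T2 * T4 * C1 * D1 = -(d * z1 * z2) *
      (T1 * T3 * (C2 * (-(d * z2)⁻¹ * D2)) - T2 * T4 * (C1 * (-(d * z1)⁻¹ * D1))) := by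
      field_simp; ring
    rw [this, key]; field_simp
  have e5 : z1 * (A1 * B1 / (C1 * D1)) * (T1 / B1 * F1 * (T3 / A1 * F4)) -
      z2 * (A2 * B2 / (C2 * D2)) * (T2 / B2 * F1 * (T4 / A2 * F4)) =
      F1 * F4 / (C1 * C2 * D1 * D2) * (z1 * T1 * T3 * C2 * D2 - z2 * T2 * T4 * C1 * D1) := by
    field_simp
  rw [mul_assoc q1, mul_assoc q1, ← mul_sub, e5, key2]
  clear h e1 e2 e3 e4 hx e5 key key2
  field_simp
  linear_combination q1 * F1 * F4 * Y * Z * X * X' * sq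

lemma IsReg.theta_mul_theta (h : p.IsReg) (hγ : p.Good γ) :
    theta p.q (p.b * p.s * γ / p.d) * theta p.q (p.b * p.s * γ / p.c) =
      p.dFactor γ⁻¹ * p.dagger.dFactor γ *
      (qPochInf p.q (p.c * p.q / p.a) * qPochInf p.q (p.d * p.q / p.a) *
        qPochInf p.q (p.c * p.q / p.b) * qPochInf p.q (p.d * p.q / p.b)) *
      ((qPochInf p.q (γ ^ 2) * qPochInf p.q (γ⁻¹ ^ 2)) /
        (qPochInf p.q (p.s * γ) * qPochInf p.q (p.s * γ⁻¹))) := by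
  obtain ⟨ha, hb, hc, hd, hs, hq⟩ := h.ne_zero
  have h0 := hγ.ne
  have n1 := h.poch_ne h.ca_ne
  have n2 := h.poch_ne h.da_ne
  have n3 : qPochInf p.q (p.c * p.q / p.b) ≠ 0 := h.poch_ne h.dagger.ca_ne
  have n4 : qPochInf p.q (p.d * p.q / p.b) ≠ 0 := h.poch_ne h.dagger.da_ne
  have f1 := hγ.f1
  have f2 := hγ.f2
  have e1 : p.b * p.s * γ / p.d = p.c * p.q / (p.a * p.s) * γ := by
    field_simp; linear_combination h.s_sq
  have e2 : p.b * p.s * γ / p.c = p.d * p.q / (p.a * p.s) * γ := by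
    field_simp; linear_combination h.s_sq
  have e3 : p.q / (p.b * p.s * γ / p.d) = p.d * p.q / (p.b * p.s) * γ⁻¹ := by field_simp
  have e4 : p.q / (p.b * p.s * γ / p.c) = p.c * p.q / (p.b * p.s) * γ⁻¹ := by field_simp
  rw [theta, theta, e3, e4, e1, e2, dFactor_dagger_eq, dFactor, inv_inv]
  rw [dFactor] at f1 f2
  rw [inv_inv] at f2
  simp only [div_ne_zero_iff, mul_ne_zero_iff] at f1 f2
  obtain ⟨⟨⟨x1, -⟩, -⟩, -, x2⟩ := f1
  obtain ⟨⟨⟨x3, -⟩, -⟩, -, x4⟩ := f2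
  generalize qPochInf p.q (p.c * p.q / p.a) = Q1, qPochInf p.q (p.d * p.q / p.a) = Q2,
    qPochInf p.q (p.c * p.q / p.b) = Q3, qPochInf p.q (p.d * p.q / p.b) = Q4,
    qPochInf p.q (p.s * γ⁻¹) = Q5, qPochInf p.q (p.s * γ) = Q6, qPochInf p.q (γ⁻¹ ^ 2) = Q7,
    qPochInf p.q (γ ^ 2) = Q8 at *
  generalize qPochInf p.q (p.c * p.q / (p.a * p.s) * γ) = R1
  generalize qPochInf p.q (p.d * p.q / (p.a * p.s) * γ) = R2
  generalize qPochInf p.q (p.c * p.q / (p.b * p.s) * γ⁻¹) = R3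
  generalize qPochInf p.q (p.d * p.q / (p.b * p.s) * γ⁻¹) = R4
  field_simp

lemma v2_eq (γ : ℂ) : p.v2 γ =
    theta p.q (p.a * p.z true) * theta p.q (p.a * p.z false) * theta p.q (p.b * p.z true) *
      theta p.q (p.b * p.z false) * theta p.q (p.c * p.d * p.z true * p.z false) /
    (p.a * p.b * p.z false ^ 2 * p.z true * (1 - p.q) * (theta p.q (p.z true / p.z false) *
      theta p.q (p.a / p.b) * theta p.q (p.b / p.a))) /
    (theta p.q (p.s * γ) * theta p.q (p.s * γ⁻¹) *
      (theta p.q (p.a * p.b * p.s * γ * p.z true * p.z false) *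
        theta p.q (p.a * p.b * p.s * γ⁻¹ * p.z true * p.z false))) *
    ((qPochInf p.q (p.c * p.q / p.a) * qPochInf p.q (p.d * p.q / p.a) *
        qPochInf p.q (p.c * p.q / p.b) * qPochInf p.q (p.d * p.q / p.b)) *
      ((qPochInf p.q (γ ^ 2) * qPochInf p.q (γ⁻¹ ^ 2)) /
        (qPochInf p.q (p.s * γ) * qPochInf p.q (p.s * γ⁻¹)))) := by
  simp only [v2, pm, one_div, ← inv_pow, z_true, z_false, div_eq_mul_inv _ γ]
  rw [show p.a * p.b * p.s * p.zm * p.zp * γ = p.a * p.b * p.s * γ * p.zp * p.zm by ring,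
    show p.a * p.b * p.s * p.zm * p.zp * γ⁻¹ = p.a * p.b * p.s * γ⁻¹ * p.zp * p.zm by ring,
    show p.c * p.d * p.zm * p.zp = p.c * p.d * p.zp * p.zm by ring]
  simp only [div_eq_mul_inv, mul_inv]
  ring

lemma IsReg.v2_mul_gramDet (h : p.IsReg) (hγ : p.Good γ) :
    p.v2 γ * p.gramDet γ = -p.gram p.dCoef p.dagger.dCoef γ := by
  obtain ⟨ha, hb, _, _, hs, _⟩ := h.ne_zero
  have hz1 := h.z_ne' true
  have hz2 := h.z_ne' false
  have hq1 := h.one_sub_ne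
  obtain ⟨n1, n3, n7, n9⟩ := h.theta_ne true
  obtain ⟨n2, n4, n8, n10⟩ := h.theta_ne false
  have n5 := h.theta_z_div_ne
  have n6 := h.theta_ba_ne
  have g1 := hγ.t1
  have g2 := hγ.t2
  have g3 := hγ.t3
  have g4 := hγ.t4
  rw [h.gram_cross hγ.ne, h.theta_mul_theta hγ, gramDet_eq, h.det_dCoef hγ.ne,
    h.det_dCoef (inv_ne_zero hγ.ne), v2_eq, h.theta_div_swap hb ha, kap, kap]
  generalize (qPochInf p.q (p.c * p.q / p.a) * qPochInf p.q (p.d * p.q / p.a) *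
        qPochInf p.q (p.c * p.q / p.b) * qPochInf p.q (p.d * p.q / p.b)) = V1
  generalize (qPochInf p.q (γ ^ 2) * qPochInf p.q (γ⁻¹ ^ 2)) /
        (qPochInf p.q (p.s * γ) * qPochInf p.q (p.s * γ⁻¹)) = V2
  generalize theta p.q (p.z true / p.z false) = Z, theta p.q (p.b / p.a) = W,
    theta p.q (p.a * p.z true) = A1, theta p.q (p.a * p.z false) = A2,
    theta p.q (p.b * p.z true) = B1, theta p.q (p.b * p.z false) = B2,
    theta p.q (p.c * p.z true) = C1, theta p.q (p.c * p.z false) = C2,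
    theta p.q (p.d * p.z true) = D1, theta p.q (p.d * p.z false) = D2,
    theta p.q (p.s * γ) = S1, theta p.q (p.s * γ⁻¹) = S2,
    theta p.q (p.a * p.b * p.s * γ * p.z true * p.z false) = Y1,
    theta p.q (p.a * p.b * p.s * γ⁻¹ * p.z true * p.z false) = Y2,
    theta p.q (p.c * p.d * p.z true * p.z false) = Y3, p.dFactor γ = F1, p.dFactor γ⁻¹ = F2,
    p.dagger.dFactor γ = F3, p.dagger.dFactor γ⁻¹ = F4 at *
  generalize (p.z true : ℂ) = z1, (p.z false : ℂ) = z2, (1 - p.q : ℂ) = q1, p.a = a, p.b = b at *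
  clear hγ h
  field_simp

lemma v2_inv (γ : ℂ) : p.v2 γ⁻¹ = p.v2 γ := by
  rw [v2_eq, v2_eq, inv_inv]; ring

lemma v1_inv (γ : ℂ) : p.v1 γ⁻¹ = p.v1 γ := by
  rw [v1_eq, v1_eq, inv_inv]; ring

/-- The symmetric weight matrix. -/
def wVec (p : Params) (γ : ℂ) (y : ℂ²) : ℂ² :=
  ![p.v1 γ * y 0 + p.v2 γ * y 1, p.v2 γ * y 0 + p.dagger.v1 γ * y 1]

/-- The weight matrix inverts the Gram matrix. -/
lemma IsReg.gram_mul_wVec (h : p.IsReg) (hγ : p.Good γ) (y : ℂ²) :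
    p.gram p.dCoef p.dCoef γ * p.wVec γ y 0 + p.gram p.dCoef p.dagger.dCoef γ * p.wVec γ y 1 = y 0 ∧
    p.gram p.dagger.dCoef p.dCoef γ * p.wVec γ y 0 +
      p.gram p.dagger.dCoef p.dagger.dCoef γ * p.wVec γ y 1 = y 1 := by
  have e1 := h.v1_mul_gramDet hγ
  have e2 := h.v2_mul_gramDet hγ
  have e3 := h.v2_mul_gramDet hγ.inv
  have e4 := h.dagger.v1_mul_gramDet hγ.dagger
  rw [v2_inv, gramDet_inv, gram_inv] at e3
  rw [gramDet_dagger, gram_dagger] at e4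
  change p.dagger.v1 γ * p.gramDet γ = p.gram p.dCoef p.dCoef γ at e4
  have hne := h.gramDet_ne hγ
  have ed : p.gramDet γ = p.gram p.dCoef p.dCoef γ * p.gram p.dagger.dCoef p.dagger.dCoef γ -
    p.gram p.dCoef p.dagger.dCoef γ * p.gram p.dagger.dCoef p.dCoef γ := rfl
  have hsym : p.gram p.dagger.dCoef p.dCoef γ = p.gram p.dCoef p.dagger.dCoef γ :=
    neg_injective (e3.symm.trans e2)
  rw [hsym] at ed ⊢
  simp only [wVec, Matrix.cons_val_zero, Matrix.cons_val_one]
  constructor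
  · apply mul_right_cancel₀ hne
    linear_combination (p.gram p.dCoef p.dCoef γ * y 0) * e1 +
      (p.gram p.dCoef p.dCoef γ * y 1 + p.gram p.dCoef p.dagger.dCoef γ * y 0) * e2 +
      p.gram p.dCoef p.dagger.dCoef γ * y 1 * e4 - y 0 * ed
  · apply mul_right_cancel₀ hne
    linear_combination (p.gram p.dCoef p.dagger.dCoef γ * y 0) * e1 +
      (p.gram p.dCoef p.dagger.dCoef γ * y 1 + p.gram p.dagger.dCoef p.dagger.dCoef γ * y 0) * e2 +
      p.gram p.dagger.dCoef p.dagger.dCoef γ * y 1 * e4 - y 1 * ed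

/-! ### Positivity and reality -/

lemma PairDomain.pos {α β : ℂ} (h : p.PairDomain α β) (hr : p.IsReg)
    (hα : ∀ i, α * p.pt i ≠ 1) (i : RqIndex) :
    ∃ r : ℝ, 0 < r ∧ (1 - α * p.pt i) * (1 - β * p.pt i) = r := by
  have hq := hr.q_pos
  have hq1 := hr.q_lt_one
  have hzp := hr.zp_pos
  have hzm := hr.zm_neg
  have anti : ∀ {m n : ℤ}, m ≤ n → p.q ^ n ≤ p.q ^ m := fun hmn =>
    zpow_le_zpow_right_of_le_one₀ hq hq1.le hmn
  have hx : ∀ n, p.pt (true, n) = p.zp * p.q ^ n := fun n => by simp [pt, z]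
  have hx' : ∀ n, p.pt (false, n) = p.zm * p.q ^ n := fun n => by simp [pt, z]
  rcases h.2 with h | ⟨r, t, rfl, rfl, k, h1, h2, h3⟩ | ⟨r, t, rfl, rfl, k, h1, h2, h3⟩
  · refine ⟨‖1 - α * p.pt i‖ ^ 2, by
      have := norm_pos_iff.2 (sub_ne_zero.2 (hα i).symm); positivity, ?_⟩
    rw [← normSq_eq_norm_sq, ← Complex.mul_conj]
    simp [h]
  · have ht : 0 < t := inv_pos.1 (lt_trans (by positivity) h1)
    have hr : 0 < r := inv_pos.1 ((inv_pos.2 ht).trans h2)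
    refine ⟨(1 - r * p.pt i) * (1 - t * p.pt i), ?_, by push_cast; ring⟩
    obtain ⟨ε, n⟩ := i
    cases ε
    · have : p.pt (false, n) < 0 := by rw [hx']; exact mul_neg_of_neg_of_pos hzm (by positivity)
      have e1 : 0 < 1 - r * p.pt (false, n) := by nlinarith
      have e2 : 0 < 1 - t * p.pt (false, n) := by nlinarith
      positivity
    · rcases le_or_gt k n with hn | hn
      · have b1 : p.pt (true, n) < t⁻¹ := by
          rw [hx]; exact lt_of_le_of_lt (mul_le_mul_of_nonneg_left (anti hn) hzp.le) h1
        have e2 : 0 < 1 - t * p.pt (true, n) := by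
          have := (mul_lt_mul_iff_right₀ ht).2 b1
          rw [mul_inv_cancel₀ ht.ne'] at this; linarith
        have e1 : 0 < 1 - r * p.pt (true, n) := by
          have := (mul_lt_mul_iff_right₀ hr).2 (b1.trans h2)
          rw [mul_inv_cancel₀ hr.ne'] at this; linarith
        positivity
      · have b1 : r⁻¹ < p.pt (true, n) := by
          rw [hx]; exact lt_of_lt_of_le h3 (mul_le_mul_of_nonneg_left (anti (by omega)) hzp.le)
        have e1 : 1 - r * p.pt (true, n) < 0 := by
          have := (mul_lt_mul_iff_right₀ hr).2 b1
          rw [mul_inv_cancel₀ hr.ne'] at this; linarith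
        have e2 : 1 - t * p.pt (true, n) < 0 := by
          have := (mul_lt_mul_iff_right₀ ht).2 (h2.trans b1)
          rw [mul_inv_cancel₀ ht.ne'] at this; linarith
        exact mul_pos_of_neg_of_neg e1 e2
  · have ht : t < 0 := inv_lt_zero.1 (h3.trans (mul_neg_of_neg_of_pos hzm (by positivity)))
    have hr : r < 0 := inv_lt_zero.1 (h2.trans (inv_lt_zero.2 ht))
    refine ⟨(1 - r * p.pt i) * (1 - t * p.pt i), ?_, by push_cast; ring⟩
    obtain ⟨ε, n⟩ := i
    cases ε
    · rcases le_or_gt k n with hn | hn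
      · have b1 : t⁻¹ < p.pt (false, n) := by
          rw [hx']; exact lt_of_lt_of_le h3 (mul_le_mul_of_nonpos_left (anti hn) hzm.le)
        have e2 : 0 < 1 - t * p.pt (false, n) := by
          have := mul_lt_mul_of_neg_left b1 ht
          rw [mul_inv_cancel₀ ht.ne] at this; linarith
        have e1 : 0 < 1 - r * p.pt (false, n) := by
          have := mul_lt_mul_of_neg_left (h2.trans b1) hr
          rw [mul_inv_cancel₀ hr.ne] at this; linarith
        positivity
      · have b1 : p.pt (false, n) < r⁻¹ := by
          rw [hx']; exact lt_of_le_of_lt (mul_le_mul_of_nonpos_left (anti (by omega)) hzm.le) h1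
        have e1 : 1 - r * p.pt (false, n) < 0 := by
          have := mul_lt_mul_of_neg_left b1 hr
          rw [mul_inv_cancel₀ hr.ne] at this; linarith
        have e2 : 1 - t * p.pt (false, n) < 0 := by
          have := mul_lt_mul_of_neg_left (b1.trans h2) ht
          rw [mul_inv_cancel₀ ht.ne] at this; linarith
        exact mul_pos_of_neg_of_neg e1 e2
    · have : 0 < p.pt (true, n) := by rw [hx]; positivity
      have e1 : 0 < 1 - r * p.pt (true, n) := by nlinarith
      have e2 : 0 < 1 - t * p.pt (true, n) := by nlinarith
      positivity

lemma PairDomain.qPochInf_pos {α β : ℂ} (h : p.PairDomain α β) (hr : p.IsReg)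
    (hα : ∀ i, α * p.pt i ≠ 1) (hβ : ∀ i, β * p.pt i ≠ 1) (i : RqIndex) :
    ∃ r : ℝ, 0 < r ∧ qPochInf p.q (α * p.pt i) * qPochInf p.q (β * p.pt i) = r := by
  choose ρ h1 h2 using h.pos hr hα
  have hlim := (tendsto_qPoch hr.q_pos hr.q_lt_one (α * p.pt i)).mul
    (tendsto_qPoch hr.q_pos hr.q_lt_one (β * p.pt i))
  have e : ∀ n, qPoch p.q (α * p.pt i) n * qPoch p.q (β * p.pt i) n =
      ((∏ k ∈ range n, ρ (i.1, i.2 + k) : ℝ) : ℂ) := fun n => by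
    rw [qPoch, qPoch, ← Finset.prod_mul_distrib, Complex.ofReal_prod]
    refine prod_congr rfl fun k _ => ?_
    rw [← h2]
    simp only [pt, zpow_add₀ hr.q_pos.ne', zpow_natCast]
    push_cast; ring
  simp_rw [e] at hlim
  set P := qPochInf p.q (α * p.pt i) * qPochInf p.q (β * p.pt i)
  have hre := (continuous_re.tendsto _).comp hlim
  have him := (Complex.continuous_im.tendsto _).comp hlim
  simp only [Function.comp_def, ofReal_re, Complex.ofReal_im] at hre him
  have hP : P = (P.re : ℂ) := Complex.ext rfl (tendsto_nhds_unique him tendsto_const_nhds)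
  have hne : P ≠ 0 := mul_ne_zero (hr.qPochInf_pt_ne hα i) (hr.qPochInf_pt_ne hβ i)
  refine ⟨P.re, lt_of_le_of_ne (ge_of_tendsto' hre fun n => Finset.prod_nonneg fun _ _ =>
    (h1 _).le) fun e => hne (by rw [hP, ← e]; simp), hP⟩

lemma IsGeneric.w_pos (h : p.IsGeneric) (i : RqIndex) : ∃ r : ℝ, 0 < r ∧ p.w (p.pt i) = r := by
  have hr := h.isRegular
  obtain ⟨r, h1, h2⟩ := h.ab.qPochInf_pos hr hr.a_pt hr.b_pt i
  obtain ⟨t, h3, h4⟩ := h.cd.qPochInf_pos hr hr.c_pt hr.d_pt i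
  exact ⟨r / t, by positivity, by rw [w, h2, h4]; push_cast; rfl⟩

/-- The sign of a half line. -/
def sgn (ε : Bool) : ℝ := if ε then 1 else -1

/-- The mass of a point of `ℝ_q` for the measure `w(x) d_q x`. -/
def mass (p : Params) (i : RqIndex) : ℝ := (1 - p.q) * |p.pt i| * ‖p.w (p.pt i)‖

lemma IsGeneric.mass_pos (h : p.IsGeneric) (i : RqIndex) : 0 < p.mass i := by
  obtain ⟨r, h1, h2⟩ := h.w_pos i
  have hx : p.pt i ≠ 0 := mod_cast h.isRegular.pt_ne i
  have hq := sub_pos.2 h.q_lt_one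
  rw [mass, h2, norm_of_nonneg h1.le]
  positivity

lemma sgn_mul_self (ε : Bool) : sgn ε * sgn ε = 1 := by cases ε <;> simp [sgn]

namespace IsGeneric
variable (h : p.IsGeneric)
include h

lemma sgn_pt (i : RqIndex) : p.pt i = sgn i.1 * |p.pt i| := by
  have := zpow_pos h.q_pos i.2
  have h1 := h.zp_pos
  have h2 := h.zm_neg
  obtain ⟨ε, n⟩ := i
  cases ε
  · rw [abs_of_neg (by simp only [pt, z]; simpa using mul_neg_of_neg_of_pos h2 this)]
    simp [sgn]
  · rw [abs_of_pos (by simp only [pt, z]; simpa using mul_pos h1 this)]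
    simp [sgn]

lemma weight_eq (i : RqIndex) :
    (1 - p.q) * (p.pt i * p.w (p.pt i)) = ((sgn i.1 * p.mass i : ℝ) : ℂ) := by
  obtain ⟨r, h1, h2⟩ := h.w_pos i
  rw [mass, h2, norm_of_nonneg h1.le]
  nth_rewrite 1 [h.sgn_pt i]
  push_cast; ring

lemma kap_eq (ε : Bool) : p.kap ε = ((sgn ε * ‖p.kap ε‖ : ℝ) : ℂ) := by
  have hr := h.isRegular
  have t := hr.tendsto_weight ε
  obtain ⟨s, h3, h4⟩ := hr.s_pos
  have t2 := t.const_mul (sgn ε : ℂ)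
  have e : ∀ k : ℕ, (sgn ε : ℂ) * (p.s ^ (2 * k) *
      ((1 - p.q) * (p.pt (ε, -(k : ℤ)) * p.w (p.pt (ε, -(k : ℤ)))))) =
      ((s ^ (2 * k) * p.mass (ε, -(k : ℤ)) : ℝ) : ℂ) := fun k => by
    rw [h.weight_eq, h4]
    have := sgn_mul_self ε
    have this : (sgn ε : ℂ) * sgn ε = 1 := mod_cast this
    push_cast
    linear_combination (s ^ (2 * k) * p.mass (ε, -(k : ℤ)) : ℂ) * this
  simp_rw [e] at t2
  have hre := (continuous_re.tendsto _).comp t2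
  have him := (Complex.continuous_im.tendsto _).comp t2
  simp only [Function.comp_def, ofReal_re, Complex.ofReal_im] at hre him
  set P := (sgn ε : ℂ) * p.kap ε with hP0
  have hP : P = (P.re : ℂ) := Complex.ext rfl (tendsto_nhds_unique him tendsto_const_nhds)
  have hnn : 0 ≤ P.re := ge_of_tendsto' hre fun k => by have := h.mass_pos (ε, -(k : ℤ)); positivity
  have hn : ‖p.kap ε‖ = P.re := by
    have : ‖P‖ = ‖p.kap ε‖ := by rw [hP0, norm_mul]; cases ε <;> simp [sgn]
    rw [← this, hP, norm_of_nonneg hnn]; simp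
  have hs : (sgn ε : ℂ) * sgn ε = 1 := mod_cast sgn_mul_self ε
  rw [hn]
  push_cast
  rw [← hP, hP0, ← mul_assoc, hs, one_mul]

lemma conj_ab :
    (conj p.a = p.a ∧ conj p.b = p.b ∧ p.a ≠ conj p.b) ∨
      (conj p.a = p.b ∧ conj p.b = p.a ∧ p.a = conj p.b) := by
  have key : ∀ r t : ℝ, p.a = r → p.b = t → conj p.a = p.a ∧ conj p.b = p.b ∧ p.a ≠ conj p.b :=
    fun r t h1 h2 => by
      have h3 : conj p.b = p.b := by rw [h2, conj_ofReal]
      exact ⟨by rw [h1, conj_ofReal], h3, by rw [h3]; exact h.a_ne_b⟩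
  rcases h.ab.2 with h1 | ⟨r, t, h1, h2, -⟩ | ⟨r, t, h1, h2, -⟩
  · exact Or.inr ⟨by rw [h1, conj_conj], h1.symm, h1⟩
  · exact Or.inl (key r t h1 h2)
  · exact Or.inl (key r t h1 h2)

lemma conj_cd :
    (conj p.c = p.c ∧ conj p.d = p.d) ∨ (conj p.c = p.d ∧ conj p.d = p.c) := by
  rcases h.cd.2 with h1 | ⟨r, t, h1, h2, -⟩ | ⟨r, t, h1, h2, -⟩
  · exact Or.inr ⟨by rw [h1, conj_conj], h1.symm⟩
  · exact Or.inl ⟨by rw [h1, conj_ofReal], by rw [h2, conj_ofReal]⟩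
  · exact Or.inl ⟨by rw [h1, conj_ofReal], by rw [h2, conj_ofReal]⟩

end IsGeneric

/-- The reality conditions on the parameters. -/
structure IsReal (p : Params) : Prop where
  isRegular : p.IsReg
  conj_ab : (conj p.a = p.a ∧ conj p.b = p.b ∧ p.a ≠ conj p.b) ∨
      (conj p.a = p.b ∧ conj p.b = p.a ∧ p.a = conj p.b)
  conj_cd : (conj p.c = p.c ∧ conj p.d = p.d) ∨ (conj p.c = p.d ∧ conj p.d = p.c)

lemma IsGeneric.isReal (h : p.IsGeneric) : p.IsReal := ⟨h.isRegular, h.conj_ab, h.conj_cd⟩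

lemma IsReal.dagger (h : p.IsReal) : p.dagger.IsReal where
  isRegular := h.isRegular.dagger
  conj_ab := by
    simp only [Params.dagger]
    rcases h.conj_ab with ⟨h1, h2, h3⟩ | ⟨h1, h2, h3⟩
    · exact Or.inl ⟨h2, h1, fun e => h3 (by rw [h2, e, h1])⟩
    · exact Or.inr ⟨h2, h1, h1.symm⟩
  conj_cd := h.conj_cd

open Classical in
/-- The parameters after complex conjugation, up to the interchange of `c` and `d`. -/
def star (p : Params) : Params := if p.a = conj p.b then p.dagger else p

lemma IsReal.star_cases (h : p.IsReal) :
    (p.star = p ∧ p.dagger.star = p.dagger ∧ conj p.a = p.a ∧ conj p.b = p.b) ∨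
      (p.star = p.dagger ∧ p.dagger.star = p ∧ conj p.a = p.b ∧ conj p.b = p.a) := by
  rcases h.conj_ab with ⟨h1, h2, h3⟩ | ⟨h1, h2, h3⟩
  · exact Or.inl ⟨if_neg h3, if_neg (fun e : p.b = conj p.a => h3 (by rw [h2, e, h1])), h1, h2⟩
  · have e : p.dagger.a = conj p.dagger.b := h1.symm
    exact Or.inr ⟨if_pos h3, by rw [star, if_pos e]; rfl, h1, h2⟩

lemma IsReal.conj_s (h : p.IsReal) : conj p.s = p.s := by
  obtain ⟨r, -, e⟩ := h.isRegular.s_pos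
  rw [e, conj_ofReal]

lemma IsReal.star_fields (h : p.IsReal) : p.star.q = p.q ∧ p.star.c = p.c ∧ p.star.d = p.d ∧
    p.star.a = conj p.a ∧ p.star.b = conj p.b ∧ p.star.s = p.s ∧ p.star.pt = p.pt ∧
    p.star.z = p.z ∧ p.star.L = p.L ∧ p.star.IsReg := by
  rcases h.star_cases with ⟨h1, -, h2, h3⟩ | ⟨h1, -, h2, h3⟩ <;> rw [h1, h2, h3]
  · exact ⟨rfl, rfl, rfl, rfl, rfl, rfl, rfl, rfl, rfl, h.isRegular⟩
  · exact ⟨rfl, rfl, rfl, rfl, rfl, s_dagger, rfl, rfl, funext L_dagger, h.isRegular.dagger⟩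

lemma IsReal.conj_phiSeries (h : p.IsReal) (hγ : mu (conj γ) = mu γ) (hγ0 : γ ≠ 0)
    (x : ℝ) : conj (p.phiSeries γ x) = p.star.phiSeries γ x := by
  have hc := h.conj_s
  have e : conj γ = γ ∨ conj γ = γ⁻¹ := by
    have hc0 : conj γ ≠ 0 := by simpa using hγ0
    rw [mu, mu] at hγ
    have : (conj γ - γ) * (conj γ * γ - 1) = 0 := by field_simp at hγ; linear_combination hγ
    rcases mul_eq_zero.1 this with e | e
    · exact Or.inl (sub_eq_zero.1 e)
    · exact Or.inr (eq_inv_of_mul_eq_one_left (sub_eq_zero.1 e))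
  obtain ⟨f1, f2, f3, f4, f5, f6, -⟩ := h.star_fields
  rw [phiSeries, phiSeries, phi32, phi32, Complex.conj_tsum, f1, f2, f3, f4, f5, f6]
  refine tsum_congr fun n => ?_
  simp only [map_mul, map_div₀, map_pow, conj_qPoch, conj_ofReal, hc]
  have sw : qPoch p.q (p.s * conj γ) n * qPoch p.q (p.s / conj γ) n =
      qPoch p.q (p.s * γ) n * qPoch p.q (p.s / γ) n := by
    rcases e with e | e <;> rw [e]
    rw [div_inv_eq_mul, ← div_eq_mul_inv, mul_comm]
  rw [mul_assoc (qPoch _ _ n), sw]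
  rcases h.conj_cd with ⟨h4, h5⟩ | ⟨h4, h5⟩ <;> rw [h4, h5] <;> ring

lemma IsReal.conj_L (h : p.IsReal) (f : RqIndex → ℂ) (i : RqIndex) :
    p.L (fun j => conj (f j)) i = conj (p.L f i) := by
  simp only [L, coeffC, coeffA, coeffB, map_add, map_mul, map_sub, map_inv₀, map_div₀, map_one,
    h.conj_s, conj_ofReal]
  rcases h.conj_ab with ⟨h1, h2, -⟩ | ⟨h1, h2, -⟩ <;>
    rcases h.conj_cd with ⟨h3, h4⟩ | ⟨h3, h4⟩ <;> rw [h1, h2, h3, h4] <;> ring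

lemma IsReal.conj_phi (h : p.IsReal) (hγ : mu (conj γ) = mu γ) (hγ0 : γ ≠ 0)
    (i : RqIndex) : conj (p.phi γ i) = p.star.phi γ i := by
  have hr := h.isRegular
  obtain ⟨f1, f2, f3, f4, f5, f6, f7, f8, f9, f10⟩ := h.star_fields
  obtain ⟨hp, hp'⟩ := hr.phi_spec hγ0
  obtain ⟨hs, hs'⟩ := f10.phi_spec hγ0
  rw [f7, f5, Complex.norm_conj] at hs'
  rw [f9] at hs
  obtain ⟨ε, n⟩ := i
  obtain ⟨N, hN⟩ := hr.exists_threshold ε (r := 1 / ‖p.b‖) (by have := hr.b_ne; positivity)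
  have hmu : conj (mu γ) = mu γ := Eq.trans (by simp [mu]) hγ
  refine hr.solution_unique (m := mu γ) (f := fun j => conj (p.phi γ j)) (N := N)
    (fun n => ?_) (fun n => hs _) (fun n hn => ?_) n
  · rw [h.conj_L, hp, map_mul, hmu]
  · rw [hp' _ ((hN n).2 hn), hs' _ ((hN n).2 hn), h.conj_phiSeries hγ hγ0]

lemma IsReal.conj_dCoef (h : p.IsReal) (ε : Bool) (γ : ℂ) :
    conj (p.dCoef ε γ) = p.star.dCoef ε (conj γ) := by
  obtain ⟨f1, f2, f3, f4, f5, f6, f7, f8, -⟩ := h.star_fields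
  have hq := h.isRegular.q_pos
  have hq1 := h.isRegular.q_lt_one
  rw [dCoef_eq, dCoef_eq, dFactor, dFactor, f1, f2, f3, f4, f5, f6, f8]
  simp only [map_mul, map_div₀, map_pow, map_inv₀, conj_qPochInf hq hq1, conj_theta hq hq1,
    conj_ofReal, h.conj_s]
  rcases h.conj_cd with ⟨h4, h5⟩ | ⟨h4, h5⟩ <;> rw [h4, h5]
  ring

/-- The leading coefficient of the combination of `φ_γ` and `φ_γ†` with coefficients `u`. -/
def trc (p : Params) (ε : Bool) (γ : ℂ) (u : ℂ²) : ℂ :=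
  p.dCoef ε γ * u 0 + p.dagger.dCoef ε γ * u 1

lemma vMat_mulVec (γ : ℂ) (y : ℂ²) :
    p.vMat γ *ᵥ y = ![p.wVec γ y 1, p.wVec γ y 0] := by
  ext j; fin_cases j <;> simp [vMat, wVec, Matrix.mulVec, dotProduct, Fin.sum_univ_two]

lemma IsReal.rowT_dot (h : p.IsReal) (y u : ℂ²) :
    (p.star = p → p.rowT y ⬝ᵥ ![u 1, u 0] = conj (y 0) * u 0 + conj (y 1) * u 1) ∧
    (p.star = p.dagger → p.rowT y ⬝ᵥ ![u 1, u 0] = conj (y 0) * u 1 + conj (y 1) * u 0) := by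
  have hne : p.dagger ≠ p := fun e => h.isRegular.ab 0 (by
    have : p.a = p.b := congrArg Params.b e
    rw [this, div_self h.isRegular.b_ne, zpow_zero])
  constructor
  · intro hs
    have : p.a ≠ conj p.b := fun e => hne (by rw [star, if_pos e] at hs; exact hs)
    simp [rowT, this, dotProduct, Fin.sum_univ_two]; ring
  · intro hs
    have : p.a = conj p.b := by by_contra e; rw [star, if_neg e] at hs; exact hne hs.symm
    rw [rowT, if_pos this]
    simp [dotProduct, Fin.sum_univ_two]

lemma Circle.mu_conj (z : Circle) : mu (conj (z : ℂ)) = mu z := by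
  rw [← Circle.coe_inv_eq_conj, coe_inv, mu, mu, inv_inv, add_comm]

lemma IsReal.formHc_Psi (h : p.IsReal) (g : Circle → ℂ²) (i : RqIndex) (t : ℝ) :
    p.formHc g (p.Psi i).1 t =
      p.phi (exp t) i * p.wVec (exp t) (g (exp t)) 0 +
        p.dagger.phi (exp t) i * p.wVec (exp t) (g (exp t)) 1 := by
  set z := exp t
  have h1 := h.conj_phi (Circle.mu_conj z) z.coe_ne_zero i
  have h2 : conj (p.dagger.phi z i) = p.dagger.star.phi z i :=
    h.dagger.conj_phi (Circle.mu_conj z) z.coe_ne_zero i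
  rw [formHc, vMat_mulVec]
  rcases h.star_cases with ⟨e2, e1, -⟩ | ⟨e2, e1, -⟩
  · rw [((h.rowT_dot _ _).1 e2)]
    simp only [Psi, Matrix.cons_val_zero, Matrix.cons_val_one]
    rw [h1, h2, e1, e2]
  · rw [((h.rowT_dot _ _).2 e2)]
    simp only [Psi, Matrix.cons_val_zero, Matrix.cons_val_one]
    rw [h1, h2, e1, e2]; ring

lemma IsGeneric.formHc_eq (h : p.IsGeneric) (g₁ g₂ : Circle → ℂ²)
    (ht : p.Good (exp t)) :
    p.formHc g₁ g₂ t = ∑ ε : Bool, ‖p.kap ε‖ *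
      (p.trc ε (exp t : ℂ)⁻¹ (p.wVec (exp t) (g₁ (exp t))) *
        conj (p.trc ε (exp t : ℂ)⁻¹ (p.wVec (exp t) (g₂ (exp t))))) := by
  set z := exp t
  have hz : conj (z : ℂ) = (z : ℂ)⁻¹ := by rw [← Circle.coe_inv_eq_conj, coe_inv]
  obtain ⟨e0, e1⟩ := h.isRegular.gram_mul_wVec ht (g₂ z)
  have k1 := h.kap_eq true
  have k2 := h.kap_eq false
  simp only [sgn, if_true, one_mul] at k1
  simp only [sgn, Bool.false_eq_true, if_false] at k2
  have h1 : ∀ ε, conj (p.dCoef ε z) = p.star.dCoef ε (z : ℂ)⁻¹ := fun ε => by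
    rw [h.isReal.conj_dCoef, hz]
  have h2 : ∀ ε, conj (p.dagger.dCoef ε z) = p.dagger.star.dCoef ε (z : ℂ)⁻¹ := fun ε => by
    rw [h.isReal.dagger.conj_dCoef, hz]
  rw [formHc, vMat_mulVec]
  have c0 := congrArg conj e0
  have c1 := congrArg conj e1
  have k1' : conj (p.kap true) = ‖p.kap true‖ := by rw [k1]; simp
  have k2' : conj (p.kap false) = -‖p.kap false‖ := by rw [k2]; simp
  simp only [gram, map_add, map_mul, map_sub, h1, h2, k1', k2'] at c0 c1
  rcases h.isReal.star_cases with ⟨s2, s1, -⟩ | ⟨s2, s1, -⟩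
  · rw [((h.isReal.rowT_dot _ _).1 s2), ← c0, ← c1, s1, s2]
    simp only [trc, Fintype.sum_bool, map_add, map_mul]; ring
  · rw [((h.isReal.rowT_dot _ _).2 s2), ← c0, ← c1, s1, s2]
    simp only [trc, Fintype.sum_bool, map_add, map_mul]; ring

/-- Lebesgue measure on the period. -/
abbrev muT : Measure ℝ := volume.restrict (Ioc (-π) π)

lemma ae_exp_ne (w : ℂ) : ∀ᵐ t ∂muT,
    (exp t : ℂ) ≠ w := by
  rw [ae_restrict_iff' measurableSet_Ioc]
  refine measure_mono_null (t := {Complex.arg w}) (fun t ht => ?_) (measure_singleton _)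
  simp only [Set.mem_compl_iff, Set.mem_ofPred_eq, not_forall, not_not] at ht
  obtain ⟨⟨h1, h2⟩, h3⟩ := ht
  rw [← h3, Set.mem_singleton_iff, Circle.arg_exp h1 h2]

lemma ae_exp_theta {q : ℝ} (h0 : 0 < q) {y : ℂ} (hy : y ≠ 0) :
    ∀ᵐ t ∂muT, ∀ n : ℤ, y * (exp t : ℂ) ≠ (q : ℂ) ^ n ∧ y * (exp t : ℂ)⁻¹ ≠ (q : ℂ) ^ n := by
  rw [ae_all_iff]
  intro n
  have hq : (q : ℂ) ≠ 0 := mod_cast h0.ne'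
  have hqn := zpow_ne_zero n hq
  filter_upwards [ae_exp_ne ((q : ℂ) ^ n / y), ae_exp_ne (y / q ^ n)] with t h1 h2
  refine ⟨fun e => h1 (by rw [← e]; field_simp), fun e => h2 ?_⟩
  have := (exp t).coe_ne_zero
  rw [← e]; field_simp

lemma IsReg.ae_good (h : p.IsReg) :
    ∀ᵐ t ∂muT, p.Good (exp t) := by
  have hq := h.q_pos
  have hq1 := h.q_lt_one
  obtain ⟨ha, hb, hc, hd, hs, hqc⟩ := h.ne_zero
  have hz1 := h.z_ne' true
  have hz2 := h.z_ne' false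
  have key : ∀ {x : ℂ}, (∀ n : ℤ, x ≠ (p.q : ℂ) ^ n) → qPochInf p.q x ≠ 0 := fun hx =>
    qPochInf_ne_zero hq hq1 fun k hk => hx (-k) (by
      rw [zpow_neg, zpow_natCast]; exact eq_inv_of_mul_eq_one_left hk)
  filter_upwards [ae_exp_ne 1, ae_exp_ne (-1), ae_exp_theta hq hs,
    ae_exp_theta hq (show p.a * p.b * p.s * p.z true * p.z false ≠ 0 by positivity),
    ae_exp_theta hq (show p.c * p.q / (p.a * p.s) ≠ 0 by positivity),
    ae_exp_theta hq (show p.d * p.q / (p.a * p.s) ≠ 0 by positivity),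
    ae_exp_theta hq (show p.c * p.q / (p.b * p.s) ≠ 0 by positivity),
    ae_exp_theta hq (show p.d * p.q / (p.b * p.s) ≠ 0 by positivity)] with t g1 g2 g3 g4 g5 g6 g7 g8
  set z : ℂ := (exp t : ℂ)
  have hz0 : z ≠ 0 := (exp t).coe_ne_zero
  have hzn : ‖z‖ = 1 := norm_coe _
  have hsq : z ^ 2 ≠ 1 := fun e => by
    rcases mul_self_eq_one_iff.1 ((sq z).symm.trans e) with e | e
    exacts [g1 e, g2 e]
  have hqz : ∀ {y : ℂ}, ‖y‖ = 1 → y ^ 2 ≠ 1 → qPochInf p.q (y ^ 2) ≠ 0 := fun hy hy2 =>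
    qPochInf_ne_zero hq hq1 fun k hk => by
      have hn := congrArg norm hk
      rw [norm_mul, norm_pow, hy, norm_pow, norm_of_nonneg hq.le] at hn
      simp only [one_pow, one_mul, norm_one] at hn
      have hk0 : k = 0 := by by_contra hk0; exact absurd hn (pow_lt_one₀ hq.le hq1 hk0).ne
      rw [hk0, pow_zero, mul_one] at hk
      exact hy2 hk
  have hq1' := hqz hzn hsq
  have hq2' := hqz (y := z⁻¹) (by rw [norm_inv, hzn, inv_one])
    (by rw [inv_pow]; exact fun e => hsq (inv_eq_one.1 e))
  have ca := h.poch_ne h.ca_ne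
  have da := h.poch_ne h.da_ne
  have cb : qPochInf p.q (p.c * p.q / p.b) ≠ 0 := h.poch_ne h.dagger.ca_ne
  have db : qPochInf p.q (p.d * p.q / p.b) ≠ 0 := h.poch_ne h.dagger.da_ne
  have k3 := key fun n => (g3 n).1
  have k3' := key fun n => (g3 n).2
  have k5 := key fun n => (g5 n).1
  have k5' := key fun n => (g5 n).2
  have k6 := key fun n => (g6 n).1
  have k6' := key fun n => (g6 n).2
  have k7 := key fun n => (g7 n).1
  have k7' := key fun n => (g7 n).2
  have k8 := key fun n => (g8 n).1
  have k8' := key fun n => (g8 n).2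
  refine ⟨hz0, hsq, theta_ne_zero hq hq1 (by positivity) fun n => (g3 n).1,
    theta_ne_zero hq hq1 (by positivity) fun n => (g3 n).2,
    theta_ne_zero hq hq1 (by positivity) fun n e => (g4 n).1 (by rw [← e]; ring),
    theta_ne_zero hq hq1 (by positivity) fun n e => (g4 n).2 (by rw [← e]; ring), ?_, ?_, ?_, ?_⟩
  · rw [dFactor]; positivity
  · rw [dFactor, inv_inv]; positivity
  · rw [dFactor_dagger_eq]; positivity
  · rw [dFactor_dagger_eq, inv_inv]; positivity

lemma tsum_int_telescope {D f : ℤ → ℂ} {l : ℂ} (hf : Summable f) (h : ∀ n, f n = D (n - 1) - D n)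
    (hD : Tendsto D atTop (𝓝 l)) (hD' : Tendsto (fun k : ℕ => D (-(k : ℤ))) atTop (𝓝 0)) :
    ∑' n, f n = -l := by
  have i1 : Function.Injective fun n : ℕ => (n : ℤ) := Nat.cast_injective
  have i2 : Function.Injective fun n : ℕ => -((n : ℤ) + 1) := fun m n e => by simp only at e; omega
  have s1 := hf.comp_injective i1
  have s2 := hf.comp_injective i2
  have t1 : Tendsto (fun N : ℕ => ∑ n ∈ range N, f n) atTop (𝓝 (D (-1) - l)) := by
    have e : ∀ N : ℕ, ∑ n ∈ range N, f n = D (-1) - D (N - 1) := fun N => by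
      induction N with
      | zero => simp
      | succ N ih => rw [sum_range_succ, ih, h]; push_cast; rw [add_sub_cancel_right]; ring
    simp_rw [e]
    have : Tendsto (fun N : ℕ => (N : ℤ) - 1) atTop atTop := by
      simpa only [sub_eq_add_neg] using
        tendsto_atTop_add_const_right _ (-1 : ℤ) tendsto_natCast_atTop_atTop
    exact (hD.comp this).const_sub _
  have t2 : Tendsto (fun N : ℕ => ∑ n ∈ range N, f (-((n : ℤ) + 1))) atTop
      (𝓝 (0 - D (-1))) := by
    have e : ∀ N : ℕ, ∑ n ∈ range N, f (-((n : ℤ) + 1)) = D (-((N + 1 : ℕ) : ℤ)) - D (-1) :=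
      fun N => by
        induction N with
        | zero => simp
        | succ N ih =>
          rw [sum_range_succ, ih, h]; push_cast
          rw [show -((N : ℤ) + 1) - 1 = -((N : ℤ) + 1 + 1) by ring]; ring
    simp_rw [e]
    exact ((tendsto_add_atTop_iff_nat (f := fun k : ℕ => D (-(k : ℤ))) 1).2 hD').sub_const _
  rw [(HasSum.of_nat_of_neg_add_one s1.hasSum s2.hasSum).tsum_eq,
    tendsto_nhds_unique s1.hasSum.tendsto_sum_nat t1,
    tendsto_nhds_unique s2.hasSum.tendsto_sum_nat t2]
  ring

/-! ### The Hilbert space of square-integrable functions -/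

/-- Multiplication by the square root of the mass. -/
def wt (p : Params) (f : RqIndex → ℂ) (i : RqIndex) : ℂ := (√(p.mass i) : ℝ) * f i

open Classical in
/-- A square-integrable function as an element of `ℓ²`. -/
def toL2 (p : Params) (f : RqIndex → ℂ) : lp (fun _ : RqIndex => ℂ) 2 :=
  if h : Memℓp (p.wt f) 2 then ⟨p.wt f, h⟩ else 0

lemma IsGeneric.norm_wt_sq (h : p.IsGeneric) (f : RqIndex → ℂ) (i : RqIndex) :
    ‖p.wt f i‖ ^ 2 = p.mass i * ‖f i‖ ^ 2 := by
  rw [wt, norm_mul, mul_pow, norm_of_nonneg (Real.sqrt_nonneg _), sq_sqrt (h.mass_pos i).le]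

lemma memℓp_two_iff : Memℓp f 2 ↔ Summable fun i => ‖f i‖ ^ 2 := by
  rw [memℓp_gen_iff (by norm_num)]
  norm_num

lemma IsGeneric.memL2_iff_summable (h : p.IsGeneric) :
    p.MemL2 f ↔ Summable fun i => p.mass i * ‖f i‖ ^ 2 := by
  have hq := (sub_pos.2 h.q_lt_one).ne'
  rw [MemL2, ← summable_mul_left_iff hq]
  refine iff_of_eq (congrArg Summable (funext fun i => ?_))
  rw [mass]; ring

lemma IsGeneric.memL2_iff (h : p.IsGeneric) :
    p.MemL2 f ↔ Memℓp (p.wt f) 2 := by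
  rw [h.memL2_iff_summable, memℓp_two_iff]
  simp_rw [h.norm_wt_sq]

lemma IsGeneric.toL2_apply (h : p.IsGeneric) (hf : p.MemL2 f) (i : RqIndex) :
    p.toL2 f i = p.wt f i := by
  rw [toL2, dif_pos (h.memL2_iff.1 hf)]

lemma wt_add (f g : RqIndex → ℂ) : p.wt (f + g) = p.wt f + p.wt g := by
  ext i; simp [wt, mul_add]

lemma wt_smul (c : ℂ) (f : RqIndex → ℂ) : p.wt (c • f) = c • p.wt f := by
  ext i; simp [wt, mul_left_comm]

lemma wt_sub (f g : RqIndex → ℂ) : p.wt (f - g) = p.wt f - p.wt g := by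
  ext i; simp [wt, mul_sub]

namespace IsGeneric
variable (h : p.IsGeneric)
include h

lemma memL2_add (hf : p.MemL2 f) (hg : p.MemL2 g) :
    p.MemL2 (f + g) := by
  rw [h.memL2_iff, wt_add]; exact (h.memL2_iff.1 hf).add (h.memL2_iff.1 hg)

lemma memL2_sub (hf : p.MemL2 f) (hg : p.MemL2 g) :
    p.MemL2 (f - g) := by
  rw [h.memL2_iff, wt_sub]; exact (h.memL2_iff.1 hf).sub (h.memL2_iff.1 hg)

lemma memL2_smul (c : ℂ) (hf : p.MemL2 f) :
    p.MemL2 (c • f) := by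
  rw [h.memL2_iff, wt_smul]; exact (h.memL2_iff.1 hf).const_smul c

lemma toL2_add (hf : p.MemL2 f) (hg : p.MemL2 g) :
    p.toL2 (f + g) = p.toL2 f + p.toL2 g := by
  ext i
  rw [lp.coeFn_add, Pi.add_apply, h.toL2_apply hf, h.toL2_apply hg,
    h.toL2_apply (h.memL2_add hf hg), wt_add]; rfl

lemma toL2_sub (hf : p.MemL2 f) (hg : p.MemL2 g) :
    p.toL2 (f - g) = p.toL2 f - p.toL2 g := by
  ext i
  rw [lp.coeFn_sub, Pi.sub_apply, h.toL2_apply hf, h.toL2_apply hg,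
    h.toL2_apply (h.memL2_sub hf hg), wt_sub]; rfl

lemma toL2_smul (c : ℂ) (hf : p.MemL2 f) :
    p.toL2 (c • f) = c • p.toL2 f := by
  ext i
  rw [lp.coeFn_smul, Pi.smul_apply, h.toL2_apply hf, h.toL2_apply (h.memL2_smul c hf), wt_smul]; rfl

lemma qInt_eq {F : RqIndex → ℂ}
    (hF : Summable fun i => (p.mass i : ℂ) * F i) :
    p.qInt (fun i => F i * p.w (p.pt i)) = ∑' i, (p.mass i : ℂ) * F i := by
  have hq : (1 - p.q : ℂ) ≠ 0 := mod_cast (sub_pos.2 h.q_lt_one).ne'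
  have e : ∀ ε : Bool, (1 - p.q : ℂ) * ∑' n : ℤ, F (ε, n) * p.w (p.pt (ε, n)) * p.pt (ε, n) =
      (sgn ε : ℂ) * ∑' n : ℤ, (p.mass (ε, n) : ℂ) * F (ε, n) := fun ε => by
    rw [← tsum_mul_left, ← tsum_mul_left]
    refine tsum_congr fun n => ?_
    have := h.weight_eq (ε, n)
    push_cast at this
    linear_combination F (ε, n) * this
  rw [qInt, e, e, hF.tsum_prod, tsum_bool]
  simp [sgn]; ring

lemma innerL2_eq (hf : p.MemL2 f)
    (hg : p.MemL2 g) : p.innerL2 f g = inner ℂ (p.toL2 g) (p.toL2 f) := by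
  have hs := lp.summable_inner (𝕜 := ℂ) (p.toL2 g) (p.toL2 f)
  have e : ∀ i, inner ℂ (p.toL2 g i) (p.toL2 f i) = (p.mass i : ℂ) * (f i * conj (g i)) := fun i => by
    rw [h.toL2_apply hf, h.toL2_apply hg, RCLike.inner_apply, wt, wt, map_mul, conj_ofReal]
    have : ((√(p.mass i) : ℝ) : ℂ) * (√(p.mass i) : ℝ) = p.mass i := by
      exact_mod_cast Real.mul_self_sqrt (h.mass_pos i).le
    linear_combination (f i * conj (g i)) * this
  simp_rw [e] at hs
  rw [innerL2, h.qInt_eq hs, lp.inner_eq_tsum]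
  simp_rw [e]

lemma normSqL2_eq (hf : p.MemL2 f) :
    p.normSqL2 f = ‖p.toL2 f‖ ^ 2 := by
  rw [normSqL2, h.innerL2_eq hf hf, inner_self_eq_norm_sq_to_K]
  norm_cast

lemma memL2_of_finite
    (hf : (Function.support f).Finite) : p.MemL2 f := by
  rw [h.memL2_iff_summable]
  refine summable_of_hasFiniteSupport (hf.subset fun i hi => ?_)
  contrapose! hi
  simp only [Function.mem_support, not_not] at hi ⊢
  simp [hi]

lemma innerL2_finite
    (hf : (Function.support f).Finite) :
    p.innerL2 f g = ∑ i ∈ hf.toFinset, (p.mass i : ℂ) * (f i * conj (g i)) := by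
  have hz : ∀ i ∉ hf.toFinset, (p.mass i : ℂ) * (f i * conj (g i)) = 0 := fun i hi => by
    simp only [Set.Finite.mem_toFinset, Function.mem_support, not_not] at hi
    simp [hi]
  rw [innerL2, h.qInt_eq (summable_of_ne_finset_zero hz), tsum_eq_sum hz]

end IsGeneric

/-! ### Regularity at the origin and Green's formula -/

/-- The function and its `q`-derivative have two-sided limits at the origin. -/
def Reg (p : Params) (f : RqIndex → ℂ) : Prop :=
  (∃ l : ℂ, ∀ ε : Bool, Tendsto (fun n : ℤ => f (ε, n)) atTop (𝓝 l)) ∧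
  (∃ l : ℂ, ∀ ε : Bool, Tendsto (fun n : ℤ => p.qDeriv f (ε, n)) atTop (𝓝 l))

lemma IsGeneric.casorati_sub (h : p.IsGeneric) (f g : RqIndex → ℂ) (i : RqIndex) :
    p.casorati f g (down i) - p.casorati f g i =
      sgn i.1 * (p.mass i * (p.L f i * g i - f i * p.L g i)) := by
  have hr := h.isRegular
  have hw := h.weight_eq i
  push_cast at hw
  rw [hr.casorati_eq, hr.casorati_eq, up_down, mul_assoc (1 - p.q : ℂ), hr.coeffB_weight_down i]
  simp only [L]
  linear_combination ((f (down i) * g i - f i * g (down i)) * p.coeffA (p.pt i) -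
    (f i * g (up i) - f (up i) * g i) * p.coeffB (p.pt i)) * hw

namespace IsReg
variable (h : p.IsReg)
include h

lemma tendsto_pt (ε : Bool) :
    Tendsto (fun n : ℤ => (p.pt (ε, n) : ℂ)) atTop (𝓝 0) := by
  rw [tendsto_zero_iff_norm_tendsto_zero, Metric.tendsto_atTop]
  intro r hr
  obtain ⟨N, hN⟩ := h.exists_threshold ε hr
  refine ⟨N, fun n hn => ?_⟩
  rw [Real.dist_0_eq_abs, abs_norm, norm_real, norm_eq_abs]
  exact (hN n).2 hn

lemma tendsto_w (ε : Bool) :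
    Tendsto (fun n : ℤ => p.w (p.pt (ε, n))) atTop (𝓝 1) := by
  have t := h.tendsto_pt ε
  have e : ∀ y : ℂ, Tendsto (fun n : ℤ => qPochInf p.q (y * p.pt (ε, n))) atTop (𝓝 1) := fun y => by
    have := ((continuous_qPochInf h.q_pos h.q_lt_one).tendsto (y * 0)).comp (t.const_mul y)
    rwa [mul_zero, show qPochInf p.q 0 = 1 by simp [qPochInf]] at this
  have := ((e p.a).mul (e p.b)).div ((e p.c).mul (e p.d)) (by simp)
  rw [mul_one, div_one] at this
  exact this

lemma tendsto_u (ε : Bool) :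
    Tendsto (fun n : ℤ => p.u (p.pt (ε, n))) atTop (𝓝 ((1 - p.q) ^ 2 * p.s / (p.c * p.d))) := by
  have t := h.tendsto_pt ε
  have t2 := (((((t.sub_const (1 / p.c)).mul (t.sub_const (1 / p.d))).const_mul p.s)).const_mul
    ((1 - p.q : ℂ) ^ 2)).mul (h.tendsto_w ε)
  have hc := h.c_ne
  have hd := h.d_ne
  rw [show (1 - p.q : ℂ) ^ 2 * (p.s * ((0 - 1 / p.c) * (0 - 1 / p.d))) * 1 =
    (1 - p.q) ^ 2 * p.s / (p.c * p.d) by field_simp; ring] at t2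
  refine t2.congr fun n => ?_
  have := h.pt_ne (ε, n)
  rw [u, coeffB]
  field_simp

lemma casorati_qDeriv (f g : RqIndex → ℂ) (i : RqIndex) :
    p.casorati f g i = (p.qDeriv f i * g i - f i * p.qDeriv g i) * p.u (p.pt i) := by
  have hq := h.one_sub_ne
  have := h.pt_ne i
  rw [casorati, qDeriv, qDeriv]
  field_simp
  ring

lemma tendsto_casorati_zero
    {f0 f1 g0 g1 : ℂ} (hf : Tendsto (fun n : ℤ => f (ε, n)) atTop (𝓝 f0))
    (hf' : Tendsto (fun n : ℤ => p.qDeriv f (ε, n)) atTop (𝓝 f1))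
    (hg : Tendsto (fun n : ℤ => g (ε, n)) atTop (𝓝 g0))
    (hg' : Tendsto (fun n : ℤ => p.qDeriv g (ε, n)) atTop (𝓝 g1)) :
    Tendsto (fun n : ℤ => p.casorati f g (ε, n)) atTop
      (𝓝 ((f1 * g0 - f0 * g1) * ((1 - p.q) ^ 2 * p.s / (p.c * p.d)))) := by
  simp_rw [h.casorati_qDeriv]
  exact ((hf'.mul hg).sub (hf.mul hg')).mul (h.tendsto_u ε)

lemma tendsto_mass (ε : Bool) :
    Tendsto (fun k : ℕ => ‖p.s‖ ^ k * √(p.mass (ε, -(k : ℤ)))) atTop (𝓝 √‖p.kap ε‖) := by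
  refine ((continuous_sqrt.tendsto _).comp (h.tendsto_weight ε).norm).congr fun k => ?_
  have hq : (0 : ℝ) ≤ 1 - p.q := (sub_pos.2 h.q_lt_one).le
  have e : ‖(1 - p.q : ℂ)‖ = 1 - p.q := by rw [← ofReal_one, ← ofReal_sub, norm_of_nonneg hq]
  rw [Function.comp, norm_mul, norm_mul, norm_mul, e, norm_pow, norm_real, norm_eq_abs,
    pow_mul', Real.sqrt_mul (by positivity), sqrt_sq (by positivity), mass, mul_assoc (1 - p.q)]

end IsReg

lemma IsGeneric.tendsto_far (h : p.IsGeneric) (hf : p.MemL2 f) (ε : Bool) :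
    Tendsto (fun k : ℕ => (p.s ^ k)⁻¹ * f (ε, -(k : ℤ))) atTop (𝓝 0) := by
  have hr := h.isRegular
  have hs := norm_pos_iff.2 hr.s_ne
  have h1 := ((memℓp_two_iff.1 (h.memL2_iff.1 hf)).tendsto_cofinite_zero.comp
    (f := fun k : ℕ => (ε, -(k : ℤ))) (g := fun i => ‖p.wt f i‖ ^ 2)
    (Function.Injective.tendsto_cofinite fun m n e => by simpa using e))
  rw [Nat.cofinite_eq_atTop] at h1
  have h2 := ((continuous_sqrt.tendsto _).comp h1)
  have hk : 0 < √‖p.kap ε‖ := sqrt_pos.2 (norm_pos_iff.2 (hr.kap_ne ε))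
  have h3 := h2.div (hr.tendsto_mass ε) hk.ne'
  rw [sqrt_zero, zero_div] at h3
  rw [tendsto_zero_iff_norm_tendsto_zero]
  refine h3.congr fun k => ?_
  have hm := sqrt_pos.2 (h.mass_pos (ε, -(k : ℤ)))
  simp only [Function.comp, Pi.div_apply]
  rw [sqrt_sq (norm_nonneg _), wt, norm_mul, norm_mul, norm_inv, norm_pow, norm_of_nonneg hm.le]
  field_simp

lemma IsGeneric.tendsto_casorati_far (h : p.IsGeneric) (hf : p.MemL2 f)
    (hg : p.MemL2 g) (ε : Bool) :
    Tendsto (fun k : ℕ => p.casorati f g (ε, -(k : ℤ))) atTop (𝓝 0) := by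
  have := h.isRegular.tendsto_casorati (ε := ε) one_ne_zero (F := 0) (G := 0) (f := f) (g := g)
    (by simpa using h.tendsto_far hf ε) (by simpa using h.tendsto_far hg ε)
  simpa using this

lemma IsGeneric.memL2_conj (h : p.IsGeneric) (hf : p.MemL2 f) :
    p.MemL2 fun i => conj (f i) := by
  rw [h.memL2_iff_summable] at hf ⊢; simpa using hf

lemma Reg.conj (hf : p.Reg f) : p.Reg fun i => conj (f i) := by
  obtain ⟨⟨l, hl⟩, ⟨m, hm⟩⟩ := hf
  refine ⟨⟨conj l, fun ε => (continuous_conj.tendsto _).comp (hl ε)⟩,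
    ⟨conj m, fun ε => ((continuous_conj.tendsto _).comp (hm ε)).congr fun n => ?_⟩⟩
  simp [qDeriv]

lemma IsGeneric.summable_inner (h : p.IsGeneric) (hf : p.MemL2 f)
    (hg : p.MemL2 g) : Summable fun i => (p.mass i : ℂ) * (f i * conj (g i)) := by
  refine (lp.summable_inner (𝕜 := ℂ) (p.toL2 g) (p.toL2 f)).congr fun i => ?_
  rw [h.toL2_apply hf, h.toL2_apply hg, RCLike.inner_apply, wt, wt, map_mul, conj_ofReal]
  have : ((√(p.mass i) : ℝ) : ℂ) * (√(p.mass i) : ℝ) = p.mass i := by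
    exact_mod_cast Real.mul_self_sqrt (h.mass_pos i).le
  linear_combination (f i * conj (g i)) * this

lemma tsum_eq_zero_of_flux {H D : RqIndex → ℂ} {l : ℂ} (hs : Summable H)
    (hH : ∀ i, sgn i.1 * H i = D (down i) - D i)
    (hD : ∀ ε : Bool, Tendsto (fun n : ℤ => D (ε, n)) atTop (𝓝 l))
    (hD' : ∀ ε : Bool, Tendsto (fun k : ℕ => D (ε, -(k : ℤ))) atTop (𝓝 0)) : ∑' i, H i = 0 := by
  have key : ∀ ε : Bool, (sgn ε : ℂ) * ∑' n : ℤ, H (ε, n) = -l := fun ε => by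
    have s4 : Summable fun n : ℤ => (sgn ε : ℂ) * H (ε, n) :=
      Summable.mul_left _ (hs.comp_injective (i := fun n : ℤ => (ε, n)) (Prod.mk_right_injective ε))
    rw [← tsum_mul_left]
    exact tsum_int_telescope (D := fun n => D (ε, n)) s4 (fun n => hH (ε, n)) (hD ε) (hD' ε)
  rw [hs.tsum_prod, tsum_bool]
  have k1 := key true
  have k2 := key false
  simp only [sgn, if_true, Bool.false_eq_true, if_false] at k1 k2
  push_cast at k1 k2
  linear_combination k1 - k2

lemma IsGeneric.green (h : p.IsGeneric) (hf : p.MemL2 f) (hg : p.MemL2 g)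
    (hLf : p.MemL2 (p.L f)) (hLg : p.MemL2 (p.L g)) (rf : p.Reg f) (rg : p.Reg g) :
    p.innerL2 (p.L f) g = p.innerL2 f (p.L g) := by
  obtain ⟨⟨f0, hf0⟩, ⟨f1, hf1⟩⟩ := rf
  obtain ⟨⟨g0, hg0⟩, ⟨g1, hg1⟩⟩ := rg.conj
  have s1 := h.summable_inner hLf hg
  have s2 := h.summable_inner hf hLg
  rw [innerL2, innerL2, h.qInt_eq s1, h.qInt_eq s2, ← sub_eq_zero, ← s1.tsum_sub s2]
  refine tsum_eq_zero_of_flux (s1.sub s2) (D := p.casorati f fun i => conj (g i)) (fun i => ?_)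
    (fun ε => h.isRegular.tendsto_casorati_zero (hf0 ε) (hf1 ε) (hg0 ε) (hg1 ε))
    (fun ε => h.tendsto_casorati_far hf (h.memL2_conj hg) ε)
  rw [h.casorati_sub, h.isReal.conj_L]
  ring

namespace IsReg
variable (h : p.IsReg)
include h

lemma limits_of_hasDerivAt {F : ℂ → ℂ} {F' : ℂ}
    (hF : HasDerivAt F F' 0) {N : ℤ}
    (hf : ∀ n ≥ N, f (ε, n) = F (p.pt (ε, n))) :
    Tendsto (fun n : ℤ => f (ε, n)) atTop (𝓝 (F 0)) ∧
      Tendsto (fun n : ℤ => p.qDeriv f (ε, n)) atTop (𝓝 F') := by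
  have t := h.tendsto_pt ε
  have hq := h.one_sub_ne
  have hq0 := h.q_ne
  constructor
  · refine ((hF.continuousAt.tendsto.comp t).congr' ?_)
    filter_upwards [eventually_ge_atTop N] with n hn using (hf n hn).symm
  · have ts : Tendsto (fun n : ℤ => (p.pt (ε, n) : ℂ)) atTop (𝓝[≠] 0) :=
      tendsto_nhdsWithin_iff.2 ⟨t, .of_forall fun n => h.pt_ne _⟩
    have h1 := (hasDerivAt_iff_tendsto_slope.1 hF).comp ts
    have h2 := h1.comp (tendsto_atTop_add_const_right atTop (1 : ℤ) tendsto_id)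
    have h3 := (h1.sub (h2.const_mul (p.q : ℂ))).div_const (1 - p.q : ℂ)
    rw [show (F' - p.q * F') / (1 - p.q : ℂ) = F' by field_simp] at h3
    refine h3.congr' ?_
    filter_upwards [eventually_ge_atTop N] with n hn
    have := h.pt_ne (ε, n)
    simp only [Function.comp, slope_def_field, sub_zero, id]
    rw [qDeriv, hf n hn, up, hf (n + 1) (by omega), show p.pt (ε, n + 1) = p.q * p.pt (ε, n) from
      h.pt_up (ε, n)]
    push_cast; field_simp; ring

lemma differentiableOn_phiFun_right (γ : ℂ) :
    DifferentiableOn ℂ (p.phiFun γ) (ball 0 (1 / (2 * ‖p.b‖))) := by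
  have hb := norm_pos_iff.2 h.b_ne
  obtain ⟨M, -, hM⟩ := h.phiTerm_le (max ‖p.s * γ‖ ‖p.s / γ‖) (ρ := 1 / 2) (by norm_num)
  refine Complex.differentiableOn_tsum_of_summable_norm
    ((summable_geometric_of_lt_one (r := 1 / 2) (by norm_num) (by norm_num)).mul_left M)
    (fun n => ?_) isOpen_ball
    fun n x hx => hM γ (le_max_left _ _) (le_max_right _ _) x ?_ n
  · unfold phiPoly
    exact (DifferentiableOn.fun_finsetProd fun j _ => by fun_prop).const_mul _
  · rw [mem_ball_zero_iff, lt_div_iff₀ (by positivity)] at hx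
    rw [norm_mul]; linarith

lemma exists_near {r : ℝ} (hr : 0 < r) :
    ∃ N : ℤ, ∀ ε, ∀ n ≥ N, |p.pt (ε, n)| < r := by
  choose N hN using fun ε => h.exists_threshold ε hr
  refine ⟨max (N true) (N false), fun ε n hn => (hN ε n).2 ?_⟩
  cases ε
  · exact (le_max_right _ _).trans hn
  · exact (le_max_left _ _).trans hn

lemma phi_limits (hγ : γ ≠ 0) (ε : Bool) :
    Tendsto (fun n : ℤ => p.phi γ (ε, n)) atTop (𝓝 (p.phiFun γ 0)) ∧
      Tendsto (fun n : ℤ => p.qDeriv (p.phi γ) (ε, n)) atTop (𝓝 (deriv (p.phiFun γ) 0)) := by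
  have hb := norm_pos_iff.2 h.b_ne
  obtain ⟨N, hN⟩ := h.exists_threshold ε (r := 1 / ‖p.b‖) (by positivity)
  refine h.limits_of_hasDerivAt (((h.differentiableOn_phiFun_right γ).differentiableAt
    (Metric.ball_mem_nhds 0 (by positivity))).hasDerivAt) (N := N) fun n hn => h.phi_eq hγ ?_
  rw [norm_mul_pt_lt h.b_ne]
  exact (hN n).2 hn

lemma exists_phi_bound : ∃ N : ℤ, ∃ C > 0, ∀ γ : Circle, ∀ ε, ∀ n ≥ N,
    ‖p.phi γ (ε, n)‖ ≤ C ∧ ‖p.qDeriv (p.phi γ) (ε, n)‖ ≤ C := by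
  have hb := norm_pos_iff.2 h.b_ne
  have hq0 := h.q_pos
  have hq := sub_pos.2 h.q_lt_one
  obtain ⟨M, hM0, hM⟩ := h.phiTerm_le ‖p.s‖ (ρ := 1 / 2) (by norm_num)
  set r := 1 / (2 * ‖p.b‖) with hr
  have hr0 : 0 < r := by positivity
  obtain ⟨N, hN⟩ := h.exists_near hr0
  have hbd : ∀ γ : Circle, ∀ x ∈ ball (0 : ℂ) r, ‖p.phiFun γ x‖ ≤ M * 2 := fun γ x hx => by
    have hx' : ‖p.b * x‖ ≤ 1 / 2 := by
      rw [mem_ball_zero_iff, hr, lt_div_iff₀ (by positivity)] at hx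
      rw [norm_mul]; linarith
    have hs := (hasSum_geometric_of_lt_one (r := 1 / 2) (by norm_num) (by norm_num)).mul_left M
    have := tsum_of_norm_bounded hs (hM γ (by rw [norm_mul, norm_coe, mul_one])
      (by rw [norm_div, norm_coe, div_one]) x hx')
    norm_num at this; exact this
  have hmem : ∀ ε, ∀ n ≥ N, (p.pt (ε, n) : ℂ) ∈ ball (0 : ℂ) r := fun ε n hn => by
    rw [mem_ball_zero_iff, norm_real]; exact hN ε n hn
  have hphi : ∀ γ : Circle, ∀ ε, ∀ n ≥ N, p.phi γ (ε, n) = p.phiFun γ (p.pt (ε, n)) :=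
    fun γ ε n hn => h.phi_eq γ.coe_ne_zero (by
      have := hmem ε n hn
      rw [mem_ball_zero_iff, hr, lt_div_iff₀ (by positivity)] at this
      rw [norm_mul]; linarith)
  set C' := (2 * (M * 2) + 1) / r
  have hC' : 0 < C' := by positivity
  refine ⟨N, M * 2 + 2 * C' / (1 - p.q), by positivity, fun γ ε n hn => ⟨?_, ?_⟩⟩
  · rw [hphi γ ε n hn]
    have : 0 < 2 * C' / (1 - p.q) := by positivity
    linarith [hbd γ _ (hmem ε n hn)]
  · have d1 := norm_sub_le_of_differentiableOn (h.differentiableOn_phiFun_right γ) (hbd γ)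
      (hmem ε n hn)
    have d2 := norm_sub_le_of_differentiableOn (h.differentiableOn_phiFun_right γ) (hbd γ)
      (hmem ε (n + 1) (by omega))
    change ‖_‖ ≤ C' * _ at d1 d2
    have hx := norm_pos_iff.2 (h.pt_ne (ε, n))
    have e : ‖(p.pt (ε, n + 1) : ℂ)‖ ≤ ‖(p.pt (ε, n) : ℂ)‖ := by
      rw [show p.pt (ε, n + 1) = p.q * p.pt (ε, n) from h.pt_up (ε, n)]; push_cast
      rw [norm_mul, norm_of_nonneg hq0.le]
      nlinarith [h.q_lt_one]
    have hC2 : 2 * C' / (1 - p.q) ≤ M * 2 + 2 * C' / (1 - p.q) := by linarith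
    refine le_trans ?_ hC2
    have en : ‖(1 - p.q : ℂ)‖ = 1 - p.q := by rw [← ofReal_one, ← ofReal_sub, norm_of_nonneg hq.le]
    rw [qDeriv, up, hphi γ ε n hn, hphi γ ε (n + 1) (by omega), norm_div, norm_mul, en,
      div_le_div_iff₀ (by positivity) hq]
    have t := norm_sub_le (p.phiFun γ (p.pt (ε, n)) - p.phiFun γ 0)
      (p.phiFun γ (p.pt (ε, n + 1)) - p.phiFun γ 0)
    rw [sub_sub_sub_cancel_right] at t
    have : ‖p.phiFun γ (p.pt (ε, n)) - p.phiFun γ (p.pt (ε, n + 1))‖ ≤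
        2 * C' * ‖(p.pt (ε, n) : ℂ)‖ := by
      have := mul_le_mul_of_nonneg_left e hC'.le
      linarith
    nlinarith

lemma exists_phi_circle_bound (i : RqIndex) :
    ∃ B, ∀ γ : Circle, ‖p.phi γ i‖ ≤ B := by
  have hc : Continuous fun γ : Circle => p.phi γ i :=
    (h.differentiableOn_phi i).continuousOn.comp_continuous continuous_subtype_val
      fun γ => γ.coe_ne_zero
  obtain ⟨B, hB⟩ := isCompact_univ.exists_bound_of_continuousOn hc.continuousOn
  exact ⟨B, fun γ => hB γ (Set.mem_univ _)⟩

end IsReg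

/-! ### Fourier coefficients of bounded functions -/

lemma neg_pi_le_pi : -π ≤ π := by linarith [pi_pos]

lemma intervalIntegrable_iff_Ioc {E : Type*} [NormedAddCommGroup E] {f : ℝ → E} :
    IntervalIntegrable f volume (-π) π ↔ IntegrableOn f (Ioc (-π) π) :=
  intervalIntegrable_iff_integrableOn_Ioc_of_le neg_pi_le_pi

lemma intervalIntegrable_of_bound {f : ℝ → ℂ} (hf : AEStronglyMeasurable f muT) {B : ℝ}
    (hB : ∀ t, ‖f t‖ ≤ B) : IntervalIntegrable f volume (-π) π := by
  rw [intervalIntegrable_iff_Ioc]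
  exact Integrable.of_bound hf B (.of_forall hB)

/-- Fourier coefficients on the unit circle. -/
def fc (f : ℝ → ℂ) (j : ℤ) : ℂ := 1 / (2 * π) * ∫ t in -π..π, f t * exp t ^ (-j)

lemma hasSum_sq_fc {f : ℝ → ℂ} (hf : AEStronglyMeasurable f muT) {B : ℝ} (hB : ∀ t, ‖f t‖ ≤ B) :
    HasSum (fun j => ‖fc f j‖ ^ 2) ((2 * π)⁻¹ * ∫ t in -π..π, ‖f t‖ ^ 2) := by
  have hab : -π < π := by linarith [pi_pos]
  have h := hasSum_sq_fourierCoeffOn hab (MemLp.of_bound hf B (.of_forall hB))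
  rw [show π - -π = 2 * π by ring, smul_eq_mul] at h
  refine h.congr_fun fun j => ?_
  rw [fourierCoeffOn_eq_integral, fc]
  congr 2
  rw [show π - -π = 2 * π by ring, Complex.real_smul]
  push_cast
  congr 1
  refine integral_congr fun t _ => ?_
  have hp : (π : ℂ) ≠ 0 := mod_cast Real.pi_ne_zero
  simp only [smul_eq_mul]
  rw [fourier_coe_apply, mul_comm, ← Complex.exp_int_mul]
  congr 2
  push_cast
  field_simp

lemma tendsto_fc {f : ℝ → ℂ} (hf : AEStronglyMeasurable f muT) {B : ℝ} (hB : ∀ t, ‖f t‖ ≤ B) :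
    Tendsto (fc f) cofinite (𝓝 0) := by
  have := ((continuous_sqrt.tendsto _).comp (hasSum_sq_fc hf hB).summable.tendsto_cofinite_zero)
  rw [sqrt_zero] at this
  rw [tendsto_zero_iff_norm_tendsto_zero]
  refine this.congr fun j => ?_
  rw [Function.comp, sqrt_sq (norm_nonneg _)]

lemma measurable_exp_zpow (n : ℤ) : Measurable fun t : ℝ => (exp t : ℂ) ^ n := by
  have : Continuous fun t : ℝ => (exp t : ℂ) := continuous_subtype_val.comp exp.continuous
  exact (this.zpow₀ n fun t => Or.inl (exp t).coe_ne_zero).measurable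

lemma norm_exp_zpow (t : ℝ) (n : ℤ) : ‖(exp t : ℂ) ^ n‖ = 1 := by
  rw [norm_zpow, norm_coe, one_zpow]

/-- The Chebyshev factor `cos nt`. -/
def cheb (n : ℤ) (t : ℝ) : ℂ := ((exp t : ℂ) ^ n + exp t ^ (-n)) / 2

lemma cheb_neg (n : ℤ) (t : ℝ) : cheb (-n) t = cheb n t := by rw [cheb, cheb, neg_neg, add_comm]

lemma cheb_zero (t : ℝ) : cheb 0 t = 1 := by simp [cheb]

lemma coe_exp_neg (t : ℝ) : (exp (-t) : ℂ) = (exp t : ℂ)⁻¹ := by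
  rw [Circle.exp_neg, coe_inv]

lemma cheb_even (n : ℤ) (t : ℝ) : cheb n (-t) = cheb n t := by
  simp only [cheb, coe_exp_neg, inv_zpow', neg_neg]; ring

lemma norm_cheb_le (n : ℤ) (t : ℝ) : ‖cheb n t‖ ≤ 1 := by
  rw [cheb, norm_div]
  have := norm_add_le ((exp t : ℂ) ^ n) ((exp t : ℂ) ^ (-n))
  rw [norm_exp_zpow, norm_exp_zpow] at this
  norm_num at this ⊢
  linarith

lemma measurable_cheb (n : ℤ) : Measurable (cheb n) :=
  ((measurable_exp_zpow n).add (measurable_exp_zpow (-n))).div_const 2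

lemma mu_mul_cheb (n : ℤ) (t : ℝ) :
    mu (exp t) * cheb n t = cheb (n + 1) t + cheb (n - 1) t := by
  have := (exp t).coe_ne_zero
  simp only [mu, cheb, neg_add, neg_sub]
  rw [zpow_add₀ this, zpow_add₀ this, zpow_sub₀ this, zpow_sub₀ this, zpow_neg_one, zpow_one]
  simp only [zpow_neg]
  field_simp
  ring

lemma integral_cheb_mul {f : ℝ → ℂ} (hf : AEStronglyMeasurable f muT) {B : ℝ}
    (hB : ∀ t, ‖f t‖ ≤ B) (n j : ℤ) :
    1 / (4 * π) * ∫ t in -π..π, cheb n t * (f t * exp t ^ (-j)) =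
      (fc f (j - n) + fc f (j + n)) / 4 := by
  have hI : ∀ m : ℤ, IntervalIntegrable (fun t => f t * exp t ^ m) volume
      (-π) π := fun m =>
    intervalIntegrable_of_bound (hf.mul (measurable_exp_zpow m).aestronglyMeasurable)
      (B := B) fun t => by rw [norm_mul, norm_exp_zpow, mul_one]; exact hB t
  have e : ∀ t, cheb n t * (f t * exp t ^ (-j)) =
      (1 / 2) * (f t * exp t ^ (-(j - n)) + f t * exp t ^ (-(j + n))) :=
    fun t => by
      have := (exp t).coe_ne_zero
      rw [cheb, neg_sub, neg_add, sub_eq_add_neg, zpow_add₀ this, zpow_add₀ this]; ring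
  simp_rw [e]
  rw [intervalIntegral.integral_const_mul, intervalIntegral.integral_add (hI _) (hI _), fc, fc]
  have hp : (π : ℂ) ≠ 0 := mod_cast Real.pi_ne_zero
  field_simp

lemma tendsto_integral_cheb {f : ℝ → ℂ} (hf : AEStronglyMeasurable f muT) {B : ℝ}
    (hB : ∀ t, ‖f t‖ ≤ B) :
    Tendsto (fun n : ℕ => 1 / (4 * π) * ∫ t in -π..π, cheb n t * f t : ℕ → ℂ) atTop (𝓝 0) := by
  have e := fun n : ℕ => integral_cheb_mul hf hB n 0
  simp only [neg_zero, zpow_zero, mul_one, zero_sub, zero_add] at e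
  simp_rw [e]
  have t := tendsto_fc hf hB
  have i1 : Tendsto (fun n : ℕ => -(n : ℤ)) atTop cofinite := by
    rw [← Nat.cofinite_eq_atTop]
    exact Function.Injective.tendsto_cofinite fun m n e => by simpa using e
  have i2 : Tendsto (fun n : ℕ => (n : ℤ)) atTop cofinite := by
    rw [← Nat.cofinite_eq_atTop]
    exact Function.Injective.tendsto_cofinite Nat.cast_injective
  simpa using ((t.comp i1).add (t.comp i2)).div_const 4

lemma integral_comp_neg_pi (f : ℝ → ℂ) :
    ∫ t in -π..π, f (-t) = ∫ t in -π..π, f t := by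
  rw [integral_comp_neg, neg_neg]

/-! ### Null sequences in `ℓ²` -/

/-- Convergence to zero in `ℓ²`. -/
def SqNull (F : ℕ → RqIndex → ℂ) : Prop :=
  (∀ n, Summable fun i => ‖F n i‖ ^ 2) ∧ Tendsto (fun n => ∑' i, ‖F n i‖ ^ 2) atTop (𝓝 0)

lemma SqNull.add {F G : ℕ → RqIndex → ℂ} (hF : SqNull F) (hG : SqNull G) :
    SqNull fun n i => F n i + G n i := by
  have b : ∀ n i, ‖F n i + G n i‖ ^ 2 ≤ 2 * ‖F n i‖ ^ 2 + 2 * ‖G n i‖ ^ 2 := fun n i => by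
    have := norm_add_le (F n i) (G n i)
    nlinarith [sq_nonneg (‖F n i‖ - ‖G n i‖), norm_nonneg (F n i + G n i)]
  have s1 := fun n => (hF.1 n).mul_left 2
  have s2 := fun n => (hG.1 n).mul_left 2
  have s := fun n => Summable.of_nonneg_of_le (fun i => sq_nonneg _) (b n) ((s1 n).add (s2 n))
  refine ⟨s, squeeze_zero (fun n => tsum_nonneg fun i => sq_nonneg _)
    (fun n => (s n).tsum_le_tsum (b n) ((s1 n).add (s2 n))) ?_⟩
  simp_rw [fun n => (s1 n).tsum_add (s2 n), tsum_mul_left]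
  simpa using (hF.2.const_mul 2).add (hG.2.const_mul 2)

lemma SqNull.of_dominated {F : ℕ → RqIndex → ℂ} {D : RqIndex → ℝ} (hD : Summable fun i => D i ^ 2)
    (hF : ∀ n i, ‖F n i‖ ≤ D i) (h0 : ∀ i, Tendsto (fun n => F n i) atTop (𝓝 0)) : SqNull F := by
  have b : ∀ n i, ‖F n i‖ ^ 2 ≤ D i ^ 2 := fun n i =>
    pow_le_pow_left₀ (norm_nonneg _) (hF n i) 2
  refine ⟨fun n => Summable.of_nonneg_of_le (fun i => sq_nonneg _) (b n) hD, ?_⟩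
  have := tendsto_tsum_of_dominated_convergence (𝓕 := atTop) (f := fun n i => ‖F n i‖ ^ 2)
    (g := fun _ => (0 : ℝ)) hD (fun i => by simpa using ((h0 i).norm.pow 2))
    (.of_forall fun n i => by rw [Real.norm_of_nonneg (sq_nonneg _)]; exact b n i)
  simpa using this

/-- Translation along both half lines. -/
def shiftEquiv (m : ℤ) : RqIndex ≃ RqIndex := (Equiv.refl Bool).prodCongr (Equiv.addRight m)

lemma shiftEquiv_apply (m : ℤ) (i : RqIndex) : shiftEquiv m i = (i.1, i.2 + m) := rfl

lemma SqNull.of_shift {δ : RqIndex → ℝ} {S : RqIndex → ℂ} {e : ℕ → ℤ} {C : ℝ}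
    (hδ : ∀ i, |δ i| ≤ C) (hS : Summable fun i => ‖S i‖ ^ 2)
    (h0 : ∀ i : RqIndex, Tendsto (fun n => δ (i.1, i.2 - e n)) atTop (𝓝 0)) :
    SqNull fun n i => δ i * S (i.1, i.2 + e n) := by
  have hG : SqNull fun n i => δ (i.1, i.2 - e n) * S i := by
    refine SqNull.of_dominated (D := fun i => C * ‖S i‖) ?_ (fun n i => ?_) fun i => ?_
    · simp_rw [mul_pow]; exact hS.mul_left _
    · rw [norm_mul, norm_real]
      exact mul_le_mul_of_nonneg_right (hδ _) (norm_nonneg _)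
    · have := ((continuous_ofReal.tendsto 0).comp (h0 i)).mul_const (S i)
      simpa using this
  have e1 : ∀ n i, ‖(δ i : ℂ) * S (i.1, i.2 + e n)‖ ^ 2 =
      (fun i : RqIndex => ‖(δ (i.1, i.2 - e n) : ℂ) * S i‖ ^ 2) (shiftEquiv (e n) i) := fun n i => by
    simp [shiftEquiv_apply]
  refine ⟨fun n => ?_, ?_⟩
  · simp_rw [e1]
    exact ((shiftEquiv (e n)).summable_iff (f := fun i : RqIndex =>
      ‖(δ (i.1, i.2 - e n) : ℂ) * S i‖ ^ 2)).2 (hG.1 n)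
  · refine hG.2.congr fun n => ?_
    simp_rw [e1]
    exact ((shiftEquiv (e n)).tsum_eq fun i : RqIndex =>
      ‖(δ (i.1, i.2 - e n) : ℂ) * S i‖ ^ 2).symm

lemma lp_norm_sq (f : lp (fun _ : RqIndex => ℂ) 2) : ‖f‖ ^ 2 = ∑' i, ‖f i‖ ^ 2 := by
  have := lp.norm_rpow_eq_tsum (p := 2) (by norm_num) f
  simpa using this

/-- Bounded sequences that tend to zero pointwise are weakly null. -/
lemma tendsto_inner_of_pointwise {X : ℕ → lp (fun _ : RqIndex => ℂ) 2} {C : ℝ}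
    (hX : ∀ n, ‖X n‖ ≤ C) (h0 : ∀ i, Tendsto (fun n => X n i) atTop (𝓝 0))
    (f : lp (fun _ : RqIndex => ℂ) 2) : Tendsto (fun n => inner ℂ (X n) f) atTop (𝓝 0) := by
  classical
  have hC : 0 ≤ C := (norm_nonneg _).trans (hX 0)
  rw [Metric.tendsto_atTop]
  intro ε hε
  have hs := lp.hasSum_single (p := 2) (by norm_num) f
  obtain ⟨s, hs⟩ := (Metric.tendsto_nhds.1 hs (ε / (2 * (C + 1))) (by positivity)).exists
  set P := ∑ i ∈ s, lp.single (E := fun _ : RqIndex => ℂ) 2 i (f i)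
  have t : Tendsto (fun n => inner ℂ (X n) P) atTop (𝓝 0) := by
    have : ∀ n, inner ℂ (X n) P = ∑ i ∈ s, f i * conj (X n i) := fun n => by
      rw [inner_sum]
      refine sum_congr rfl fun i _ => ?_
      rw [lp.inner_single_right]; rfl
    simp_rw [this]
    rw [show (0 : ℂ) = ∑ i ∈ s, f i * 0 by simp]
    refine tendsto_finsetSum _ fun i _ => Tendsto.const_mul _ ?_
    have := (continuous_conj.tendsto _).comp (h0 i)
    rw [map_zero] at this; exact this
  obtain ⟨N, hN⟩ := Metric.tendsto_atTop.1 t (ε / 2) (by positivity)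
  refine ⟨N, fun n hn => ?_⟩
  have h1 := hN n hn
  rw [dist_zero_right] at h1 ⊢
  rw [dist_comm, dist_eq_norm] at hs
  have h2 : ‖inner ℂ (X n) (f - P)‖ ≤ C * (ε / (2 * (C + 1))) :=
    (norm_inner_le_norm _ _).trans (mul_le_mul (hX n) hs.le (norm_nonneg _) hC)
  have h3 : C * (ε / (2 * (C + 1))) < ε / 2 := by
    rw [← mul_div_assoc, div_lt_div_iff₀ (by positivity) two_pos]; nlinarith
  have e : inner ℂ (X n) f = inner ℂ (X n) P + inner ℂ (X n) (f - P) := by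
    rw [← inner_add_right, add_sub_cancel]
  rw [e]
  linarith [norm_add_le (inner ℂ (X n) P) (inner ℂ (X n) (f - P))]

lemma wave_solution {c : ℤ → ℤ → ℂ}
    (hw : ∀ j k, c (j + 1) k + c (j - 1) k = c j (k + 1) + c j (k - 1))
    (hs : ∀ j k, c j (-k) = c j k) (k : ℕ) (j : ℤ) :
    2 * c j k = c (j + k) 0 + c (j - k) 0 := by
  induction k using Nat.strong_induction_on generalizing j with
  | _ k ih =>
    match k with
    | 0 => simp; ring
    | 1 =>
      have h := hw j 0
      have h2 := hs j 1
      simp only [zero_add, zero_sub] at h; push_cast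
      linear_combination -h - h2
    | k + 2 =>
      have i1 := ih (k + 1) (by omega) (j + 1)
      have i2 := ih (k + 1) (by omega) (j - 1)
      have i3 := ih k (by omega) j
      have h := hw j (k + 1)
      push_cast at i1 i2 ⊢
      rw [show j + 1 + ((k : ℤ) + 1) = j + (k + 2) by ring,
        show j + 1 - ((k : ℤ) + 1) = j - k by ring] at i1
      rw [show j - 1 + ((k : ℤ) + 1) = j + k by ring,
        show j - 1 - ((k : ℤ) + 1) = j - (k + 2) by ring] at i2
      rw [show (k : ℤ) + 1 + 1 = k + 2 by ring, show (k : ℤ) + 1 - 1 = k by ring] at h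
      linear_combination -2 * h + i1 + i2 - i3

/-! ### Wave packets -/

/-- Pointwise control of a coefficient vector on the circle. -/
def NiceAt (p : Params) (N t : ℝ) (y : ℂ²) : Prop :=
  y = 0 ∨ ((exp t : ℂ) ^ 2 ≠ 1 ∧ (∀ j, ‖y j‖ ≤ N) ∧
    ∀ ε, ‖p.dCoef ε (exp t)‖ ≤ N ∧ ‖p.dCoef ε (exp t : ℂ)⁻¹‖ ≤ N ∧
      ‖p.dagger.dCoef ε (exp t)‖ ≤ N ∧ ‖p.dagger.dCoef ε (exp t : ℂ)⁻¹‖ ≤ N)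

/-- Bounded even coefficient functions supported where the connection coefficients are bounded. -/
structure Nice (p : Params) (N : ℝ) (u : ℝ → ℂ²) : Prop where
  one_le : 1 ≤ N
  meas : ∀ j, AEStronglyMeasurable (fun t => u t j) muT
  even : ∀ᵐ t ∂muT, u (-t) = u t
  at_pt : ∀ t, p.NiceAt N t (u t)

lemma Nice.bound (hu : p.Nice N u) (t : ℝ) (j : Fin 2) :
    ‖u t j‖ ≤ N := by
  rcases hu.at_pt t with h | h
  · rw [h]; simpa using zero_le_one.trans hu.one_le
  · exact h.2.1 j

lemma Nice.smul {N M : ℝ} (hu : p.Nice N u) {c : ℝ → ℂ}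
    (hc : AEStronglyMeasurable c muT) (he : ∀ᵐ t ∂muT, c (-t) = c t) (hM : 1 ≤ M)
    (hb : ∀ t, ‖c t‖ ≤ M) : p.Nice (N * M) fun t => c t • u t where
  one_le := by nlinarith [hu.one_le]
  meas j := hc.mul (hu.meas j)
  even := by filter_upwards [hu.even, he] with t ht ht'; rw [ht, ht']
  at_pt t := by
    have hN := zero_le_one.trans hu.one_le
    have hNM : N ≤ N * M := le_mul_of_one_le_right hN hM
    rcases hu.at_pt t with h | ⟨h1, h2, h3⟩
    · left; rw [h, smul_zero]
    · refine Or.inr ⟨h1, fun j => ?_, fun ε => ?_⟩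
      · rw [Pi.smul_apply, smul_eq_mul, norm_mul, mul_comm N]
        exact mul_le_mul (hb t) (h2 j) (norm_nonneg _) (zero_le_one.trans hM)
      · obtain ⟨a1, a2, a3, a4⟩ := h3 ε
        exact ⟨a1.trans hNM, a2.trans hNM, a3.trans hNM, a4.trans hNM⟩

/-- The combination of `φ_γ` and `φ_γ†` with coefficients `y`. -/
def kern (p : Params) (i : RqIndex) (t : ℝ) (y : ℂ²) : ℂ :=
  p.phi (exp t) i * y 0 + p.dagger.phi (exp t) i * y 1

/-- The wave packet with coefficient function `u`. -/
def packet (p : Params) (u : ℝ → ℂ²) (i : RqIndex) : ℂ :=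
  1 / (4 * π) * ∫ t in -π..π, p.kern i t (u t)

lemma IsReg.continuous_phi_exp (h : p.IsReg) (i : RqIndex) :
    Continuous fun t : ℝ => p.phi (exp t) i :=
  ((h.differentiableOn_phi i).continuousOn.comp_continuous continuous_subtype_val
    fun γ : Circle => γ.coe_ne_zero).comp exp.continuous

lemma IsReg.aesm_kern (h : p.IsReg)
    (hu : ∀ j, AEStronglyMeasurable (fun t => u t j) muT) (i : RqIndex) :
    AEStronglyMeasurable (fun t => p.kern i t (u t)) muT :=
  ((h.continuous_phi_exp i).aestronglyMeasurable.mul (hu 0)).add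
    ((h.dagger.continuous_phi_exp i).aestronglyMeasurable.mul (hu 1))

lemma IsReg.exists_kern_bound (h : p.IsReg) : ∃ B : RqIndex → ℝ, (∀ i, 0 < B i) ∧
    (∃ N₀ : ℤ, ∃ C, ∀ ε, ∀ n ≥ N₀, B (ε, n) ≤ C) ∧
    ∀ i t (y : ℂ²) (N : ℝ), (∀ j, ‖y j‖ ≤ N) → ‖p.kern i t y‖ ≤ B i * N := by
  obtain ⟨N1, C1, hC1, h1⟩ := h.exists_phi_bound
  obtain ⟨N2, C2, hC2, h2⟩ := h.dagger.exists_phi_bound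
  choose B1 hB1 using h.exists_phi_circle_bound
  choose B2 hB2 using h.dagger.exists_phi_circle_bound
  refine ⟨fun i => if max N1 N2 ≤ i.2 then C1 + C2 else |B1 i| + |B2 i| + 1, fun i => ?_,
    ⟨max N1 N2, C1 + C2, fun ε n hn => (if_pos hn).le⟩, fun i t y N hy => ?_⟩
  · dsimp only; split_ifs <;> positivity
  · have key : ‖p.phi (exp t) i‖ + ‖p.dagger.phi (exp t) i‖ ≤
        if max N1 N2 ≤ i.2 then C1 + C2 else |B1 i| + |B2 i| + 1 := by
      split_ifs with hi
      · exact add_le_add (h1 _ i.1 i.2 ((le_max_left _ _).trans hi)).1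
          (h2 _ i.1 i.2 ((le_max_right _ _).trans hi)).1
      · linarith [hB1 i (exp t), hB2 i (exp t), le_abs_self (B1 i),
          le_abs_self (B2 i)]
    refine le_trans ?_ (mul_le_mul_of_nonneg_right key ((norm_nonneg _).trans (hy 0)))
    rw [kern, add_mul]
    refine (norm_add_le _ _).trans (add_le_add ?_ ?_) <;> rw [norm_mul] <;>
      exact mul_le_mul_of_nonneg_left (hy _) (norm_nonneg _)

lemma L_kern (hr : p.IsReg) (i : RqIndex) (t : ℝ) (y : ℂ²) :
    p.coeffA (p.pt i) * p.kern (down i) t y + p.coeffB (p.pt i) * p.kern (up i) t y +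
      p.coeffC (p.pt i) * p.kern i t y = mu (exp t) * p.kern i t y := by
  have h1 := hr.L_phi (exp t).coe_ne_zero i
  have h2 := hr.dagger.L_phi (exp t).coe_ne_zero i
  rw [L_dagger] at h2
  simp only [L] at h1 h2
  simp only [kern]
  linear_combination y 0 * h1 + y 1 * h2

lemma IsReg.intervalIntegrable_kern (h : p.IsReg)
    (hu : p.Nice N u) (i : RqIndex) :
    IntervalIntegrable (fun t => p.kern i t (u t)) volume (-π) π := by
  obtain ⟨B, -, -, hB⟩ := h.exists_kern_bound
  exact intervalIntegrable_of_bound (h.aesm_kern hu.meas i) fun t => hB i t (u t) N (hu.bound t)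

lemma IsReg.L_packet (h : p.IsReg) (hu : p.Nice N u) :
    p.L (p.packet u) = p.packet fun t => mu (exp t) • u t := by
  ext i
  have hI := h.intervalIntegrable_kern hu
  have e : ∀ t, p.kern i t (mu (exp t) • u t) =
      p.coeffA (p.pt i) * p.kern (down i) t (u t) + p.coeffB (p.pt i) * p.kern (up i) t (u t) +
      p.coeffC (p.pt i) * p.kern i t (u t) := fun t => by
    rw [L_kern h]; simp only [kern, Pi.smul_apply, smul_eq_mul]; ring
  simp only [L, packet]
  simp_rw [e]
  rw [intervalIntegral.integral_add (((hI _).const_mul _).add ((hI _).const_mul _))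
    ((hI _).const_mul _), intervalIntegral.integral_add ((hI _).const_mul _) ((hI _).const_mul _),
    intervalIntegral.integral_const_mul, intervalIntegral.integral_const_mul,
    intervalIntegral.integral_const_mul]
  ring

lemma IsReg.reg_packet (h : p.IsReg) (hu : p.Nice N u) :
    p.Reg (p.packet u) := by
  have hI := h.intervalIntegrable_kern hu
  obtain ⟨N1, C1, hC1, h1⟩ := h.exists_phi_bound
  obtain ⟨N2, C2, hC2, h2⟩ := h.dagger.exists_phi_bound
  have hb := hu.bound
  have gen : ∀ {F F' : ℝ → RqIndex → ℂ} {l l' : ℝ → ℂ}, (∀ i, Measurable fun t => F t i) →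
      (∀ i, Measurable fun t => F' t i) →
      (∀ t ε, ∀ n ≥ N1, ‖F t (ε, n)‖ ≤ C1) → (∀ t ε, ∀ n ≥ N2, ‖F' t (ε, n)‖ ≤ C2) →
      (∀ t ε, Tendsto (fun n : ℤ => F t (ε, n)) atTop (𝓝 (l t))) →
      (∀ t ε, Tendsto (fun n : ℤ => F' t (ε, n)) atTop (𝓝 (l' t))) → ∀ ε,
      Tendsto (fun n : ℤ => 1 / (4 * π) * ∫ t in -π..π,
        (F t (ε, n) * u t 0 + F' t (ε, n) * u t 1) : ℤ → ℂ) atTop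
        (𝓝 (1 / (4 * π) * ∫ t in -π..π, (l t * u t 0 + l' t * u t 1))) := by
    intro F F' l l' m1 m2 b1 b2 t1 t2 ε
    refine Tendsto.const_mul _ (intervalIntegral.tendsto_integral_filter_of_dominated_convergence
      (fun _ => C1 * N + C2 * N) (.of_forall fun n => ?_) ?_ (by simp)
      (.of_forall fun t _ => ((t1 t ε).mul_const _).add ((t2 t ε).mul_const _)))
    · rw [Set.uIoc_of_le neg_pi_le_pi]
      exact ((m1 _).aestronglyMeasurable.mul (hu.meas 0)).add
        ((m2 _).aestronglyMeasurable.mul (hu.meas 1))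
    · filter_upwards [eventually_ge_atTop (max N1 N2)] with n hn
      refine .of_forall fun t _ => (norm_add_le _ _).trans (add_le_add ?_ ?_) <;> rw [norm_mul]
      · exact mul_le_mul (b1 t ε n ((le_max_left _ _).trans hn)) (hb t 0) (norm_nonneg _) hC1.le
      · exact mul_le_mul (b2 t ε n ((le_max_right _ _).trans hn)) (hb t 1) (norm_nonneg _) hC2.le
  have l1 := fun (t : ℝ) ε => h.phi_limits (exp t).coe_ne_zero ε
  have l2 := fun (t : ℝ) ε => h.dagger.phi_limits (exp t).coe_ne_zero ε
  have m1 : ∀ i, Measurable fun t : ℝ => p.phi (exp t) i := fun i =>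
    (h.continuous_phi_exp i).measurable
  have m2 : ∀ i, Measurable fun t : ℝ => p.dagger.phi (exp t) i := fun i =>
    (h.dagger.continuous_phi_exp i).measurable
  refine ⟨⟨_, gen m1 m2 (fun t ε n hn => (h1 _ ε n hn).1) (fun t ε n hn => (h2 _ ε n hn).1)
    (fun t ε => (l1 t ε).1) (fun t ε => (l2 t ε).1)⟩,
    ⟨_, fun ε => (gen (F := fun t => p.qDeriv (p.phi (exp t)))
      (F' := fun t => p.qDeriv (p.dagger.phi (exp t)))
      (fun i => ((m1 i).sub (m1 (up i))).div_const _) (fun i => ((m2 i).sub (m2 (up i))).div_const _)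
      (fun t ε n hn => (h1 _ ε n hn).2) (fun t ε n hn => (h2 _ ε n hn).2)
    (fun t ε => (l1 t ε).2) (fun t ε => (l2 t ε).2) ε).congr fun n => ?_⟩⟩
  rw [qDeriv, packet, packet, ← mul_sub, ← intervalIntegral.integral_sub (hI _) (hI _),
    mul_div_assoc, ← intervalIntegral.integral_div]
  congr 1
  refine integral_congr fun t _ => ?_
  simp only [qDeriv, kern]
  ring

/-! ### Asymptotics of wave packets -/

/-- The leading term of `kern` at infinity. -/
def farMain (p : Params) (i : RqIndex) (t : ℝ) (y : ℂ²) : ℂ :=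
  p.s ^ (-i.2) * (p.trc i.1 (exp t) y * exp t ^ (-i.2) + p.trc i.1 (exp t : ℂ)⁻¹ y * exp t ^ i.2)

lemma NiceAt.norm_trc_le {N t : ℝ} {y : ℂ²} (hy : p.NiceAt N t y) (ε : Bool) :
    ‖p.trc ε (exp t) y‖ ≤ 2 * N ^ 2 ∧ ‖p.trc ε (exp t : ℂ)⁻¹ y‖ ≤ 2 * N ^ 2 := by
  rcases hy with h | ⟨-, h2, h3⟩
  · rw [h]; simp only [trc, Pi.zero_apply, mul_zero, add_zero, norm_zero]
    exact ⟨by positivity, by positivity⟩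
  · obtain ⟨a1, a2, a3, a4⟩ := h3 ε
    have hN := (norm_nonneg _).trans (h2 0)
    have k : ∀ a b : ℂ, ‖a‖ ≤ N → ‖b‖ ≤ N → ‖a * y 0 + b * y 1‖ ≤ 2 * N ^ 2 := fun a b ha hb => by
      have e1 := mul_le_mul ha (h2 0) (norm_nonneg _) hN
      have e2 := mul_le_mul hb (h2 1) (norm_nonneg _) hN
      rw [← norm_mul] at e1 e2; linarith [norm_add_le (a * y 0) (b * y 1)]
    exact ⟨k _ _ a1 a3, k _ _ a2 a4⟩

lemma IsReg.exists_asym_sub_bound (h : p.IsReg) : ∃ K : ℤ, ∃ C > 0, ∀ ε, ∀ n ≤ K, ∀ γ : ℂ,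
    ‖γ‖ = 1 → ‖p.asym γ (ε, n) - (p.s * γ) ^ (-n)‖ ≤ C * (‖p.s‖ ^ (-n) * ‖(1 / p.pt (ε, n) : ℂ)‖) := by
  obtain ⟨C, hC, r, hr, hb⟩ := h.exists_asym_bound (R := 1) (by simpa using h.q_lt_one) zero_le_one
  obtain ⟨K, hK⟩ := h.exists_far (1 / r)
  refine ⟨K, C, hC, fun ε n hn γ hγ => ?_⟩
  have hx : ‖(1 / p.pt (ε, n) : ℂ)‖ < r := by
    have := hK ε n hn
    have h0 : 0 < |p.pt (ε, n)| := lt_trans (by positivity) this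
    rw [norm_div, norm_one, norm_real, norm_eq_abs, div_lt_iff₀ h0]
    rwa [div_lt_iff₀ hr, mul_comm] at this
  have := hb γ hγ.le _ hx
  rw [asym, ← mul_sub_one, norm_mul, norm_zpow, norm_mul, hγ, mul_one]
  calc _ ≤ ‖p.s‖ ^ (-n) * (C * ‖(1 / p.pt (ε, n) : ℂ)‖) :=
        mul_le_mul_of_nonneg_left this (by positivity)
    _ = _ := by ring

lemma IsReg.exists_far_kern (h : p.IsReg) : ∃ K : ℤ, ∃ C > 0, ∀ ε, ∀ n ≤ K, ∀ N t y,
    p.NiceAt N t y → ‖p.kern (ε, n) t y - p.farMain (ε, n) t y‖ ≤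
      N ^ 2 * (C * (‖p.s‖ ^ (-n) * ‖(1 / p.pt (ε, n) : ℂ)‖)) := by
  obtain ⟨K1, C1, hC1, h1⟩ := h.exists_asym_sub_bound
  obtain ⟨K2, C2, hC2, h2⟩ := h.dagger.exists_asym_sub_bound
  obtain ⟨K3, h3⟩ := h.exists_phi_eq
  obtain ⟨K4, h4⟩ := h.dagger.exists_phi_eq
  refine ⟨min (min K1 K2) (min K3 K4), 2 * (C1 + C2), by positivity, fun ε n hn N t y hy => ?_⟩
  simp only [le_min_iff] at hn
  obtain ⟨⟨n1, n2⟩, n3, n4⟩ := hn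
  rcases hy with hy | ⟨hsq, hy, hd⟩
  · rw [hy]
    simp only [kern, farMain, trc, Pi.zero_apply, mul_zero, zero_mul, add_zero, sub_zero, norm_zero]
    positivity
  obtain ⟨a1, a2, a3, a4⟩ := hd ε
  have hN := (norm_nonneg _).trans (hy 0)
  set γ : ℂ := (exp t : ℂ) with hγdef
  have hγ0 : γ ≠ 0 := (exp t).coe_ne_zero
  have hγ : ‖γ‖ = 1 := norm_coe _
  have hγ' : ‖γ⁻¹‖ = 1 := by rw [norm_inv, hγ, inv_one]
  have hq : ∀ x : ℂ, ‖x‖ = 1 → p.q * ‖x‖ ^ 2 < 1 := fun x hx => by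
    rw [hx, one_pow, mul_one]; exact h.q_lt_one
  have b1 := h1 ε n n1 γ hγ
  have b2 := h1 ε n n1 γ⁻¹ hγ'
  have b3 := h2 ε n n2 γ hγ
  have b4 := h2 ε n n2 γ⁻¹ hγ'
  rw [s_dagger, pt_dagger] at b3 b4
  set X := ‖p.s‖ ^ (-n) * ‖(1 / p.pt (ε, n) : ℂ)‖
  have hX : 0 ≤ X := by positivity
  have e : p.kern (ε, n) t y - p.farMain (ε, n) t y =
      y 0 * p.dCoef ε γ * (p.asym γ (ε, n) - (p.s * γ) ^ (-n)) +
      y 0 * p.dCoef ε γ⁻¹ * (p.asym γ⁻¹ (ε, n) - (p.s * γ⁻¹) ^ (-n)) +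
      (y 1 * p.dagger.dCoef ε γ * (p.dagger.asym γ (ε, n) - (p.s * γ) ^ (-n)) +
      y 1 * p.dagger.dCoef ε γ⁻¹ * (p.dagger.asym γ⁻¹ (ε, n) - (p.s * γ⁻¹) ^ (-n))) := by
    rw [kern, farMain, ← hγdef, h3 ε n n3 γ hγ0 hsq (hq _ hγ) (hq _ hγ'),
      h4 ε n n4 γ hγ0 hsq (hq _ hγ) (hq _ hγ'), mul_zpow, mul_zpow, inv_zpow, zpow_neg γ, inv_inv]
    simp only [trc]; ring
  have k : ∀ (a b c : ℂ) (C : ℝ), ‖a‖ ≤ N → ‖b‖ ≤ N → ‖c‖ ≤ C * X →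
      ‖a * b * c‖ ≤ N ^ 2 * (C * X) := fun a b c C ha hb hc => by
    rw [norm_mul, norm_mul, sq]
    exact mul_le_mul (mul_le_mul ha hb (norm_nonneg _) hN) hc (norm_nonneg _) (by positivity)
  rw [e]
  refine (norm_add_le _ _).trans (le_trans (add_le_add (norm_add_le _ _) (norm_add_le _ _)) ?_)
  linarith [k _ _ _ _ (hy 0) a1 b1, k _ _ _ _ (hy 0) a2 b2, k _ _ _ _ (hy 1) a3 b3,
    k _ _ _ _ (hy 1) a4 b4]

lemma tendsto_atBot_of_nat {f : ℤ → ℝ} {l : ℝ}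
    (h : Tendsto (fun k : ℕ => f (-(k : ℤ))) atTop (𝓝 l)) : Tendsto f atBot (𝓝 l) := by
  have h1 : Tendsto (fun n : ℤ => (-n).toNat) atBot atTop :=
    tendsto_atTop.2 fun b => by filter_upwards [eventually_le_atBot (-(b : ℤ))] with n hn; omega
  refine (h.comp h1).congr' ?_
  filter_upwards [eventually_le_atBot 0] with n hn
  simp only [Function.comp]
  congr 1; omega

lemma summable_rqIndex {f : RqIndex → ℝ} (h0 : ∀ i, 0 ≤ f i)
    (h1 : ∀ ε, Summable fun n : ℕ => f (ε, n)) (h2 : ∀ ε, Summable fun n : ℕ => f (ε, -(n : ℤ))) :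
    Summable f := by
  rw [summable_prod_of_nonneg h0]
  exact ⟨fun ε => Summable.of_nat_of_neg (h1 ε) (h2 ε), (hasSum_fintype _).summable⟩

lemma IsReg.s_eq_norm (h : p.IsReg) : p.s = (‖p.s‖ : ℝ) := by
  obtain ⟨r, h1, h2⟩ := h.s_pos
  rw [h2, norm_of_nonneg h1.le]

lemma IsGeneric.summable_mass_near (h : p.IsGeneric) (ε : Bool) :
    Summable fun n : ℕ => p.mass (ε, n) := by
  have hq := h.q_pos
  have t := ((h.isRegular.tendsto_w ε).comp (tendsto_natCast_atTop_atTop (R := ℤ))).norm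
  rw [norm_one] at t
  obtain ⟨N, hN⟩ := eventually_atTop.1 (t.eventually_lt_const (show (1 : ℝ) < 2 by norm_num))
  have hg := (summable_geometric_of_lt_one hq.le h.q_lt_one).mul_left ((1 - p.q) * |p.z ε| * 2)
  refine Summable.of_norm_bounded_eventually_nat hg ?_
  filter_upwards [eventually_ge_atTop N] with n hn
  have h1 := hN n hn
  have h2 := sub_pos.2 h.q_lt_one
  simp only [Function.comp] at h1
  rw [Real.norm_of_nonneg (h.mass_pos _).le, mass]
  have e : |p.pt (ε, (n : ℤ))| = |p.z ε| * p.q ^ n := by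
    rw [pt, abs_mul, zpow_natCast, abs_of_pos (pow_pos hq n)]
  rw [e]
  calc _ ≤ (1 - p.q) * (|p.z ε| * p.q ^ n) * 2 := by gcongr
    _ = _ := by ring

/-- The bounded factors in the asymptotics of wave packets. -/
def farFactor (p : Params) (K : ℤ) (i : RqIndex) : ℝ :=
  if i.2 ≤ K then √(p.mass i) * ‖p.s‖ ^ (-i.2) else 0

lemma IsReg.tendsto_farFactor (h : p.IsReg) (K : ℤ) (ε : Bool) :
    Tendsto (fun n : ℤ => p.farFactor K (ε, n)) atBot (𝓝 √‖p.kap ε‖) := by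
  have t : Tendsto (fun n : ℤ => ‖p.s‖ ^ (-n) * √(p.mass (ε, n))) atBot (𝓝 √‖p.kap ε‖) :=
    tendsto_atBot_of_nat (by simpa using h.tendsto_mass ε)
  refine t.congr' ?_
  filter_upwards [eventually_le_atBot K] with n hn
  rw [farFactor, if_pos hn, mul_comm]

lemma IsReg.exists_farFactor_le (h : p.IsReg) (K : ℤ) :
    ∃ C, ∀ i, |p.farFactor K i| ≤ C := by
  have key : ∀ ε, ∃ C, ∀ n, |p.farFactor K (ε, n)| ≤ C := fun ε => by
    obtain ⟨b, hb⟩ := eventually_atBot.1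
      ((h.tendsto_farFactor K ε).abs.eventually_lt_const (lt_add_one _))
    set C := |√‖p.kap ε‖| + 1
    have hs : ∀ n ∈ Icc b K, |p.farFactor K (ε, n)| ≤
        ∑ m ∈ Icc b K, |p.farFactor K (ε, m)| := fun n hn =>
      single_le_sum (f := fun m => |p.farFactor K (ε, m)|) (fun _ _ => abs_nonneg _) hn
    have hS : 0 ≤ ∑ m ∈ Icc b K, |p.farFactor K (ε, m)| := sum_nonneg fun _ _ => abs_nonneg _
    refine ⟨C + ∑ m ∈ Icc b K, |p.farFactor K (ε, m)|, fun n => ?_⟩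
    have hC : 0 ≤ C := by positivity
    rcases le_or_gt n b with hn | hn
    · linarith [hb n hn]
    · rcases le_or_gt n K with hk | hk
      · linarith [hs n (mem_Icc.2 ⟨hn.le, hk⟩)]
      · rw [farFactor, if_neg (not_le.2 hk), abs_zero]; linarith
  choose C hC using key
  refine ⟨max (C true) (C false), fun i => (hC i.1 i.2).trans ?_⟩
  cases i.1
  · exact le_max_right _ _
  · exact le_max_left _ _

lemma IsGeneric.exists_rem_bound (h : p.IsGeneric) : ∃ K : ℤ, ∃ D : RqIndex → ℝ,
    (Summable fun i => D i ^ 2) ∧ ∀ N t y i, 1 ≤ N → p.NiceAt N t y →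
      ‖(√(p.mass i) : ℂ) * (p.kern i t y - if i.2 ≤ K then p.farMain i t y else 0)‖ ≤
        N ^ 2 * D i := by
  have hr := h.isRegular
  have hq := h.q_pos
  obtain ⟨K, C, hC, hK⟩ := hr.exists_far_kern
  obtain ⟨C2, hC2⟩ := hr.exists_farFactor_le K
  obtain ⟨B, hB0, ⟨N₀, C1, hN₀⟩, hB⟩ := hr.exists_kern_bound
  set D : RqIndex → ℝ := fun i =>
    if i.2 ≤ K then C * (p.farFactor K i * ‖(1 / p.pt i : ℂ)‖) else √(p.mass i) * B i with hD
  refine ⟨K, D, summable_rqIndex (fun i => sq_nonneg _) (fun ε => ?_) (fun ε => ?_),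
    fun N t y i hN hy => ?_⟩
  · refine Summable.of_norm_bounded_eventually_nat ((h.summable_mass_near ε).mul_left (C1 ^ 2)) ?_
    filter_upwards [eventually_ge_atTop (max N₀ (K + 1)).toNat] with n hn
    have h1 : N₀ ≤ n := by have := le_max_left N₀ (K + 1); omega
    have h2 : ¬ (n : ℤ) ≤ K := by have := le_max_right N₀ (K + 1); omega
    have h3 := hN₀ ε n h1
    rw [Real.norm_of_nonneg (sq_nonneg _), hD]
    simp only [if_neg h2]
    rw [mul_pow, sq_sqrt (h.mass_pos _).le, mul_comm]
    exact mul_le_mul_of_nonneg_right (pow_le_pow_left₀ (hB0 _).le h3 2) (h.mass_pos _).le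
  · have hz := abs_pos.2 (hr.z_ne ε)
    have hg := (summable_geometric_of_lt_one (sq_nonneg p.q)
      (pow_lt_one₀ hq.le h.q_lt_one two_ne_zero)).mul_left ((C * C2 / |p.z ε|) ^ 2)
    refine Summable.of_norm_bounded_eventually_nat hg ?_
    filter_upwards [eventually_ge_atTop (-K).toNat] with n hn
    have h2 : -(n : ℤ) ≤ K := by omega
    rw [Real.norm_of_nonneg (sq_nonneg _), hD]
    simp only [if_pos h2]
    have e : ‖(1 / p.pt (ε, -(n : ℤ)) : ℂ)‖ = p.q ^ n / |p.z ε| := by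
      rw [norm_div, norm_one, norm_real, norm_eq_abs, pt, abs_mul, zpow_neg,
        zpow_natCast, abs_of_pos (inv_pos.2 (pow_pos hq n))]
      have := pow_pos hq n
      field_simp
    rw [e, ← pow_mul, mul_comm 2, pow_mul, ← mul_pow, ← sq_abs]
    refine pow_le_pow_left₀ (abs_nonneg _) ?_ 2
    have hqn : 0 < p.q ^ n := pow_pos hq n
    rw [abs_mul, abs_mul, abs_of_pos hC, abs_of_pos (div_pos hqn hz)]
    calc _ ≤ C * (C2 * (p.q ^ n / |p.z ε|)) := by gcongr; exact hC2 _
      _ = _ := by ring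
  · have hm := Real.sqrt_nonneg (p.mass i)
    rw [norm_mul, norm_of_nonneg hm, hD]
    dsimp only
    split_ifs with hi
    · have := mul_le_mul_of_nonneg_left (hK i.1 i.2 hi N t y hy) hm
      rw [farFactor, if_pos hi]
      refine this.trans (le_of_eq ?_)
      ring
    · rw [sub_zero]
      have hyN : ∀ j, ‖y j‖ ≤ N := fun j => by
        rcases hy with hy | hy
        · rw [hy, Pi.zero_apply, norm_zero]; linarith
        · exact hy.2.1 j
      have h1 := hB i t y N hyN
      have h2 : B i * N ≤ B i * N ^ 2 := by have := hB0 i; gcongr; nlinarith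
      calc _ ≤ √(p.mass i) * (B i * N ^ 2) := by gcongr; exact h1.trans h2
        _ = _ := by ring

lemma IsReg.measurable_dCoef (h : p.IsReg) (ε : Bool) : Measurable (p.dCoef ε) := by
  have m : Measurable (qPochInf p.q) := (continuous_qPochInf h.q_pos h.q_lt_one).measurable
  have ht : Measurable (theta p.q) := m.mul (m.comp (measurable_const.div measurable_id))
  unfold dCoef
  have k : ∀ c : ℂ, Measurable fun γ : ℂ => qPochInf p.q (c / γ) := fun c =>
    m.comp (measurable_const.div measurable_id)
  have k2 : ∀ c d : ℂ, Measurable fun γ : ℂ => qPochInf p.q (c / (d * γ)) := fun c d =>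
    m.comp (measurable_const.div (measurable_id.const_mul d))
  refine (((ht.comp ?_).div_const _).mul (((k _).mul (k2 _ _)).mul (k2 _ _))).div
    (measurable_const.mul (m.comp (measurable_const.div (measurable_id.pow_const 2))))
  exact (measurable_id.const_mul (p.b * p.s)).mul_const _

lemma measurable_coe_exp : Measurable fun t : ℝ => (exp t : ℂ) := by
  simpa using measurable_exp_zpow 1

/-- The coefficient of the outgoing part of a wave packet. -/
def outgoing (p : Params) (u : ℝ → ℂ²) (ε : Bool) (t : ℝ) : ℂ := p.trc ε (exp t) (u t)

lemma IsReg.aesm_outgoing (h : p.IsReg)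
    (hu : ∀ j, AEStronglyMeasurable (fun t => u t j) muT) (ε : Bool) :
    AEStronglyMeasurable (p.outgoing u ε) muT :=
  (((h.measurable_dCoef ε).comp measurable_coe_exp).aestronglyMeasurable.mul (hu 0)).add
    (((h.dagger.measurable_dCoef ε).comp measurable_coe_exp).aestronglyMeasurable.mul (hu 1))

lemma Nice.incoming_eq (hu : p.Nice N u) (ε : Bool) :
    ∀ᵐ t ∂muT, p.trc ε (exp t : ℂ)⁻¹ (u t) = p.outgoing u ε (-t) := by
  filter_upwards [hu.even] with t ht
  rw [outgoing, ht, coe_exp_neg]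

lemma Nice.outgoing_bound (hu : p.Nice N u) (ε : Bool) (t : ℝ) :
    ‖p.outgoing u ε t‖ ≤ 2 * N ^ 2 := ((hu.at_pt t).norm_trc_le ε).1

lemma interval_congr_ae {f g : ℝ → ℂ} (h : ∀ᵐ t ∂muT, f t = g t) :
    ∫ t in -π..π, f t = ∫ t in -π..π, g t := by
  rw [integral_of_le neg_pi_le_pi, integral_of_le neg_pi_le_pi]
  exact integral_congr_ae h

lemma aesm_comp_neg {f : ℝ → ℂ} (hf : AEStronglyMeasurable f muT) :
    AEStronglyMeasurable (fun t => f (-t)) muT := by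
  have hm : muT = volume.restrict (Set.Ico (-π) π) := Measure.restrict_congr_set Ico_ae_eq_Ioc.symm
  refine hf.comp_quasiMeasurePreserving (f := fun t : ℝ => -t) ⟨measurable_neg, ?_⟩
  have : (Set.Ico (-π) π) = (fun t : ℝ => -t) ⁻¹' Ioc (-π) π := by
    ext t; simp only [Set.mem_Ico, Set.mem_preimage, Set.mem_Ioc]
    constructor <;> rintro ⟨a, b⟩ <;> constructor <;> linarith
  have h2 : Measure.map (fun t : ℝ => -t) volume = volume := Measure.map_neg_eq_self _
  nth_rewrite 1 [hm]
  rw [this, ← Measure.restrict_map measurable_neg measurableSet_Ioc, h2]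

lemma Nice.integral_farMain (hu : p.Nice N u) (h : p.IsReg)
    (n : ℤ) (i : RqIndex) :
    1 / (4 * π) * ∫ t in -π..π, cheb n t * p.farMain i t (u t) =
      p.s ^ (-i.2) * ((fc (p.outgoing u i.1) (i.2 - n) + fc (p.outgoing u i.1) (i.2 + n)) / 2) := by
  have hm := h.aesm_outgoing hu.meas i.1
  have hb := hu.outgoing_bound i.1
  have e1 := integral_cheb_mul hm hb n i.2
  set f := p.outgoing u i.1
  have hI : IntervalIntegrable (fun t => cheb n t * (f t * exp t ^ (-i.2))) volume
      (-π) π :=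
    intervalIntegrable_of_bound ((measurable_cheb n).aestronglyMeasurable.mul
      (hm.mul (measurable_exp_zpow _).aestronglyMeasurable)) (B := 1 * (2 * N ^ 2)) fun t => by
      rw [norm_mul, norm_mul, norm_exp_zpow, mul_one]
      exact mul_le_mul (norm_cheb_le n t) (hb t) (norm_nonneg _) zero_le_one
  have hI' : IntervalIntegrable (fun t => cheb n (-t) * (f (-t) * (exp (-t) : ℂ) ^ (-i.2)))
      volume (-π) π := by
    have h2 := (IntervalIntegrable.iff_comp_neg (f := fun t =>
      cheb n t * (f t * exp t ^ (-i.2))) (a := -π) (b := π)).1 hI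
    rw [neg_neg] at h2; exact h2.symm
  have e2 : ∫ t in -π..π, cheb n t * p.farMain i t (u t) =
      ∫ t in -π..π, p.s ^ (-i.2) * (cheb n t * (f t * exp t ^ (-i.2)) +
        cheb n (-t) * (f (-t) * (exp (-t) : ℂ) ^ (-i.2))) := by
    refine interval_congr_ae ?_
    filter_upwards [hu.incoming_eq i.1] with t ht
    rw [farMain, ht, cheb_even, coe_exp_neg, inv_zpow', neg_neg]
    change cheb n t * (p.s ^ (-i.2) * (f t * _ + f (-t) * _)) = _
    ring
  rw [e2, intervalIntegral.integral_const_mul, intervalIntegral.integral_add hI hI',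
    integral_comp_neg_pi fun t => cheb n t * (f t * exp t ^ (-i.2))]
  linear_combination 2 * p.s ^ (-i.2) * e1

lemma Nice.cheb (hu : p.Nice N u) (n : ℤ) :
    p.Nice N fun t => cheb n t • u t := by
  simpa using hu.smul (measurable_cheb n).aestronglyMeasurable
    (.of_forall (cheb_even n)) le_rfl (norm_cheb_le n)

lemma kern_smul (i : RqIndex) (t : ℝ) (c : ℂ) (y : ℂ²) :
    p.kern i t (c • y) = c * p.kern i t y := by
  simp only [kern, Pi.smul_apply, smul_eq_mul]; ring

/-- The travelling wave that a wave packet approaches. -/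
def travel (p : Params) (u : ℝ → ℂ²) (n : ℤ) (i : RqIndex) : ℂ :=
  (√‖p.kap i.1‖ / 2 : ℝ) * fc (p.outgoing u i.1) (i.2 + n)

lemma Nice.hasSum_travel (hu : p.Nice N u) (h : p.IsReg) (n : ℤ) :
    HasSum (fun i => ‖p.travel u n i‖ ^ 2) (∑ ε, ‖p.kap ε‖ / 4 *
      ((2 * π)⁻¹ * ∫ t in -π..π, ‖p.outgoing u ε t‖ ^ 2)) := by
  have e : ∀ ε (m : ℤ), ‖p.travel u n (ε, m)‖ ^ 2 =
      ‖p.kap ε‖ / 4 * ‖fc (p.outgoing u ε) (m + n)‖ ^ 2 := fun ε m => by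
    rw [travel, norm_mul, mul_pow, norm_real, norm_eq_abs, sq_abs, div_pow, sq_sqrt (norm_nonneg _)]
    norm_num
  have k : ∀ ε, HasSum (fun m : ℤ => ‖p.travel u n (ε, m)‖ ^ 2) (‖p.kap ε‖ / 4 *
      ((2 * π)⁻¹ * ∫ t in -π..π, ‖p.outgoing u ε t‖ ^ 2)) := fun ε => by
    simp_rw [e]
    exact ((Equiv.addRight n).hasSum_iff.2
      (hasSum_sq_fc (h.aesm_outgoing hu.meas ε) (hu.outgoing_bound ε))).mul_left _
  have hs : Summable fun i => ‖p.travel u n i‖ ^ 2 := by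
    rw [summable_prod_of_nonneg fun i => sq_nonneg _]
    exact ⟨fun ε => (k ε).summable, (hasSum_fintype _).summable⟩
  rw [← sum_congr rfl fun ε _ => (k ε).tsum_eq, ← tsum_fintype (L := .unconditional _),
    ← hs.tsum_prod]
  exact hs.hasSum

lemma Nice.sqNull (hu : p.Nice N u) (h : p.IsGeneric) :
    SqNull fun n i => p.wt (p.packet fun t => Params.cheb n t • u t) i - p.travel u n i := by
  have hr := h.isRegular
  obtain ⟨K, D, hD, hK⟩ := h.exists_rem_bound
  obtain ⟨C, hC⟩ := hr.exists_farFactor_le K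
  set S : RqIndex → ℂ := fun i => fc (p.outgoing u i.1) i.2 with hS
  have hSs : Summable fun i => ‖S i‖ ^ 2 := by
    rw [summable_prod_of_nonneg fun i => sq_nonneg _]
    exact ⟨fun ε => (hasSum_sq_fc (hr.aesm_outgoing hu.meas ε) (hu.outgoing_bound ε)).summable,
      (hasSum_fintype _).summable⟩
  set rem : RqIndex → ℝ → ℂ := fun i t =>
    (√(p.mass i) : ℂ) * (p.kern i t (u t) - if i.2 ≤ K then p.farMain i t (u t) else 0) with hrem
  have hremB : ∀ i t, ‖rem i t‖ ≤ N ^ 2 * D i := fun i t => hK N t (u t) i hu.one_le (hu.at_pt t)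
  have hfm : ∀ i, AEStronglyMeasurable (fun t => p.farMain i t (u t)) muT := fun i => by
    refine (((hr.aesm_outgoing hu.meas i.1).mul (measurable_exp_zpow _).aestronglyMeasurable).add
      (AEStronglyMeasurable.mul ?_ (measurable_exp_zpow _).aestronglyMeasurable)).const_mul _
    refine (aesm_comp_neg (hr.aesm_outgoing hu.meas i.1)).congr ?_
    filter_upwards [hu.incoming_eq i.1] with t ht using ht.symm
  have hremm : ∀ i, AEStronglyMeasurable (rem i) muT := fun i => by
    refine ((hr.aesm_kern hu.meas i).sub ?_).const_mul _
    split_ifs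
    · exact hfm i
    · exact aestronglyMeasurable_const
  set E : ℕ → RqIndex → ℂ := fun n i =>
    1 / (4 * π) * ∫ t in -π..π, Params.cheb n t * rem i t with hE
  have hEn : SqNull E := by
    refine SqNull.of_dominated (D := fun i => N ^ 2 / 2 * D i) ?_ (fun n i => ?_)
      fun i => tendsto_integral_cheb (hremm i) (hremB i)
    · simp_rw [mul_pow]; exact hD.mul_left _
    · have := intervalIntegral.norm_integral_le_of_norm_le_const (a := -π) (b := π)
        (f := fun t => Params.cheb n t * rem i t) (C := 1 * (N ^ 2 * D i)) fun t _ => by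
          rw [norm_mul]
          exact mul_le_mul (norm_cheb_le n t) (hremB i t) (norm_nonneg _) zero_le_one
      have hp := pi_pos
      have e4 : ‖(1 / (4 * π) : ℂ)‖ = 1 / (4 * π) := by
        rw [show (1 / (4 * π) : ℂ) = ((1 / (4 * π) : ℝ) : ℂ) by push_cast; rfl,
          norm_of_nonneg (by positivity)]
      rw [hE]
      dsimp only
      rw [norm_mul, e4]
      refine (mul_le_mul_of_nonneg_left this (by positivity)).trans (le_of_eq ?_)
      rw [show π - -π = 2 * π by ring, abs_of_pos (by positivity)]
      field_simp; ring
  have hlim : ∀ i : RqIndex, Tendsto (fun n : ℕ => i.2 - (n : ℤ)) atTop atBot := fun i => by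
    simp only [sub_eq_add_neg]
    exact tendsto_atBot_add_const_left _ _
      (tendsto_neg_atTop_atBot.comp tendsto_natCast_atTop_atTop)
  have T1 : SqNull fun n i => ((p.farFactor K i - √‖p.kap i.1‖) / 2 : ℝ) * S (i.1, i.2 + (n : ℤ)) := by
    refine SqNull.of_shift (C := C + ∑ ε, √‖p.kap ε‖) (fun i => ?_) hSs fun i => ?_
    · have h1 := hC i
      have h2 := single_le_sum (f := fun ε => √‖p.kap ε‖) (fun _ _ => Real.sqrt_nonneg _)
        (mem_univ i.1)
      have h3 := Real.sqrt_nonneg ‖p.kap i.1‖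
      rw [abs_div, abs_two]
      have h4 := abs_sub (p.farFactor K i) √‖p.kap i.1‖
      rw [abs_of_nonneg h3] at h4
      have h5 := abs_nonneg (p.farFactor K i - √‖p.kap i.1‖)
      linarith
    · have := (((hr.tendsto_farFactor K i.1).comp (hlim i)).sub_const √‖p.kap i.1‖).div_const 2
      rw [sub_self, zero_div] at this; exact this
  have T2 : SqNull fun n i => (p.farFactor K i / 2 : ℝ) * S (i.1, i.2 + -(n : ℤ)) := by
    refine SqNull.of_shift (C := C) (fun i => ?_) hSs fun i => ?_
    · rw [abs_div, abs_two]; linarith [hC i, abs_nonneg (p.farFactor K i)]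
    · refine tendsto_const_nhds.congr' ?_
      filter_upwards [eventually_gt_atTop (K - i.2).toNat] with n hn
      rw [farFactor, if_neg (by simp only; omega), zero_div]
  have key := (T1.add T2).add hEn
  have e : ∀ (n : ℕ) i, p.wt (p.packet fun t => Params.cheb n t • u t) i - p.travel u n i =
      ((p.farFactor K i - √‖p.kap i.1‖) / 2 : ℝ) * S (i.1, i.2 + (n : ℤ)) +
        (p.farFactor K i / 2 : ℝ) * S (i.1, i.2 + -(n : ℤ)) + E n i := fun n i => by
    have hE1 : E n i = (√(p.mass i) : ℂ) * (p.packet (fun t => Params.cheb n t • u t) i -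
        if i.2 ≤ K then p.s ^ (-i.2) * ((S (i.1, i.2 + -(n : ℤ)) + S (i.1, i.2 + (n : ℤ))) / 2)
          else 0) := by
      have hIk := hr.intervalIntegrable_kern (hu.cheb n) i
      rw [packet, hE]
      simp_rw [kern_smul] at hIk ⊢
      split_ifs with hi
      · have hIf : IntervalIntegrable (fun t => Params.cheb n t * p.farMain i t (u t)) volume
            (-π) π := by
          have hm := (sqrt_pos.2 (h.mass_pos i)).ne'
          have hm' : (√(p.mass i) : ℂ) ≠ 0 := mod_cast hm
          have hIr : IntervalIntegrable (fun t => Params.cheb n t * rem i t) volume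
              (-π) π :=
            intervalIntegrable_of_bound ((measurable_cheb n).aestronglyMeasurable.mul (hremm i))
              (B := 1 * (N ^ 2 * D i)) fun t => by
                rw [norm_mul]
                exact mul_le_mul (norm_cheb_le n t) (hremB i t) (norm_nonneg _) zero_le_one
          refine (hIk.sub (hIr.const_mul (√(p.mass i) : ℂ)⁻¹)).congr_ae (.of_forall fun t => ?_)
          simp only [hrem, if_pos hi]; field_simp; ring
        have hF := hu.integral_farMain hr n i
        rw [show S (i.1, i.2 + -(n : ℤ)) = fc (p.outgoing u i.1) (i.2 - n) from rfl,
          show S (i.1, i.2 + (n : ℤ)) = fc (p.outgoing u i.1) (i.2 + n) from rfl, ← hF, ← mul_sub,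
          ← intervalIntegral.integral_sub hIk hIf, mul_left_comm (√(p.mass i) : ℂ),
          ← intervalIntegral.integral_const_mul (√(p.mass i) : ℂ)]
        congr 1
        refine integral_congr fun t _ => ?_
        simp only [hrem, if_pos hi]; ring
      · rw [sub_zero, mul_left_comm (√(p.mass i) : ℂ),
          ← intervalIntegral.integral_const_mul (√(p.mass i) : ℂ)]
        congr 1
        refine integral_congr fun t _ => ?_
        simp only [hrem, if_neg hi]; ring
    rw [hE1, wt, travel, farFactor, show fc (p.outgoing u i.1) (i.2 + n) = S (i.1, i.2 + (n : ℤ)) from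
      rfl]
    split_ifs with hi
    · have hs : p.s ^ (-i.2) = ((‖p.s‖ ^ (-i.2) : ℝ) : ℂ) := by
        rw [Complex.ofReal_zpow, ← hr.s_eq_norm]
      rw [hs]; push_cast; ring
    · push_cast; ring
  exact ⟨fun n => by simp_rw [e]; exact key.1 n, by simp_rw [e]; exact key.2⟩

/-! ### The isometry for nice coefficient functions -/

/-- The spectral energy of a coefficient function. -/
def energy (p : Params) (u : ℝ → ℂ²) : ℝ :=
  ∑ ε, ‖p.kap ε‖ * ((4 * π)⁻¹ * ∫ t in -π..π, ‖p.outgoing u ε t‖ ^ 2)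

lemma Nice.memL2 (hu : p.Nice N u) (h : p.IsGeneric) :
    p.MemL2 (p.packet u) := by
  have h1 := (hu.sqNull h).1 0
  have h2 := (hu.hasSum_travel h.isRegular 0).summable
  simp only [Nat.cast_zero, cheb_zero, one_smul] at h1
  rw [← memℓp_two_iff] at h1 h2
  rw [h.memL2_iff]
  have := h1.add h2
  convert this using 1
  ext i; simp

lemma packet_add_of {i : RqIndex}
    (hu : IntervalIntegrable (fun t => p.kern i t (u t)) volume (-π) π)
    (hv : IntervalIntegrable (fun t => p.kern i t (v t)) volume (-π) π) :
    p.packet (fun t => u t + v t) i = p.packet u i + p.packet v i := by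
  simp only [packet]
  rw [← mul_add, ← intervalIntegral.integral_add hu hv]
  congr 1
  refine integral_congr fun t _ => ?_
  simp only [kern, Pi.add_apply]; ring

lemma packet_smul (c : ℂ) (u : ℝ → ℂ²) (i : RqIndex) :
    p.packet (fun t => c • u t) i = c * p.packet u i := by
  simp only [packet, kern_smul]
  rw [intervalIntegral.integral_const_mul]; ring

lemma Nice.packet_L_cheb (hu : p.Nice N u) (h : p.IsReg) (n : ℤ) :
    p.L (p.packet fun t => Params.cheb n t • u t) =
      (p.packet fun t => Params.cheb (n + 1) t • u t) +
        p.packet fun t => Params.cheb (n - 1) t • u t := by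
  rw [h.L_packet (hu.cheb n)]
  ext i
  rw [Pi.add_apply, ← packet_add_of (h.intervalIntegrable_kern (hu.cheb _) i)
    (h.intervalIntegrable_kern (hu.cheb _) i)]
  congr 1
  ext t : 1
  rw [smul_smul, mu_mul_cheb, add_smul]

lemma Nice.normSq (hu : p.Nice N u) (h : p.IsGeneric) :
    ‖p.toL2 (p.packet u)‖ ^ 2 = p.energy u := by
  have hr := h.isRegular
  set f : ℤ → RqIndex → ℂ := fun n => p.packet fun t => Params.cheb n t • u t with hf
  have hm : ∀ n, p.MemL2 (f n) := fun n => (hu.cheb n).memL2 h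
  have hL : ∀ n, p.L (f n) = f (n + 1) + f (n - 1) := fun n => hu.packet_L_cheb hr n
  have hreg : ∀ n, p.Reg (f n) := fun n => hr.reg_packet (hu.cheb n)
  have hLm : ∀ n, p.MemL2 (p.L (f n)) := fun n => by rw [hL]; exact h.memL2_add (hm _) (hm _)
  have hneg : ∀ n, f (-n) = f n := fun n => by simp only [hf, cheb_neg]
  set X : ℤ → lp (fun _ : RqIndex => ℂ) 2 := fun n => p.toL2 (f n) with hX
  set c : ℤ → ℤ → ℂ := fun j k => inner ℂ (X k) (X j) with hc
  have hw : ∀ j k, c (j + 1) k + c (j - 1) k = c j (k + 1) + c j (k - 1) := fun j k => by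
    have := h.green (hm j) (hm k) (hLm j) (hLm k) (hreg j) (hreg k)
    rw [hL, hL, h.innerL2_eq (h.memL2_add (hm _) (hm _)) (hm _),
      h.innerL2_eq (hm _) (h.memL2_add (hm _) (hm _)), h.toL2_add (hm _) (hm _),
      h.toL2_add (hm _) (hm _), inner_add_left, inner_add_right] at this
    exact this
  have hs : ∀ j k, c j (-k) = c j k := fun j k => by simp only [hc, hX, hneg]
  have hwave := fun n : ℕ => wave_solution hw hs n n
  simp only [sub_self] at hwave
  -- approximation by travelling waves
  set A := ∑ ε, ‖p.kap ε‖ / 4 * ((2 * π)⁻¹ * ∫ t in -π..π, ‖p.outgoing u ε t‖ ^ 2) with hA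
  have hT := fun n => hu.hasSum_travel hr n
  set Y : ℤ → lp (fun _ : RqIndex => ℂ) 2 := fun n => ⟨p.travel u n, memℓp_two_iff.2 (hT n).summable⟩
  have hY : ∀ n, ‖Y n‖ = √A := fun n => by
    rw [← sqrt_sq (norm_nonneg (Y n)), lp_norm_sq]
    exact congrArg _ (hT n).tsum_eq
  have hd : ∀ n : ℕ, ‖X n - Y n‖ ^ 2 = ∑' i, ‖p.wt (f n) i - p.travel u n i‖ ^ 2 := fun n => by
    rw [lp_norm_sq]
    refine tsum_congr fun i => ?_
    rw [lp.coeFn_sub, Pi.sub_apply, h.toL2_apply (hm n)]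
  have hlim : Tendsto (fun n : ℕ => ‖X n - Y n‖) atTop (𝓝 0) := by
    have := ((continuous_sqrt.tendsto _).comp (hu.sqNull h).2)
    rw [sqrt_zero] at this
    refine this.congr fun n => ?_
    rw [Function.comp, ← sqrt_sq (norm_nonneg (X n - Y n)), hd]
  have hXn : Tendsto (fun n : ℕ => ‖X n‖) atTop (𝓝 √A) := by
    rw [tendsto_iff_dist_tendsto_zero]
    refine squeeze_zero (fun _ => dist_nonneg) (fun n => ?_) hlim
    rw [Real.dist_eq, ← hY n]
    exact abs_norm_sub_norm_le _ _
  have hA0 : 0 ≤ A := (hT 0).nonneg fun _ => sq_nonneg _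
  have hXsq : Tendsto (fun n : ℕ => ‖X n‖ ^ 2) atTop (𝓝 A) := by
    have := hXn.pow 2
    rwa [sq_sqrt hA0] at this
  obtain ⟨C, hC⟩ := hXn.bddAbove_range
  have hC : ∀ n : ℕ, ‖X n‖ ≤ C := fun n => hC ⟨n, rfl⟩
  have hpt : ∀ i, Tendsto (fun n : ℕ => X n i) atTop (𝓝 0) := fun i => by
    obtain ⟨B, -, -, hB⟩ := hr.exists_kern_bound
    have := (tendsto_integral_cheb (hr.aesm_kern hu.meas i)
      fun t => hB i t (u t) N (hu.bound t)).const_mul (√(p.mass i) : ℂ)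
    rw [mul_zero] at this
    refine this.congr fun n => ?_
    rw [hX]
    dsimp only
    rw [h.toL2_apply (hm n), wt, hf]
    simp only [packet, kern_smul]
  have hweak := (tendsto_inner_of_pointwise (X := fun n => X n) hC hpt (X 0)).comp
    (tendsto_id.nsmul_atTop two_pos : Tendsto (fun n : ℕ => 2 • n) atTop atTop)
  have hcn : ∀ n : ℕ, c (n + n) 0 = conj (inner ℂ (X ((2 • n : ℕ) : ℤ)) (X 0)) := fun n => by
    rw [inner_conj_symm]
    simp only [hc]
    rw [show (n : ℤ) + n = ((2 • n : ℕ) : ℤ) by rw [smul_eq_mul]; push_cast; ring]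
  have hc2 : Tendsto (fun n : ℕ => c (n + n) 0) atTop (𝓝 0) := by
    simp_rw [hcn]
    have := (continuous_conj.tendsto _).comp hweak
    rw [map_zero] at this; exact this
  have hnn : ∀ k, c k k = ((‖X k‖ ^ 2 : ℝ) : ℂ) := fun k => by
    simp only [hc, inner_self_eq_norm_sq_to_K]; norm_cast
  have hfin : Tendsto (fun n : ℕ => 2 * c n n) atTop (𝓝 (2 * A)) := by
    simp_rw [hnn]
    exact ((continuous_ofReal.tendsto _).comp hXsq).const_mul 2
  have hfin2 : Tendsto (fun n : ℕ => 2 * c n n) atTop (𝓝 (0 + c 0 0)) := by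
    simp_rw [hwave]
    exact hc2.add_const _
  have key := tendsto_nhds_unique hfin hfin2
  rw [zero_add, hnn] at key
  have key2 : 2 * A = ‖X 0‖ ^ 2 := mod_cast key
  have e0 : f 0 = p.packet u := by simp only [hf, cheb_zero, one_smul]
  rw [← e0]
  change ‖X 0‖ ^ 2 = _
  rw [← key2, hA, energy, mul_sum]
  refine sum_congr rfl fun ε _ => ?_
  rw [mul_inv, mul_inv]
  ring

lemma intervalIntegrable_of_tendsto {f : ℝ → ℂ} {F : ℕ → ℝ → ℂ} {C : ℝ}
    (hF : ∀ n, IntervalIntegrable (F n) volume (-π) π)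
    (hC : ∀ n, ∫ t in -π..π, ‖F n t‖ ≤ C) (hf : AEStronglyMeasurable f muT)
    (hlim : ∀ᵐ t ∂muT, Tendsto (fun n => F n t) atTop (𝓝 (f t))) :
    IntervalIntegrable f volume (-π) π := by
  simp_rw [intervalIntegrable_iff_Ioc] at hF ⊢
  refine ⟨hf, ?_⟩
  have h1 := Lp.eLpNorm_lim_le_liminf_eLpNorm (p := 1) (fun n => (hF n).aestronglyMeasurable) f hlim
  have h2 : ∀ n, eLpNorm (F n) 1 muT ≤ ENNReal.ofReal C := fun n => by
    rw [eLpNorm_one_eq_lintegral_enorm, ← ofReal_integral_norm_eq_lintegral_enorm (hF n)]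
    refine ENNReal.ofReal_le_ofReal ?_
    have := hC n
    rwa [integral_of_le neg_pi_le_pi] at this
  rw [hasFiniteIntegral_iff_enorm, ← eLpNorm_one_eq_lintegral_enorm]
  have h3 : liminf (fun n => eLpNorm (F n) 1 muT) atTop ≤ ENNReal.ofReal C :=
    liminf_le_of_le (by isBoundedDefault) fun b hb => by
      obtain ⟨n, hn⟩ := hb.exists
      exact hn.trans (h2 n)
  exact (h1.trans h3).trans_lt ENNReal.ofReal_lt_top

lemma intervalIntegrable_mul_of_sq {f g : ℝ → ℂ} (hf : AEStronglyMeasurable f muT)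
    (hg : AEStronglyMeasurable g muT)
    (hf2 : IntervalIntegrable (fun t => ‖f t‖ ^ 2) volume (-π) π)
    (hg2 : IntervalIntegrable (fun t => ‖g t‖ ^ 2) volume (-π) π) :
    IntervalIntegrable (fun t => f t * conj (g t)) volume (-π) π := by
  simp_rw [intervalIntegrable_iff_Ioc] at hf2 hg2 ⊢
  refine (hf2.add hg2).mono' (hf.mul (continuous_conj.comp_aestronglyMeasurable hg))
    (.of_forall fun t => ?_)
  rw [norm_mul, RCLike.norm_conj, Pi.add_apply]
  nlinarith [sq_nonneg (‖f t‖ - ‖g t‖), sq_nonneg ‖f t‖, sq_nonneg ‖g t‖]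

/-! ### Extension to coefficient functions of finite energy -/

/-- Even measurable coefficient functions of finite energy. -/
structure Adm (p : Params) (u : ℝ → ℂ²) : Prop where
  meas : ∀ j, AEStronglyMeasurable (fun t => u t j) muT
  even : ∀ᵐ t ∂muT, u (-t) = u t
  int : ∀ ε, IntervalIntegrable (fun t => ‖p.outgoing u ε t‖ ^ 2) volume (-π) π

lemma outgoing_add (u v : ℝ → ℂ²) (ε : Bool) (t : ℝ) :
    p.outgoing (fun t => u t + v t) ε t = p.outgoing u ε t + p.outgoing v ε t := by
  simp only [outgoing, trc, Pi.add_apply]; ring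

lemma outgoing_smul (c : ℝ → ℂ) (u : ℝ → ℂ²) (ε : Bool) (t : ℝ) :
    p.outgoing (fun t => c t • u t) ε t = c t * p.outgoing u ε t := by
  simp only [outgoing, trc, Pi.smul_apply, smul_eq_mul]; ring

lemma outgoing_eq_zero (h : u t = 0) (ε : Bool) :
    p.outgoing u ε t = 0 := by
  simp [outgoing, trc, h]

lemma outgoing_congr (h : u t = v t) (ε : Bool) :
    p.outgoing u ε t = p.outgoing v ε t := by
  simp only [outgoing, h]

lemma Nice.adm (hu : p.Nice N u) (h : p.IsReg) : p.Adm u where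
  meas := hu.meas
  even := hu.even
  int ε := by
    have hm := h.aesm_outgoing hu.meas ε
    rw [intervalIntegrable_iff_Ioc]
    exact Integrable.of_bound (hm.norm.pow 2) ((2 * N ^ 2) ^ 2) (.of_forall fun t => by
      rw [norm_pow, norm_norm]
      exact pow_le_pow_left₀ (norm_nonneg _) (hu.outgoing_bound ε t) 2)

lemma energy_mono
    (hu : ∀ ε, IntervalIntegrable (fun t => ‖p.outgoing u ε t‖ ^ 2) volume (-π) π)
    (hv : ∀ ε, IntervalIntegrable (fun t => ‖p.outgoing v ε t‖ ^ 2) volume (-π) π)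
    (hle : ∀ ε t, ‖p.outgoing v ε t‖ ≤ ‖p.outgoing u ε t‖) : p.energy v ≤ p.energy u := by
  refine Finset.sum_le_sum fun ε _ => mul_le_mul_of_nonneg_left (mul_le_mul_of_nonneg_left
    (intervalIntegral.integral_mono_on neg_pi_le_pi (hv ε) (hu ε) fun t _ =>
      pow_le_pow_left₀ (norm_nonneg _) (hle ε t) 2) (by positivity)) (norm_nonneg _)

lemma Nice.mass_mul_sq_le (hu : p.Nice N u) (h : p.IsGeneric)
    (i : RqIndex) : p.mass i * ‖p.packet u i‖ ^ 2 ≤ p.energy u := by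
  rw [← hu.normSq h, ← h.norm_wt_sq, ← h.toL2_apply (hu.memL2 h)]
  exact pow_le_pow_left₀ (norm_nonneg _) (lp.norm_apply_le_norm two_ne_zero _ i) 2

/-- The set on which the truncated coefficient function agrees with the original one. -/
def cutSet (p : Params) (u : ℝ → ℂ²) (n : ℕ) : Set ℝ :=
  {t | (exp t : ℂ) ^ 2 ≠ 1 ∧ (∀ j, ‖u t j‖ ≤ n + 1) ∧
    ∀ ε, ‖p.dCoef ε (exp t)‖ ≤ n + 1 ∧ ‖p.dCoef ε (exp t : ℂ)⁻¹‖ ≤ n + 1 ∧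
      ‖p.dagger.dCoef ε (exp t)‖ ≤ n + 1 ∧
      ‖p.dagger.dCoef ε (exp t : ℂ)⁻¹‖ ≤ n + 1}

open Classical in
/-- Truncation of a coefficient function. -/
def cut (p : Params) (u : ℝ → ℂ²) (n : ℕ) (t : ℝ) : ℂ² :=
  if t ∈ p.cutSet u n then u t else 0

lemma cut_cases (u : ℝ → ℂ²) (n : ℕ) (t : ℝ) :
    (t ∈ p.cutSet u n ∧ p.cut u n t = u t) ∨ (t ∉ p.cutSet u n ∧ p.cut u n t = 0) := by
  by_cases ht : t ∈ p.cutSet u n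
  · exact Or.inl ⟨ht, if_pos ht⟩
  · exact Or.inr ⟨ht, if_neg ht⟩

lemma cutSet_mono (u : ℝ → ℂ²) {m n : ℕ} (h : m ≤ n) : p.cutSet u m ⊆ p.cutSet u n := by
  have h' : (m : ℝ) + 1 ≤ n + 1 := mod_cast Nat.succ_le_succ h
  rintro t ⟨h1, h2, h3⟩
  exact ⟨h1, fun j => (h2 j).trans h', fun ε => ⟨(h3 ε).1.trans h', (h3 ε).2.1.trans h',
    (h3 ε).2.2.1.trans h', (h3 ε).2.2.2.trans h'⟩⟩

lemma eventually_mem_cutSet (u : ℝ → ℂ²) (ht : p.Good (exp t)) :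
    ∀ᶠ n in atTop, t ∈ p.cutSet u n := by
  have k : ∀ x : ℝ, ∀ᶠ n : ℕ in atTop, x ≤ n + 1 := fun x => by
    filter_upwards [(tendsto_natCast_atTop_atTop (R := ℝ)).eventually_ge_atTop x] with n hn
    linarith
  have e : ∀ᶠ n : ℕ in atTop, (∀ j, ‖u t j‖ ≤ n + 1) ∧
    ∀ ε, ‖p.dCoef ε (exp t)‖ ≤ n + 1 ∧ ‖p.dCoef ε (exp t : ℂ)⁻¹‖ ≤ n + 1 ∧
      ‖p.dagger.dCoef ε (exp t)‖ ≤ n + 1 ∧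
      ‖p.dagger.dCoef ε (exp t : ℂ)⁻¹‖ ≤ n + 1 :=
    (eventually_all.2 fun j => k _).and (eventually_all.2 fun ε =>
      (k _).and ((k _).and ((k _).and (k _))))
  filter_upwards [e] with n hn using ⟨ht.sq, hn⟩

lemma eventually_cut_eq (u : ℝ → ℂ²) (ht : p.Good (exp t)) :
    ∀ᶠ n in atTop, p.cut u n t = u t := by
  filter_upwards [eventually_mem_cutSet u ht] with n hn using if_pos hn

lemma IsReg.nullMeasurableSet_cutSet (h : p.IsReg)
    (hu : ∀ j, AEStronglyMeasurable (fun t => u t j) muT) (n : ℕ) :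
    NullMeasurableSet (p.cutSet u n) muT := by
  have m1 := measurable_coe_exp
  have m2 : Measurable fun t : ℝ => (exp t : ℂ)⁻¹ := m1.inv
  have k : ∀ {f : ℝ → ℂ}, AEStronglyMeasurable f muT →
      NullMeasurableSet {t | ‖f t‖ ≤ n + 1} muT := fun hf =>
    nullMeasurableSet_le hf.norm.aemeasurable aemeasurable_const
  have s1 : MeasurableSet {t : ℝ | (exp t : ℂ) ^ 2 ≠ 1} :=
    (m1.pow_const 2) (measurableSet_singleton 1).compl
  have d1 := fun ε => ((h.measurable_dCoef ε).comp m1).aestronglyMeasurable (μ := muT)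
  have d2 := fun ε => ((h.measurable_dCoef ε).comp m2).aestronglyMeasurable (μ := muT)
  have d3 := fun ε => ((h.dagger.measurable_dCoef ε).comp m1).aestronglyMeasurable (μ := muT)
  have d4 := fun ε => ((h.dagger.measurable_dCoef ε).comp m2).aestronglyMeasurable (μ := muT)
  have := s1.nullMeasurableSet.inter ((NullMeasurableSet.iInter fun j => k (hu j)).inter
    (NullMeasurableSet.iInter fun ε => (k (d1 ε)).inter ((k (d2 ε)).inter
      ((k (d3 ε)).inter (k (d4 ε))))))
  convert this using 1
  ext t
  simp only [cutSet, Set.mem_ofPred_eq, Set.mem_inter_iff, Set.mem_iInter, Function.comp]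

lemma cutSet_neg (ht : u (-t) = u t) (n : ℕ) :
    -t ∈ p.cutSet u n ↔ t ∈ p.cutSet u n := by
  have e : ((exp t : ℂ)⁻¹) ^ 2 ≠ 1 ↔ (exp t : ℂ) ^ 2 ≠ 1 := by rw [inv_pow, Ne, inv_eq_one, Ne]
  simp only [cutSet, Set.mem_ofPred_eq, ht, coe_exp_neg, inv_inv, e]
  refine and_congr_right fun _ => and_congr_right fun _ => forall_congr' fun ε => ?_
  tauto

lemma cut_even (hu : ∀ᵐ t ∂muT, u (-t) = u t) (n : ℕ) :
    ∀ᵐ t ∂muT, p.cut u n (-t) = p.cut u n t := by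
  filter_upwards [hu] with t ht
  unfold cut
  split_ifs with h1 h2 h2
  · exact ht
  · exact absurd ((cutSet_neg ht n).1 h1) h2
  · exact absurd ((cutSet_neg ht n).2 h2) h1
  · rfl

lemma IsReg.cut_meas (h : p.IsReg)
    (hu : ∀ j, AEStronglyMeasurable (fun t => u t j) muT) (n : ℕ) (j : Fin 2) :
    AEStronglyMeasurable (fun t => p.cut u n t j) muT := by
  refine ((hu j).indicator₀ (h.nullMeasurableSet_cutSet hu n)).congr (.of_forall fun t => ?_)
  rcases cut_cases (p := p) u n t with ⟨h1, h2⟩ | ⟨h1, h2⟩ <;> simp [h1, h2]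

lemma IsReg.nice_cut (h : p.IsReg)
    (hu : ∀ j, AEStronglyMeasurable (fun t => u t j) muT) (he : ∀ᵐ t ∂muT, u (-t) = u t) (n : ℕ) :
    p.Nice (n + 1) (p.cut u n) where
  one_le := by simp
  meas := h.cut_meas hu n
  even := cut_even he n
  at_pt t := by
    rcases cut_cases (p := p) u n t with ⟨h1, h2⟩ | ⟨h1, h2⟩
    · rw [h2]; exact Or.inr h1
    · exact Or.inl h2

lemma IsReg.nice_cut_sub (h : p.IsReg)
    (hu : ∀ j, AEStronglyMeasurable (fun t => u t j) muT) (he : ∀ᵐ t ∂muT, u (-t) = u t) {n m : ℕ}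
    (hnm : n ≤ m) : p.Nice (m + 1) fun t => p.cut u m t - p.cut u n t where
  one_le := by simp
  meas j := (h.cut_meas hu m j).sub (h.cut_meas hu n j)
  even := by filter_upwards [cut_even he m, cut_even he n] with t h1 h2; rw [h1, h2]
  at_pt t := by
    rcases cut_cases (p := p) u m t with ⟨h1, h2⟩ | ⟨h1, h2⟩ <;>
      rcases cut_cases (p := p) u n t with ⟨h3, h4⟩ | ⟨h3, h4⟩
    · left; rw [h2, h4, sub_self]
    · right; rw [h2, h4, sub_zero]; exact h1
    · exact absurd (cutSet_mono u hnm h3) h1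
    · left; rw [h2, h4, sub_self]

lemma norm_outgoing_cut_le (u : ℝ → ℂ²) (n : ℕ) (ε : Bool) (t : ℝ) :
    ‖p.outgoing (p.cut u n) ε t‖ ≤ ‖p.outgoing u ε t‖ := by
  rcases cut_cases (p := p) u n t with ⟨h1, h2⟩ | ⟨h1, h2⟩
  · rw [outgoing_congr h2]
  · rw [outgoing_eq_zero h2, norm_zero]; exact norm_nonneg _

lemma Adm.intervalIntegrable_kern (hu : p.Adm u) (h : p.IsGeneric)
    (i : RqIndex) : IntervalIntegrable (fun t => p.kern i t (u t)) volume (-π) π := by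
  have hr := h.isRegular
  have hp := pi_pos
  have hN := hr.nice_cut hu.meas hu.even
  refine intervalIntegrable_of_tendsto (F := fun n t => p.kern i t (p.cut u n t))
    (C := 4 * π * √(p.energy u / p.mass i)) (fun n => hr.intervalIntegrable_kern (hN n) i)
    (fun n => ?_) (hr.aesm_kern hu.meas i) ?_
  · set k : ℝ → ℂ := fun t => p.kern i t (p.cut u n t) with hk
    have hkm := hr.aesm_kern (hN n).meas i
    set c : ℝ → ℂ := fun t => conj (k t) / (‖k t‖ : ℝ) with hc
    have hcm : AEStronglyMeasurable c muT :=
      ((continuous_conj.comp_aestronglyMeasurable hkm).aemeasurable.div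
        (continuous_ofReal.comp_aestronglyMeasurable hkm.norm).aemeasurable).aestronglyMeasurable
    have hce : ∀ᵐ t ∂muT, c (-t) = c t := by
      filter_upwards [(hN n).even] with t ht
      have : k (-t) = k t := by simp only [hk, kern, ht, coe_exp_neg, phi_inv]
      rw [hc]; simp only [this]
    have hcb : ∀ t, ‖c t‖ ≤ 1 := fun t => by
      rw [hc]; simp only [norm_div, RCLike.norm_conj, norm_real, norm_norm]
      exact div_self_le_one _
    have hw := (hN n).smul hcm hce le_rfl hcb
    rw [mul_one] at hw
    have h1 := hw.mass_mul_sq_le h i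
    have h2 : p.energy (fun t => c t • p.cut u n t) ≤ p.energy u :=
      energy_mono hu.int (hw.adm hr).int fun ε t => by
        rw [outgoing_smul, norm_mul]
        exact (mul_le_of_le_one_left (norm_nonneg _) (hcb t)).trans (norm_outgoing_cut_le u n ε t)
    have h3 : p.packet (fun t => c t • p.cut u n t) i =
        ((1 / (4 * π) * ∫ t in -π..π, ‖k t‖ : ℝ) : ℂ) := by
      rw [packet]; push_cast
      rw [← intervalIntegral.integral_ofReal]
      congr 1
      refine integral_congr fun t _ => ?_
      simp only [kern_smul]
      change c t * k t = _
      rw [hc]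
      rcases eq_or_ne (k t) 0 with e | e
      · simp [e]
      · have : ((‖k t‖ : ℝ) : ℂ) ≠ 0 := by simpa using e
        simp only
        rw [div_mul_eq_mul_div, Complex.conj_mul', sq, mul_div_assoc, div_self this, mul_one]
    have hm := h.mass_pos i
    have h4 : 0 ≤ ∫ t in -π..π, ‖k t‖ :=
      intervalIntegral.integral_nonneg neg_pi_le_pi fun t _ => norm_nonneg _
    rw [h3, norm_of_nonneg (by positivity)] at h1
    have h5 : 1 / (4 * π) * ∫ t in -π..π, ‖k t‖ ≤ √(p.energy u / p.mass i) := by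
      refine Real.le_sqrt_of_sq_le ?_
      rw [le_div_iff₀ hm]; linarith
    rw [one_div, inv_mul_le_iff₀ (by positivity)] at h5
    exact h5
  · filter_upwards [hr.ae_good] with t ht
    refine tendsto_const_nhds.congr' ?_
    filter_upwards [eventually_cut_eq u ht] with n hn
    rw [hn]

lemma Adm.norm_kern_cut_le (u : ℝ → ℂ²) (n : ℕ) (i : RqIndex) (t : ℝ) :
    ‖p.kern i t (p.cut u n t)‖ ≤ ‖p.kern i t (u t)‖ := by
  rcases cut_cases (p := p) u n t with ⟨h1, h2⟩ | ⟨h1, h2⟩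
  · rw [h2]
  · rw [h2]; simp [kern]

/-- Dominated convergence on the period. -/
lemma tendsto_interval_of_dominated {F : ℕ → ℝ → ℂ} {f : ℝ → ℂ} {b : ℝ → ℝ}
    (hF : ∀ n, AEStronglyMeasurable (F n) muT) (hb : ∀ n t, ‖F n t‖ ≤ b t)
    (hbi : IntervalIntegrable b volume (-π) π)
    (hlim : ∀ᵐ t ∂muT, Tendsto (fun n => F n t) atTop (𝓝 (f t))) :
    Tendsto (fun n => ∫ t in -π..π, F n t) atTop (𝓝 (∫ t in -π..π, f t)) := by
  rw [intervalIntegrable_iff_Ioc] at hbi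
  simp_rw [integral_of_le neg_pi_le_pi]
  exact tendsto_integral_of_dominated_convergence b hF hbi (fun n => .of_forall (hb n)) hlim

lemma tendsto_energy {F : ℕ → ℝ → ℂ²} (h : p.IsReg)
    (hu : p.Adm u) (hF : ∀ n j, AEStronglyMeasurable (fun t => F n t j) muT)
    (hb : ∀ n ε t, ‖p.outgoing (F n) ε t‖ ≤ ‖p.outgoing u ε t‖)
    (hlim : ∀ᵐ t ∂muT, ∀ᶠ n in atTop, F n t = v t) :
    Tendsto (fun n => p.energy (F n)) atTop (𝓝 (p.energy v)) := by
  refine tendsto_finsetSum _ fun ε _ => Tendsto.const_mul _ (Tendsto.const_mul _ ?_)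
  have := tendsto_interval_of_dominated (F := fun n t => ((‖p.outgoing (F n) ε t‖ ^ 2 : ℝ) : ℂ))
    (f := fun t => ((‖p.outgoing v ε t‖ ^ 2 : ℝ) : ℂ)) (b := fun t => ‖p.outgoing u ε t‖ ^ 2)
    (fun n => continuous_ofReal.comp_aestronglyMeasurable ((h.aesm_outgoing (hF n) ε).norm.pow 2))
    (fun n t => by
      rw [norm_real, norm_pow, norm_norm]
      exact pow_le_pow_left₀ (norm_nonneg _) (hb n ε t) 2) (hu.int ε) (by
      filter_upwards [hlim] with t ht
      refine tendsto_const_nhds.congr' ?_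
      filter_upwards [ht] with n hn
      rw [outgoing_congr hn])
  simp_rw [intervalIntegral.integral_ofReal] at this
  have := (continuous_re.tendsto _).comp this
  simpa only [Function.comp_def, ofReal_re] using this

lemma energy_zero : p.energy (fun _ => 0) = 0 := by
  simp [energy, outgoing, trc]

lemma packet_sub_of {i : RqIndex}
    (hu : IntervalIntegrable (fun t => p.kern i t (u t)) volume (-π) π)
    (hv : IntervalIntegrable (fun t => p.kern i t (v t)) volume (-π) π) :
    p.packet (fun t => u t - v t) i = p.packet u i - p.packet v i := by
  simp only [packet]
  rw [← mul_sub, ← intervalIntegral.integral_sub hu hv]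
  congr 1
  refine integral_congr fun t _ => ?_
  simp only [kern, Pi.sub_apply]; ring

lemma Adm.main (hu : p.Adm u) (h : p.IsGeneric) :
    p.MemL2 (p.packet u) ∧ ‖p.toL2 (p.packet u)‖ ^ 2 = p.energy u ∧
      Tendsto (fun n => p.toL2 (p.packet (p.cut u n))) atTop (𝓝 (p.toL2 (p.packet u))) := by
  have hr := h.isRegular
  have hN := hr.nice_cut hu.meas hu.even
  have hm := fun n => (hN n).memL2 h
  set X := fun n => p.toL2 (p.packet (p.cut u n)) with hX
  have htail : ∀ n ε t, ‖p.outgoing (fun t => u t - p.cut u n t) ε t‖ ≤ ‖p.outgoing u ε t‖ := by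
    intro n ε t
    rcases cut_cases (p := p) u n t with ⟨h1, h2⟩ | ⟨h1, h2⟩
    · rw [outgoing_eq_zero (by rw [h2, sub_self]), norm_zero]; exact norm_nonneg _
    · rw [outgoing_congr (v := u) (by rw [h2, sub_zero])]
  have htm : ∀ n j, AEStronglyMeasurable (fun t => (u t - p.cut u n t) j) muT := fun n j =>
    (hu.meas j).sub ((hN n).meas j)
  have htint : ∀ n ε, IntervalIntegrable
      (fun t => ‖p.outgoing (fun t => u t - p.cut u n t) ε t‖ ^ 2) volume (-π) π :=
    fun n ε => (hu.int ε).mono_fun' ((by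
      rw [Set.uIoc_of_le neg_pi_le_pi]; exact (hr.aesm_outgoing (htm n) ε).norm.pow 2))
      (.of_forall fun t => by
        simp only [norm_pow, norm_norm]
        exact pow_le_pow_left₀ (norm_nonneg _) (htail n ε t) 2)
  have htl : Tendsto (fun n => p.energy fun t => u t - p.cut u n t) atTop (𝓝 0) := by
    rw [← energy_zero (p := p)]
    refine tendsto_energy hr hu htm htail ?_
    filter_upwards [hr.ae_good] with t ht
    filter_upwards [eventually_cut_eq u ht] with n hn
    rw [hn, sub_self]
  have hcauchy : CauchySeq X := by
    refine cauchySeq_of_le_tendsto_0' (fun n => √(p.energy fun t => u t - p.cut u n t))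
      (fun n m hnm => ?_) (by
        have := (continuous_sqrt.tendsto _).comp htl; rw [sqrt_zero] at this; exact this)
    have hd := hr.nice_cut_sub hu.meas hu.even hnm
    have e : X m - X n = p.toL2 (p.packet fun t => p.cut u m t - p.cut u n t) := by
      rw [hX]; dsimp only
      rw [← h.toL2_sub (hm m) (hm n)]
      congr 1
      ext i
      rw [packet_sub_of (hr.intervalIntegrable_kern (hN m) i)
        (hr.intervalIntegrable_kern (hN n) i)]; rfl
    rw [dist_comm, dist_eq_norm, e]
    refine Real.le_sqrt_of_sq_le ?_
    rw [hd.normSq h]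
    refine energy_mono (htint n) (hd.adm hr).int fun ε t => ?_
    rcases cut_cases (p := p) u n t with ⟨h1, h2⟩ | ⟨h1, h2⟩
    · have : p.cut u m t = u t := if_pos (cutSet_mono u hnm h1)
      rw [outgoing_eq_zero (by rw [h2, this, sub_self]), norm_zero]; exact norm_nonneg _
    · rw [outgoing_congr (u := fun t => p.cut u m t - p.cut u n t) (v := p.cut u m)
        (by rw [h2, sub_zero]), outgoing_congr (u := fun t => u t - p.cut u n t) (v := u)
        (by rw [h2, sub_zero])]
      exact norm_outgoing_cut_le u m ε t
  obtain ⟨Y, hY⟩ := cauchySeq_tendsto_of_complete hcauchy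
  have hpk : ∀ i, Tendsto (fun n => p.packet (p.cut u n) i) atTop (𝓝 (p.packet u i)) := fun i => by
    refine Tendsto.const_mul _ (tendsto_interval_of_dominated
      (fun n => hr.aesm_kern (hN n).meas i) (fun n t => Adm.norm_kern_cut_le u n i t)
      (hu.intervalIntegrable_kern h i).norm ?_)
    filter_upwards [hr.ae_good] with t ht
    refine tendsto_const_nhds.congr' ?_
    filter_upwards [eventually_cut_eq u ht] with n hn
    rw [hn]
  have hYi : ∀ i, Y i = p.wt (p.packet u) i := fun i => by
    have t1 : Tendsto (fun n => X n i) atTop (𝓝 (Y i)) := by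
      rw [tendsto_iff_norm_sub_tendsto_zero] at hY ⊢
      refine squeeze_zero (fun _ => norm_nonneg _) (fun n => ?_) hY
      exact lp.norm_apply_le_norm two_ne_zero (X n - Y) i
    refine tendsto_nhds_unique t1 (((hpk i).const_mul (√(p.mass i) : ℂ)).congr fun n => ?_)
    rw [hX]; dsimp only
    rw [h.toL2_apply (hm n)]; rfl
  have hmem : p.MemL2 (p.packet u) := by rw [h.memL2_iff, ← funext hYi]; exact lp.memℓp Y
  have hYe : Y = p.toL2 (p.packet u) := by ext i; rw [hYi, h.toL2_apply hmem]
  refine ⟨hmem, ?_, hYe ▸ hY⟩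
  have t1 := (hY.norm.pow 2)
  have t2 : Tendsto (fun n => p.energy (p.cut u n)) atTop (𝓝 (p.energy u)) := by
    refine tendsto_energy hr hu (fun n => (hN n).meas) (fun n => norm_outgoing_cut_le u n) ?_
    filter_upwards [hr.ae_good] with t ht using eventually_cut_eq u ht
  rw [← hYe]
  exact tendsto_nhds_unique t1 (t2.congr fun n => ((hN n).normSq h).symm)

lemma Adm.add (hu : p.Adm u) (hv : p.Adm v) (h : p.IsReg) :
    p.Adm fun t => u t + v t where
  meas j := (hu.meas j).add (hv.meas j)
  even := by filter_upwards [hu.even, hv.even] with t h1 h2; rw [h1, h2]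
  int ε := by
    refine (((hu.int ε).add (hv.int ε)).const_mul 2).mono_fun' ?_ (.of_forall fun t => ?_)
    · rw [Set.uIoc_of_le neg_pi_le_pi]
      exact (h.aesm_outgoing (u := fun t => u t + v t)
        (fun j => (hu.meas j).add (hv.meas j)) ε).norm.pow 2
    · simp only [norm_pow, norm_norm]
      rw [outgoing_add]
      have := norm_add_le (p.outgoing u ε t) (p.outgoing v ε t)
      nlinarith [sq_nonneg (‖p.outgoing u ε t‖ - ‖p.outgoing v ε t‖),
        norm_nonneg (p.outgoing u ε t + p.outgoing v ε t)]

lemma Adm.smul (hu : p.Adm u) (c : ℂ) : p.Adm fun t => c • u t where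
  meas j := (hu.meas j).const_mul c
  even := by filter_upwards [hu.even] with t h1; rw [h1]
  int ε := by
    have := (hu.int ε).const_mul (‖c‖ ^ 2)
    refine this.congr fun t _ => ?_
    rw [outgoing_smul (fun _ => c), norm_mul, mul_pow]

/-- The polarized spectral energy. -/
def energyForm (p : Params) (u v : ℝ → ℂ²) : ℂ :=
  ∑ ε, ‖p.kap ε‖ * ((4 * π)⁻¹ * ∫ t in -π..π, p.outgoing u ε t * conj (p.outgoing v ε t))

lemma Adm.energy_add_smul (hu : p.Adm u) (hv : p.Adm v) (h : p.IsReg)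
    (c : ℂ) : p.energy (fun t => u t + c • v t) =
      p.energy u + ‖c‖ ^ 2 * p.energy v + 2 * (conj c * p.energyForm u v).re := by
  have e : ∀ ε, ∫ t in -π..π, ‖p.outgoing (fun t => u t + c • v t) ε t‖ ^ 2 =
      (∫ t in -π..π, ‖p.outgoing u ε t‖ ^ 2) +
      ‖c‖ ^ 2 * (∫ t in -π..π, ‖p.outgoing v ε t‖ ^ 2) +
      2 * (conj c * ∫ t in -π..π, p.outgoing u ε t * conj (p.outgoing v ε t)).re := fun ε => by
    have hI := intervalIntegrable_mul_of_sq (h.aesm_outgoing hu.meas ε) (h.aesm_outgoing hv.meas ε)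
      (hu.int ε) (hv.int ε)
    have hI2 := hI.const_mul (conj c)
    have hre : (∫ t in -π..π, conj c * (p.outgoing u ε t *
        conj (p.outgoing v ε t))).re = ∫ t in -π..π,
          (conj c * (p.outgoing u ε t * conj (p.outgoing v ε t))).re := by
      rw [intervalIntegrable_iff_Ioc] at hI2
      rw [integral_of_le neg_pi_le_pi, integral_of_le neg_pi_le_pi]
      exact (integral_re hI2).symm
    have hI3 : IntervalIntegrable (fun t => (conj c * (p.outgoing u ε t *
        conj (p.outgoing v ε t))).re) volume (-π) π := by
      rw [intervalIntegrable_iff_Ioc] at hI2 ⊢; exact hI2.re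
    rw [← intervalIntegral.integral_const_mul (conj c), hre, ← intervalIntegral.integral_const_mul,
      ← intervalIntegral.integral_const_mul, ← intervalIntegral.integral_add (hu.int ε)
        ((hv.int ε).const_mul _), ← intervalIntegral.integral_add ((hu.int ε).add
        ((hv.int ε).const_mul _)) (hI3.const_mul _)]
    refine integral_congr fun t _ => ?_
    change ‖p.outgoing (fun t => u t + (fun t => c • v t) t) ε t‖ ^ 2 = _
    rw [outgoing_add, outgoing_smul fun _ => c, ← normSq_eq_norm_sq,
      ← normSq_eq_norm_sq, ← normSq_eq_norm_sq, ← normSq_eq_norm_sq,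
      Complex.normSq_add, Complex.normSq_mul, map_mul]
    ring_nf
  simp only [energy, energyForm, e]
  rw [mul_sum, mul_sum, Complex.re_sum, mul_sum, ← Finset.sum_add_distrib, ← Finset.sum_add_distrib]
  refine sum_congr rfl fun ε _ => ?_
  have : ∀ x : ℂ, (conj c * ((‖p.kap ε‖ : ℂ) * ((((4 * π)⁻¹ : ℝ) : ℂ) * x))).re =
      ‖p.kap ε‖ * ((4 * π)⁻¹ * (conj c * x).re) := fun x => by
    rw [← Complex.re_ofReal_mul, ← Complex.re_ofReal_mul]
    congr 1; push_cast; ring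
  rw [this]
  ring

lemma Adm.inner_eq (hu : p.Adm u) (hv : p.Adm v) (h : p.IsGeneric) :
    p.innerL2 (p.packet u) (p.packet v) = p.energyForm u v := by
  have hr := h.isRegular
  obtain ⟨mu, nu, -⟩ := hu.main h
  obtain ⟨mv, nv, -⟩ := hv.main h
  have key : ∀ c : ℂ, (conj c * inner ℂ (p.toL2 (p.packet v)) (p.toL2 (p.packet u))).re =
      (conj c * p.energyForm u v).re := fun c => by
    have ha := hu.add (hv.smul c) hr
    obtain ⟨ma, na, -⟩ := ha.main h
    have e : p.packet (fun t => u t + c • v t) = p.packet u + c • p.packet v := by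
      ext i
      rw [packet_add_of (hu.intervalIntegrable_kern h i)
        ((hv.smul c).intervalIntegrable_kern h i), packet_smul]; rfl
    rw [hu.energy_add_smul hv hr, e, h.toL2_add mu (h.memL2_smul c mv), h.toL2_smul c mv,
      ← nu, ← nv, @norm_add_sq ℂ, norm_smul, inner_smul_right, mul_pow] at na
    have e2 : RCLike.re (c * inner ℂ (p.toL2 (p.packet u)) (p.toL2 (p.packet v))) =
        (conj c * inner ℂ (p.toL2 (p.packet v)) (p.toL2 (p.packet u))).re := by
      rw [← inner_conj_symm (p.toL2 (p.packet v)), ← map_mul, Complex.conj_re]; rfl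
    rw [e2] at na; linarith
  rw [h.innerL2_eq mu mv]
  have k1 := key 1
  have k2 := key Complex.I
  simp only [map_one, one_mul, Complex.conj_I, neg_mul, Complex.neg_re, Complex.I_mul_re,
    neg_neg] at k1 k2
  exact Complex.ext k1 k2

/-! ### The Hilbert space `ℋ_c` in terms of coefficient functions -/

/-- The coefficient function of an element of `ℋ_c`. -/
def dens (p : Params) (g : Circle → ℂ²) (t : ℝ) : ℂ² := p.wVec (exp t) (g (exp t))

lemma dens_add (g₁ g₂ : Circle → ℂ²) :
    p.dens (g₁ + g₂) = fun t => p.dens g₁ t + p.dens g₂ t := by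
  ext t j; fin_cases j <;> simp [dens, wVec] <;> ring

lemma dens_smul (c : ℂ) (g : Circle → ℂ²) : p.dens (c • g) = fun t => c • p.dens g t := by
  ext t j; fin_cases j <;> simp [dens, wVec] <;> ring

lemma IsReg.measurable_v (h : p.IsReg) : Measurable p.v1 ∧ Measurable p.v2 := by
  have m : Measurable (qPochInf p.q) := (continuous_qPochInf h.q_pos h.q_lt_one).measurable
  have ht : Measurable (theta p.q) := m.mul (m.comp (measurable_const.div measurable_id))
  have k : ∀ {f : ℂ → ℂ} (_ : Measurable f) (c : ℂ), Measurable fun γ => pm f c γ := fun hf c =>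
    (hf.comp (measurable_id.const_mul c)).mul (hf.comp (measurable_const.div measurable_id))
  have e : Measurable fun γ : ℂ => qPochInf p.q (γ ^ 2) * qPochInf p.q (1 / γ ^ 2) :=
    (m.comp (measurable_id.pow_const 2)).mul
      (m.comp (measurable_const.div (measurable_id.pow_const 2)))
  exact ⟨((e.div ((((k m _).mul (k m _)).mul (k m _)).mul ((k ht _).mul (k ht _)))).const_mul
    _).mul ((((k ht _).const_mul _).const_mul _).sub (((k ht _).const_mul _).const_mul _)),
    (e.div ((k m _).mul ((k ht _).mul (k ht _)))).const_mul _⟩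

/-- Measurable functions on the circle that are invariant under inversion. -/
def EvenMeas (g : Circle → ℂ²) : Prop :=
  AEStronglyMeasurable (fun t : ℝ => g (exp t)) muT ∧ ∀ᵐ t ∂muT, g ((exp t)⁻¹) = g (exp t)

lemma EvenMeas.dens {g : Circle → ℂ²} (hg : EvenMeas g) (h : p.IsReg) :
    (∀ j, AEStronglyMeasurable (fun t => p.dens g t j) muT) ∧
      ∀ᵐ t ∂muT, p.dens g (-t) = p.dens g t := by
  have mg : ∀ j, AEStronglyMeasurable (fun t : ℝ => g (exp t) j) muT := fun j =>
    (continuous_apply j).comp_aestronglyMeasurable hg.1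
  have mv : ∀ {f : ℂ → ℂ}, Measurable f →
      AEStronglyMeasurable (fun t : ℝ => f (exp t)) muT := fun hf =>
    (hf.comp measurable_coe_exp).aestronglyMeasurable
  constructor
  · intro j
    fin_cases j
    · exact ((mv h.measurable_v.1).mul (mg 0)).add ((mv h.measurable_v.2).mul (mg 1))
    · exact ((mv h.measurable_v.2).mul (mg 0)).add ((mv h.dagger.measurable_v.1).mul (mg 1))
  · filter_upwards [hg.2] with t ht
    rw [Params.dens, Params.dens, coe_exp_neg, Circle.exp_neg, ht, wVec, wVec, v1_inv, v2_inv, v1_inv]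

lemma EvenMeas.formHc_ae {g₁ g₂ : Circle → ℂ²} (h₁ : EvenMeas g₁) (h₂ : EvenMeas g₂)
    (h : p.IsGeneric) : ∀ᵐ t ∂muT, p.formHc g₁ g₂ t = ∑ ε : Bool, ‖p.kap ε‖ *
      (p.outgoing (p.dens g₁) ε (-t) * conj (p.outgoing (p.dens g₂) ε (-t))) := by
  filter_upwards [h.isRegular.ae_good, (h₁.dens h.isRegular).2, (h₂.dens h.isRegular).2]
    with t ht e1 e2
  simp only [h.formHc_eq g₁ g₂ ht, outgoing, e1, e2, coe_exp_neg]
  rfl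

lemma IsGeneric.formHc_Psi (h : p.IsGeneric) (g : Circle → ℂ²) (i : RqIndex) :
    p.formHc g (p.Psi i).1 = fun t => p.kern i t (p.dens g t) :=
  funext fun t => h.isReal.formHc_Psi g i t

lemma intervalIntegrable_comp_neg {E : Type*} [NormedAddCommGroup E] {f : ℝ → E} :
    IntervalIntegrable (fun t => f (-t)) volume (-π) π ↔ IntervalIntegrable f volume (-π) π := by
  have k : ∀ {f : ℝ → E}, IntervalIntegrable f volume (-π) π →
      IntervalIntegrable (fun t => f (-t)) volume (-π) π := fun {f} hf => by
    have := hf.comp_sub_left 0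
    simp only [zero_sub, neg_neg] at this; exact this.symm
  refine ⟨fun hf => ?_, k⟩
  simpa using k hf

lemma sum_mul_conj (k : Bool → ℝ) (z : Bool → ℂ) :
    ∑ ε, (k ε : ℂ) * (z ε * conj (z ε)) = ((∑ ε, k ε * ‖z ε‖ ^ 2 : ℝ) : ℂ) := by
  simp only [Complex.mul_conj', Complex.ofReal_sum, Complex.ofReal_mul, ofReal_pow]

lemma MemHc.adm {g : Circle → ℂ²} (hg : p.MemHc g) (h : p.IsGeneric) :
    p.Adm (p.dens g) := by
  have hr := h.isRegular
  have he : EvenMeas g := ⟨hg.1, hg.2.2⟩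
  obtain ⟨hm, hev⟩ := he.dens hr
  refine ⟨hm, hev, fun ε => ?_⟩
  have hk := norm_pos_iff.2 (hr.kap_ne ε)
  rw [← intervalIntegrable_comp_neg]
  have hi := (hg.2.1.norm.const_mul ‖p.kap ε‖⁻¹)
  rw [intervalIntegrable_iff_Ioc] at hi ⊢
  refine Integrable.mono' hi ((aesm_comp_neg (hr.aesm_outgoing hm ε)).norm.pow 2) ?_
  filter_upwards [he.formHc_ae he h] with t ht
  have e : p.formHc g g t =
      ((∑ ε, ‖p.kap ε‖ * ‖p.outgoing (p.dens g) ε (-t)‖ ^ 2 : ℝ) : ℂ) := by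
    rw [ht, ← sum_mul_conj]
  have h0 : 0 ≤ ∑ ε, ‖p.kap ε‖ * ‖p.outgoing (p.dens g) ε (-t)‖ ^ 2 :=
    sum_nonneg fun _ _ => by positivity
  rw [e, norm_of_nonneg h0, Real.norm_of_nonneg (sq_nonneg _),
    inv_mul_eq_div, le_div_iff₀ hk, mul_comm]
  exact single_le_sum (f := fun ε => ‖p.kap ε‖ * ‖p.outgoing (p.dens g) ε (-t)‖ ^ 2)
    (fun _ _ => by positivity) (mem_univ ε)

lemma EvenMeas.pairIntegrable {g₁ g₂ : Circle → ℂ²} (h₁ : EvenMeas g₁) (h₂ : EvenMeas g₂)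
    (h : p.IsGeneric) (a₁ : p.Adm (p.dens g₁)) (a₂ : p.Adm (p.dens g₂)) :
    p.PairIntegrable g₁ g₂ ∧ p.innerHc g₁ g₂ = p.energyForm (p.dens g₁) (p.dens g₂) := by
  have hr := h.isRegular
  have hI := fun ε => intervalIntegrable_mul_of_sq (hr.aesm_outgoing a₁.meas ε)
    (hr.aesm_outgoing a₂.meas ε) (a₁.int ε) (a₂.int ε)
  have hI' := fun ε => (intervalIntegrable_comp_neg.2 (hI ε)).const_mul (‖p.kap ε‖ : ℂ)
  have hS : IntervalIntegrable (fun t => ∑ ε : Bool, ‖p.kap ε‖ *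
      (p.outgoing (p.dens g₁) ε (-t) * conj (p.outgoing (p.dens g₂) ε (-t)))) volume
      (-π) π := by
    simp only [Fintype.sum_bool]; exact (hI' true).add (hI' false)
  have hae := h₁.formHc_ae h₂ h
  constructor
  · rw [PairIntegrable]
    rw [intervalIntegrable_iff_Ioc] at hS ⊢
    exact hS.congr (by filter_upwards [hae] with t ht using ht.symm)
  · rw [innerHc, interval_congr_ae hae, energyForm]
    simp only [Fintype.sum_bool]
    rw [intervalIntegral.integral_add (hI' true) (hI' false), intervalIntegral.integral_const_mul,
      intervalIntegral.integral_const_mul,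
      integral_comp_neg_pi fun t => p.outgoing (p.dens g₁) true t * conj (p.outgoing _ true t),
      integral_comp_neg_pi fun t => p.outgoing (p.dens g₁) false t * conj (p.outgoing _ false t)]
    push_cast; ring

lemma EvenMeas.memHc {g : Circle → ℂ²} (hg : EvenMeas g) (h : p.IsGeneric)
    (ha : p.Adm (p.dens g)) : p.MemHc g := ⟨hg.1, (hg.pairIntegrable hg h ha ha).1, hg.2⟩

lemma MemHc.evenMeas {g : Circle → ℂ²} (hg : p.MemHc g) : EvenMeas g := ⟨hg.1, hg.2.2⟩

lemma MemHc.add {g₁ g₂ : Circle → ℂ²} (h₁ : p.MemHc g₁) (h₂ : p.MemHc g₂)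
    (h : p.IsGeneric) : p.MemHc (g₁ + g₂) :=
  EvenMeas.memHc ⟨h₁.1.add h₂.1, by
    filter_upwards [h₁.2.2, h₂.2.2] with t e1 e2; rw [Pi.add_apply, Pi.add_apply, e1, e2]⟩ h
    (by rw [dens_add]; exact (h₁.adm h).add (h₂.adm h) h.isRegular)

lemma MemHc.smul {g : Circle → ℂ²} (hg : p.MemHc g) (h : p.IsGeneric) (c : ℂ) :
    p.MemHc (c • g) :=
  EvenMeas.memHc ⟨hg.1.const_smul c, by
    filter_upwards [hg.2.2] with t e1; rw [Pi.smul_apply, Pi.smul_apply, e1]⟩ h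
    (by rw [dens_smul]; exact (hg.adm h).smul c)

lemma Gc_eq (h : p.IsGeneric) (g : Circle → ℂ²) : p.Gc g = p.packet (p.dens g) := by
  ext i
  simp only [Gc, G, innerH, innerHc, innerHp, packet, h.formHc_Psi, Pi.zero_apply, zero_mul,
    tsum_zero, add_zero]

/-- The functions `Ψ(x, ·)` belong to `ℋ_c`. -/
lemma IsGeneric.memHc_Psi (h : p.IsGeneric) (i : RqIndex) : p.MemHc (p.Psi i).1 := by
  have hr := h.isRegular
  have he : EvenMeas (p.Psi i).1 := by
    constructor
    · refine Continuous.aestronglyMeasurable (continuous_pi fun j => ?_)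
      fin_cases j
      · exact hr.continuous_phi_exp i
      · exact hr.dagger.continuous_phi_exp i
    · refine .of_forall fun t => ?_
      have e1 := congrFun (p.phi_inv (exp t)) i
      have e2 := congrFun (p.dagger.phi_inv (exp t)) i
      simp only [Psi, coe_inv]
      rw [e1, e2]
  obtain ⟨hm, hev⟩ := he.dens hr
  set u := p.dens (p.Psi i).1 with hu
  have hN := hr.nice_cut hm hev
  have hki : ∀ n, ∀ᵐ t ∂muT, p.kern i t (p.cut u n t) =
      ((∑ ε, ‖p.kap ε‖ * ‖p.outgoing (p.cut u n) ε (-t)‖ ^ 2 : ℝ) : ℂ) := fun n => by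
    filter_upwards [he.formHc_ae he h, hev] with t ht h2
    rw [h.formHc_Psi, ← hu] at ht
    rcases cut_cases (p := p) u n t with ⟨k1, k2⟩ | ⟨k1, k2⟩ <;>
    rcases cut_cases (p := p) u n (-t) with ⟨k3, k4⟩ | ⟨k3, k4⟩
    · simp only [outgoing_congr k4]
      rw [k2, ← sum_mul_conj]; exact ht
    · exact absurd ((cutSet_neg h2 n).2 k1) k3
    · exact absurd ((cutSet_neg h2 n).1 k3) k1
    · simp [k2, outgoing_eq_zero k4, kern]
  have hq : ∀ n, p.packet (p.cut u n) i = (p.energy (p.cut u n) : ℂ) := fun n => by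
    have hi := fun ε => (intervalIntegrable_comp_neg.2 (((hN n).adm hr).int ε)).const_mul ‖p.kap ε‖
    rw [packet, interval_congr_ae (hki n), intervalIntegral.integral_ofReal, energy]
    simp only [Fintype.sum_bool]
    rw [intervalIntegral.integral_add (hi true) (hi false), intervalIntegral.integral_const_mul,
      intervalIntegral.integral_const_mul,
      integral_comp_neg fun t => ‖p.outgoing (p.cut u n) true t‖ ^ 2,
      integral_comp_neg fun t => ‖p.outgoing (p.cut u n) false t‖ ^ 2, neg_neg]
    push_cast; ring
  have hE0 : ∀ n ε, 0 ≤ ‖p.kap ε‖ * ((4 * π)⁻¹ *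
      ∫ t in -π..π, ‖p.outgoing (p.cut u n) ε t‖ ^ 2) := fun n ε =>
    mul_nonneg (norm_nonneg _) (mul_nonneg (by positivity)
      (intervalIntegral.integral_nonneg neg_pi_le_pi fun _ _ => by positivity))
  have hEle : ∀ n, p.energy (p.cut u n) ≤ (p.mass i)⁻¹ := fun n => by
    have h1 := (hN n).mass_mul_sq_le h i
    have h0 : 0 ≤ p.energy (p.cut u n) := sum_nonneg fun ε _ => hE0 n ε
    rw [hq, norm_of_nonneg h0] at h1
    have hm0 := h.mass_pos i
    rcases h0.eq_or_lt with e | e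
    · rw [← e]; positivity
    · rw [← one_div, le_div_iff₀ hm0]
      nlinarith
  refine he.memHc h ⟨hm, hev, fun ε => ?_⟩
  have hk := norm_pos_iff.2 (hr.kap_ne ε)
  have := (intervalIntegrable_of_tendsto (f := fun t => ((‖p.outgoing u ε t‖ ^ 2 : ℝ) : ℂ))
    (F := fun n t => ((‖p.outgoing (p.cut u n) ε t‖ ^ 2 : ℝ) : ℂ))
    (C := (p.mass i)⁻¹ * (4 * π) / ‖p.kap ε‖)
    (fun n => by
      have := ((hN n).adm hr).int ε
      rw [intervalIntegrable_iff_Ioc] at this ⊢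
      exact this.ofReal) (fun n => ?_)
    (continuous_ofReal.comp_aestronglyMeasurable ((hr.aesm_outgoing hm ε).norm.pow 2))
    ?_).norm
  · simpa using this
  · have h1 := single_le_sum (fun ε _ => hE0 n ε) (mem_univ ε)
    have h2 := h1.trans (hEle n)
    have hp := pi_pos
    rw [le_div_iff₀ hk]
    simp only [norm_of_nonneg (sq_nonneg _)]
    rw [← mul_le_mul_iff_of_pos_right (inv_pos.2 (by positivity : 0 < 4 * π)),
      mul_assoc (p.mass i)⁻¹, mul_inv_cancel₀ (by positivity), mul_one]
    refine le_trans (le_of_eq ?_) h2; ring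
  · filter_upwards [hr.ae_good] with t ht
    refine tendsto_const_nhds.congr' ?_
    filter_upwards [eventually_cut_eq u ht] with n hn
    rw [outgoing_congr hn]

lemma IsGeneric.memL2_Gc (h : p.IsGeneric) {g : Circle → ℂ²} (hg : p.MemHc g) :
    p.MemL2 (p.Gc g) := by
  rw [Gc_eq h]; exact ((hg.adm h).main h).1

/-- The integral transform `𝒢_c` is isometric. -/
lemma IsGeneric.innerL2_Gc (h : p.IsGeneric) {g₁ g₂ : Circle → ℂ²} (h₁ : p.MemHc g₁)
    (h₂ : p.MemHc g₂) : p.innerL2 (p.Gc g₁) (p.Gc g₂) = p.innerHc g₁ g₂ := by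
  rw [Gc_eq h, Gc_eq h, (h₁.adm h).inner_eq (h₂.adm h) h,
    (h₁.evenMeas.pairIntegrable h₂.evenMeas h (h₁.adm h) (h₂.adm h)).2]

/-! ### Solutions near the origin -/

lemma exists_limit_of_step {E : Type*} [NormedAddCommGroup E] [CompleteSpace E] {q C : ℝ}
    (hq : 0 < q) (hq1 : q < 1) (hC : 0 ≤ C) {w : ℕ → E}
    (hw : ∀ k, ‖w (k + 1) - w k‖ ≤ C * q ^ k * ‖w k‖) :
    (∀ k, ‖w k‖ ≤ Real.exp (C / (1 - q)) * ‖w 0‖) ∧ ∃ l, Tendsto w atTop (𝓝 l) ∧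
      ‖w 0 - l‖ ≤ C * (Real.exp (C / (1 - q)) * ‖w 0‖) / (1 - q) := by
  have h1 : ∀ k, ‖w k‖ ≤ Real.exp (C * ∑ j ∈ range k, q ^ j) * ‖w 0‖ := fun k => by
    induction k with
    | zero => simp
    | succ k ih =>
      have := norm_add_le (w k) (w (k + 1) - w k)
      rw [add_sub_cancel] at this
      rw [sum_range_succ, mul_add, add_comm (C * _), Real.exp_add, mul_assoc]
      have e := Real.add_one_le_exp (C * q ^ k)
      calc _ ≤ (C * q ^ k + 1) * ‖w k‖ := by linarith [hw k]
        _ ≤ _ := by gcongr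
  have h2 : ∀ k, ‖w k‖ ≤ Real.exp (C / (1 - q)) * ‖w 0‖ := fun k => (h1 k).trans (by
    have := (summable_geometric_of_lt_one hq.le hq1).sum_le_tsum (range k) fun _ _ => by positivity
    rw [tsum_geometric_of_lt_one hq.le hq1] at this
    rw [div_eq_mul_inv]; gcongr)
  have h3 : ∀ k, dist (w k) (w (k + 1)) ≤ C * (Real.exp (C / (1 - q)) * ‖w 0‖) * q ^ k := fun k => by
    rw [dist_comm, dist_eq_norm]
    calc _ ≤ C * q ^ k * ‖w k‖ := hw k
      _ ≤ C * q ^ k * (Real.exp (C / (1 - q)) * ‖w 0‖) := by gcongr; exact h2 k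
      _ = _ := by ring
  obtain ⟨l, hl⟩ := cauchySeq_tendsto_of_complete (cauchySeq_of_le_geometric q _ hq1 h3)
  refine ⟨h2, l, hl, ?_⟩
  rw [← dist_eq_norm]
  exact dist_le_of_le_geometric_of_tendsto₀ q _ hq1 h3 hl

lemma exists_recurrence (α β c : ℤ → ℂ) (hα : ∀ n, α n ≠ 0) (hβ : ∀ n, β n ≠ 0) (N : ℤ) (u v : ℂ) :
    ∃ y : ℤ → ℂ, (∀ n, α n * y (n - 1) + β n * y (n + 1) + c n * y n = 0) ∧
      y N = u ∧ y (N + 1) = v := by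
  let g : ℕ → ℂ × ℂ := fun k => Nat.rec (u, v) (fun k z =>
    (z.2, -(α (N + 1 + k) * z.1 + c (N + 1 + k) * z.2) / β (N + 1 + k))) k
  obtain ⟨y, h1, h2⟩ := exists_recurrence_extension α β c hα (fun n => (g (n - N).toNat).1) (N + 1)
    (fun n hn => by
      obtain ⟨k, rfl⟩ : ∃ k : ℕ, n = N + 1 + k := ⟨(n - (N + 1)).toNat, by omega⟩
      have e1 : (N + 1 + (k : ℤ) - 1 - N).toNat = k := by omega
      have e2 : (N + 1 + (k : ℤ) + 1 - N).toNat = k + 2 := by omega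
      have e3 : (N + 1 + (k : ℤ) - N).toNat = k + 1 := by omega
      have := hβ (N + 1 + k)
      simp only [e1, e2, e3, g]
      field_simp; ring)
  refine ⟨y, h1, ?_, ?_⟩
  · rw [h2 N (by omega)]; simp [g]
  · rw [h2 (N + 1) (by omega)]; simp [g]

/-- The value and the `q`-derivative of a function. -/
def jet (p : Params) (f : RqIndex → ℂ) (i : RqIndex) : ℂ × ℂ := (f i, p.qDeriv f i)

lemma IsReg.qDeriv_up (h : p.IsReg) {m : ℂ} {i : RqIndex}
    (hf : p.L f (up i) = m * f (up i)) :
    f (up i) = f i - (1 - p.q) * p.pt i * p.qDeriv f i ∧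
    p.qDeriv f (up i) = p.s⁻¹ * (p.pt (up i) - p.q / p.a) * (p.pt (up i) - p.q / p.b) /
        (p.q * p.s * (p.pt (up i) - 1 / p.c) * (p.pt (up i) - 1 / p.d)) * p.qDeriv f i +
      p.pt (up i) / (p.s * (p.pt (up i) - 1 / p.c) * (p.pt (up i) - 1 / p.d)) *
        ((p.s⁻¹ + p.s - m) / (1 - p.q)) * f (up i) := by
  have hq := h.one_sub_ne
  have hq0 := h.q_ne
  have hx := h.pt_ne i
  have hx' := h.pt_ne (up i)
  have hB := h.coeffB_ne (up i)
  have e1 : f (up i) = f i - (1 - p.q) * p.pt i * p.qDeriv f i := by rw [qDeriv]; field_simp; ring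
  have e2 : f (up (up i)) = f (up i) - (1 - p.q) * p.pt (up i) * p.qDeriv f (up i) := by
    rw [qDeriv]; field_simp; ring
  refine ⟨e1, ?_⟩
  have hxq : (p.pt (up i) : ℂ) = p.q * p.pt i := by rw [h.pt_up]; push_cast; rfl
  obtain ⟨ha, hb, hc, hd, hs, _⟩ := h.ne_zero
  have cA : p.coeffA (p.pt (up i)) = p.s⁻¹ * (p.pt (up i) - p.q / p.a) *
      (p.pt (up i) - p.q / p.b) / p.pt (up i) ^ 2 := by rw [coeffA]; field_simp
  have cB : p.coeffB (p.pt (up i)) = p.s * (p.pt (up i) - 1 / p.c) *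
      (p.pt (up i) - 1 / p.d) / p.pt (up i) ^ 2 := by rw [coeffB]; field_simp
  have hn : p.s * (p.pt (up i) - 1 / p.c) * (p.pt (up i) - 1 / p.d) ≠ 0 := fun e => hB (by
    rw [cB, e, zero_div])
  rw [L, down_up, coeffC, e2, cA, cB] at hf
  have e3 : f i = f (up i) + (1 - p.q) * p.pt i * p.qDeriv f i := by rw [e1]; ring
  rw [e3] at hf
  rw [show p.q * p.s * (p.pt (up i) - 1 / p.c) * (p.pt (up i) - 1 / p.d) =
    p.q * (p.s * (p.pt (up i) - 1 / p.c) * (p.pt (up i) - 1 / p.d)) by ring]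
  generalize p.s * (p.pt (up i) - 1 / p.c) * (p.pt (up i) - 1 / p.d) = Y,
    p.s⁻¹ * (p.pt (up i) - p.q / p.a) * (p.pt (up i) - p.q / p.b) = X, p.s⁻¹ + p.s = S at *
  rw [hxq] at hf hx' ⊢
  field_simp at hf ⊢
  refine mul_left_cancel₀ hx ?_
  linear_combination -hf

lemma IsReg.exists_step_bound (h : p.IsReg) (N : ℤ) (R : ℝ) : ∃ C ≥ 0, ∀ ε m f, ‖m‖ ≤ R →
    (∀ i, p.L f i = m * f i) → ∀ k : ℕ, ‖p.jet f (ε, N + (k + 1 : ℕ)) - p.jet f (ε, N + k)‖ ≤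
      C * p.q ^ k * ‖p.jet f (ε, N + k)‖ := by
  have hq0 := h.q_pos
  obtain ⟨ha, hb, hc, hd, hs, hqc⟩ := h.ne_zero
  have hq1 := sub_pos.2 h.q_lt_one
  set F₁ : ℂ → ℂ := fun x => p.s⁻¹ * (x - p.q / p.a) * (x - p.q / p.b) /
    (p.q * p.s * (x - 1 / p.c) * (x - 1 / p.d)) with hF₁
  set F₂ : ℂ → ℂ := fun x => x / (p.s * (x - 1 / p.c) * (x - 1 / p.d)) with hF₂
  have n2 : p.s * ((0 : ℂ) - 1 / p.c) * (0 - 1 / p.d) ≠ 0 := by simp [hs, hc, hd]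
  have n1 : p.q * p.s * ((0 : ℂ) - 1 / p.c) * (0 - 1 / p.d) ≠ 0 := by simp [hs, hc, hd, hqc]
  have d1 : DifferentiableAt ℂ F₁ 0 := DifferentiableAt.div (by fun_prop) (by fun_prop) n1
  have d2 : DifferentiableAt ℂ F₂ 0 := DifferentiableAt.div (by fun_prop) (by fun_prop) n2
  have v1 : F₁ 0 = 1 := by
    have := h.s_sq
    simp only [hF₁]
    rw [div_eq_one_iff_eq n1]
    field_simp at this ⊢
    linear_combination -(p.q : ℂ) * this
  have v2 : F₂ 0 = 0 := by simp [hF₂]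
  have key : ∀ ε, ∃ C ≥ 0, ∀ k : ℕ, ‖F₁ (p.pt (ε, N + (k + 1 : ℕ))) - 1‖ ≤ C * p.q ^ k ∧
      ‖F₂ (p.pt (ε, N + (k + 1 : ℕ)))‖ ≤ C * p.q ^ k ∧ ‖(p.pt (ε, N + k) : ℂ)‖ ≤ C * p.q ^ k := by
    intro ε
    have e : ∀ k : ℕ, (p.pt (ε, N + (k + 1 : ℕ)) : ℂ) = p.pt (ε, N + 1) * p.q ^ k := fun k => by
      have := zpow_add₀ h.q_pos.ne' (N + 1) k
      rw [zpow_natCast] at this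
      rw [pt, pt, show N + ((k + 1 : ℕ) : ℤ) = N + 1 + k by push_cast; ring, this]
      push_cast; ring
    have e' : ∀ k : ℕ, ‖(p.pt (ε, N + k) : ℂ)‖ = ‖(p.pt (ε, N) : ℂ)‖ * p.q ^ k := fun k => by
      have := zpow_add₀ h.q_pos.ne' N k
      rw [zpow_natCast] at this
      rw [pt, pt, this, ← mul_assoc]
      simp only [Complex.ofReal_mul, norm_mul, ofReal_pow, norm_pow, norm_of_nonneg hq0.le]
    have t : Tendsto (fun k : ℕ => (p.pt (ε, N + (k + 1 : ℕ)) : ℂ)) atTop (𝓝 0) :=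
      (h.tendsto_pt ε).comp (tendsto_atTop_add_const_left _ _
        (tendsto_natCast_atTop_atTop.comp (tendsto_add_atTop_nat 1)))
    have O : (fun k : ℕ => (p.pt (ε, N + (k + 1 : ℕ)) : ℂ) - 0) =O[atTop] fun k : ℕ => p.q ^ k := by
      refine Asymptotics.IsBigO.of_bound ‖(p.pt (ε, N + 1) : ℂ)‖ (.of_forall fun k => ?_)
      rw [sub_zero, e, norm_mul, norm_pow, norm_pow, norm_real p.q]
    obtain ⟨C₁, h1, b1⟩ := Asymptotics.bound_of_isBigO_nat_atTop ((d1.isBigO_sub.comp_tendsto t).trans O)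
    obtain ⟨C₂, h2, b2⟩ := Asymptotics.bound_of_isBigO_nat_atTop ((d2.isBigO_sub.comp_tendsto t).trans O)
    refine ⟨C₁ + C₂ + ‖(p.pt (ε, N) : ℂ)‖, by positivity, fun k => ?_⟩
    have hk := pow_pos hq0 k
    have k1 := b1 hk.ne'
    have k2 := b2 hk.ne'
    simp only [Function.comp, v1, v2, sub_zero, Real.norm_of_nonneg hk.le] at k1 k2
    have := norm_nonneg (p.pt (ε, N) : ℂ)
    rw [e']
    exact ⟨k1.trans (by gcongr; linarith), k2.trans (by gcongr; linarith), by gcongr; linarith⟩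
  choose C hC0 hC using key
  set M := (‖p.s⁻¹ + p.s‖ + |R|) / (1 - p.q) with hM
  set D := C true + C false with hD
  have hM0 : 0 ≤ M := by positivity
  have hD0 : 0 ≤ D := add_nonneg (hC0 _) (hC0 _)
  refine ⟨D + D * (M * (1 + D)), by positivity, fun ε m f hm hf k => ?_⟩
  have hCD : C ε ≤ D := by cases ε <;> simp [hD, hC0]
  obtain ⟨b1, b2, b3⟩ := hC ε k
  have hk := pow_pos hq0 k
  have hk1 : p.q ^ k ≤ 1 := pow_le_one₀ hq0.le h.q_lt_one.le
  have b1' := b1.trans (mul_le_mul_of_nonneg_right hCD hk.le)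
  have b2' := b2.trans (mul_le_mul_of_nonneg_right hCD hk.le)
  have b3' := b3.trans (mul_le_mul_of_nonneg_right hCD hk.le)
  set i : RqIndex := (ε, N + k) with hi
  have hu : ((ε, N + (k + 1 : ℕ)) : RqIndex) = up i := by simp [hi, up, add_assoc]
  rw [hu] at b1' b2' ⊢
  obtain ⟨e1, e2⟩ := h.qDeriv_up (hf (up i))
  set J := ‖p.jet f i‖ with hJ
  have j1 : ‖f i‖ ≤ J := norm_fst_le (p.jet f i)
  have j2 : ‖p.qDeriv f i‖ ≤ J := norm_snd_le (p.jet f i)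
  have hJ0 : 0 ≤ J := norm_nonneg _
  have q1 : ‖(1 - p.q : ℂ)‖ = 1 - p.q := by rw [← ofReal_one, ← ofReal_sub, norm_of_nonneg hq1.le]
  have s1 : ‖f (up i) - f i‖ ≤ D * p.q ^ k * J := by
    rw [e1, sub_sub_cancel_left, norm_neg, norm_mul, norm_mul, q1]
    calc _ ≤ 1 * (D * p.q ^ k) * J := by gcongr; linarith
      _ = _ := by ring
  have s2 : ‖f (up i)‖ ≤ (1 + D) * J := by
    have := norm_add_le (f i) (f (up i) - f i)
    rw [add_sub_cancel] at this
    have k2 : D * p.q ^ k * J ≤ D * 1 * J := by gcongr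
    linarith
  have s3 : ‖(p.s⁻¹ + p.s - m) / (1 - p.q)‖ ≤ M := by
    rw [norm_div, q1, hM]; gcongr
    exact (norm_sub_le _ _).trans (by gcongr; exact hm.trans (le_abs_self R))
  have s4 : ‖p.qDeriv f (up i) - p.qDeriv f i‖ ≤ (D + D * (M * (1 + D))) * p.q ^ k * J := by
    have e3 : p.qDeriv f (up i) - p.qDeriv f i = (F₁ (p.pt (up i)) - 1) * p.qDeriv f i +
        F₂ (p.pt (up i)) * ((p.s⁻¹ + p.s - m) / (1 - p.q)) * f (up i) := by rw [e2, hF₁, hF₂]; ring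
    rw [e3]
    refine (norm_add_le _ _).trans ?_
    rw [norm_mul, norm_mul, norm_mul]
    calc _ ≤ D * p.q ^ k * J + D * p.q ^ k * M * ((1 + D) * J) := by gcongr
      _ = _ := by ring
  rw [Prod.norm_def]
  refine max_le (s1.trans ?_) s4
  have : 0 ≤ D * (M * (1 + D)) := by positivity
  gcongr
  linarith

/-- The boundary values of a function at the origin. -/
def HasJet (p : Params) (f : RqIndex → ℂ) (ε : Bool) (β : ℂ × ℂ) : Prop :=
  Tendsto (fun n : ℤ => p.jet f (ε, n)) atTop (𝓝 β)

lemma HasJet.fst {β : ℂ × ℂ} (hf : p.HasJet f ε β) :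
    Tendsto (fun n : ℤ => f (ε, n)) atTop (𝓝 β.1) := (continuous_fst.tendsto β).comp hf

lemma HasJet.snd {β : ℂ × ℂ} (hf : p.HasJet f ε β) :
    Tendsto (fun n : ℤ => p.qDeriv f (ε, n)) atTop (𝓝 β.2) := (continuous_snd.tendsto β).comp hf

lemma reg_iff : p.Reg f ↔ ∃ β, ∀ ε, p.HasJet f ε β :=
  ⟨fun ⟨⟨l, hl⟩, ⟨m, hm⟩⟩ => ⟨(l, m), fun ε => (hl ε).prodMk_nhds (hm ε)⟩,
    fun ⟨β, hβ⟩ => ⟨⟨β.1, fun ε => (hβ ε).fst⟩, ⟨β.2, fun ε => (hβ ε).snd⟩⟩⟩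

lemma jet_add_smul (f g : RqIndex → ℂ) (c e : ℂ) (i : RqIndex) :
    p.jet (c • f + e • g) i = c • p.jet f i + e • p.jet g i := by
  ext
  · simp [jet]
  · simp [jet, qDeriv]; ring

lemma L_add_smul (f g : RqIndex → ℂ) (c e : ℂ) (i : RqIndex) :
    p.L (c • f + e • g) i = c * p.L f i + e * p.L g i := by
  simp [L]; ring

lemma HasJet.add_smul {β δ : ℂ × ℂ} (hf : p.HasJet f ε β)
    (hg : p.HasJet g ε δ) (c e : ℂ) : p.HasJet (c • f + e • g) ε (c • β + e • δ) :=
  ((hf.const_smul c).add (hg.const_smul e)).congr fun _ => (jet_add_smul f g c e _).symm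

lemma IsReg.exists_hasJet (h : p.IsReg) (R : ℝ) (N : ℤ) : ∃ C ≥ 0, ∀ ε m f, ‖m‖ ≤ R →
    (∀ i, p.L f i = m * f i) → (∀ k : ℕ, ‖p.jet f (ε, N + k)‖ ≤ C * ‖p.jet f (ε, N)‖) ∧
      ∃ β, p.HasJet f ε β ∧ ∀ k : ℕ, ‖p.jet f (ε, N + k) - β‖ ≤ C * p.q ^ k * ‖p.jet f (ε, N + k)‖ := by
  obtain ⟨C, hC0, hC⟩ := h.exists_step_bound N R
  have hq1 := sub_pos.2 h.q_lt_one
  set P := Real.exp (C / (1 - p.q)) with hP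
  have hP0 : 0 < P := Real.exp_pos _
  refine ⟨P + C * P / (1 - p.q), by positivity, fun ε m f hm hf => ?_⟩
  have hs := hC ε m f hm hf
  obtain ⟨h1, β, h2, -⟩ := exists_limit_of_step h.q_pos h.q_lt_one hC0
    (w := fun k : ℕ => p.jet f (ε, N + k)) hs
  refine ⟨fun k => ?_, β, ?_, fun k => ?_⟩
  · have := h1 k
    simp only [Nat.cast_zero, add_zero] at this
    refine this.trans ?_
    have : 0 ≤ C * P / (1 - p.q) := by positivity
    gcongr; linarith
  · have t : Tendsto (fun n : ℤ => (n - N).toNat) atTop atTop := tendsto_atTop.2 fun b => by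
      filter_upwards [eventually_ge_atTop (N + b)] with n hn
      omega
    refine (h2.comp t).congr' ?_
    filter_upwards [eventually_ge_atTop N] with n hn
    simp only [Function.comp]
    rw [show N + ((n - N).toNat : ℤ) = n by omega]
  · have hk : p.q ^ k ≤ 1 := pow_le_one₀ h.q_pos.le h.q_lt_one.le
    have hqk := pow_pos h.q_pos k
    obtain ⟨-, β', h3, h4⟩ := exists_limit_of_step h.q_pos h.q_lt_one (C := C * p.q ^ k)
      (by positivity) (w := fun j : ℕ => p.jet f (ε, N + (k + j : ℕ))) fun j => by
        have := hs (k + j)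
        rw [pow_add, ← mul_assoc] at this; exact this
    have e : β' = β := tendsto_nhds_unique h3
      ((h2.comp (tendsto_add_atTop_nat k)).congr fun j => by simp [add_comm])
    rw [e] at h4
    simp only [add_zero] at h4
    refine h4.trans ?_
    have : Real.exp (C * p.q ^ k / (1 - p.q)) ≤ P := by rw [hP]; gcongr; nlinarith
    calc _ ≤ C * p.q ^ k * (P * ‖p.jet f (ε, N + k)‖) / (1 - p.q) := by gcongr
      _ = C * P / (1 - p.q) * p.q ^ k * ‖p.jet f (ε, N + k)‖ := by ring
      _ ≤ _ := by gcongr; linarith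

lemma IsReg.casorati_hasJet (h : p.IsReg) {m : ℂ}
    {β δ : ℂ × ℂ} (hf : ∀ i, p.L f i = m * f i) (hg : ∀ i, p.L g i = m * g i)
    (jf : p.HasJet f ε β) (jg : p.HasJet g ε δ) (n : ℤ) : p.casorati f g (ε, n) =
      (β.2 * δ.1 - β.1 * δ.2) * ((1 - p.q) ^ 2 * p.s / (p.c * p.d)) := by
  have t := h.tendsto_casorati_zero jf.fst jf.snd jg.fst jg.snd
  refine tendsto_nhds_unique (tendsto_const_nhds.congr' ?_) t
  filter_upwards [eventually_ge_atTop n] with k hk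
  have := h.casorati_const (ε := ε) (K := k) (fun n _ => hf (ε, n)) (fun n _ => hg (ε, n))
    (k - n).toNat
  rwa [show k - ((k - n).toNat : ℤ) = n by omega] at this

lemma IsReg.eq_zero_of_hasJet (h : p.IsReg) {m : ℂ}
    (hf : ∀ i, p.L f i = m * f i) (jf : p.HasJet f ε 0) (n : ℤ) : f (ε, n) = 0 := by
  obtain ⟨C, -, hC⟩ := h.exists_hasJet ‖m‖ 0
  obtain ⟨-, β, hβ, hk⟩ := hC ε m f le_rfl hf
  rw [tendsto_nhds_unique hβ jf] at hk
  have t := (tendsto_pow_atTop_nhds_zero_of_lt_one h.q_pos.le h.q_lt_one).const_mul C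
  rw [mul_zero] at t
  obtain ⟨K, hK⟩ := eventually_atTop.1 (t.eventually_lt_const zero_lt_one)
  have L0 : ∀ i, p.L (fun _ => 0) i = m * (fun _ : RqIndex => (0 : ℂ)) i := fun i => by simp [L]
  refine h.solution_unique (g := fun _ => 0) (fun n => hf _) (fun n => L0 (ε, n)) (N := K)
    (fun n hn => ?_) n
  have h1 := hk n.toNat
  have h2 := hK n.toNat (by omega)
  rw [sub_zero, zero_add, show ((n.toNat : ℕ) : ℤ) = n by omega] at h1
  have h3 : ‖p.jet f (ε, n)‖ = 0 := by
    by_contra e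
    have := lt_of_le_of_ne (norm_nonneg _) (Ne.symm e)
    nlinarith
  exact congrArg Prod.fst (norm_eq_zero.1 h3)

lemma IsGeneric.exists_solution_of_jet (hg : p.IsGeneric) (m : ℂ) (β : ℂ × ℂ) :
    ∃ f, (∀ i, p.L f i = m * f i) ∧ ∀ ε, p.HasJet f ε β := by
  have h := hg.isRegular
  have main : ∀ ε, ∃ f, (∀ i, p.L f i = m * f i) ∧ p.HasJet f ε β := fun ε => by
    have ex : ∀ u v : ℂ, ∃ f, (∀ i, p.L f i = m * f i) ∧ f (ε, 0) = u ∧ f (ε, 1) = v := fun u v => by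
      have := fun δ => exists_recurrence (fun n => p.coeffA (p.pt (δ, n)))
        (fun n => p.coeffB (p.pt (δ, n))) (fun n => p.coeffC (p.pt (δ, n)) - m)
        (fun n => h.coeffA_ne (δ, n)) (fun n => h.coeffB_ne (δ, n)) 0 u v
      choose y h1 h2 h3 using this
      refine ⟨fun i => y i.1 i.2, fun i => ?_, h2 ε, h3 ε⟩
      simp only [L, up, down]
      linear_combination h1 i.1 i.2
    obtain ⟨f, hf, f0, f1⟩ := ex 1 0
    obtain ⟨g, hg', g0, g1⟩ := ex 0 1
    obtain ⟨C, -, hC⟩ := h.exists_hasJet ‖m‖ 0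
    obtain ⟨-, x, hx, -⟩ := hC ε m f le_rfl hf
    obtain ⟨-, y, hy, -⟩ := hC ε m g le_rfl hg'
    have hD := h.casorati_hasJet hf hg' hx hy 0
    have hne : x.2 * y.1 - x.1 * y.2 ≠ 0 := fun e => by
      rw [e, zero_mul, h.casorati_eq] at hD
      simp only [up, zero_add, f0, f1, g0, g1] at hD
      have hw0 : p.w (p.pt (ε, 0)) ≠ 0 := by
        obtain ⟨r, hr, e⟩ := hg.w_pos (ε, 0)
        rw [e]; exact_mod_cast hr.ne'
      have hw : (1 - p.q : ℂ) * p.coeffB (p.pt (ε, 0)) * (p.pt (ε, 0) * p.w (p.pt (ε, 0))) ≠ 0 :=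
        mul_ne_zero (mul_ne_zero (mod_cast (sub_pos.2 h.q_lt_one).ne') (h.coeffB_ne _))
          (mul_ne_zero (h.pt_ne _) hw0)
      simp [hw] at hD
    have hj := hx.add_smul hy ((β.2 * y.1 - β.1 * y.2) / (x.2 * y.1 - x.1 * y.2))
      ((x.2 * β.1 - x.1 * β.2) / (x.2 * y.1 - x.1 * y.2))
    have e : ((β.2 * y.1 - β.1 * y.2) / (x.2 * y.1 - x.1 * y.2)) • x +
        ((x.2 * β.1 - x.1 * β.2) / (x.2 * y.1 - x.1 * y.2)) • y = β := by
      ext <;> simp only [Prod.fst_add, Prod.snd_add, Prod.smul_fst, Prod.smul_snd, smul_eq_mul] <;>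
        rw [div_mul_eq_mul_div, div_mul_eq_mul_div, ← add_div, div_eq_iff hne] <;> ring
    rw [e] at hj
    exact ⟨_, fun i => by rw [L_add_smul, hf, hg']; simp; ring, hj⟩
  choose f hf jf using main
  refine ⟨fun i => f i.1 i, fun i => hf i.1 i, fun ε => jf ε⟩

/-- A solution is determined by its values far out. -/
lemma IsReg.solution_unique_far (h : p.IsReg) {m : ℂ} {N : ℤ}
    (hf : ∀ i, p.L f i = m * f i) (hg : ∀ i, p.L g i = m * g i)
    (hfg : ∀ n ≤ N, f (ε, n) = g (ε, n)) (n : ℤ) : f (ε, n) = g (ε, n) := by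
  have : ∀ k : ℕ, ∀ n ≤ N + k, f (ε, n) = g (ε, n) := fun k => by
    induction k with
    | zero => simpa using hfg
    | succ k ih =>
      intro n hn
      have h1 := hf (ε, n - 1)
      have h2 := hg (ε, n - 1)
      simp only [L, up, down, sub_add_cancel] at h1 h2
      rw [ih (n - 1) (by push_cast at hn; omega), ih (n - 1 - 1) (by push_cast at hn; omega)] at h1
      exact mul_left_cancel₀ (h.coeffB_ne (ε, n - 1)) (by linear_combination h1 - h2)
  exact this (n - N).toNat n (by omega)

/-! ### The asymptotic solutions -/

lemma IsReg.q_mul_sq_lt (h : p.IsReg) (hγ : ‖γ‖ < 1) : p.q * ‖γ‖ ^ 2 < 1 := by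
  have := h.q_pos
  have := h.q_lt_one
  have : ‖γ‖ ^ 2 ≤ 1 := pow_le_one₀ (norm_nonneg _) hγ.le
  nlinarith

namespace IsGeneric
variable (h : p.IsGeneric)
include h

lemma exists_Phi : ∃ K : ℤ, ∀ ε γ, γ ≠ 0 → ‖γ‖ < 1 →
    p.InV (mu γ) (p.Phi ε γ) ∧ ∀ n ≤ K, p.Phi ε γ (ε, n) = p.asym γ (ε, n) := by
  have hr := h.isRegular
  obtain ⟨K₁, hK₁⟩ := hr.exists_far_asym
  obtain ⟨K₂, hK₂⟩ := hr.exists_far ‖p.q ^ 2 / (p.a * p.s)‖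
  refine ⟨min K₁ K₂, fun ε γ h0 h1 => ?_⟩
  have hP : ∀ n ≤ min K₁ K₂, p.PhiSeries γ ε n = p.asym γ (ε, n) := fun n hn => hr.PhiSeries_eq (by
    have h2 := hK₂ ε n (hn.trans (min_le_right _ _))
    have h3 : 0 < |p.pt (ε, n)| := lt_of_le_of_lt (norm_nonneg _) h2
    rw [show p.q ^ 2 * γ / (p.a * p.s * p.pt (ε, n)) =
      γ * (p.q ^ 2 / (p.a * p.s)) / p.pt (ε, n) by ring, norm_div, norm_mul, norm_real,
      norm_eq_abs, div_lt_one h3]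
    nlinarith [norm_nonneg (p.q ^ 2 / (p.a * p.s))])
  have hL := fun δ (n : ℤ) (hn : n ≤ min K₁ K₂) => hr.L_asym h0 (hr.q_mul_sq_lt h1)
    (hK₁ δ n (hn.trans (min_le_left _ _)))
  have := fun δ => exists_recurrence_extension' (fun n => p.coeffA (p.pt (δ, n)))
    (fun n => p.coeffB (p.pt (δ, n))) (fun n => p.coeffC (p.pt (δ, n)) - mu γ)
    (fun n => hr.coeffB_ne (δ, n)) (fun n => p.asym γ (δ, n)) (min K₁ K₂) (fun n hn => by
      have := hL δ n hn
      simp only [L, up, down] at this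
      linear_combination this)
  choose y hy hya using this
  have hS : ∀ i, p.L (fun i => y i.1 i.2) i = mu γ * (fun i : RqIndex => y i.1 i.2) i := fun i => by
    simp only [L, up, down]
    linear_combination hy i.1 i.2
  obtain ⟨_, -, hC⟩ := hr.exists_hasJet ‖mu γ‖ 0
  obtain ⟨-, β, hβ, -⟩ := hC ε _ _ le_rfl hS
  obtain ⟨g, hg, jg⟩ := h.exists_solution_of_jet (mu γ) β
  have hreg : p.Reg fun i => if i.1 = ε then y i.1 i.2 else g i := reg_iff.2 ⟨β, fun δ => by
    by_cases hi : δ = ε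
    · rw [← hi] at hβ
      refine hβ.congr fun n => ?_
      simp only [jet, qDeriv, up, hi, if_true]
    · refine (jg δ).congr fun n => ?_
      simp only [jet, qDeriv, up, hi, if_false]⟩
  have hs : p.InV (mu γ) (p.Phi ε γ) ∧ ∀ᶠ n : ℤ in atBot, p.Phi ε γ (ε, n) = p.PhiSeries γ ε n := by
    refine Classical.epsilon_spec (p := fun f => p.InV (mu γ) f ∧
      ∀ᶠ n : ℤ in atBot, f (ε, n) = p.PhiSeries γ ε n) 
      ⟨fun i => if i.1 = ε then y i.1 i.2 else g i, ⟨fun i => ?_, hreg⟩, ?_⟩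
    · by_cases hi : i.1 = ε
      · have := hS i
        simp only [L, up, down, hi, if_true] at this ⊢; exact this
      · have := hg i
        simp only [L, up, down, hi, if_false] at this ⊢; exact this
    · filter_upwards [eventually_le_atBot (min K₁ K₂)] with n hn
      rw [if_pos rfl, hP n hn]
      exact hya ε n (hn.trans (by omega))
  obtain ⟨N, hN⟩ := eventually_atBot.1 hs.2
  refine ⟨hs.1, fun n hn => ?_⟩
  have := hr.solution_unique_far (N := min N (min K₁ K₂)) (ε := ε) hs.1.1 hS (fun k hk => by
    have k1 := hk.trans (min_le_right _ _)
    rw [hN k (hk.trans (min_le_left _ _)), hP k k1, hya ε k (by omega)]) n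
  rw [this]
  exact hya ε n (by omega)

lemma inV_Phi (ε : Bool) (h0 : γ ≠ 0) (h1 : ‖γ‖ < 1) :
    p.InV (mu γ) (p.Phi ε γ) := by
  obtain ⟨_, hK⟩ := h.exists_Phi
  exact (hK ε γ h0 h1).1

lemma tendsto_Phi (ε : Bool) (h0 : γ ≠ 0) (h1 : ‖γ‖ < 1) :
    Tendsto (fun k : ℕ => ((p.s * γ) ^ k)⁻¹ * p.Phi ε γ (ε, -(k : ℤ))) atTop (𝓝 1) := by
  obtain ⟨K, hK⟩ := h.exists_Phi
  refine (h.isRegular.tendsto_asym ε h0 (h.isRegular.q_mul_sq_lt h1)).congr' ?_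
  filter_upwards [eventually_ge_atTop (-K).toNat] with k hk
  rw [(hK ε γ h0 h1).2 _ (by omega)]

lemma tendsto_Phi_zero (ε : Bool) (h0 : γ ≠ 0) (h1 : ‖γ‖ < 1) :
    Tendsto (fun k : ℕ => (p.s ^ k)⁻¹ * p.Phi ε γ (ε, -(k : ℤ))) atTop (𝓝 0) := by
  have := (tendsto_pow_atTop_nhds_zero_of_norm_lt_one h1).mul (h.tendsto_Phi ε h0 h1)
  rw [zero_mul] at this
  refine this.congr fun k => ?_
  have := pow_ne_zero k h0
  have := pow_ne_zero k h.isRegular.s_ne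
  rw [mul_pow]; field_simp

end IsGeneric

lemma eventually_unit (h0 : γ ≠ 0) (h1 : ‖γ‖ < 1) : ∀ᶠ ζ in 𝓝 γ, ζ ≠ 0 ∧ ‖ζ‖ < 1 :=
  (eventually_ne_nhds h0).and ((continuous_norm.tendsto γ).eventually_lt_const h1)

lemma continuousAt_mu (h0 : γ ≠ 0) : ContinuousAt mu γ := continuousAt_id.add (continuousAt_inv₀ h0)

lemma IsGeneric.continuousAt_Phi (h : p.IsGeneric) (ε : Bool) (n : ℤ) (h0 : γ ≠ 0)
    (h1 : ‖γ‖ < 1) : ContinuousAt (fun ζ => p.Phi ε ζ (ε, n)) γ := by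
  have hr := h.isRegular
  obtain ⟨K₁, hK₁⟩ := hr.exists_far_asym
  obtain ⟨K, hK⟩ := h.exists_Phi
  have hev := eventually_unit h0 h1
  have : ∀ k : ℕ, ∀ n ≤ min K K₁ + k, ContinuousAt (fun ζ => p.Phi ε ζ (ε, n)) γ := fun k => by
    induction k with
    | zero =>
      intro n hn
      have hn' : n ≤ min K K₁ := by simpa using hn
      have hy : ‖p.q * (1 / p.pt (ε, n)) / p.b‖ < 1 := by
        have := hK₁ ε n (hn'.trans (min_le_right _ _))
        rw [mul_div_assoc, norm_mul, norm_of_nonneg hr.q_pos.le]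
        nlinarith [hr.q_pos, hr.q_lt_one, norm_nonneg (1 / (p.pt (ε, n) : ℂ) / p.b)]
      have c1 : ContinuousAt (fun ζ => p.bigFun ζ (1 / p.pt (ε, n))) γ :=
        (hr.differentiableOn_bigFun_left hy).continuousOn.continuousAt
          ((by fun_prop : Continuous fun γ : ℂ => p.q * ‖γ‖ ^ 2).isOpen_preimage _ isOpen_Iio
            |>.mem_nhds (hr.q_mul_sq_lt h1))
      have c2 : ContinuousAt (fun ζ => p.asym ζ (ε, n)) γ :=
        ((continuousAt_id.const_mul p.s).zpow₀ _ (Or.inl (mul_ne_zero hr.s_ne h0))).mul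
          (c1.const_mul _)
      refine c2.congr ?_
      filter_upwards [hev] with ζ hζ
      exact ((hK ε ζ hζ.1 hζ.2).2 n (hn'.trans (min_le_left _ _))).symm
    | succ k ih =>
      intro n hn
      have c1 := ih (n - 1) (by push_cast at hn; omega)
      have c2 := ih (n - 1 - 1) (by push_cast at hn; omega)
      have c3 : ContinuousAt (fun ζ => ((mu ζ - p.coeffC (p.pt (ε, n - 1))) * p.Phi ε ζ (ε, n - 1) -
          p.coeffA (p.pt (ε, n - 1)) * p.Phi ε ζ (ε, n - 1 - 1)) / p.coeffB (p.pt (ε, n - 1))) γ :=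
        ((((continuousAt_mu h0).sub_const (p.coeffC (p.pt (ε, n - 1)))).mul c1).sub
        (c2.const_mul (p.coeffA (p.pt (ε, n - 1))))).div_const (p.coeffB (p.pt (ε, n - 1)))
      refine c3.congr ?_
      filter_upwards [hev] with ζ hζ
      have := (h.inV_Phi ε hζ.1 hζ.2).1 (ε, n - 1)
      simp only [L, up, down, sub_add_cancel] at this
      rw [div_eq_iff (hr.coeffB_ne _)]
      linear_combination -this
  exact this (n - min K K₁).toNat n (by omega)

/-- The boundary values of `Φ_γ` at the origin. -/
def bd (p : Params) (ε : Bool) (γ : ℂ) : ℂ × ℂ :=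
  limUnder atTop fun n : ℤ => p.jet (p.Phi ε γ) (ε, n)

namespace IsGeneric
variable (h : p.IsGeneric)
include h

lemma hasJet_Phi (ε δ : Bool) (h0 : γ ≠ 0) (h1 : ‖γ‖ < 1) :
    p.HasJet (p.Phi ε γ) δ (p.bd ε γ) := by
  obtain ⟨β, hβ⟩ := reg_iff.1 (h.inV_Phi ε h0 h1).2
  have : p.bd ε γ = β := (hβ ε).limUnder_eq
  rw [this]; exact hβ δ

lemma continuousAt_jet (ε : Bool) (n : ℤ) (h0 : γ ≠ 0)
    (h1 : ‖γ‖ < 1) : ContinuousAt (fun ζ => p.jet (p.Phi ε ζ) (ε, n)) γ :=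
  (h.continuousAt_Phi ε n h0 h1).prodMk
    (((h.continuousAt_Phi ε n h0 h1).sub (h.continuousAt_Phi ε (n + 1) h0 h1)).div_const _)

/-- Uniform bounds for `Φ_ζ` near the origin. -/
lemma exists_near_bound (N : ℤ) (ε : Bool) (h0 : γ ≠ 0)
    (h1 : ‖γ‖ < 1) : ∃ C ≥ 0, ∀ᶠ ζ in 𝓝 γ, ∀ k : ℕ, ‖p.jet (p.Phi ε ζ) (ε, N + k)‖ ≤ C ∧
      ‖p.jet (p.Phi ε ζ) (ε, N + k) - p.bd ε ζ‖ ≤ C * p.q ^ k := by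
  have hr := h.isRegular
  obtain ⟨C, hC0, hC⟩ := hr.exists_hasJet (‖mu γ‖ + 1) N
  have e1 := (continuousAt_mu h0).norm.eventually_lt_const (lt_add_one ‖mu γ‖)
  set B := ‖p.jet (p.Phi ε γ) (ε, N)‖ + 1
  have e2 : ∀ᶠ ζ in 𝓝 γ, ‖p.jet (p.Phi ε ζ) (ε, N)‖ < B :=
    (h.continuousAt_jet ε N h0 h1).norm.eventually_lt_const (lt_add_one _)
  have hB : 0 ≤ B := by positivity
  refine ⟨C * B + C * (C * B), by positivity, ?_⟩
  filter_upwards [eventually_unit h0 h1, e1, e2] with ζ hζ m1 m2 k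
  obtain ⟨b1, β, hβ, b2⟩ := hC ε _ _ m1.le (h.inV_Phi ε hζ.1 hζ.2).1
  rw [tendsto_nhds_unique hβ (h.hasJet_Phi ε ε hζ.1 hζ.2)] at b2
  have k1 : ‖p.jet (p.Phi ε ζ) (ε, N + k)‖ ≤ C * B := (b1 k).trans (by gcongr)
  have hk := pow_pos hr.q_pos k
  refine ⟨k1.trans (by have : 0 ≤ C * (C * B) := by positivity
                       linarith), ?_⟩
  calc _ ≤ C * p.q ^ k * ‖p.jet (p.Phi ε ζ) (ε, N + k)‖ := b2 k
    _ ≤ C * p.q ^ k * (C * B) := by gcongr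
    _ = C * (C * B) * p.q ^ k := by ring
    _ ≤ _ := by gcongr; have : 0 ≤ C * B := by positivity
                linarith

lemma continuousAt_bd (ε : Bool) (h0 : γ ≠ 0) (h1 : ‖γ‖ < 1) :
    ContinuousAt (p.bd ε) γ := by
  obtain ⟨C, hC0, hC⟩ := h.exists_near_bound 0 ε h0 h1
  refine continuousAt_of_locally_uniform_approx_of_continuousAt fun u hu => ?_
  obtain ⟨r, hr, hru⟩ := Metric.mem_uniformity_dist.1 hu
  have t := (tendsto_pow_atTop_nhds_zero_of_lt_one h.q_pos.le h.q_lt_one).const_mul C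
  rw [mul_zero] at t
  obtain ⟨k, hk⟩ := (t.eventually_lt_const hr).exists
  refine ⟨_, hC, _, h.continuousAt_jet ε (0 + k) h0 h1, fun ζ hζ => hru ?_⟩
  rw [dist_comm, dist_eq_norm]
  exact ((hζ k).2).trans_lt hk

end IsGeneric

/-! ### The discrete spectrum -/

/-- Uniform bounds for `Φ_ζ` far out. -/
lemma IsGeneric.exists_far_bound (h : p.IsGeneric) (ε : Bool) : ∃ K ≤ (0 : ℤ), ∃ C ≥ 0, ∀ ζ, ζ ≠ 0 →
    ‖ζ‖ < 1 → ∀ k : ℕ, -(k : ℤ) ≤ K →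
      √(p.mass (ε, -(k : ℤ))) * ‖p.Phi ε ζ (ε, -(k : ℤ))‖ ≤ C * ‖ζ‖ ^ k := by
  have hr := h.isRegular
  obtain ⟨K₁, hK₁⟩ := h.exists_Phi
  obtain ⟨C, hC0, r, hr0, hC⟩ := hr.exists_asym_bound (R := 1) (by simpa using hr.q_lt_one) zero_le_one
  obtain ⟨K₂, hK₂⟩ := hr.exists_far (1 / r)
  obtain ⟨M, hM⟩ := (hr.tendsto_mass ε).bddAbove_range
  have hM0 : 0 ≤ M := le_trans (by positivity) (hM ⟨0, rfl⟩)
  refine ⟨min (min K₁ K₂) 0, min_le_right _ _, M * (1 + C * r), by positivity, ?_⟩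
  intro ζ z0 z1 k hk
  have hx := hK₂ ε _ (hk.trans ((min_le_left _ _).trans (min_le_right _ _)))
  have hx0 : 0 < |p.pt (ε, -(k : ℤ))| := lt_trans (by positivity) hx
  have hy : ‖(1 : ℂ) / p.pt (ε, -(k : ℤ))‖ < r := by
    rw [norm_div, norm_one, norm_real, norm_eq_abs, div_lt_iff₀ hx0]
    rwa [div_lt_iff₀ hr0, mul_comm] at hx
  have h2 := hC ζ z1.le _ hy
  have h4 : ‖p.s‖ ^ k * √(p.mass (ε, -(k : ℤ))) ≤ M := hM ⟨k, rfl⟩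
  rw [(hK₁ ε ζ z0 z1).2 _ (hk.trans ((min_le_left _ _).trans (min_le_left _ _))), asym, neg_neg,
    zpow_natCast, norm_mul, norm_pow, norm_mul, mul_pow]
  generalize p.gauge (1 / p.pt (ε, -(k : ℤ))) * p.bigFun ζ (1 / p.pt (ε, -(k : ℤ))) = X at *
  have h3 : ‖X‖ ≤ 1 + C * r := by
    have := norm_add_le (1 : ℂ) (X - 1)
    rw [add_sub_cancel, norm_one] at this
    have := mul_le_mul_of_nonneg_left hy.le hC0.le
    linarith
  calc _ = (‖p.s‖ ^ k * √(p.mass (ε, -(k : ℤ)))) * (‖X‖ * ‖ζ‖ ^ k) := by ring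
    _ ≤ M * ((1 + C * r) * ‖ζ‖ ^ k) := mul_le_mul h4
        (mul_le_mul_of_nonneg_right h3 (by positivity)) (by positivity) hM0
    _ = _ := by ring

lemma IsGeneric.exists_dominating (h : p.IsGeneric) (ε : Bool) (h0 : γ ≠ 0) (h1 : ‖γ‖ < 1) :
    ∃ B : ℤ → ℝ, Summable B ∧ ∀ᶠ ζ in 𝓝 γ, ∀ n,
      p.mass (ε, n) * (‖p.Phi ε ζ (ε, n)‖ * ‖p.Phi ε γ (ε, n)‖) ≤ B n := by
  obtain ⟨K, hK, C, hC0, far⟩ := h.exists_far_bound ε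
  obtain ⟨E, hE0, hE⟩ := h.exists_near_bound K ε h0 h1
  let b : ℤ → ℝ := fun n => if K ≤ n then p.mass (ε, n) else 0
  have hb0 : ∀ n, 0 ≤ b n := fun n => by
    simp only [b]; split_ifs; exacts [(h.mass_pos _).le, le_rfl]
  have hb1 : ∀ n, K ≤ n → b n = p.mass (ε, n) := fun n hn => if_pos hn
  have hb : Summable b := by
    refine Summable.of_nat_of_neg ((h.summable_mass_near ε).congr fun n => ?_)
      (summable_of_ne_finset_zero (s := range ((-K).toNat + 1)) fun n hn => if_neg ?_)
    · rw [hb1 _ (by omega)]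
    · rw [mem_range] at hn
      omega
  have hg : Summable fun n : ℤ => ‖γ‖ ^ n.natAbs := by
    have := summable_geometric_of_lt_one (norm_nonneg _) h1
    exact Summable.of_nat_of_neg (by simpa using this) (by simpa using this)
  clear_value b
  refine ⟨fun n => C ^ 2 * ‖γ‖ ^ n.natAbs + E ^ 2 * b n, (hg.mul_left _).add (hb.mul_left _), ?_⟩
  filter_upwards [eventually_unit h0 h1, hE] with ζ hζ hn n
  have hm := h.mass_pos (ε, n)
  rcases le_or_gt n K with hnK | hnK
  · obtain ⟨k, rfl⟩ : ∃ k : ℕ, n = -(k : ℤ) := ⟨(-n).toNat, by omega⟩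
    have f1 := far ζ hζ.1 hζ.2 k hnK
    have f2 := far γ h0 h1 k hnK
    have hz : ‖ζ‖ ^ k ≤ 1 := pow_le_one₀ (norm_nonneg _) hζ.2.le
    have e := mul_nonneg (sq_nonneg E) (hb0 (-(k : ℤ)))
    have := mul_le_mul (f1.trans (mul_le_of_le_one_right hC0 hz)) f2 (by positivity) hC0
    rw [Int.natAbs_neg, Int.natAbs_natCast]
    refine le_trans (le_of_eq ?_) (this.trans (by linarith))
    rw [mul_mul_mul_comm, Real.mul_self_sqrt hm.le]
  · obtain ⟨k, rfl⟩ : ∃ k : ℕ, n = K + k := ⟨(n - K).toNat, by omega⟩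
    have f1 : ‖p.Phi ε ζ (ε, K + k)‖ ≤ E := (norm_fst_le (p.jet _ _)).trans (hn k).1
    have f2 : ‖p.Phi ε γ (ε, K + k)‖ ≤ E := (norm_fst_le (p.jet _ _)).trans (hE.self_of_nhds k).1
    have f3 := mul_le_mul_of_nonneg_left (mul_le_mul f1 f2 (norm_nonneg _) hE0) hm.le
    have e : 0 ≤ C ^ 2 * ‖γ‖ ^ (K + (k : ℤ)).natAbs := by positivity
    rw [hb1 _ hnK.le]; linarith

/-- The overlap of two asymptotic solutions on a half line. -/
def overlap (p : Params) (ε : Bool) (ζ γ : ℂ) : ℂ :=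
  ∑' n : ℤ, (p.mass (ε, n) : ℂ) * (p.Phi ε ζ (ε, n) * p.Phi ε γ (ε, n))

namespace IsGeneric
variable (h : p.IsGeneric)
include h

lemma norm_overlap_term (ε : Bool) (ζ γ : ℂ) (n : ℤ) :
    ‖(p.mass (ε, n) : ℂ) * (p.Phi ε ζ (ε, n) * p.Phi ε γ (ε, n))‖ =
      p.mass (ε, n) * (‖p.Phi ε ζ (ε, n)‖ * ‖p.Phi ε γ (ε, n)‖) := by
  rw [norm_mul, norm_mul, norm_of_nonneg (h.mass_pos _).le]

lemma continuousAt_overlap (ε : Bool) (h0 : γ ≠ 0)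
    (h1 : ‖γ‖ < 1) : ContinuousAt (fun ζ => p.overlap ε ζ γ) γ := by
  obtain ⟨B, hB, hd⟩ := h.exists_dominating ε h0 h1
  refine tendsto_tsum_of_dominated_convergence hB (fun n => ?_) ?_
  · exact ((h.continuousAt_Phi ε n h0 h1).mul_const _).const_mul _
  · filter_upwards [hd] with ζ hζ n
    rw [h.norm_overlap_term]; exact hζ n

lemma flux_overlap (ε : Bool) (h0 : γ ≠ 0) (h1 : ‖γ‖ < 1) :
    ∀ᶠ ζ in 𝓝 γ, sgn ε * ((mu ζ - mu γ) * p.overlap ε ζ γ) =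
      -(((p.bd ε ζ).2 * (p.bd ε γ).1 - (p.bd ε ζ).1 * (p.bd ε γ).2) *
        ((1 - p.q) ^ 2 * p.s / (p.c * p.d))) := by
  have hr := h.isRegular
  obtain ⟨B, hB, hd⟩ := h.exists_dominating ε h0 h1
  filter_upwards [eventually_unit h0 h1, hd] with ζ hζ hb
  have hS : Summable fun n : ℤ => (p.mass (ε, n) : ℂ) * (p.Phi ε ζ (ε, n) * p.Phi ε γ (ε, n)) :=
    Summable.of_norm_bounded hB fun n => by rw [h.norm_overlap_term]; exact hb n
  have jz := h.hasJet_Phi ε ε hζ.1 hζ.2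
  have jg := h.hasJet_Phi ε ε h0 h1
  rw [← tsum_int_telescope ((hS.mul_left (mu ζ - mu γ)).mul_left (sgn ε : ℂ))
    (D := fun n => p.casorati (p.Phi ε ζ) (p.Phi ε γ) (ε, n)) (fun n => ?_)
    (hr.tendsto_casorati_zero jz.fst jz.snd jg.fst jg.snd), tsum_mul_left, tsum_mul_left, overlap]
  · have := hr.tendsto_casorati (ε := ε) one_ne_zero (f := p.Phi ε ζ) (g := p.Phi ε γ) (F := 0)
      (G := 0) (by simpa using h.tendsto_Phi_zero ε hζ.1 hζ.2)
      (by simpa using h.tendsto_Phi_zero ε h0 h1)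
    simpa using this
  · have := h.casorati_sub (p.Phi ε ζ) (p.Phi ε γ) (ε, n)
    rw [(h.inV_Phi ε hζ.1 hζ.2).1, (h.inV_Phi ε h0 h1).1] at this
    exact (this.trans (by ring)).symm

lemma v_eq (h0 : γ ≠ 0) (h1 : ‖γ‖ < 1) :
    p.v γ = ((p.bd true γ).2 * (p.bd false γ).1 - (p.bd true γ).1 * (p.bd false γ).2) *
      ((1 - p.q) ^ 2 * p.s / (p.c * p.d)) :=
  h.isRegular.casorati_hasJet (h.inV_Phi true h0 h1).1 (h.inV_Phi false h0 h1).1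
    (h.hasJet_Phi true true h0 h1) (h.hasJet_Phi false true h0 h1) 0

lemma bd_ne (ε : Bool) (h0 : γ ≠ 0) (h1 : ‖γ‖ < 1) :
    p.bd ε γ ≠ 0 := fun e => by
  have j := h.hasJet_Phi ε ε h0 h1
  rw [e] at j
  have t := h.tendsto_Phi ε h0 h1
  simp only [h.isRegular.eq_zero_of_hasJet (h.inV_Phi ε h0 h1).1 j, mul_zero] at t
  exact zero_ne_one (tendsto_nhds_unique tendsto_const_nhds t)

end IsGeneric

lemma IsReg.u_zero_ne (h : p.IsReg) : (1 - p.q : ℂ) ^ 2 * p.s / (p.c * p.d) ≠ 0 := by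
  have hq := h.one_sub_ne
  have := h.s_ne
  have := h.c_ne
  have := h.d_ne
  positivity

/-- Regular solutions with vanishing Casorati determinant are proportional. -/
lemma IsReg.exists_eq_mul (h : p.IsReg) {m : ℂ} {x y : ℂ × ℂ}
    (hf : ∀ i, p.L f i = m * f i) (hg : ∀ i, p.L g i = m * g i) (jf : ∀ ε, p.HasJet f ε x)
    (jg : ∀ ε, p.HasJet g ε y) (hy : y ≠ 0) (hD : p.casorati f g (true, 0) = 0) :
    ∃ b : ℂ, x = b • y ∧ ∀ i, f i = b * g i := by
  rw [h.casorati_hasJet hf hg (jf true) (jg true), mul_eq_zero, or_iff_left h.u_zero_ne] at hD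
  have hb : ∃ b : ℂ, x = b • y := by
    by_cases h1 : y.1 = 0
    · have h2 : y.2 ≠ 0 := fun e => hy (Prod.ext h1 e)
      refine ⟨x.2 / y.2, Prod.ext ?_ ?_⟩
      · simp only [Prod.smul_fst, smul_eq_mul]; field_simp; linear_combination -hD
      · simp [h2]
    · refine ⟨x.1 / y.1, Prod.ext ?_ ?_⟩
      · simp [h1]
      · simp only [Prod.smul_snd, smul_eq_mul]; field_simp; linear_combination hD
  obtain ⟨b, rfl⟩ := hb
  refine ⟨b, rfl, fun ⟨ε, n⟩ => ?_⟩
  have j := (jf ε).add_smul (jg ε) 1 (-b)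
  rw [one_smul ℂ (b • y), neg_smul b y, add_neg_cancel] at j
  have := h.eq_zero_of_hasJet (m := m) (fun i => by rw [L_add_smul, hf, hg]; simp; ring) j n
  simp only [Pi.add_apply, Pi.smul_apply, smul_eq_mul] at this
  linear_combination this

lemma Gam_unit (ht : t ∈ p.Gam) : (t : ℂ) ≠ 0 ∧ ‖(t : ℂ)‖ < 1 :=
  ⟨mod_cast ht.2.2.1, by rw [norm_real, norm_eq_abs]; exact abs_lt.2 ⟨ht.1, ht.2.1⟩⟩

namespace IsGeneric
variable (h : p.IsGeneric)
include h

lemma bFactor_spec (ht : t ∈ p.Gam) : p.bFactor t ≠ 0 ∧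
    p.bd true t = p.bFactor t • p.bd false t ∧
      ∀ i, p.Phi true t i = p.bFactor t * p.Phi false t i := by
  obtain ⟨h0, h1⟩ := Gam_unit ht
  have j := fun ε δ => h.hasJet_Phi ε δ h0 h1
  obtain ⟨b, -, hb⟩ := h.isRegular.exists_eq_mul (h.inV_Phi true h0 h1).1 (h.inV_Phi false h0 h1).1
    (j true) (j false) (h.bd_ne false h0 h1) ht.2.2.2
  have hs : ∀ i, p.Phi true t i = p.bFactor t * p.Phi false t i :=
    Classical.epsilon_spec (p := fun r : ℂ => ∀ i, p.Phi true t i = r * p.Phi false t i) ⟨b, hb⟩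
  have e : p.Phi true t = p.bFactor t • p.Phi false t + (0 : ℂ) • p.Phi false t := by
    ext i; simp [hs i]
  have k := (j false true).add_smul (j false true) (p.bFactor t) 0
  rw [← e, zero_smul, add_zero] at k
  have e2 := tendsto_nhds_unique (j true true) k
  exact ⟨fun e3 => h.bd_ne true h0 h1 (by rw [e2, e3, zero_smul]), e2, hs⟩

lemma summable_half (ε : Bool) (h0 : γ ≠ 0) (h1 : ‖γ‖ < 1) :
    Summable fun n : ℤ => p.mass (ε, n) * ‖p.Phi ε γ (ε, n)‖ ^ 2 := by
  obtain ⟨B, hB, hd⟩ := h.exists_dominating ε h0 h1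
  refine hB.of_nonneg_of_le (fun n => mul_nonneg (h.mass_pos _).le (sq_nonneg _)) fun n => ?_
  rw [sq]; exact hd.self_of_nhds n

lemma memL2_Phi (ht : t ∈ p.Gam) : p.MemL2 (p.Phi true t) := by
  obtain ⟨h0, h1⟩ := Gam_unit ht
  rw [h.memL2_iff_summable,
    summable_prod_of_nonneg fun i => mul_nonneg (h.mass_pos i).le (sq_nonneg _)]
  refine ⟨fun ε => ?_, (hasSum_fintype _).summable⟩
  cases ε
  · refine ((h.summable_half false h0 h1).mul_left (‖p.bFactor t‖ ^ 2)).congr fun n => ?_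
    rw [(h.bFactor_spec ht).2.2, norm_mul]; ring
  · exact h.summable_half true h0 h1

/-- The eigenfunctions are real. -/
lemma conj_Phi (ht : t ∈ p.Gam) (i : RqIndex) :
    conj (p.Phi true t i) = p.Phi true t i := by
  obtain ⟨h0, h1⟩ := Gam_unit ht
  have hr := h.isRegular
  have hV := h.inV_Phi true h0 h1
  obtain ⟨β, hβ⟩ := reg_iff.1 (Reg.conj (p := p) hV.2)
  have hm : conj (mu (t : ℂ)) = mu t := by simp [mu]
  have hL : ∀ i, p.L (fun i => conj (p.Phi true t i)) i = mu t * conj (p.Phi true t i) := fun i => by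
    rw [h.isReal.conj_L, hV.1, map_mul, hm]
  have hD : p.casorati (fun i => conj (p.Phi true t i)) (p.Phi true t) (true, 0) = 0 := by
    refine tendsto_nhds_unique (tendsto_const_nhds.congr fun k => ?_)
      (h.tendsto_casorati_far (h.memL2_conj (h.memL2_Phi ht)) (h.memL2_Phi ht) true)
    rw [← hr.casorati_const (K := 0) (fun n _ => hL (true, n)) (fun n _ => hV.1 (true, n)) k, zero_sub]
  obtain ⟨b, -, hb⟩ := hr.exists_eq_mul hL hV.1 hβ (fun ε => h.hasJet_Phi true ε h0 h1)
    (h.bd_ne true h0 h1) hD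
  have t1 := h.tendsto_Phi true h0 h1
  have t2 := (continuous_conj.tendsto _).comp t1
  rw [map_one] at t2
  have hb1 : b = 1 := by
    rw [← mul_one b]
    refine tendsto_nhds_unique ((t1.const_mul b).congr fun k => ?_) t2
    rw [Function.comp, map_mul, map_inv₀, map_pow, map_mul, h.isReal.conj_s, conj_ofReal, hb]; ring
  rw [hb i, hb1, one_mul]

lemma toL2_Phi_ne (ht : t ∈ p.Gam) :
    p.toL2 (p.Phi true t) ≠ 0 := fun e => by
  obtain ⟨h0, h1⟩ := Gam_unit ht
  have : ∀ i, p.Phi true t i = 0 := fun i => by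
    have k := h.toL2_apply (h.memL2_Phi ht) i
    rw [e, wt] at k
    have hm : ((√(p.mass i) : ℝ) : ℂ) ≠ 0 := mod_cast (sqrt_pos.2 (h.mass_pos i)).ne'
    exact (mul_eq_zero.1 k.symm).resolve_left hm
  have t1 := h.tendsto_Phi true h0 h1
  simp only [this, mul_zero] at t1
  exact zero_ne_one (tendsto_nhds_unique tendsto_const_nhds t1)

lemma normSq_Phi (ht : t ∈ p.Gam) :
    ((‖p.toL2 (p.Phi true t)‖ ^ 2 : ℝ) : ℂ) =
      p.overlap true t t + p.bFactor t ^ 2 * p.overlap false t t := by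
  have hm := h.memL2_Phi ht
  have hs := h.summable_inner hm hm
  have e1 := h.innerL2_eq hm hm
  rw [inner_self_eq_norm_sq_to_K, innerL2, h.qInt_eq hs] at e1
  simp only [h.conj_Phi ht] at e1 hs
  rw [hs.tsum_prod, tsum_fintype, Fintype.sum_bool] at e1
  rw [ofReal_pow]
  refine e1.symm.trans ?_
  rw [overlap, overlap, ← tsum_mul_left]
  congr 2
  ext n
  rw [(h.bFactor_spec ht).2.2]; ring

/-- The weights of the discrete spectrum are the inverse squared norms of the eigenfunctions. -/
lemma N_eq (ht : t ∈ p.Gam) :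
    p.N t = (((‖p.toL2 (p.Phi true t)‖ ^ 2)⁻¹ : ℝ) : ℂ) := by
  obtain ⟨h0, h1⟩ := Gam_unit ht
  obtain ⟨hb, hbd, -⟩ := h.bFactor_spec ht
  have hT := h.normSq_Phi ht
  have hT0 : ((‖p.toL2 (p.Phi true t)‖ ^ 2 : ℝ) : ℂ) ≠ 0 := by
    exact_mod_cast (pow_pos (norm_pos_iff.2 (h.toL2_Phi_ne ht)) 2).ne'
  rw [Complex.ofReal_inv]
  generalize ((‖p.toL2 (p.Phi true t)‖ ^ 2 : ℝ) : ℂ) = T at *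
  set b := p.bFactor t
  set γ : ℂ := (t : ℂ)
  set z := p.bd false γ with hz
  obtain ⟨l, hl⟩ : ∃ l : ℂ × ℂ →L[ℂ] ℂ, l z ≠ 0 := by
    by_contra! hc
    exact h.bd_ne false h0 h1 (Prod.ext (hc (ContinuousLinearMap.fst ℂ ℂ ℂ))
      (hc (ContinuousLinearMap.snd ℂ ℂ ℂ)))
  set W : ℂ → ℂ := fun ζ => (-p.overlap false ζ γ * l (p.bd true ζ) -
    b⁻¹ * p.overlap true ζ γ * l (p.bd false ζ)) / l z with hW
  have hWv : ∀ᶠ ζ in 𝓝 γ, p.v ζ = (mu ζ - mu γ) * W ζ := by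
    filter_upwards [h.flux_overlap true h0 h1, h.flux_overlap false h0 h1, eventually_unit h0 h1]
      with ζ f1 f2 hζ
    have hv := h.v_eq hζ.1 hζ.2
    rw [hbd] at f1
    rw [← hz] at f2
    generalize (1 - p.q : ℂ) ^ 2 * p.s / (p.c * p.d) = u at *
    have e : p.v ζ • z = (-((mu ζ - mu γ) * p.overlap false ζ γ)) • p.bd true ζ +
        (-(b⁻¹ * ((mu ζ - mu γ) * p.overlap true ζ γ))) • p.bd false ζ := by
      simp only [sgn, if_true, Bool.false_eq_true, if_false, ofReal_one, one_mul,
        Complex.ofReal_neg, neg_mul, neg_inj, Prod.smul_fst, Prod.smul_snd, smul_eq_mul] at f1 f2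
      rw [f1, f2, hv]
      ext <;> simp only [Prod.smul_fst, Prod.smul_snd, Prod.fst_add, Prod.snd_add, smul_eq_mul] <;>
        field_simp <;> ring
    have := congrArg l e
    rw [map_add, map_smul, map_smul, map_smul, smul_eq_mul, smul_eq_mul, smul_eq_mul] at this
    rw [hW]; field_simp
    field_simp at this
    linear_combination this
  have hWc : Tendsto W (𝓝 γ) (𝓝 (-b⁻¹ * T)) := by
    have c1 := (l.continuous.tendsto _).comp (h.continuousAt_bd true h0 h1)
    have c2 := (l.continuous.tendsto _).comp (h.continuousAt_bd false h0 h1)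
    have c3 : Tendsto W (𝓝 γ) (𝓝 (W γ)) := (((h.continuousAt_overlap false h0 h1).neg.mul c1).sub
      (((h.continuousAt_overlap true h0 h1).const_mul b⁻¹).mul c2)).div_const (l z)
    have e : W γ = -b⁻¹ * T := by
      simp only [hW]
      rw [hbd, ← hz, map_smul, hT, smul_eq_mul]
      field_simp; ring
    rwa [e] at c3
  clear_value W
  have hγ1 : 1 - 1 / (γ * γ) ≠ 0 := fun e => by
    have h2 : γ * γ = 1 := by field_simp at e; linear_combination e
    have := congrArg norm h2
    rw [norm_mul, norm_one] at this
    nlinarith [norm_nonneg γ]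
  have lim : Tendsto (fun ζ : ℂ => (ζ - γ) * ((1 / ζ - ζ) / (ζ * p.v ζ))) (𝓝[≠] γ)
      (𝓝 ((1 / γ - γ) / γ / ((1 - 1 / (γ * γ)) * (-b⁻¹ * T)))) := by
    have id0 : Tendsto (fun ζ : ℂ => ζ) (𝓝[≠] γ) (𝓝 γ) := nhdsWithin_le_nhds
    have n1 := ((((tendsto_const_nhds (x := (1 : ℂ))).div id0 h0).sub id0).div id0 h0).div
      ((((tendsto_const_nhds (x := (1 : ℂ))).sub ((tendsto_const_nhds (x := (1 : ℂ))).div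
        (id0.mul_const γ) (mul_ne_zero h0 h0)))).mul (hWc.mono_left nhdsWithin_le_nhds))
      (mul_ne_zero hγ1 (mul_ne_zero (neg_ne_zero.2 (inv_ne_zero hb)) hT0))
    refine n1.congr' ?_
    filter_upwards [nhdsWithin_le_nhds hWv, nhdsWithin_le_nhds (eventually_unit h0 h1),
      self_mem_nhdsWithin] with ζ k1 k2 k3
    have e : mu ζ - mu γ = (ζ - γ) * (1 - 1 / (ζ * γ)) := by
      have := k2.1
      rw [mu, mu]; field_simp; ring
    have k4 : ζ - γ ≠ 0 := sub_ne_zero.2 k3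
    simp only [Pi.div_apply]
    rw [k1, e, show ζ * ((ζ - γ) * (1 - 1 / (ζ * γ)) * W ζ) =
      (ζ - γ) * (ζ * ((1 - 1 / (ζ * γ)) * W ζ)) by ring, ← mul_div_assoc (ζ - γ),
      mul_div_mul_left _ _ k4, div_div]
  have hN : p.N γ = b⁻¹ * ((1 / γ - γ) / γ / ((1 - 1 / (γ * γ)) * (-b⁻¹ * T))) := by
    rw [N, lim.limUnder_eq]
  rw [hN]
  have e3 : (1 / γ - γ) / γ = -(1 - 1 / (γ * γ)) := by field_simp; ring
  rw [e3]
  generalize 1 - 1 / (γ * γ) = X at *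
  field_simp

end IsGeneric

/-! ### The transform of wave packets -/

lemma norm_mu_gt (h0 : t ≠ 0) (h1 : |t| < 1) : 2 < ‖mu (t : ℂ)‖ := by
  have e : mu (t : ℂ) = ((t + t⁻¹ : ℝ) : ℂ) := by rw [mu]; push_cast; rfl
  have ht := abs_pos.2 h0
  rw [e, norm_real, norm_eq_abs]
  have : |t + t⁻¹| = |t| + |t|⁻¹ := by
    rcases h0.lt_or_gt with hn | hn
    · rw [abs_of_neg hn, abs_of_neg (add_neg hn (inv_lt_zero.2 hn)), inv_neg]; ring
    · rw [abs_of_pos hn, abs_of_pos (by positivity)]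
  rw [this]
  have h3 : 0 < (1 - |t|) ^ 2 / |t| := div_pos (pow_pos (sub_pos.2 h1) 2) ht
  have h4 : (1 - |t|) ^ 2 / |t| = |t| + |t|⁻¹ - 2 := by field_simp; ring
  linarith

lemma norm_mu_exp_le (t : ℝ) : ‖mu (exp t : ℂ)‖ ≤ 2 := by
  refine (norm_add_le _ _).trans ?_
  rw [norm_inv, norm_coe]; norm_num

lemma Nice.inner_Phi (hu : p.Nice N u) (h : p.IsGeneric)
    (ht : t ∈ p.Gam) : inner ℂ (p.toL2 (p.Phi true t)) (p.toL2 (p.packet u)) = 0 := by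
  obtain ⟨h0, h1⟩ := Gam_unit ht
  have hr := h.isRegular
  have hmt := norm_mu_gt ht.2.2.1 (abs_lt.2 ⟨ht.1, ht.2.1⟩)
  have hV := h.inV_Phi true h0 h1
  have hΦ := h.memL2_Phi ht
  have hconj : conj (mu (t : ℂ)) = mu t := by simp [mu]
  generalize mu (t : ℂ) = m at *
  have hlow : ∀ x : ℝ, ‖m‖ - 2 ≤ ‖mu (exp x : ℂ) - m‖ := fun x => by
    have := norm_sub_norm_le m (mu (exp x : ℂ))
    rw [norm_sub_rev]; linarith [norm_mu_exp_le x]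
  have hpos : 0 < ‖m‖ - 2 := sub_pos.2 hmt
  have hne : ∀ x : ℝ, mu (exp x : ℂ) - m ≠ 0 := fun x =>
    norm_pos_iff.1 (hpos.trans_le (hlow x))
  have hn := hu.smul (c := fun x : ℝ => (mu (exp x : ℂ) - m)⁻¹) (M := max 1 (‖m‖ - 2)⁻¹)
    (((measurable_coe_exp.add measurable_coe_exp.inv).sub_const m).inv.aestronglyMeasurable)
    (.of_forall fun x => by
      simp only [coe_exp_neg, mu, inv_inv, add_comm]) (le_max_left _ _) (fun x => by
      rw [norm_inv]
      exact (inv_anti₀ hpos (hlow x)).trans (le_max_right _ _))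
  set u' : ℝ → ℂ² := fun x => (mu (exp x : ℂ) - m)⁻¹ • u x with hu'
  have hL : p.L (p.packet u') = m • p.packet u' + p.packet u := by
    ext i
    rw [hr.L_packet hn]
    have e : (fun x => mu (exp x : ℂ) • u' x) = fun x => m • u' x + u x := by
      ext x j
      have := hne x
      simp only [hu', Pi.add_apply, Pi.smul_apply, smul_eq_mul]
      field_simp; ring
    have k := hr.intervalIntegrable_kern hn i
    rw [e, packet_add_of (u := fun x => m • u' x) (v := u) (by
      simp only [kern_smul]; exact k.const_mul m) (hr.intervalIntegrable_kern hu i), packet_smul]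
    rfl
  have m1 := hn.memL2 h
  have m2 := hu.memL2 h
  have m3 := h.memL2_smul m m1
  have eL : p.L (p.Phi true t) = m • p.Phi true t := funext hV.1
  have hg := h.green m1 hΦ (by rw [hL]; exact h.memL2_add m3 m2) (by rw [eL]; exact h.memL2_smul m hΦ)
    (hr.reg_packet hn) hV.2
  rw [hL, eL, h.innerL2_eq (h.memL2_add m3 m2) hΦ, h.innerL2_eq m1 (h.memL2_smul m hΦ),
    h.toL2_add m3 m2, h.toL2_smul m m1, h.toL2_smul m hΦ, inner_add_right, inner_smul_right,
    inner_smul_left, hconj] at hg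
  linear_combination hg

namespace IsGeneric
variable (h : p.IsGeneric)
include h

lemma inner_Gc_Phi {g : Circle → ℂ²} (hg : p.MemHc g)
    (ht : t ∈ p.Gam) : inner ℂ (p.toL2 (p.Phi true t)) (p.toL2 (p.Gc g)) = 0 := by
  have ha := hg.adm h
  rw [Gc_eq h]
  have hN := h.isRegular.nice_cut ha.meas ha.even
  refine tendsto_nhds_unique (tendsto_const_nhds.inner (ha.main h).2.2) ?_
  exact tendsto_const_nhds.congr fun n => ((hN n).inner_Phi h ht).symm

lemma Gc_add {g₁ g₂ : Circle → ℂ²} (h₁ : p.MemHc g₁)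
    (h₂ : p.MemHc g₂) : p.Gc (g₁ + g₂) = p.Gc g₁ + p.Gc g₂ := by
  ext i
  rw [Gc_eq h, Gc_eq h, Gc_eq h, dens_add]
  exact packet_add_of ((h₁.adm h).intervalIntegrable_kern h i)
    ((h₂.adm h).intervalIntegrable_kern h i)

lemma Gc_smul (c : ℂ) (g : Circle → ℂ²) :
    p.Gc (c • g) = c • p.Gc g := by
  ext i
  rw [Gc_eq h, Gc_eq h, dens_smul, packet_smul]
  rfl

lemma inner_Gc_Psi {e : Circle → ℂ²} (he : p.MemHc e)
    (i : RqIndex) : inner ℂ (p.toL2 (p.Gc (p.Psi i).1)) (p.toL2 (p.Gc e)) = p.Gc e i := by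
  have hi := h.memHc_Psi i
  rw [← h.innerL2_eq (h.memL2_Gc he) (h.memL2_Gc hi), h.innerL2_Gc he hi]
  simp only [Gc, G, innerH, innerHp, Pi.zero_apply, zero_mul, tsum_zero, add_zero]

lemma sum_Psi (s : Finset RqIndex) (c : RqIndex → ℂ) :
    p.MemHc (∑ i ∈ s, c i • (p.Psi i).1) ∧ ∀ e, p.MemHc e →
      inner ℂ (p.toL2 (p.Gc (∑ i ∈ s, c i • (p.Psi i).1))) (p.toL2 (p.Gc e)) =
        ∑ i ∈ s, conj (c i) * p.Gc e i := by
  classical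
  induction s using Finset.induction_on with
  | empty =>
    have hi := h.memHc_Psi (true, 0)
    have e0 : (0 : Circle → ℂ²) = (0 : ℂ) • (p.Psi (true, 0)).1 := (zero_smul _ _).symm
    simp only [Finset.sum_empty]
    rw [e0]
    refine ⟨hi.smul h 0, fun e _ => ?_⟩
    rw [h.Gc_smul, h.toL2_smul 0 (h.memL2_Gc hi), zero_smul, inner_zero_left]
  | insert i s hi ih =>
    have m1 := (h.memHc_Psi i).smul h (c i)
    rw [Finset.sum_insert hi]
    refine ⟨m1.add ih.1 h, fun e he => ?_⟩
    rw [Finset.sum_insert hi, h.Gc_add m1 ih.1, h.toL2_add (h.memL2_Gc m1) (h.memL2_Gc ih.1),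
      inner_add_left, ih.2 e he, h.Gc_smul, h.toL2_smul _ (h.memL2_Gc (h.memHc_Psi i)),
      inner_smul_left, h.inner_Gc_Psi he]

lemma transformFin_fst {F : RqIndex → ℂ}
    (hF : (Function.support F).Finite) :
    (p.transformFin F).1 = ∑ i ∈ hF.toFinset, ((p.mass i : ℂ) * F i) • (p.Psi i).1 := by
  have key : ∀ φ : RqIndex → ℂ, p.qInt (fun i => F i * φ i * p.w (p.pt i)) =
      ∑ i ∈ hF.toFinset, (p.mass i : ℂ) * F i * φ i := fun φ => by
    have hz : ∀ i ∉ hF.toFinset, (p.mass i : ℂ) * (F i * φ i) = 0 := fun i hi => by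
      simp only [Set.Finite.mem_toFinset, Function.mem_support, not_not] at hi
      simp [hi]
    rw [h.qInt_eq (summable_of_ne_finset_zero hz), tsum_eq_sum hz]
    exact sum_congr rfl fun i _ => by ring
  ext γ j
  rw [Finset.sum_apply, Finset.sum_apply]
  fin_cases j
  · exact key _
  · exact key _

/-- The transform inverts `𝒢_c` on the continuous spectrum. -/
lemma continuous_part {g : Circle → ℂ²} (hg : p.MemHc g)
    {F : RqIndex → ℂ} (hF : (Function.support F).Finite) : p.MemHc (p.transformFin F).1 ∧
      0 ≤ (p.innerHc ((p.transformFin F).1 - g) ((p.transformFin F).1 - g)).re ∧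
      (p.innerHc ((p.transformFin F).1 - g) ((p.transformFin F).1 - g)).re ≤
        ‖p.toL2 (F - p.Gc g)‖ ^ 2 := by
  obtain ⟨m1, k1⟩ := h.sum_Psi hF.toFinset fun i => (p.mass i : ℂ) * F i
  rw [← h.transformFin_fst hF] at m1 k1
  have m2 := hg.smul h (-1)
  set T := (p.transformFin F).1
  have eT : T - g = T + (-1 : ℂ) • g := by rw [neg_one_smul, sub_eq_add_neg]
  have me : p.MemHc (T - g) := by rw [eT]; exact m1.add m2 h
  have lF := h.memL2_of_finite hF
  have lg := h.memL2_Gc hg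
  have le := h.memL2_Gc me
  set X := p.toL2 (p.Gc (T - g)) with hX
  have hX' : X = p.toL2 (p.Gc T) - p.toL2 (p.Gc g) := by
    rw [hX, eT, h.Gc_add m1 m2, h.Gc_smul, h.toL2_add (h.memL2_Gc m1) (h.memL2_smul _ lg),
      h.toL2_smul _ lg, neg_one_smul, sub_eq_add_neg]
  have e1 : inner ℂ (p.toL2 F) X = inner ℂ (p.toL2 (p.Gc T)) X := by
    rw [k1 _ me, ← inner_conj_symm, hX, ← h.innerL2_eq lF le, h.innerL2_finite hF, map_sum]
    refine sum_congr rfl fun i _ => ?_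
    simp only [map_mul, conj_conj, conj_ofReal]; ring
  have e2 : inner ℂ X X = inner ℂ (p.toL2 (F - p.Gc g)) X := by
    rw [h.toL2_sub lF lg, inner_sub_left, e1, ← inner_sub_left, ← hX']
  have e3 : (p.innerHc (T - g) (T - g)).re = ‖X‖ ^ 2 := by
    rw [← h.innerL2_Gc me me]; exact h.normSqL2_eq le
  rw [e3]
  refine ⟨m1, sq_nonneg _, ?_⟩
  have e4 := norm_inner_le_norm (𝕜 := ℂ) (p.toL2 (F - p.Gc g)) X
  rw [← e2, inner_self_eq_norm_sq_to_K, norm_pow, RCLike.norm_ofReal, abs_norm] at e4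
  rcases (norm_nonneg X).eq_or_lt with e5 | e5
  · rw [← e5, zero_pow two_ne_zero]; exact sq_nonneg _
  · exact pow_le_pow_left₀ (norm_nonneg _) (le_of_mul_le_mul_right (by rwa [← sq]) e5) 2

end IsGeneric

lemma mu_injOn {s t : ℝ} (hs : s ∈ p.Gam) (ht : t ∈ p.Gam) (e : mu (s : ℂ) = mu t) : s = t := by
  have e1 : s + s⁻¹ = t + t⁻¹ := by
    have : ((s + s⁻¹ : ℝ) : ℂ) = ((t + t⁻¹ : ℝ) : ℂ) := by push_cast; exact e
    exact_mod_cast this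
  have s0 := hs.2.2.1
  have t0 := ht.2.2.1
  have e2 : (s - t) * (s * t - 1) = 0 := by field_simp at e1; linear_combination e1
  have e3 : s * t < 1 := by
    have h1 := abs_lt.2 ⟨hs.1, hs.2.1⟩
    have h2 := abs_lt.2 ⟨ht.1, ht.2.1⟩
    refine (le_abs_self _).trans_lt ?_
    rw [abs_mul]
    exact mul_lt_one_of_nonneg_of_lt_one_left (abs_nonneg _) h1 h2.le
  exact sub_eq_zero.1 ((mul_eq_zero.1 e2).resolve_right (sub_neg.2 e3).ne)

/-- The normalized eigenfunctions are orthonormal. -/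
lemma IsGeneric.orthonormal_Phi (h : p.IsGeneric) : Orthonormal ℂ fun γ : p.Gam =>
    ((‖p.toL2 (p.Phi true (γ : ℝ))‖⁻¹ : ℝ) : ℂ) • p.toL2 (p.Phi true (γ : ℝ)) := by
  constructor
  · rintro ⟨t, ht⟩
    have := norm_pos_iff.2 (h.toL2_Phi_ne ht)
    rw [norm_smul, norm_real, norm_inv, norm_norm, inv_mul_cancel₀ this.ne']
  · rintro ⟨s, hs⟩ ⟨t, ht⟩ hst
    have hV := fun {t : ℝ} (ht : t ∈ p.Gam) => h.inV_Phi true (Gam_unit ht).1 (Gam_unit ht).2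
    have ms := h.memL2_Phi hs
    have mt := h.memL2_Phi ht
    have es : p.L (p.Phi true s) = mu (s : ℂ) • p.Phi true s := funext (hV hs).1
    have et : p.L (p.Phi true t) = mu (t : ℂ) • p.Phi true t := funext (hV ht).1
    have hg := h.green mt ms (by rw [et]; exact h.memL2_smul _ mt)
      (by rw [es]; exact h.memL2_smul _ ms) (hV ht).2 (hV hs).2
    have hconj : conj (mu (s : ℂ)) = mu s := by simp [mu]
    rw [es, et, h.innerL2_eq (h.memL2_smul _ mt) ms, h.innerL2_eq mt (h.memL2_smul _ ms),
      h.toL2_smul _ mt, h.toL2_smul _ ms, inner_smul_right, inner_smul_left, hconj] at hg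
    have hne : mu (t : ℂ) - mu s ≠ 0 := sub_ne_zero.2 fun e =>
      hst (Subtype.ext (mu_injOn ht hs e).symm)
    have h0 := (mul_eq_zero.1 (by linear_combination hg :
      (mu (t : ℂ) - mu s) * inner ℂ (p.toL2 (p.Phi true s)) (p.toL2 (p.Phi true t)) = 0)).resolve_left
        hne
    simp only
    rw [inner_smul_left, inner_smul_right, h0, mul_zero, mul_zero]

/-- The discrete part of the transform does not see the continuous spectrum. -/
lemma IsGeneric.discrete_part (h : p.IsGeneric) {g : Circle → ℂ²} (hg : p.MemHc g)
    {F : RqIndex → ℂ} (hF : (Function.support F).Finite) : p.MemHp (p.transformFin F).2 ∧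
      0 ≤ (p.innerHp (p.transformFin F).2 (p.transformFin F).2).re ∧
      (p.innerHp (p.transformFin F).2 (p.transformFin F).2).re ≤ ‖p.toL2 (F - p.Gc g)‖ ^ 2 := by
  have hO := h.orthonormal_Phi
  set Y := p.toL2 (F - p.Gc g) with hY
  have lF := h.memL2_of_finite hF
  have lg := h.memL2_Gc hg
  have e : ∀ γ : p.Gam, (p.transformFin F).2 γ * conj ((p.transformFin F).2 γ) * p.N (γ : ℝ) =
      ((‖inner ℂ (((‖p.toL2 (p.Phi true (γ : ℝ))‖⁻¹ : ℝ) : ℂ) • p.toL2 (p.Phi true (γ : ℝ))) Y‖ ^ 2 :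
        ℝ) : ℂ) := by
    rintro ⟨t, ht⟩
    have e1 : (p.transformFin F).2 ⟨t, ht⟩ = inner ℂ (p.toL2 (p.Phi true t)) Y := by
      rw [hY, h.toL2_sub lF lg, inner_sub_right, h.inner_Gc_Phi hg ht, sub_zero]
      exact h.innerL2_eq lF (h.memL2_Phi ht)
    rw [e1, h.N_eq ht, inner_smul_left, conj_ofReal, norm_mul, norm_real, norm_inv,
      norm_norm, Complex.mul_conj']
    push_cast; ring
  have hs := hO.inner_products_summable Y
  have e2 : p.innerHp (p.transformFin F).2 (p.transformFin F).2 = ((∑' γ : p.Gam,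
      ‖inner ℂ (((‖p.toL2 (p.Phi true (γ : ℝ))‖⁻¹ : ℝ) : ℂ) • p.toL2 (p.Phi true (γ : ℝ))) Y‖ ^ 2 :
        ℝ) : ℂ) := by
    rw [innerHp, Complex.ofReal_tsum]; exact tsum_congr e
  rw [e2, ofReal_re]
  refine ⟨?_, tsum_nonneg fun _ => sq_nonneg _, hO.tsum_inner_products_le Y⟩
  rw [MemHp]
  simp_rw [e]
  exact Complex.ofRealCLM.summable hs

end Params

end BigQJacobi
end

theorem mainTheorem9 (p : BigQJacobi.Params) (hp : p.IsGeneric) :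
    (∀ g : Circle → Fin 2 → ℂ, p.MemHc g →
      (∀ i : BigQJacobi.RqIndex, p.PairIntegrable g (p.Psi i).1) ∧ p.MemL2 (p.Gc g)) ∧
    (∀ g₁ g₂ : Circle → Fin 2 → ℂ, p.MemHc g₁ → p.MemHc g₂ →
      p.PairIntegrable g₁ g₂ ∧ p.innerL2 (p.Gc g₁) (p.Gc g₂) = p.innerHc g₁ g₂) ∧
    (∀ g : Circle → Fin 2 → ℂ, p.MemHc g → p.TransformEq (p.Gc g) (g, 0)) := by
  have pair : ∀ g₁ g₂ : Circle → Fin 2 → ℂ, p.MemHc g₁ → p.MemHc g₂ → p.PairIntegrable g₁ g₂ :=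
    fun g₁ g₂ h₁ h₂ => (h₁.evenMeas.pairIntegrable h₂.evenMeas hp (h₁.adm hp) (h₂.adm hp)).1
  refine ⟨fun g hg => ⟨fun i => pair _ _ hg (hp.memHc_Psi i), hp.memL2_Gc hg⟩,
    fun g₁ g₂ h₁ h₂ => ⟨pair _ _ h₁ h₂, hp.innerL2_Gc h₁ h₂⟩, fun g hg =>
      ⟨hp.memL2_Gc hg, ⟨hg, ?_⟩, fun F hF hlim => ?_⟩⟩
  · simp [BigQJacobi.Params.MemHp]
  · have c := fun n => hp.continuous_part hg (hF n)
    have d := fun n => hp.discrete_part hg (hF n)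
    refine ⟨fun n => ⟨(c n).1, (d n).1⟩, ?_⟩
    have e : ∀ n, p.normSqH (p.transformFin (F n) - (g, 0)) =
        (p.innerHc ((p.transformFin (F n)).1 - g) ((p.transformFin (F n)).1 - g)).re +
          (p.innerHp (p.transformFin (F n)).2 (p.transformFin (F n)).2).re := fun n => by
      rw [BigQJacobi.Params.normSqH, BigQJacobi.Params.innerH, Complex.add_re, Prod.fst_sub,
        Prod.snd_sub, sub_zero]
    have hl := hlim.add hlim
    rw [add_zero] at hl
    refine squeeze_zero (fun n => ?_) (fun n => ?_) hl
    · rw [e]; exact add_nonneg (c n).2.1 (d n).2.1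
    · rw [e, hp.normSqL2_eq (hp.memL2_sub (hp.memL2_of_finite (hF n)) (hp.memL2_Gc hg))]
      exact add_le_add (c n).2.2 (d n).2.2
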